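/- **Setting.** Let $\mathcal C$ be a category with a class $\mathcal T$ of morphisms, called covers, such that: isomorphisms are covers; composites of covers are covers; pullbacks along covers exist and covers are stable under them; every cover is an effective epimorphism; if $f$ and $g\circ f$ are covers, so is $g$; and for covers $\kappa\colon P\to M$ and $f\colon Q\to P$, every action of the Čech groupoid $P\times_MP\rightrightarrows P$ on $Q$ along $f$ has a quotient $Q\to N$ with an induced map $N\to M$ such that $Q\cong N\times_MP$. A *groupoid* in $(\mathcal C,\mathcal T)$ is an internal groupoid whose source and target maps are covers. An *HS bibundle* from a groupoid $G$ to a groupoid $H$ is an object $P$ with commuting left $G$- and right $H$-actions along moment maps $l\colon P\to G_0$ and $r\colon P\to H_0$ such that $l$ is a principal right $H$-bundle ($l$ is a cover and $P\times_{H_0}H_1\to P\times_{G_0}P$, $(p,h)\mapsto(p,ph)$, is an isomorphism). HS bibundles are composed by the balanced product $P\otimes_HQ$; functors give bibundles; 2-morphisms are equivariant maps (automatically invertible). A *categorified groupoid* $G\rightrightarrows M$ consists of an object $M$, a groupoid $G$, invariant covers $s,t\colon G_0\to M$, a multiplication $m$ (an HS bibundle $E_m$ from $G\times_{s,M,t}G$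 to $G$), a unit $u\colon M\to G_0$ and an inversion $i$ (an HS bibundle from $G$ to $G$), with the source and target relations of a groupoid, and 2-morphisms $\alpha_G\colon m(m\times\mathrm{id})\Rightarrow m(\mathrm{id}\times m)$, $\rho_G\colon m(\mathrm{id},us)\Rightarrow\mathrm{id}$, $\lambda_G\colon m(ut,\mathrm{id})\Rightarrow\mathrm{id}$, $\eta\colon m(\mathrm{id},i)\Rightarrow ut$, $\varepsilon\colon m(i,\mathrm{id})\Rightarrow us$, such that $\alpha_G$ satisfies the pentagon condition and $\alpha_G,\rho_G,\lambda_G$ the triangle condition. A *categorified (right) action* of it consists of a groupoid $E$, an invariant map $J\colon E_0\to M$, an HS bibundle $E_{\mathrm{act}}$ from $E\times_{J,M,t}G$ to $E$ (the action morphism $\mathrm{act}$) with $J\circ\mathrm{act}=s\circ\mathrm{pr}_2$, and 2-morphisms $\alpha\colon\mathrm{act}(\mathrm{act}\times\mathrm{id})\Rightarrow\mathrm{act}(\mathrm{id}\times m)$ (the associator) and $\rho\colon\mathrm{act}(\mathrm{id},uJ)\Rightarrow\mathrm{id}_E$ (the unitor) satisfying the pentagon condition (with $\alpha_G$) and the triangle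 condition (with $\lambda_G$). An isomorphism of categorified actions is an isomorphism of the groupoids $E$ over $M$ together with an equivariant isomorphism of the bibundles $E_{\mathrm{act}}$ compatible with the associators and the unitors. A simplicial object $X$ in $\mathcal C$ satisfies $\mathrm{Kan}(m,j)$ (resp. $\mathrm{Kan}!(m,j)$) if the presheaf $\mathrm{Hom}(\Lambda[m,j],X)$ is representable and $X_m\to\mathrm{Hom}(\Lambda[m,j],X)$ is a cover (resp. an isomorphism). It is a *2-groupoid object* if it satisfies $\mathrm{Kan}(m,j)$ for all $m\ge1$, $0\le j\le m$, and $\mathrm{Kan}!(m,j)$ for all $m\ge3$, $0\le j\le m$. A morphism $\pi\colon A\to X$ of 2-groupoid objects is a *2-groupoid Kan fibration* if for all $m\ge1$, $0\le j\le m$, the presheaf $\mathrm{Hom}(\Lambda[m,j],A)\times_{\mathrm{Hom}(\Lambda[m,j],X)}X_m$ is representable and the map from $A_m$ to it is a cover, which for $m=2$ is an isomorphism. A 2-groupoid object $X$ *corresponds* to $G\rightrightarrows M$ if $X_0=M$, $X_1=G_0$, $X_2=E_m$ (up to chosen isomorphisms), with $d_1=t$, $d_0=s$ on $X_1$, with $(d_2,d_0)$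 and $d_1$ on $X_2$ the left and right moment maps, with $s_0=u$ on $X_0$, $s_1=\rho_G^{-1}(1)$ and $s_0=\lambda_G^{-1}(1)$ on $X_1$, and with $X_3$ given by $\alpha_G$: elements $m_{012},m_{023},m_{123},m_{013}$ of $X_2$ are the faces $d_3,d_1,d_0,d_2$ of an element of $X_3$ if and only if $\alpha_G(m_{012}\otimes m_{023})=m_{123}\otimes m_{013}$. **Theorem.** Let $X$ be a 2-groupoid object in $(\mathcal C,\mathcal T)$. There is a categorified groupoid $G\rightrightarrows M$ to which $X$ corresponds. For every categorified groupoid $G\rightrightarrows M$ to which $X$ corresponds (with chosen isomorphisms), there is a bijection between isomorphism classes of categorified actions of $G\rightrightarrows M$ (on arbitrary groupoids $E$ in $(\mathcal C,\mathcal T)$) and isomorphism classes of 2-groupoid Kan fibrations $\pi\colon A\to X$ (isomorphisms being over $X$), such that the class of an action corresponds to the class of $\pi$ if and only if $A$ is the action 2-groupoid of the action, that is, up to chosen isomorphisms: $A_0=E_0$ and $A_1=E_{\mathrm{act}}$; $\pi_0=J$ and $\pi_1=\mathrm{pr}_2\circ l$; on $A_1$, $d_1=\mathrm{pr}_1\circ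 l$ and $d_0=r$, where $l,r$ are the moment maps of $E_{\mathrm{act}}$; $s_0=\rho^{-1}(1)$ on $A_0$; and elements $a_{01},a_{12},a_{02}$ of $A_1$ and $\mu$ of $X_2$ are the faces $d_2,d_0,d_1$ and the image under $\pi_2$ of an element of $A_2$ if and only if $\alpha(a_{01}\otimes a_{12})=\mu\otimes a_{02}$. -/

import Mathlib

open CategoryTheory CategoryTheory.Limits Opposite Simplicial

universe v u

set_option linter.unusedSectionVars false
set_option linter.unusedVariables false

namespace HigherGpd

/-! ## Categories with a singleton pretopology -/

section Pretopology

variable {C : Type u} [Category.{v} C]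

/-- A singleton Grothendieck pretopology: `W f` says that `f` is a cover. -/
class SingletonPretopology (W : MorphismProperty C) : Prop where
  of_isIso : ∀ {X Y : C} (f : X ⟶ Y), IsIso f → W f
  comp : ∀ {X Y Z : C} (f : X ⟶ Y) (g : Y ⟶ Z), W f → W g → W (f ≫ g)
  hasPullback : ∀ {X Y Z : C} (f : X ⟶ Z) (g : Y ⟶ Z), W g → HasPullback f g
  base_change : ∀ {P X Y Z : C} {p : P ⟶ X} {q : P ⟶ Y} {f : X ⟶ Z} {g : Y ⟶ Z},
    IsPullback p q f g → W g → W p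

/-- An action of the Čech groupoid `P ×_M P ⇉ P` of a map `κ : P ⟶ M` on `Q` along `f : Q ⟶ P`,
written on generalized elements: `act q p` is the transport of `q` to the fibre over `p`. -/
structure CechAction {M P Q : C} (κ : P ⟶ M) (f : Q ⟶ P) where
  act : ∀ {T : C} (q : T ⟶ Q) (p : T ⟶ P), (q ≫ f) ≫ κ = p ≫ κ → (T ⟶ Q)
  act_nat : ∀ {T T' : C} (w : T' ⟶ T) (q : T ⟶ Q) (p : T ⟶ P) (e : (q ≫ f) ≫ κ = p ≫ κ)
    (e' : ((w ≫ q) ≫ f) ≫ κ = (w ≫ p) ≫ κ), act (w ≫ q) (w ≫ p) e' = w ≫ act q p e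
  act_f : ∀ {T : C} (q : T ⟶ Q) (p : T ⟶ P) (e : (q ≫ f) ≫ κ = p ≫ κ), act q p e ≫ f = p
  act_self : ∀ {T : C} (q : T ⟶ Q), act q (q ≫ f) rfl = q
  act_act : ∀ {T : C} (q : T ⟶ Q) (p p' : T ⟶ P) (e : (q ≫ f) ≫ κ = p ≫ κ)
    (e' : (act q p e ≫ f) ≫ κ = p' ≫ κ) (e'' : (q ≫ f) ≫ κ = p' ≫ κ),
    act (act q p e) p' e' = act q p' e''

/-- The standing assumptions under which Hilsum–Skandalis bibundles between groupoids in `(C, W)`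
can be composed: the pretopology is subcanonical (covers are effective epimorphisms), covers
satisfy the two-out-of-three property, and for a cover `κ : P ⟶ M`, every action of the Čech
groupoid of `κ` along a cover `Q ⟶ P` has a quotient `N`, with `Q ≅ N ×_M P`. -/
class NicePretopology (W : MorphismProperty C) : Prop extends SingletonPretopology W where
  effectiveEpi : ∀ {X Y : C} (f : X ⟶ Y), W f → EffectiveEpi f
  of_comp : ∀ {X Y Z : C} (f : X ⟶ Y) (g : Y ⟶ Z), W f → W (f ≫ g) → W g
  quotient : ∀ {M P Q : C} (κ : P ⟶ M) (f : Q ⟶ P), W κ → W f → ∀ A : CechAction κ f,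
    ∃ (N : C) (g : N ⟶ M) (k : Q ⟶ N), IsPullback k f g κ ∧
      ∀ {T : C} (q : T ⟶ Q) (p : T ⟶ P) (e : (q ≫ f) ≫ κ = p ≫ κ), A.act q p e ≫ k = q ≫ k

end Pretopology

section Pullbacks

variable {C : Type u} [Category.{v} C] {W : MorphismProperty C} [NicePretopology W]

/-- The fibre product `X ×_Z Y` along a cover `g : Y ⟶ Z`. -/
noncomputable def Fp {X Y Z : C} (f : X ⟶ Z) (g : Y ⟶ Z) (hg : W g) : C :=
  haveI := SingletonPretopology.hasPullback f g hg
  pullback f g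

variable {X Y Z : C} {f : X ⟶ Z} {g : Y ⟶ Z} (hg : W g)

noncomputable def Fp.fst : Fp f g hg ⟶ X :=
  haveI := SingletonPretopology.hasPullback f g hg
  pullback.fst f g

noncomputable def Fp.snd : Fp f g hg ⟶ Y :=
  haveI := SingletonPretopology.hasPullback f g hg
  pullback.snd f g

theorem Fp.isPullback : IsPullback (Fp.fst (f := f) hg) (Fp.snd hg) f g :=
  haveI := SingletonPretopology.hasPullback f g hg
  IsPullback.of_hasPullback f g

theorem Fp.cond : Fp.fst (f := f) hg ≫ f = Fp.snd hg ≫ g := (Fp.isPullback hg).w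

noncomputable def Fp.lift {T : C} (a : T ⟶ X) (b : T ⟶ Y) (e : a ≫ f = b ≫ g) : T ⟶ Fp f g hg :=
  (Fp.isPullback hg).lift a b e

@[simp]
theorem Fp.lift_fst {T : C} (a : T ⟶ X) (b : T ⟶ Y) (e : a ≫ f = b ≫ g) :
    Fp.lift hg a b e ≫ Fp.fst hg = a := (Fp.isPullback hg).lift_fst a b e

@[simp]
theorem Fp.lift_snd {T : C} (a : T ⟶ X) (b : T ⟶ Y) (e : a ≫ f = b ≫ g) :
    Fp.lift hg a b e ≫ Fp.snd hg = b := (Fp.isPullback hg).lift_snd a b e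

@[simp]
theorem Fp.lift_fst_assoc {T V : C} (a : T ⟶ X) (b : T ⟶ Y) (e : a ≫ f = b ≫ g) (w : X ⟶ V) :
    Fp.lift hg a b e ≫ Fp.fst hg ≫ w = a ≫ w := by rw [← Category.assoc, Fp.lift_fst]

@[simp]
theorem Fp.lift_snd_assoc {T V : C} (a : T ⟶ X) (b : T ⟶ Y) (e : a ≫ f = b ≫ g) (w : Y ⟶ V) :
    Fp.lift hg a b e ≫ Fp.snd hg ≫ w = b ≫ w := by rw [← Category.assoc, Fp.lift_snd]

theorem Fp.ext {T : C} {a b : T ⟶ Fp f g hg} (h₁ : a ≫ Fp.fst hg = b ≫ Fp.fst hg)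
    (h₂ : a ≫ Fp.snd hg = b ≫ Fp.snd hg) : a = b := (Fp.isPullback hg).hom_ext h₁ h₂

theorem Fp.fst_cover : W (Fp.fst (f := f) hg) :=
  SingletonPretopology.base_change (Fp.isPullback hg) hg

theorem Fp.snd_cover (hf : W f) : W (Fp.snd (f := f) hg) :=
  SingletonPretopology.base_change (Fp.isPullback hg).flip hf

theorem cover_comp {X Y Z : C} {f : X ⟶ Y} {g : Y ⟶ Z} (hf : W f) (hg : W g) : W (f ≫ g) :=
  SingletonPretopology.comp f g hf hg

theorem cover_id (X : C) : W (𝟙 X) := SingletonPretopology.of_isIso _ inferInstance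

theorem isPullback_of_points {P X Y Z : C} {p : P ⟶ X} {q : P ⟶ Y} {f : X ⟶ Z} {g : Y ⟶ Z}
    (w : p ≫ f = q ≫ g)
    (h : ∀ {T : C} (a : T ⟶ X) (b : T ⟶ Y), a ≫ f = b ≫ g → ∃ c : T ⟶ P, c ≫ p = a ∧ c ≫ q = b)
    (h' : ∀ {T : C} (c c' : T ⟶ P), c ≫ p = c' ≫ p → c ≫ q = c' ≫ q → c = c') :
    IsPullback p q f g :=
  ⟨⟨w⟩, ⟨PullbackCone.IsLimit.mk w (fun s => (h s.fst s.snd s.condition).choose)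
    (fun s => (h s.fst s.snd s.condition).choose_spec.1)
    (fun s => (h s.fst s.snd s.condition).choose_spec.2)
    (fun s m h₁ h₂ => h' _ _ (h₁.trans (h s.fst s.snd s.condition).choose_spec.1.symm)
      (h₂.trans (h s.fst s.snd s.condition).choose_spec.2.symm))⟩⟩

/-- The product over `Z` of two covers is a cover. -/
theorem Fp.map_cover {X' Y' : C} {p : X' ⟶ X} {q : Y' ⟶ Y} (hp : W p) (hq : W q)
    {f' : X' ⟶ Z} {g' : Y' ⟶ Z} (hg' : W g') (hf : p ≫ f = f') (hg₂ : q ≫ g = g')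
    (m : Fp f' g' hg' ⟶ Fp f g hg) (h₁ : m ≫ Fp.fst hg = Fp.fst hg' ≫ p)
    (h₂ : m ≫ Fp.snd hg = Fp.snd hg' ≫ q) : W m := by
  subst hf hg₂
  let n : Fp (p ≫ f) (q ≫ g) hg' ⟶ Fp (p ≫ f) g hg :=
    Fp.lift hg (Fp.fst hg') (Fp.snd hg' ≫ q) (by simpa using Fp.cond hg')
  let k : Fp (p ≫ f) g hg ⟶ Fp f g hg :=
    Fp.lift hg (Fp.fst hg ≫ p) (Fp.snd hg) (by simpa using Fp.cond hg)
  have hn : W n := by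
    refine SingletonPretopology.base_change (g := q) (f := Fp.snd hg) (q := Fp.snd hg')
      (isPullback_of_points (by simp [n]) (fun a b e => ?_) (fun c c' e e' => ?_)) hq
    · have h : (a ≫ Fp.fst hg) ≫ p ≫ f = b ≫ q ≫ g := by
        rw [← Category.assoc b, ← e, Category.assoc, Category.assoc, Fp.cond hg]
      exact ⟨Fp.lift hg' (a ≫ Fp.fst hg) b h, Fp.ext hg (by simp [n]) (by simp [n, e]), by simp⟩
    · refine Fp.ext hg' ?_ e'
      simpa [n] using congrArg (· ≫ Fp.fst hg) e
  have hk : W k := by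
    refine SingletonPretopology.base_change (g := p) (f := Fp.fst hg) (q := Fp.fst hg)
      (isPullback_of_points (by simp [k]) (fun a b e => ?_) (fun c c' e e' => ?_)) hp
    · have h : b ≫ p ≫ f = (a ≫ Fp.snd hg) ≫ g := by
        rw [← Category.assoc b, ← e, Category.assoc, Category.assoc, Fp.cond hg]
      exact ⟨Fp.lift hg b (a ≫ Fp.snd hg) h, Fp.ext hg (by simp [k, e]) (by simp [k]), by simp⟩
    · refine Fp.ext hg e' ?_
      simpa [k] using congrArg (· ≫ Fp.snd hg) e
  have : m = n ≫ k := Fp.ext hg (by simp [n, k, h₁]) (by simp [n, k, h₂])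
  rw [this]
  exact cover_comp hn hk

/-- Covers are epimorphisms. -/
theorem cover_cancel {X Y Z : C} {f : X ⟶ Y} (hf : W f) {a b : Y ⟶ Z} (e : f ≫ a = f ≫ b) :
    a = b := by
  have := NicePretopology.effectiveEpi f hf
  exact (cancel_epi f).1 e

/-- Morphisms descend along covers. -/
theorem cover_desc {X Y Z : C} {f : X ⟶ Y} (hf : W f) (a : X ⟶ Z)
    (h : ∀ {T : C} (x y : T ⟶ X), x ≫ f = y ≫ f → x ≫ a = y ≫ a) : ∃ b : Y ⟶ Z, f ≫ b = a := by
  have := NicePretopology.effectiveEpi f hf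
  exact ⟨EffectiveEpi.desc f a h, EffectiveEpi.fac f a h⟩

end Pullbacks

/-! ## Internal groupoids and Hilsum–Skandalis bibundles

Structure maps defined on fibre products are described by their effect on generalized elements
`T ⟶ X`, naturally in `T`; by the Yoneda lemma this is the same as a morphism from the fibre
product, which exists because the source and target maps are covers. -/

section Groupoids

variable {C : Type u} [Category.{v} C] (W : MorphismProperty C)

/-- A groupoid object in `(C, W)`. The product `mul g h` is defined when the source of `g` is the
target of `h`. -/
structure Gpd where
  ob : C
  mor : C
  s : mor ⟶ ob
  t : mor ⟶ ob
  s_cover : W s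
  t_cover : W t
  one : ob ⟶ mor
  inv : mor ⟶ mor
  mul : ∀ {T : C} (g h : T ⟶ mor), g ≫ s = h ≫ t → (T ⟶ mor)
  mul_nat : ∀ {T T' : C} (w : T' ⟶ T) (g h : T ⟶ mor) (e : g ≫ s = h ≫ t)
    (e' : (w ≫ g) ≫ s = (w ≫ h) ≫ t), mul (w ≫ g) (w ≫ h) e' = w ≫ mul g h e
  one_s : one ≫ s = 𝟙 ob
  one_t : one ≫ t = 𝟙 ob
  inv_s : inv ≫ s = t
  inv_t : inv ≫ t = s
  mul_s : ∀ {T : C} (g h : T ⟶ mor) (e : g ≫ s = h ≫ t), mul g h e ≫ s = h ≫ s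
  mul_t : ∀ {T : C} (g h : T ⟶ mor) (e : g ≫ s = h ≫ t), mul g h e ≫ t = g ≫ t
  one_mul : ∀ {T : C} (g : T ⟶ mor) (e : (g ≫ t ≫ one) ≫ s = g ≫ t),
    mul (g ≫ t ≫ one) g e = g
  mul_one : ∀ {T : C} (g : T ⟶ mor) (e : g ≫ s = (g ≫ s ≫ one) ≫ t),
    mul g (g ≫ s ≫ one) e = g
  mul_assoc : ∀ {T : C} (g h k : T ⟶ mor) (e₁ : g ≫ s = h ≫ t) (e₂ : h ≫ s = k ≫ t)
    (e₃ : mul g h e₁ ≫ s = k ≫ t) (e₄ : g ≫ s = mul h k e₂ ≫ t),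
    mul (mul g h e₁) k e₃ = mul g (mul h k e₂) e₄
  mul_inv : ∀ {T : C} (g : T ⟶ mor) (e : g ≫ s = (g ≫ inv) ≫ t),
    mul g (g ≫ inv) e = g ≫ t ≫ one
  inv_mul : ∀ {T : C} (g : T ⟶ mor) (e : (g ≫ inv) ≫ s = g ≫ t),
    mul (g ≫ inv) g e = g ≫ s ≫ one

variable {W}

/-- A functor between internal groupoids. -/
structure Gpd.Fun (G H : Gpd W) where
  ob : G.ob ⟶ H.ob
  mor : G.mor ⟶ H.mor
  mor_s : mor ≫ H.s = G.s ≫ ob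
  mor_t : mor ≫ H.t = G.t ≫ ob
  mor_one : G.one ≫ mor = ob ≫ H.one
  mor_mul : ∀ {T : C} (g h : T ⟶ G.mor) (e : g ≫ G.s = h ≫ G.t)
    (e' : (g ≫ mor) ≫ H.s = (h ≫ mor) ≫ H.t),
    H.mul (g ≫ mor) (h ≫ mor) e' = G.mul g h e ≫ mor

/-- A functor from `G` to the trivial groupoid on `M`, i.e. an invariant map `G.ob ⟶ M`. -/
structure Gpd.ToTriv (G : Gpd W) (M : C) where
  map : G.ob ⟶ M
  inv : G.s ≫ map = G.t ≫ map

/-- A Hilsum–Skandalis bibundle from `G` to `H`: an object `X` with commuting left `G`- and right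
`H`-actions along the moment maps `l` and `r`, such that `l` is a right principal `H`-bundle, i.e.
a cover whose shear map `X ×_{H.ob} H.mor ⟶ X ×_{G.ob} X` is an isomorphism. -/
structure HSBibundle (G H : Gpd W) where
  X : C
  l : X ⟶ G.ob
  r : X ⟶ H.ob
  lact : ∀ {T : C} (g : T ⟶ G.mor) (p : T ⟶ X), g ≫ G.s = p ≫ l → (T ⟶ X)
  ract : ∀ {T : C} (p : T ⟶ X) (h : T ⟶ H.mor), p ≫ r = h ≫ H.t → (T ⟶ X)
  lact_nat : ∀ {T T' : C} (w : T' ⟶ T) (g : T ⟶ G.mor) (p : T ⟶ X) (e : g ≫ G.s = p ≫ l)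
    (e' : (w ≫ g) ≫ G.s = (w ≫ p) ≫ l), lact (w ≫ g) (w ≫ p) e' = w ≫ lact g p e
  ract_nat : ∀ {T T' : C} (w : T' ⟶ T) (p : T ⟶ X) (h : T ⟶ H.mor) (e : p ≫ r = h ≫ H.t)
    (e' : (w ≫ p) ≫ r = (w ≫ h) ≫ H.t), ract (w ≫ p) (w ≫ h) e' = w ≫ ract p h e
  lact_l : ∀ {T : C} (g : T ⟶ G.mor) (p : T ⟶ X) (e : g ≫ G.s = p ≫ l),
    lact g p e ≫ l = g ≫ G.t
  lact_r : ∀ {T : C} (g : T ⟶ G.mor) (p : T ⟶ X) (e : g ≫ G.s = p ≫ l),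
    lact g p e ≫ r = p ≫ r
  one_lact : ∀ {T : C} (p : T ⟶ X) (e : (p ≫ l ≫ G.one) ≫ G.s = p ≫ l),
    lact (p ≫ l ≫ G.one) p e = p
  mul_lact : ∀ {T : C} (g g' : T ⟶ G.mor) (p : T ⟶ X) (e₁ : g ≫ G.s = g' ≫ G.t)
    (e₂ : g' ≫ G.s = p ≫ l) (e₃ : G.mul g g' e₁ ≫ G.s = p ≫ l)
    (e₄ : g ≫ G.s = lact g' p e₂ ≫ l),
    lact (G.mul g g' e₁) p e₃ = lact g (lact g' p e₂) e₄
  ract_r : ∀ {T : C} (p : T ⟶ X) (h : T ⟶ H.mor) (e : p ≫ r = h ≫ H.t),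
    ract p h e ≫ r = h ≫ H.s
  ract_l : ∀ {T : C} (p : T ⟶ X) (h : T ⟶ H.mor) (e : p ≫ r = h ≫ H.t),
    ract p h e ≫ l = p ≫ l
  ract_one : ∀ {T : C} (p : T ⟶ X) (e : p ≫ r = (p ≫ r ≫ H.one) ≫ H.t),
    ract p (p ≫ r ≫ H.one) e = p
  ract_mul : ∀ {T : C} (p : T ⟶ X) (h h' : T ⟶ H.mor) (e₁ : p ≫ r = h ≫ H.t)
    (e₂ : ract p h e₁ ≫ r = h' ≫ H.t) (e₃ : h ≫ H.s = h' ≫ H.t)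
    (e₄ : p ≫ r = H.mul h h' e₃ ≫ H.t),
    ract (ract p h e₁) h' e₂ = ract p (H.mul h h' e₃) e₄
  comm : ∀ {T : C} (g : T ⟶ G.mor) (p : T ⟶ X) (h : T ⟶ H.mor) (e₁ : g ≫ G.s = p ≫ l)
    (e₂ : lact g p e₁ ≫ r = h ≫ H.t) (e₃ : p ≫ r = h ≫ H.t)
    (e₄ : g ≫ G.s = ract p h e₃ ≫ l),
    ract (lact g p e₁) h e₂ = lact g (ract p h e₃) e₄
  l_cover : W l
  shear : ∀ {T : C} (p p' : T ⟶ X), p ≫ l = p' ≫ l →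
    ∃! h : T ⟶ H.mor, ∃ e : p ≫ r = h ≫ H.t, ract p h e = p'

/-- A 2-morphism between HS bibundles: an equivariant map (automatically invertible). -/
structure HSHom {G H : Gpd W} (P Q : HSBibundle G H) where
  map : P.X ⟶ Q.X
  map_l : map ≫ Q.l = P.l
  map_r : map ≫ Q.r = P.r
  map_lact : ∀ {T : C} (g : T ⟶ G.mor) (p : T ⟶ P.X) (e : g ≫ G.s = p ≫ P.l)
    (e' : g ≫ G.s = (p ≫ map) ≫ Q.l), P.lact g p e ≫ map = Q.lact g (p ≫ map) e'
  map_ract : ∀ {T : C} (p : T ⟶ P.X) (h : T ⟶ H.mor) (e : p ≫ P.r = h ≫ H.t)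
    (e' : (p ≫ map) ≫ Q.r = h ≫ H.t), P.ract p h e ≫ map = Q.ract (p ≫ map) h e'

end Groupoids


section Constructions

variable {C : Type u} [Category.{v} C] {W : MorphismProperty C}

theorem Gpd.mul_congr (G : Gpd W) {T : C} {g g' h h' : T ⟶ G.mor} (hg : g = g') (hh : h = h')
    (e : g ≫ G.s = h ≫ G.t) (e' : g' ≫ G.s = h' ≫ G.t) : G.mul g h e = G.mul g' h' e' := by
  subst hg hh; rfl

theorem HSBibundle.lact_congr {G H : Gpd W} (P : HSBibundle G H) {T : C} {g g' : T ⟶ G.mor}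
    {p p' : T ⟶ P.X} (hg : g = g') (hp : p = p') (e : g ≫ G.s = p ≫ P.l)
    (e' : g' ≫ G.s = p' ≫ P.l) : P.lact g p e = P.lact g' p' e' := by
  subst hg hp; rfl

theorem HSBibundle.ract_congr {G H : Gpd W} (P : HSBibundle G H) {T : C} {h h' : T ⟶ H.mor}
    {p p' : T ⟶ P.X} (hp : p = p') (hh : h = h') (e : p ≫ P.r = h ≫ H.t)
    (e' : p' ≫ P.r = h' ≫ H.t) : P.ract p h e = P.ract p' h' e' := by
  subst hh hp; rfl

/-- The unit bibundle: `G.mor` with left and right multiplication. -/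
def unitBibundle (G : Gpd W) : HSBibundle G G where
  X := G.mor
  l := G.t
  r := G.s
  lact := G.mul
  ract := G.mul
  lact_nat := G.mul_nat
  ract_nat := G.mul_nat
  lact_l := G.mul_t
  lact_r := G.mul_s
  one_lact := G.one_mul
  mul_lact g g' p e₁ e₂ e₃ e₄ := G.mul_assoc g g' p e₁ e₂ e₃ e₄
  ract_r := G.mul_s
  ract_l := G.mul_t
  ract_one := G.mul_one
  ract_mul p h h' e₁ e₂ e₃ e₄ := G.mul_assoc p h h' e₁ e₃ e₂ e₄
  comm g p h e₁ e₂ e₃ e₄ := G.mul_assoc g p h e₁ e₃ e₂ e₄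
  l_cover := G.t_cover
  shear {T} p p' e := by
    have e1 : (p ≫ G.inv) ≫ G.s = p' ≫ G.t := by rw [Category.assoc, G.inv_s, e]
    refine ⟨G.mul (p ≫ G.inv) p' e1, ⟨by rw [G.mul_t, Category.assoc, G.inv_t], ?_⟩, ?_⟩
    · have e2 : p ≫ G.s = (p ≫ G.inv) ≫ G.t := by rw [Category.assoc, G.inv_t]
      have e3 : (G.mul p (p ≫ G.inv) e2) ≫ G.s = p' ≫ G.t := by rw [G.mul_s, e1]
      have e4 : (p' ≫ G.t ≫ G.one) ≫ G.s = p' ≫ G.t := by simp [G.one_s]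
      rw [← G.mul_assoc _ _ _ e2 e1 e3]
      refine (G.mul_congr ?_ rfl _ e4).trans (G.one_mul p' e4)
      rw [G.mul_inv, ← Category.assoc, e, Category.assoc]
    · rintro h ⟨e5, rfl⟩
      have e2 : (p ≫ G.inv) ≫ G.s = p ≫ G.t := by rw [Category.assoc, G.inv_s]
      have e3 : (G.mul (p ≫ G.inv) p e2) ≫ G.s = h ≫ G.t := by rw [G.mul_s, e5]
      have e4 : (h ≫ G.t ≫ G.one) ≫ G.s = h ≫ G.t := by simp [G.one_s]
      rw [← G.mul_assoc _ _ _ e2 e5 e3]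
      refine ((G.one_mul h e4).symm.trans (G.mul_congr ?_ rfl _ _))
      rw [G.inv_mul, ← Category.assoc, ← e5, Category.assoc]

section FunLemmas

variable {G H : Gpd W} (F : Gpd.Fun G H)

theorem Gpd.Fun.s_ob : G.s ≫ F.ob = F.mor ≫ H.s := F.mor_s.symm

theorem Gpd.Fun.t_ob : G.t ≫ F.ob = F.mor ≫ H.t := F.mor_t.symm

theorem Gpd.Fun.s_ob_assoc {V : C} (w : H.ob ⟶ V) : G.s ≫ F.ob ≫ w = F.mor ≫ H.s ≫ w := by
  rw [← Category.assoc, F.s_ob, Category.assoc]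

theorem Gpd.Fun.t_ob_assoc {V : C} (w : H.ob ⟶ V) : G.t ≫ F.ob ≫ w = F.mor ≫ H.t ≫ w := by
  rw [← Category.assoc, F.t_ob, Category.assoc]

theorem Gpd.Fun.mul_mor {T : C} (g h : T ⟶ G.mor) (e : g ≫ G.s = h ≫ G.t) :
    G.mul g h e ≫ F.mor = H.mul (g ≫ F.mor) (h ≫ F.mor) (by
      rw [Category.assoc, F.mor_s, Category.assoc, F.mor_t, ← Category.assoc, e,
        Category.assoc]) := (F.mor_mul g h e _).symm

end FunLemmas

theorem HSBibundle.div_unique {G H : Gpd W} (P : HSBibundle G H) {T : C} {p p' : T ⟶ P.X}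
    {h h' : T ⟶ H.mor} (e : p ≫ P.r = h ≫ H.t) (e' : p ≫ P.r = h' ≫ H.t)
    (k : P.ract p h e = p') (k' : P.ract p h' e' = p') : h = h' :=
  (P.shear p p' (by rw [← k, P.ract_l])).unique ⟨e, k⟩ ⟨e', k'⟩

/-- The division map of a principal bundle: `p * div p p' = p'`. -/
noncomputable def HSBibundle.div {G H : Gpd W} (P : HSBibundle G H) {T : C} (p p' : T ⟶ P.X)
    (e : p ≫ P.l = p' ≫ P.l) : T ⟶ H.mor := (P.shear p p' e).exists.choose

theorem HSBibundle.div_t {G H : Gpd W} (P : HSBibundle G H) {T : C} (p p' : T ⟶ P.X)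
    (e : p ≫ P.l = p' ≫ P.l) : p ≫ P.r = P.div p p' e ≫ H.t :=
  (P.shear p p' e).exists.choose_spec.choose

theorem HSBibundle.ract_div {G H : Gpd W} (P : HSBibundle G H) {T : C} (p p' : T ⟶ P.X)
    (e : p ≫ P.l = p' ≫ P.l) (k : p ≫ P.r = P.div p p' e ≫ H.t) :
    P.ract p (P.div p p' e) k = p' :=
  (P.shear p p' e).exists.choose_spec.choose_spec

theorem HSBibundle.div_s {G H : Gpd W} (P : HSBibundle G H) {T : C} (p p' : T ⟶ P.X)
    (e : p ≫ P.l = p' ≫ P.l) : P.div p p' e ≫ H.s = p' ≫ P.r := by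
  rw [← P.ract_r p _ (P.div_t p p' e), P.ract_div]

variable [NicePretopology W]

/-- The composite of a functor `F : G' ⟶ G` with an HS bibundle `P` from `G` to `H`, realised as
the pullback of `P` along `F`. For the unit bibundle this is the bundlisation of `F`. -/
noncomputable def restrict {G' G H : Gpd W} (F : Gpd.Fun G' G) (P : HSBibundle G H) :
    HSBibundle G' H where
  X := Fp F.ob P.l P.l_cover
  l := Fp.fst P.l_cover
  r := Fp.snd P.l_cover ≫ P.r
  lact g p e := Fp.lift P.l_cover (g ≫ G'.t)
    (P.lact (g ≫ F.mor) (p ≫ Fp.snd P.l_cover) (by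
      rw [Category.assoc, F.mor_s, ← Category.assoc, e, Category.assoc, Fp.cond, Category.assoc]))
    (by rw [P.lact_l, Category.assoc, Category.assoc, F.mor_t])
  ract p h e := Fp.lift P.l_cover (p ≫ Fp.fst P.l_cover)
    (P.ract (p ≫ Fp.snd P.l_cover) h (by simpa using e))
    (by rw [P.ract_l, Category.assoc, Category.assoc, Fp.cond])
  lact_nat w g p e e' := by
    refine Fp.ext _ (by simp) ?_
    simp only [Fp.lift_snd, Category.assoc]
    rw [← P.lact_nat]
  ract_nat w p h e e' := by
    refine Fp.ext _ (by simp) ?_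
    simp only [Fp.lift_snd, Category.assoc]
    rw [← P.ract_nat]
  lact_l g p e := by simp
  lact_r g p e := by simp [P.lact_r]
  one_lact p e := by
    refine Fp.ext _ (by simp [G'.one_t]) ?_
    simp only [Fp.lift_snd]
    have e2 : ((p ≫ Fp.snd P.l_cover) ≫ P.l ≫ G.one) ≫ G.s = (p ≫ Fp.snd P.l_cover) ≫ P.l := by
      simp [G.one_s]
    refine (P.lact_congr ?_ rfl _ e2).trans (P.one_lact _ e2)
    simp only [Category.assoc, F.mor_one]
    rw [← Category.assoc _ F.ob, Fp.cond, Category.assoc]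
  mul_lact g g' p e₁ e₂ e₃ e₄ := by
    refine Fp.ext _ (by simp [G'.mul_t]) ?_
    simp only [Fp.lift_snd]
    have e5 : (g ≫ F.mor) ≫ G.s = (g' ≫ F.mor) ≫ G.t := by
      simp only [Category.assoc, F.mor_s, F.mor_t]; rw [← Category.assoc, e₁, Category.assoc]
    have e6 : (g' ≫ F.mor) ≫ G.s = (p ≫ Fp.snd P.l_cover) ≫ P.l := by
      rw [Category.assoc, F.mor_s, ← Category.assoc, e₂, Category.assoc, Fp.cond, Category.assoc]
    have e7 := P.mul_lact (g ≫ F.mor) (g' ≫ F.mor) (p ≫ Fp.snd P.l_cover) e5 e6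
      (by rw [G.mul_s, e6]) (by rw [P.lact_l, e5])
    refine (P.lact_congr ?_ rfl _ _).trans (e7.trans (P.lact_congr rfl ?_ _ _))
    · rw [F.mor_mul]
    · simp
  ract_r p h e := by simp [P.ract_r]
  ract_l p h e := by simp
  ract_one p e := by
    refine Fp.ext _ (by simp) ?_
    simp only [Fp.lift_snd]
    exact (P.ract_congr rfl (by simp) _ (by simp [H.one_t])).trans (P.ract_one _ (by simp [H.one_t]))
  ract_mul p h h' e₁ e₂ e₃ e₄ := by
    refine Fp.ext _ (by simp) ?_
    simp only [Fp.lift_snd]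
    refine (P.ract_congr (by simp) rfl _ ?_).trans (P.ract_mul (p ≫ Fp.snd P.l_cover) h h' ?_ ?_ e₃ ?_)
    · rw [P.ract_r, e₃]
    · simpa using e₁
    · rw [P.ract_r, e₃]
    · simpa using e₄
  comm g p h e₁ e₂ e₃ e₄ := by
    refine Fp.ext _ (by simp) ?_
    simp only [Fp.lift_snd]
    have e6 : (g ≫ F.mor) ≫ G.s = (p ≫ Fp.snd P.l_cover) ≫ P.l := by
      rw [Category.assoc, F.mor_s, ← Category.assoc, e₁, Category.assoc, Fp.cond, Category.assoc]
    have e7 : (p ≫ Fp.snd P.l_cover) ≫ P.r = h ≫ H.t := by simpa using e₃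
    refine (P.ract_congr (by simp) rfl _ ?_).trans ((P.comm (g ≫ F.mor) (p ≫ Fp.snd P.l_cover) h e6 ?_
      e7 ?_).trans (P.lact_congr rfl (by simp) _ _))
    · rw [P.lact_r, e7]
    · rw [P.lact_r, e7]
    · rw [P.ract_l, e6]
  l_cover := Fp.fst_cover P.l_cover
  shear p p' e := by
    have e1 : (p ≫ Fp.snd P.l_cover) ≫ P.l = (p' ≫ Fp.snd P.l_cover) ≫ P.l := by
      rw [Category.assoc, Category.assoc, ← Fp.cond, ← Category.assoc, e, Category.assoc]
    obtain ⟨h, ⟨e2, e3⟩, h2⟩ := P.shear _ _ e1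
    refine ⟨h, ⟨by simpa using e2, Fp.ext _ (by simpa using e) (by simpa using e3)⟩, ?_⟩
    rintro h' ⟨e4, e5⟩
    exact h2 h' ⟨by simpa using e4, by rw [← e5]; simp⟩


/-- The fibre product of groupoids `G ×_M H` over an object `M`. -/
noncomputable def fiberProd {G H : Gpd W} {M : C} (a : G.ToTriv M) (b : H.ToTriv M)
    (hb : W b.map) : Gpd W where
  ob := Fp a.map b.map hb
  mor := Fp (G.s ≫ a.map) (H.s ≫ b.map) (cover_comp H.s_cover hb)
  s := Fp.lift hb (Fp.fst _ ≫ G.s) (Fp.snd _ ≫ H.s) (by simpa using Fp.cond _)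
  t := Fp.lift hb (Fp.fst _ ≫ G.t) (Fp.snd _ ≫ H.t)
    (by simpa [a.inv, b.inv] using Fp.cond (f := G.s ≫ a.map) (cover_comp H.s_cover hb))
  s_cover := Fp.map_cover hb G.s_cover H.s_cover _ rfl rfl _ (by simp) (by simp)
  t_cover := Fp.map_cover hb G.t_cover H.t_cover _ a.inv.symm b.inv.symm _ (by simp) (by simp)
  one := Fp.lift _ (Fp.fst hb ≫ G.one) (Fp.snd hb ≫ H.one) (by
    have h₁ : G.one ≫ G.s ≫ a.map = a.map := by rw [← Category.assoc, G.one_s, Category.id_comp]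
    have h₂ : H.one ≫ H.s ≫ b.map = b.map := by rw [← Category.assoc, H.one_s, Category.id_comp]
    rw [Category.assoc, Category.assoc, h₁, h₂, Fp.cond])
  inv := Fp.lift _ (Fp.fst _ ≫ G.inv) (Fp.snd _ ≫ H.inv) (by
    have h₁ : G.inv ≫ G.s ≫ a.map = G.s ≫ a.map := by rw [← Category.assoc, G.inv_s, a.inv]
    have h₂ : H.inv ≫ H.s ≫ b.map = H.s ≫ b.map := by rw [← Category.assoc, H.inv_s, b.inv]
    rw [Category.assoc, Category.assoc, h₁, h₂, Fp.cond])
  mul g h e := Fp.lift _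
    (G.mul (g ≫ Fp.fst _) (h ≫ Fp.fst _) (by simpa using e =≫ Fp.fst hb))
    (H.mul (g ≫ Fp.snd _) (h ≫ Fp.snd _) (by simpa using e =≫ Fp.snd hb)) (by
      rw [← Category.assoc, G.mul_s, ← Category.assoc, H.mul_s]
      simpa using h ≫= Fp.cond (f := G.s ≫ a.map) (cover_comp H.s_cover hb))
  mul_nat w g h e e' := by
    refine Fp.ext _ ?_ ?_
    · simp only [Fp.lift_fst, Category.assoc]
      rw [← G.mul_nat]
    · simp only [Fp.lift_snd, Category.assoc]
      rw [← H.mul_nat]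
  one_s := Fp.ext _ (by simp [G.one_s]) (by simp [H.one_s])
  one_t := Fp.ext _ (by simp [G.one_t]) (by simp [H.one_t])
  inv_s := Fp.ext _ (by simp [G.inv_s]) (by simp [H.inv_s])
  inv_t := Fp.ext _ (by simp [G.inv_t]) (by simp [H.inv_t])
  mul_s g h e := Fp.ext _ (by simp [G.mul_s]) (by simp [H.mul_s])
  mul_t g h e := Fp.ext _ (by simp [G.mul_t]) (by simp [H.mul_t])
  one_mul g e := by
    refine Fp.ext _ ?_ ?_
    · simp only [Fp.lift_fst]
      exact (G.mul_congr (by simp) rfl _ (by simp [G.one_s])).trans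
        (G.one_mul _ (by simp [G.one_s]))
    · simp only [Fp.lift_snd]
      exact (H.mul_congr (by simp) rfl _ (by simp [H.one_s])).trans
        (H.one_mul _ (by simp [H.one_s]))
  mul_one g e := by
    refine Fp.ext _ ?_ ?_
    · simp only [Fp.lift_fst]
      exact (G.mul_congr rfl (by simp) _ (by simp [G.one_t])).trans
        (G.mul_one _ (by simp [G.one_t]))
    · simp only [Fp.lift_snd]
      exact (H.mul_congr rfl (by simp) _ (by simp [H.one_t])).trans
        (H.mul_one _ (by simp [H.one_t]))
  mul_assoc g h k e₁ e₂ e₃ e₄ := by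
    refine Fp.ext _ ?_ ?_
    · simp only [Fp.lift_fst]
      exact G.mul_assoc _ _ _ (by simpa using e₁ =≫ Fp.fst hb) (by simpa using e₂ =≫ Fp.fst hb) _ _
    · simp only [Fp.lift_snd]
      exact H.mul_assoc _ _ _ (by simpa using e₁ =≫ Fp.snd hb) (by simpa using e₂ =≫ Fp.snd hb) _ _
  mul_inv g e := by
    refine Fp.ext _ ?_ ?_
    · simp only [Fp.lift_fst]
      exact (G.mul_congr rfl (by simp) _ (by simp [G.inv_t])).trans
        ((G.mul_inv _ (by simp [G.inv_t])).trans (by simp))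
    · simp only [Fp.lift_snd]
      exact (H.mul_congr rfl (by simp) _ (by simp [H.inv_t])).trans
        ((H.mul_inv _ (by simp [H.inv_t])).trans (by simp))
  inv_mul g e := by
    refine Fp.ext _ ?_ ?_
    · simp only [Fp.lift_fst]
      exact (G.mul_congr (by simp) rfl _ (by simp [G.inv_s])).trans
        ((G.inv_mul _ (by simp [G.inv_s])).trans (by simp))
    · simp only [Fp.lift_snd]
      exact (H.mul_congr (by simp) rfl _ (by simp [H.inv_s])).trans
        ((H.inv_mul _ (by simp [H.inv_s])).trans (by simp))

/-- The first projection `G ×_M H ⟶ G`. -/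
noncomputable def fpFst {G H : Gpd W} {M : C} (a : G.ToTriv M) (b : H.ToTriv M)
    (hb : W b.map) : Gpd.Fun (fiberProd a b hb) G where
  ob := Fp.fst hb
  mor := Fp.fst (f := G.s ≫ a.map) (cover_comp H.s_cover hb)
  mor_s := (Fp.lift_fst _ _ _ _).symm
  mor_t := (Fp.lift_fst _ _ _ _).symm
  mor_one := Fp.lift_fst _ _ _ _
  mor_mul _ _ _ _ := (Fp.lift_fst _ _ _ _).symm

/-- The second projection `G ×_M H ⟶ H`. -/
noncomputable def fpSnd {G H : Gpd W} {M : C} (a : G.ToTriv M) (b : H.ToTriv M)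
    (hb : W b.map) : Gpd.Fun (fiberProd a b hb) H where
  ob := Fp.snd hb
  mor := Fp.snd (f := G.s ≫ a.map) (cover_comp H.s_cover hb)
  mor_s := (Fp.lift_snd _ _ _ _).symm
  mor_t := (Fp.lift_snd _ _ _ _).symm
  mor_one := Fp.lift_snd _ _ _ _
  mor_mul _ _ _ _ := (Fp.lift_snd _ _ _ _).symm

section FiberProdInterface

variable {G H : Gpd W} {M : C} {a : G.ToTriv M} {b : H.ToTriv M} {hb : W b.map}

theorem fp_cond : (fpFst a b hb).ob ≫ a.map = (fpSnd a b hb).ob ≫ b.map := Fp.cond hb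

theorem fp_mor_cond : (fpFst a b hb).mor ≫ G.s ≫ a.map = (fpSnd a b hb).mor ≫ H.s ≫ b.map :=
  Fp.cond (cover_comp H.s_cover hb)

/-- The object `(x, y)` of `G ×_M H`. -/
noncomputable def fpOb (a : G.ToTriv M) (b : H.ToTriv M) (hb : W b.map) {T : C} (x : T ⟶ G.ob)
    (y : T ⟶ H.ob) (e : x ≫ a.map = y ≫ b.map) : T ⟶ (fiberProd a b hb).ob := Fp.lift hb x y e

/-- The arrow `(g, h)` of `G ×_M H`. -/
noncomputable def fpMor (a : G.ToTriv M) (b : H.ToTriv M) (hb : W b.map) {T : C} (g : T ⟶ G.mor)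
    (h : T ⟶ H.mor) (e : g ≫ G.s ≫ a.map = h ≫ H.s ≫ b.map) : T ⟶ (fiberProd a b hb).mor :=
  Fp.lift (cover_comp H.s_cover hb) g h e

@[simp] theorem fpOb_fst {T : C} (x : T ⟶ G.ob) (y : T ⟶ H.ob) (e : x ≫ a.map = y ≫ b.map) :
    fpOb a b hb x y e ≫ (fpFst a b hb).ob = x := Fp.lift_fst _ _ _ _

@[simp] theorem fpOb_snd {T : C} (x : T ⟶ G.ob) (y : T ⟶ H.ob) (e : x ≫ a.map = y ≫ b.map) :
    fpOb a b hb x y e ≫ (fpSnd a b hb).ob = y := Fp.lift_snd _ _ _ _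

@[simp] theorem fpMor_fst {T : C} (g : T ⟶ G.mor) (h : T ⟶ H.mor)
    (e : g ≫ G.s ≫ a.map = h ≫ H.s ≫ b.map) :
    fpMor a b hb g h e ≫ (fpFst a b hb).mor = g := Fp.lift_fst _ _ _ _

@[simp] theorem fpMor_snd {T : C} (g : T ⟶ G.mor) (h : T ⟶ H.mor)
    (e : g ≫ G.s ≫ a.map = h ≫ H.s ≫ b.map) :
    fpMor a b hb g h e ≫ (fpSnd a b hb).mor = h := Fp.lift_snd _ _ _ _

@[simp] theorem fpOb_fst_assoc {T V : C} (x : T ⟶ G.ob) (y : T ⟶ H.ob)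
    (e : x ≫ a.map = y ≫ b.map) (w : G.ob ⟶ V) :
    fpOb a b hb x y e ≫ (fpFst a b hb).ob ≫ w = x ≫ w := by rw [← Category.assoc, fpOb_fst]

@[simp] theorem fpOb_snd_assoc {T V : C} (x : T ⟶ G.ob) (y : T ⟶ H.ob)
    (e : x ≫ a.map = y ≫ b.map) (w : H.ob ⟶ V) :
    fpOb a b hb x y e ≫ (fpSnd a b hb).ob ≫ w = y ≫ w := by rw [← Category.assoc, fpOb_snd]

@[simp] theorem fpMor_fst_assoc {T V : C} (g : T ⟶ G.mor) (h : T ⟶ H.mor)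
    (e : g ≫ G.s ≫ a.map = h ≫ H.s ≫ b.map) (w : G.mor ⟶ V) :
    fpMor a b hb g h e ≫ (fpFst a b hb).mor ≫ w = g ≫ w := by rw [← Category.assoc, fpMor_fst]

@[simp] theorem fpMor_snd_assoc {T V : C} (g : T ⟶ G.mor) (h : T ⟶ H.mor)
    (e : g ≫ G.s ≫ a.map = h ≫ H.s ≫ b.map) (w : H.mor ⟶ V) :
    fpMor a b hb g h e ≫ (fpSnd a b hb).mor ≫ w = h ≫ w := by rw [← Category.assoc, fpMor_snd]

theorem fp_ob_ext {T : C} {x y : T ⟶ (fiberProd a b hb).ob}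
    (h₁ : x ≫ (fpFst a b hb).ob = y ≫ (fpFst a b hb).ob)
    (h₂ : x ≫ (fpSnd a b hb).ob = y ≫ (fpSnd a b hb).ob) : x = y := Fp.ext hb h₁ h₂

theorem fp_mor_ext {T : C} {x y : T ⟶ (fiberProd a b hb).mor}
    (h₁ : x ≫ (fpFst a b hb).mor = y ≫ (fpFst a b hb).mor)
    (h₂ : x ≫ (fpSnd a b hb).mor = y ≫ (fpSnd a b hb).mor) : x = y :=
  Fp.ext (cover_comp H.s_cover hb) h₁ h₂

end FiberProdInterface

/-- The map `G ×_M H ⟶ N` induced by `G ⟶ N`. -/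
noncomputable def toTrivFst {G H : Gpd W} {M N : C} (a : G.ToTriv M) (b : H.ToTriv M)
    (hb : W b.map) (c : G.ToTriv N) : (fiberProd a b hb).ToTriv N where
  map := (fpFst a b hb).ob ≫ c.map
  inv := by rw [Gpd.Fun.s_ob_assoc, Gpd.Fun.t_ob_assoc, c.inv]

/-- The map `G ×_M H ⟶ N` induced by `H ⟶ N`. -/
noncomputable def toTrivSnd {G H : Gpd W} {M N : C} (a : G.ToTriv M) (b : H.ToTriv M)
    (hb : W b.map) (c : H.ToTriv N) : (fiberProd a b hb).ToTriv N where
  map := (fpSnd a b hb).ob ≫ c.map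
  inv := by rw [Gpd.Fun.s_ob_assoc, Gpd.Fun.t_ob_assoc, c.inv]

/-- The product `P ×_M Q` of HS bibundles from `G` to `G'` and from `H` to `H'` over `M`. -/
noncomputable def prodBibundle {G G' H H' : Gpd W} {M : C} (a : G.ToTriv M) (a' : G'.ToTriv M)
    (b : H.ToTriv M) (b' : H'.ToTriv M) (hb : W b.map) (hb' : W b'.map)
    (P : HSBibundle G G') (Q : HSBibundle H H')
    (hP : P.l ≫ a.map = P.r ≫ a'.map) (hQ : Q.l ≫ b.map = Q.r ≫ b'.map) :
    HSBibundle (fiberProd a b hb) (fiberProd a' b' hb') where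
  X := Fp (P.l ≫ a.map) (Q.l ≫ b.map) (cover_comp Q.l_cover hb)
  l := fpOb a b hb (Fp.fst _ ≫ P.l) (Fp.snd _ ≫ Q.l) (by simpa using Fp.cond _)
  r := fpOb a' b' hb' (Fp.fst _ ≫ P.r) (Fp.snd _ ≫ Q.r) (by
    rw [Category.assoc, Category.assoc, ← hP, ← hQ, Fp.cond])
  lact g p e := Fp.lift _
    (P.lact (g ≫ (fpFst a b hb).mor) (p ≫ Fp.fst _) (by
      simpa [Gpd.Fun.s_ob] using e =≫ (fpFst a b hb).ob))
    (Q.lact (g ≫ (fpSnd a b hb).mor) (p ≫ Fp.snd _) (by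
      simpa [Gpd.Fun.s_ob] using e =≫ (fpSnd a b hb).ob)) (by
      rw [← Category.assoc, P.lact_l, ← Category.assoc, Q.lact_l]
      simpa [a.inv, b.inv] using g ≫= fp_mor_cond (a := a) (b := b) (hb := hb))
  ract p h e := Fp.lift _
    (P.ract (p ≫ Fp.fst _) (h ≫ (fpFst a' b' hb').mor) (by
      simpa [Gpd.Fun.t_ob] using e =≫ (fpFst a' b' hb').ob))
    (Q.ract (p ≫ Fp.snd _) (h ≫ (fpSnd a' b' hb').mor) (by
      simpa [Gpd.Fun.t_ob] using e =≫ (fpSnd a' b' hb').ob)) (by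
      rw [← Category.assoc, P.ract_l, ← Category.assoc, Q.ract_l]
      simpa using p ≫= Fp.cond (f := P.l ≫ a.map) (cover_comp Q.l_cover hb))
  lact_nat w g p e e' := by
    refine Fp.ext _ ?_ ?_
    · simp only [Fp.lift_fst, Category.assoc]
      rw [← P.lact_nat]
    · simp only [Fp.lift_snd, Category.assoc]
      rw [← Q.lact_nat]
  ract_nat w p h e e' := by
    refine Fp.ext _ ?_ ?_
    · simp only [Fp.lift_fst, Category.assoc]
      rw [← P.ract_nat]
    · simp only [Fp.lift_snd, Category.assoc]
      rw [← Q.ract_nat]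
  lact_l g p e := fp_ob_ext (by simp [P.lact_l, Gpd.Fun.t_ob]) (by simp [Q.lact_l, Gpd.Fun.t_ob])
  lact_r g p e := fp_ob_ext (by simp [P.lact_r]) (by simp [Q.lact_r])
  one_lact p e := by
    refine Fp.ext _ ?_ ?_
    · simp only [Fp.lift_fst]
      exact (P.lact_congr (by simp [Gpd.Fun.mor_one]) rfl _ (by simp [G.one_s])).trans
        (P.one_lact _ (by simp [G.one_s]))
    · simp only [Fp.lift_snd]
      exact (Q.lact_congr (by simp [Gpd.Fun.mor_one]) rfl _ (by simp [H.one_s])).trans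
        (Q.one_lact _ (by simp [H.one_s]))
  mul_lact g g' p e₁ e₂ e₃ e₄ := by
    have e₁₁ := e₁ =≫ (fpFst a b hb).ob
    have e₁₂ := e₁ =≫ (fpSnd a b hb).ob
    have e₂₁ := e₂ =≫ (fpFst a b hb).ob
    have e₂₂ := e₂ =≫ (fpSnd a b hb).ob
    simp only [Category.assoc, fpOb_fst, fpOb_snd, Gpd.Fun.s_ob, Gpd.Fun.t_ob]
      at e₁₁ e₁₂ e₂₁ e₂₂
    refine Fp.ext _ ?_ ?_
    · simp only [Fp.lift_fst]
      refine (P.lact_congr (Gpd.Fun.mul_mor _ _ _ _) rfl _ ?_).trans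
        ((P.mul_lact (g ≫ (fpFst a b hb).mor) (g' ≫ (fpFst a b hb).mor) _
        (by simpa using e₁₁) (by simpa using e₂₁) ?_ ?_).trans (P.lact_congr rfl (by simp) _ _))
      · simp [G.mul_s, e₂₁]
      · simp [G.mul_s, e₂₁]
      · simp [P.lact_l, e₁₁]
    · simp only [Fp.lift_snd]
      refine (Q.lact_congr (Gpd.Fun.mul_mor _ _ _ _) rfl _ ?_).trans
        ((Q.mul_lact (g ≫ (fpSnd a b hb).mor) (g' ≫ (fpSnd a b hb).mor) _
        (by simpa using e₁₂) (by simpa using e₂₂) ?_ ?_).trans (Q.lact_congr rfl (by simp) _ _))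
      · simp [H.mul_s, e₂₂]
      · simp [H.mul_s, e₂₂]
      · simp [Q.lact_l, e₁₂]
  ract_r p h e := fp_ob_ext (by simp [Gpd.Fun.s_ob, P.ract_r]) (by simp [Gpd.Fun.s_ob, Q.ract_r])
  ract_l p h e := fp_ob_ext (by simp [P.ract_l]) (by simp [Q.ract_l])
  ract_one p e := by
    refine Fp.ext _ ?_ ?_
    · simp only [Fp.lift_fst]
      exact (P.ract_congr rfl (by simp [Gpd.Fun.mor_one]) _ (by simp [G'.one_t])).trans
        (P.ract_one _ (by simp [G'.one_t]))
    · simp only [Fp.lift_snd]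
      exact (Q.ract_congr rfl (by simp [Gpd.Fun.mor_one]) _ (by simp [H'.one_t])).trans
        (Q.ract_one _ (by simp [H'.one_t]))
  ract_mul p h h' e₁ e₂ e₃ e₄ := by
    have e₁₁ := e₁ =≫ (fpFst a' b' hb').ob
    have e₁₂ := e₁ =≫ (fpSnd a' b' hb').ob
    have e₃₁ := e₃ =≫ (fpFst a' b' hb').ob
    have e₃₂ := e₃ =≫ (fpSnd a' b' hb').ob
    simp only [Category.assoc, fpOb_fst, fpOb_snd, Gpd.Fun.s_ob, Gpd.Fun.t_ob]
      at e₁₁ e₁₂ e₃₁ e₃₂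
    refine Fp.ext _ ?_ ?_
    · simp only [Fp.lift_fst]
      refine (P.ract_congr (by simp) rfl _ ?_).trans
        ((P.ract_mul _ (h ≫ (fpFst a' b' hb').mor) (h' ≫ (fpFst a' b' hb').mor)
        (by simpa using e₁₁) ?_ (by simpa using e₃₁) ?_).trans
        (P.ract_congr rfl (Gpd.Fun.mul_mor _ _ _ _).symm _ _))
      · simp [P.ract_r, e₃₁]
      · simp [P.ract_r, e₃₁]
      · simp [G'.mul_t, e₁₁]
    · simp only [Fp.lift_snd]
      refine (Q.ract_congr (by simp) rfl _ ?_).trans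
        ((Q.ract_mul _ (h ≫ (fpSnd a' b' hb').mor) (h' ≫ (fpSnd a' b' hb').mor)
        (by simpa using e₁₂) ?_ (by simpa using e₃₂) ?_).trans
        (Q.ract_congr rfl (Gpd.Fun.mul_mor _ _ _ _).symm _ _))
      · simp [Q.ract_r, e₃₂]
      · simp [Q.ract_r, e₃₂]
      · simp [H'.mul_t, e₁₂]
  comm g p h e₁ e₂ e₃ e₄ := by
    have e₁₁ := e₁ =≫ (fpFst a b hb).ob
    have e₁₂ := e₁ =≫ (fpSnd a b hb).ob
    have e₃₁ := e₃ =≫ (fpFst a' b' hb').ob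
    have e₃₂ := e₃ =≫ (fpSnd a' b' hb').ob
    simp only [Category.assoc, fpOb_fst, fpOb_snd, Gpd.Fun.s_ob, Gpd.Fun.t_ob]
      at e₁₁ e₁₂ e₃₁ e₃₂
    refine Fp.ext _ ?_ ?_
    · simp only [Fp.lift_fst]
      refine (P.ract_congr (by simp) rfl _ ?_).trans ((P.comm (g ≫ (fpFst a b hb).mor)
        (p ≫ Fp.fst _) (h ≫ (fpFst a' b' hb').mor) (by simpa using e₁₁) ?_
        (by simpa using e₃₁) ?_).trans (P.lact_congr rfl (by simp) _ _))
      · simp [P.lact_r, e₃₁]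
      · simp [P.lact_r, e₃₁]
      · simp [P.ract_l, e₁₁]
    · simp only [Fp.lift_snd]
      refine (Q.ract_congr (by simp) rfl _ ?_).trans ((Q.comm (g ≫ (fpSnd a b hb).mor)
        (p ≫ Fp.snd _) (h ≫ (fpSnd a' b' hb').mor) (by simpa using e₁₂) ?_
        (by simpa using e₃₂) ?_).trans (Q.lact_congr rfl (by simp) _ _))
      · simp [Q.lact_r, e₃₂]
      · simp [Q.lact_r, e₃₂]
      · simp [Q.ract_l, e₁₂]
  l_cover := Fp.map_cover hb P.l_cover Q.l_cover _ rfl rfl _ (Fp.lift_fst _ _ _ _)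
    (Fp.lift_snd _ _ _ _)
  shear p p' e := by
    have e₁ := e =≫ (fpFst a b hb).ob
    have e₂ := e =≫ (fpSnd a b hb).ob
    simp only [Category.assoc, fpOb_fst, fpOb_snd] at e₁ e₂
    obtain ⟨h₁, ⟨k₁, k₁'⟩, u₁⟩ := P.shear (p ≫ Fp.fst _) (p' ≫ Fp.fst _) (by simpa using e₁)
    obtain ⟨h₂, ⟨k₂, k₂'⟩, u₂⟩ := Q.shear (p ≫ Fp.snd _) (p' ≫ Fp.snd _) (by simpa using e₂)
    have k : h₁ ≫ G'.s ≫ a'.map = h₂ ≫ H'.s ≫ b'.map := by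
      rw [a'.inv, b'.inv, ← Category.assoc, ← k₁, ← Category.assoc, ← k₂]
      simp only [Category.assoc]
      rw [← hP, ← hQ, Fp.cond]
    refine ⟨fpMor a' b' hb' h₁ h₂ k, ⟨fp_ob_ext ?_ ?_, Fp.ext _ ?_ ?_⟩, ?_⟩
    · simpa [Gpd.Fun.t_ob] using k₁
    · simpa [Gpd.Fun.t_ob] using k₂
    · simp only [Fp.lift_fst, fpMor_fst]; exact k₁'
    · simp only [Fp.lift_snd, fpMor_snd]; exact k₂'
    · rintro h ⟨e₃, e₄⟩
      have e₃₁ := e₃ =≫ (fpFst a' b' hb').ob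
      have e₃₂ := e₃ =≫ (fpSnd a' b' hb').ob
      simp only [Category.assoc, fpOb_fst, fpOb_snd, Gpd.Fun.t_ob] at e₃₁ e₃₂
      refine fp_mor_ext ?_ ?_
      · rw [fpMor_fst]
        exact u₁ _ ⟨by simpa using e₃₁, by rw [← e₄, Fp.lift_fst]⟩
      · rw [fpMor_snd]
        exact u₂ _ ⟨by simpa using e₃₂, by rw [← e₄, Fp.lift_snd]⟩

/-- The product-type functor `K ⟶ G ×_M H` with components `F` and `F'`. -/
noncomputable def pairFun {K G H : Gpd W} {M : C} (a : G.ToTriv M) (b : H.ToTriv M)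
    (hb : W b.map) (F : Gpd.Fun K G) (F' : Gpd.Fun K H) (e : F.ob ≫ a.map = F'.ob ≫ b.map) :
    Gpd.Fun K (fiberProd a b hb) where
  ob := fpOb a b hb F.ob F'.ob e
  mor := fpMor a b hb F.mor F'.mor (by rw [← F.s_ob_assoc, ← F'.s_ob_assoc, e])
  mor_s := fp_ob_ext (by simp [Gpd.Fun.s_ob]) (by simp [Gpd.Fun.s_ob])
  mor_t := fp_ob_ext (by simp [Gpd.Fun.t_ob]) (by simp [Gpd.Fun.t_ob])
  mor_one := fp_mor_ext (by simp [Gpd.Fun.mor_one]) (by simp [Gpd.Fun.mor_one])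
  mor_mul g h e e' := fp_mor_ext
    (by simp only [Category.assoc, Gpd.Fun.mul_mor, fpMor_fst])
    (by simp only [Category.assoc, Gpd.Fun.mul_mor, fpMor_snd])

/-- The identity functor. -/
def Gpd.Fun.id (G : Gpd W) : Gpd.Fun G G where
  ob := 𝟙 _
  mor := 𝟙 _
  mor_s := by simp
  mor_t := by simp
  mor_one := by simp
  mor_mul g h e e' := by simp

/-- The composite of two functors. -/
def Gpd.Fun.comp {G H K : Gpd W} (F : Gpd.Fun G H) (F' : Gpd.Fun H K) : Gpd.Fun G K where
  ob := F.ob ≫ F'.ob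
  mor := F.mor ≫ F'.mor
  mor_s := by rw [F.s_ob_assoc, F'.s_ob, Category.assoc]
  mor_t := by rw [F.t_ob_assoc, F'.t_ob, Category.assoc]
  mor_one := by rw [← Category.assoc, F.mor_one, Category.assoc, F'.mor_one, Category.assoc]
  mor_mul g h e e' := by
    have k : G.mul g h e ≫ F.mor ≫ F'.mor = (G.mul g h e ≫ F.mor) ≫ F'.mor := by simp
    rw [k, F.mul_mor, F'.mul_mor]
    exact K.mul_congr (by simp) (by simp) _ _

/-- The functor `E ⟶ M ⟶ G` given by an invariant map `J : E.ob ⟶ M` and a map `u : M ⟶ G.ob`. -/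
def constFun {E G : Gpd W} {M : C} (J : E.ToTriv M) (u : M ⟶ G.ob) : Gpd.Fun E G where
  ob := J.map ≫ u
  mor := E.s ≫ J.map ≫ u ≫ G.one
  mor_s := by simp [G.one_s]
  mor_t := by
    rw [← Category.assoc E.t, ← J.inv]
    simp [G.one_t]
  mor_one := by rw [← Category.assoc, E.one_s]; simp
  mor_mul g h e e' := by
    have k : h ≫ E.s ≫ J.map = g ≫ E.s ≫ J.map := by
      rw [J.inv, ← Category.assoc h, ← e, Category.assoc, J.inv]
    have k₂ : E.mul g h e ≫ E.s ≫ J.map ≫ u ≫ G.one = h ≫ E.s ≫ J.map ≫ u ≫ G.one := by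
      rw [← Category.assoc, E.mul_s, Category.assoc]
    have k₃ : g ≫ E.s ≫ J.map ≫ u ≫ G.one = h ≫ E.s ≫ J.map ≫ u ≫ G.one := by
      simpa using (k =≫ (u ≫ G.one)).symm
    rw [k₂]
    have k₄ : (h ≫ E.s ≫ J.map ≫ u ≫ G.one) ≫ G.s
        = ((h ≫ E.s ≫ J.map ≫ u ≫ G.one) ≫ G.s ≫ G.one) ≫ G.t := by simp [G.one_s, G.one_t]
    refine (G.mul_congr k₃ ?_ _ k₄).trans (G.mul_one _ k₄)
    simp only [Category.assoc]
    rw [← Category.assoc G.one, G.one_s, Category.id_comp]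

/-- The associativity functor `(G ×_M H) ×_N K ⟶ G ×_M (H ×_N K)`. -/
noncomputable def assocFun {G H K : Gpd W} {M N : C} (a : G.ToTriv M) (b : H.ToTriv M)
    (hb : W b.map) (c : H.ToTriv N) (d : K.ToTriv N) (hd : W d.map)
    (hb' : W (toTrivFst c d hd b).map) :
    Gpd.Fun (fiberProd (toTrivSnd a b hb c) d hd) (fiberProd a (toTrivFst c d hd b) hb') :=
  pairFun _ _ _ ((fpFst _ _ _).comp (fpFst _ _ _))
    (pairFun _ _ _ ((fpFst _ _ _).comp (fpSnd _ _ _)) (fpSnd _ _ _) (by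
      exact (Category.assoc _ _ _).trans
        (fp_cond (a := toTrivSnd a b hb c) (b := d) (hb := hd))))
    (by simp [Gpd.Fun.comp, pairFun, toTrivFst, fp_cond])

/-- The composite `P ⊗_H Q` of HS bibundles from `G` to `H` and from `H` to `K`: an HS bibundle `R`
from `G` to `K` with a balanced map `(p, q) ↦ p ⊗ q` from `P ×_{H.ob} Q`, compatible with the
outer moment maps and actions. It is unique up to unique isomorphism: it is the quotient of
`P ×_{H.ob} Q` by the diagonal action of `H`. -/
structure Composite {G H K : Gpd W} (P : HSBibundle G H) (Q : HSBibundle H K) where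
  R : HSBibundle G K
  ten : ∀ {T : C} (p : T ⟶ P.X) (q : T ⟶ Q.X), p ≫ P.r = q ≫ Q.l → (T ⟶ R.X)
  ten_nat : ∀ {T T' : C} (w : T' ⟶ T) (p : T ⟶ P.X) (q : T ⟶ Q.X) (e : p ≫ P.r = q ≫ Q.l)
    (e' : (w ≫ p) ≫ P.r = (w ≫ q) ≫ Q.l), ten (w ≫ p) (w ≫ q) e' = w ≫ ten p q e
  ten_l : ∀ {T : C} (p : T ⟶ P.X) (q : T ⟶ Q.X) (e : p ≫ P.r = q ≫ Q.l),
    ten p q e ≫ R.l = p ≫ P.l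
  ten_r : ∀ {T : C} (p : T ⟶ P.X) (q : T ⟶ Q.X) (e : p ≫ P.r = q ≫ Q.l),
    ten p q e ≫ R.r = q ≫ Q.r
  lact_ten : ∀ {T : C} (g : T ⟶ G.mor) (p : T ⟶ P.X) (q : T ⟶ Q.X) (e : p ≫ P.r = q ≫ Q.l)
    (e₁ : g ≫ G.s = p ≫ P.l) (e₂ : g ≫ G.s = ten p q e ≫ R.l)
    (e₃ : P.lact g p e₁ ≫ P.r = q ≫ Q.l), R.lact g (ten p q e) e₂ = ten (P.lact g p e₁) q e₃
  ten_ract : ∀ {T : C} (p : T ⟶ P.X) (q : T ⟶ Q.X) (k : T ⟶ K.mor) (e : p ≫ P.r = q ≫ Q.l)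
    (e₁ : q ≫ Q.r = k ≫ K.t) (e₂ : ten p q e ≫ R.r = k ≫ K.t)
    (e₃ : p ≫ P.r = Q.ract q k e₁ ≫ Q.l), R.ract (ten p q e) k e₂ = ten p (Q.ract q k e₁) e₃
  balanced : ∀ {T : C} (p : T ⟶ P.X) (h : T ⟶ H.mor) (q : T ⟶ Q.X) (e₁ : p ≫ P.r = h ≫ H.t)
    (e₂ : h ≫ H.s = q ≫ Q.l) (e₃ : P.ract p h e₁ ≫ P.r = q ≫ Q.l)
    (e₄ : p ≫ P.r = Q.lact h q e₂ ≫ Q.l), ten (P.ract p h e₁) q e₃ = ten p (Q.lact h q e₂) e₄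

/-- The underlying object of a composite, with its elementary properties. -/
structure TensorObj {G H K : Gpd W} (P : HSBibundle G H) (Q : HSBibundle H K) where
  N : C
  g : N ⟶ G.ob
  g_cover : W g
  ten : ∀ {T : C} (p : T ⟶ P.X) (q : T ⟶ Q.X), p ≫ P.r = q ≫ Q.l → (T ⟶ N)
  ten_nat : ∀ {T T' : C} (w : T' ⟶ T) (p : T ⟶ P.X) (q : T ⟶ Q.X) (e : p ≫ P.r = q ≫ Q.l)
    (e' : (w ≫ p) ≫ P.r = (w ≫ q) ≫ Q.l), ten (w ≫ p) (w ≫ q) e' = w ≫ ten p q e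
  ten_g : ∀ {T : C} (p : T ⟶ P.X) (q : T ⟶ Q.X) (e : p ≫ P.r = q ≫ Q.l),
    ten p q e ≫ g = p ≫ P.l
  balanced : ∀ {T : C} (p : T ⟶ P.X) (h : T ⟶ H.mor) (q : T ⟶ Q.X) (e₁ : p ≫ P.r = h ≫ H.t)
    (e₂ : h ≫ H.s = q ≫ Q.l) (e₃ : P.ract p h e₁ ≫ P.r = q ≫ Q.l)
    (e₄ : p ≫ P.r = Q.lact h q e₂ ≫ Q.l), ten (P.ract p h e₁) q e₃ = ten p (Q.lact h q e₂) e₄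
  exactness : ∀ {T : C} (p p' : T ⟶ P.X) (q q' : T ⟶ Q.X) (e : p ≫ P.r = q ≫ Q.l)
    (e' : p' ≫ P.r = q' ≫ Q.l), ten p q e = ten p' q' e' →
    ∃ (h : T ⟶ H.mor) (e₁ : p' ≫ P.r = h ≫ H.t) (e₂ : h ≫ H.s = q ≫ Q.l),
      p = P.ract p' h e₁ ∧ q' = Q.lact h q e₂
  surj : ∀ {T : C} (n : T ⟶ N), ∃ (T' : C) (w : T' ⟶ T) (p : T' ⟶ P.X) (q : T' ⟶ Q.X)
    (e : p ≫ P.r = q ≫ Q.l), W w ∧ ten p q e = w ≫ n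
  desc : ∀ {T : C} (n : T ⟶ N) {Z : C} (φ : ∀ {T' : C} (w : T' ⟶ T) (p : T' ⟶ P.X) (q : T' ⟶ Q.X)
      (e : p ≫ P.r = q ≫ Q.l), ten p q e = w ≫ n → (T' ⟶ Z))
    (_ : ∀ {T' T'' : C} (v : T'' ⟶ T') (w : T' ⟶ T) (p : T' ⟶ P.X) (q : T' ⟶ Q.X)
      (e : p ≫ P.r = q ≫ Q.l) (k : ten p q e = w ≫ n) (e' : (v ≫ p) ≫ P.r = (v ≫ q) ≫ Q.l)
      (k' : ten (v ≫ p) (v ≫ q) e' = (v ≫ w) ≫ n), φ (v ≫ w) (v ≫ p) (v ≫ q) e' k'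
        = v ≫ φ w p q e k)
    (_ : ∀ {T' : C} (w : T' ⟶ T) (p p' : T' ⟶ P.X) (q q' : T' ⟶ Q.X)
      (e : p ≫ P.r = q ≫ Q.l) (e' : p' ≫ P.r = q' ≫ Q.l) (k : ten p q e = w ≫ n)
      (k' : ten p' q' e' = w ≫ n), φ w p q e k = φ w p' q' e' k'),
    ∃ b : T ⟶ Z, ∀ {T' : C} (w : T' ⟶ T) (p : T' ⟶ P.X) (q : T' ⟶ Q.X)
      (e : p ≫ P.r = q ≫ Q.l) (k : ten p q e = w ≫ n), w ≫ b = φ w p q e k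

theorem exists_tensorObj {G H K : Gpd W} (P : HSBibundle G H) (Q : HSBibundle H K) :
    Nonempty (TensorObj P Q) := by
  let f : Fp P.r Q.l Q.l_cover ⟶ P.X := Fp.fst _
  let f' : Fp P.r Q.l Q.l_cover ⟶ Q.X := Fp.snd _
  have ff : ∀ {T : C} (x : T ⟶ Fp P.r Q.l Q.l_cover), (x ≫ f) ≫ P.r = (x ≫ f') ≫ Q.l := by
    intro T x
    simp only [f, f', Category.assoc, Fp.cond]
  have he : ∀ {T : C} (q : T ⟶ Fp P.r Q.l Q.l_cover) (p : T ⟶ P.X)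
      (e : (q ≫ f) ≫ P.l = p ≫ P.l), P.div p (q ≫ f) e.symm ≫ H.s = (q ≫ f') ≫ Q.l := by
    intro T q p e
    rw [P.div_s, ff]
  let A : CechAction P.l f := {
    act := fun q p e => Fp.lift _ p (Q.lact (P.div p (q ≫ f) e.symm) (q ≫ f') (he q p e))
      (by rw [Q.lact_l, P.div_t])
    act_nat := by
      intro T T' w q p e e'
      refine Fp.ext _ (by simp) ?_
      simp only [Fp.lift_snd, Category.assoc]
      rw [← Q.lact_nat (e' := by simpa using w ≫= he q p e)]
      refine Q.lact_congr ?_ (by simp) _ _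
      refine P.div_unique (P.div_t _ _ _) (by simpa using w ≫= P.div_t p (q ≫ f) e.symm)
        (P.ract_div _ _ _ _) ?_
      rw [P.ract_nat (e := P.div_t p (q ≫ f) e.symm), P.ract_div]
    act_f := by intro T q p e; simp [f]
    act_self := by
      intro T q
      refine Fp.ext _ (by simp [f]) ?_
      simp only [Fp.lift_snd]
      have k : ((q ≫ f) ≫ P.r) = ((q ≫ f) ≫ P.r ≫ H.one) ≫ H.t := by simp [H.one_t]
      have k₁ : P.div (q ≫ f) (q ≫ f) rfl = (q ≫ f') ≫ Q.l ≫ H.one := by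
        refine (P.div_unique (P.div_t _ _ rfl) k (P.ract_div _ _ _ _) (P.ract_one _ k)).trans ?_
        simpa using ff q =≫ H.one
      have k₂ : ((q ≫ f') ≫ Q.l ≫ H.one) ≫ H.s = (q ≫ f') ≫ Q.l := by simp [H.one_s]
      exact (Q.lact_congr k₁ rfl _ k₂).trans (Q.one_lact _ k₂)
    act_act := by
      intro T q p p' e e' e''
      refine Fp.ext _ (by simp) ?_
      simp only [Fp.lift_snd]
      have l₁ : p ≫ P.l = (q ≫ f) ≫ P.l := e.symm
      have l₂ : p' ≫ P.l = p ≫ P.l := by rw [← e, e'']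
      have l₃ : p' ≫ P.l = (q ≫ f) ≫ P.l := e''.symm
      have m₁ : P.div p' p l₂ ≫ H.s = P.div p (q ≫ f) l₁ ≫ H.t := by rw [P.div_s, P.div_t]
      have m₂ : P.div p' (q ≫ f) l₃ = H.mul (P.div p' p l₂) (P.div p (q ≫ f) l₁) m₁ := by
        refine P.div_unique (P.div_t _ _ _) (by rw [H.mul_t, P.div_t]) (P.ract_div _ _ _ _) ?_
        rw [← P.ract_mul _ _ _ (P.div_t p' p l₂) (by rw [P.ract_r, m₁]) m₁]
        exact (P.ract_congr (P.ract_div p' p l₂ _) rfl _ (P.div_t _ _ _)).trans (P.ract_div p (q ≫ f) l₁ _)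
      have m₃ : P.div p (q ≫ f) l₁ ≫ H.s = (q ≫ f') ≫ Q.l := he q p e
      have m₄ : P.div p' p l₂ ≫ H.s = Q.lact _ _ m₃ ≫ Q.l := by rw [Q.lact_l, m₁]
      have m₅ : H.mul (P.div p' p l₂) (P.div p (q ≫ f) l₁) m₁ ≫ H.s = (q ≫ f') ≫ Q.l := by
        rw [H.mul_s, m₃]
      refine Eq.trans ?_ ((Q.mul_lact (P.div p' p l₂) (P.div p (q ≫ f) l₁) (q ≫ f') m₁ m₃ m₅
        m₄).symm.trans (Q.lact_congr m₂.symm rfl _ _))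
      refine Q.lact_congr ?_ (Fp.lift_snd _ _ _ _) _ _
      congr 1
      exact Fp.lift_fst _ _ _ _ }
  obtain ⟨N, g, k, hk, hA⟩ := NicePretopology.quotient (W := W) P.l f P.l_cover
    (Fp.fst_cover Q.l_cover) A
  have k_cover : W k := SingletonPretopology.base_change hk P.l_cover
  have g_cover : W g := NicePretopology.of_comp k g k_cover
    (hk.w ▸ cover_comp (Fp.fst_cover Q.l_cover) P.l_cover)
  have hkA : ∀ {T : C} (x y : T ⟶ Fp P.r Q.l Q.l_cover), x ≫ k = y ≫ k →
      ∃ e : (x ≫ f) ≫ P.l = (y ≫ f) ≫ P.l, y = A.act x (y ≫ f) e := by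
    intro T x y e
    have e' : (x ≫ f) ≫ P.l = (y ≫ f) ≫ P.l := by
      rw [Category.assoc, ← hk.w, ← Category.assoc, e, Category.assoc, hk.w, Category.assoc]
    exact ⟨e', hk.hom_ext (by rw [hA, e]) (by rw [A.act_f])⟩
  refine ⟨{
    N := N
    g := g
    g_cover := g_cover
    ten := fun p q e => Fp.lift _ p q e ≫ k
    ten_nat := ?_
    ten_g := ?_
    balanced := ?_
    exactness := ?_
    surj := ?_
    desc := ?_ }⟩
  · intro T T' w p q e e'
    rw [← Category.assoc]
    congr 1
    exact Fp.ext _ (by simp) (by simp)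
  · intro T p q e
    rw [Category.assoc, hk.w, ← Category.assoc]
    simp [f]
  · intro T p h q e₁ e₂ e₃ e₄
    let x : T ⟶ Fp P.r Q.l Q.l_cover := Fp.lift _ (P.ract p h e₁) q e₃
    have ex : x ≫ f = P.ract p h e₁ := Fp.lift_fst _ _ _ _
    have ex' : x ≫ f' = q := Fp.lift_snd _ _ _ _
    have l₁ : (x ≫ f) ≫ P.l = p ≫ P.l := by rw [ex, P.ract_l]
    change x ≫ k = _
    rw [← hA x p l₁]
    congr 1
    refine Fp.ext _ (by simp [A]) ?_
    simp only [A, Fp.lift_snd]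
    exact Q.lact_congr (P.div_unique (P.div_t _ _ _) e₁ (P.ract_div _ _ _ _) ex.symm) ex' _ _
  · intro T p p' q q' e e' h
    obtain ⟨l₁, l₂⟩ := hkA _ _ h
    have c₁ : Fp.lift Q.l_cover p q e ≫ f = p := Fp.lift_fst _ _ _ _
    have c₂ : Fp.lift Q.l_cover p' q' e' ≫ f = p' := Fp.lift_fst _ _ _ _
    have c₃ : Fp.lift Q.l_cover p q e ≫ f' = q := Fp.lift_snd _ _ _ _
    rw [c₁, c₂] at l₁
    refine ⟨P.div p' p l₁.symm, P.div_t _ _ _, by rw [P.div_s, e], (P.ract_div _ _ _ _).symm, ?_⟩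
    have l₃ := l₂ =≫ f'
    rw [show Fp.lift Q.l_cover p' q' e' ≫ f' = q' from Fp.lift_snd _ _ _ _] at l₃
    rw [l₃]
    refine (Fp.lift_snd _ _ _ _).trans (Q.lact_congr ?_ c₃ _ _)
    congr 1
  · intro T n
    refine ⟨Fp n k k_cover, Fp.fst _, Fp.snd k_cover ≫ f, Fp.snd k_cover ≫ f', ff _,
      Fp.fst_cover _, ?_⟩
    rw [Fp.cond]
    congr 1
    exact Fp.ext _ (Fp.lift_fst _ _ _ _) (Fp.lift_snd _ _ _ _)
  · intro T n Z φ hφ hφ'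
    have key : ∀ {T : C} (x : T ⟶ Fp P.r Q.l Q.l_cover),
        Fp.lift Q.l_cover (x ≫ f) (x ≫ f') (ff x) = x :=
      fun x => Fp.ext _ (Fp.lift_fst _ _ _ _) (Fp.lift_snd _ _ _ _)
    have h₀ : Fp.lift Q.l_cover (Fp.snd k_cover ≫ f) (Fp.snd k_cover ≫ f') (ff _) ≫ k
        = Fp.fst (f := n) k_cover ≫ n := by rw [key, Fp.cond]
    have lem : ∀ {T' : C} (y : T' ⟶ Fp n k k_cover)
        (h : Fp.lift Q.l_cover (y ≫ Fp.snd k_cover ≫ f) (y ≫ Fp.snd k_cover ≫ f')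
          (by simpa using ff (y ≫ Fp.snd k_cover)) ≫ k
          = (y ≫ Fp.fst k_cover) ≫ n),
        y ≫ φ (Fp.fst k_cover) _ _ (ff _) h₀ = φ (y ≫ Fp.fst k_cover) (y ≫ Fp.snd k_cover ≫ f)
          (y ≫ Fp.snd k_cover ≫ f') _ h := fun y h => (hφ y _ _ _ _ h₀ _ h).symm
    have h₁ : ∀ {T' : C} (y : T' ⟶ Fp n k k_cover),
        Fp.lift Q.l_cover (y ≫ Fp.snd k_cover ≫ f) (y ≫ Fp.snd k_cover ≫ f')
          (by simpa using ff (y ≫ Fp.snd k_cover)) ≫ k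
          = (y ≫ Fp.fst k_cover) ≫ n := by
      intro T' y
      have c : (y ≫ Fp.fst k_cover) ≫ n = (y ≫ Fp.snd k_cover) ≫ k := by
        rw [Category.assoc, Fp.cond, ← Category.assoc]
      rw [c]
      congr 1
      exact Fp.ext _ (by simp [f]) (by simp [f'])
    obtain ⟨b, hb⟩ := cover_desc (Fp.fst_cover (f := n) k_cover)
      (φ (Fp.fst k_cover) _ _ (ff _) h₀) (by
        intro T' x y exy
        rw [lem x (h₁ x), lem y (h₁ y)]
        have : ∀ (w w' : T' ⟶ T) (hw : w = w') (p p' : T' ⟶ P.X) (q q' : T' ⟶ Q.X) e e' k₁ k₂,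
            φ w p q e k₁ = φ w' p' q' e' k₂ := by
          rintro w _ rfl p p' q q' e e' k₁ k₂
          exact hφ' _ _ _ _ _ _ _ _ _
        exact this _ _ exy _ _ _ _ _ _ _ _)
    refine ⟨b, fun {T'} w p q e h => ?_⟩
    let y : T' ⟶ Fp n k k_cover := Fp.lift _ w (Fp.lift _ p q e) h.symm
    have y₁ : y ≫ Fp.fst k_cover = w := Fp.lift_fst _ _ _ _
    have : w ≫ b = y ≫ Fp.fst k_cover ≫ b := by rw [← Category.assoc, y₁]
    rw [this, hb, lem y (h₁ y)]
    have : ∀ (w w' : T' ⟶ T) (hw : w = w') (p p' : T' ⟶ P.X) (q q' : T' ⟶ Q.X) e e' k₁ k₂,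
        φ w p q e k₁ = φ w' p' q' e' k₂ := by
      rintro w _ rfl p p' q q' e e' k₁ k₂
      exact hφ' _ _ _ _ _ _ _ _ _
    exact this _ _ y₁ _ _ _ _ _ _ _ _

namespace TensorObj

variable {G H K : Gpd W} {P : HSBibundle G H} {Q : HSBibundle H K} (A : TensorObj P Q)

theorem ten_congr {T : C} {p p' : T ⟶ P.X} {q q' : T ⟶ Q.X} (hp : p = p') (hq : q = q')
    (e : p ≫ P.r = q ≫ Q.l) (e' : p' ≫ P.r = q' ≫ Q.l) : A.ten p q e = A.ten p' q' e' := by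
  subst hp hq; rfl

theorem hom_ext {T Z : C} (n : T ⟶ A.N) {a b : T ⟶ Z}
    (h : ∀ {T' : C} (w : T' ⟶ T) (p : T' ⟶ P.X) (q : T' ⟶ Q.X) (e : p ≫ P.r = q ≫ Q.l),
      A.ten p q e = w ≫ n → w ≫ a = w ≫ b) : a = b := by
  obtain ⟨T', w, p, q, e, hw, k⟩ := A.surj n
  exact cover_cancel hw (h w p q e k)

theorem exists_r : ∃ r : A.N ⟶ K.ob, ∀ {T : C} (p : T ⟶ P.X) (q : T ⟶ Q.X)
    (e : p ≫ P.r = q ≫ Q.l), A.ten p q e ≫ r = q ≫ Q.r := by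
  obtain ⟨r, hr⟩ := A.desc (𝟙 A.N) (Z := K.ob) (fun w p q e k => q ≫ Q.r)
    (by intros; simp) (by
      intro T' w p p' q q' e e' k k'
      obtain ⟨h, e₁, e₂, -, rfl⟩ := A.exactness _ _ _ _ e e' (k.trans k'.symm)
      rw [Q.lact_r])
  exact ⟨r, fun p q e => hr _ p q e (by simp)⟩

noncomputable def r : A.N ⟶ K.ob := A.exists_r.choose

theorem ten_r {T : C} (p : T ⟶ P.X) (q : T ⟶ Q.X) (e : p ≫ P.r = q ≫ Q.l) :
    A.ten p q e ≫ A.r = q ≫ Q.r := A.exists_r.choose_spec p q e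

theorem lact_cond {T T' : C} {g : T ⟶ G.mor} {n : T ⟶ A.N} (e : g ≫ G.s = n ≫ A.g) {w : T' ⟶ T}
    {p : T' ⟶ P.X} {q : T' ⟶ Q.X} {e' : p ≫ P.r = q ≫ Q.l} (k : A.ten p q e' = w ≫ n) :
    (w ≫ g) ≫ G.s = p ≫ P.l := by
  rw [← A.ten_g p q e', k, Category.assoc, e, Category.assoc]

theorem ract_cond {T T' : C} {c : T ⟶ K.mor} {n : T ⟶ A.N} (e : n ≫ A.r = c ≫ K.t) {w : T' ⟶ T}
    {p : T' ⟶ P.X} {q : T' ⟶ Q.X} {e' : p ≫ P.r = q ≫ Q.l} (k : A.ten p q e' = w ≫ n) :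
    q ≫ Q.r = (w ≫ c) ≫ K.t := by
  rw [← A.ten_r p q e', k, Category.assoc, e, Category.assoc]

theorem exists_lact {T : C} (g : T ⟶ G.mor) (n : T ⟶ A.N) (e : g ≫ G.s = n ≫ A.g) :
    ∃ b : T ⟶ A.N, ∀ {T' : C} (w : T' ⟶ T) (p : T' ⟶ P.X) (q : T' ⟶ Q.X)
      (e' : p ≫ P.r = q ≫ Q.l) (k : A.ten p q e' = w ≫ n),
      w ≫ b = A.ten (P.lact (w ≫ g) p (A.lact_cond e k)) q (by rw [P.lact_r, e']) := by
  refine A.desc n (fun w p q e' k => A.ten (P.lact (w ≫ g) p (A.lact_cond e k)) q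
    (by rw [P.lact_r, e'])) ?_ ?_
  · intro T' T'' v w p q e' k e'' k'
    rw [← A.ten_nat (e' := by
      rw [← P.lact_nat (e' := by simpa using v ≫= A.lact_cond e k), P.lact_r]; exact e'')]
    refine A.ten_congr ?_ rfl _ _
    rw [← P.lact_nat (e' := by simpa using v ≫= A.lact_cond e k)]
    exact P.lact_congr (by simp) rfl _ _
  · intro T' w p p' q q' e₁ e₂ k k'
    obtain ⟨h, c₁, c₂, rfl, rfl⟩ := A.exactness _ _ _ _ e₁ e₂ (k.trans k'.symm)
    have c₃ : P.lact (w ≫ g) p' (A.lact_cond e k') ≫ P.r = h ≫ H.t := by rw [P.lact_r, c₁]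
    rw [← A.balanced _ h q c₃ c₂ (by rw [P.ract_r, c₂])]
    exact A.ten_congr (P.comm _ _ _ _ _ c₁ _).symm rfl _ _

theorem exists_ract {T : C} (n : T ⟶ A.N) (c : T ⟶ K.mor) (e : n ≫ A.r = c ≫ K.t) :
    ∃ b : T ⟶ A.N, ∀ {T' : C} (w : T' ⟶ T) (p : T' ⟶ P.X) (q : T' ⟶ Q.X)
      (e' : p ≫ P.r = q ≫ Q.l) (k : A.ten p q e' = w ≫ n),
      w ≫ b = A.ten p (Q.ract q (w ≫ c) (A.ract_cond e k)) (by rw [Q.ract_l, e']) := by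
  refine A.desc n (fun w p q e' k => A.ten p (Q.ract q (w ≫ c) (A.ract_cond e k))
    (by rw [Q.ract_l, e'])) ?_ ?_
  · intro T' T'' v w p q e' k e'' k'
    rw [← A.ten_nat (e' := by
      rw [← Q.ract_nat (e' := by simpa using v ≫= A.ract_cond e k), Q.ract_l]; exact e'')]
    refine A.ten_congr rfl ?_ _ _
    rw [← Q.ract_nat (e' := by simpa using v ≫= A.ract_cond e k)]
    exact Q.ract_congr rfl (by simp) _ _
  · intro T' w p p' q q' e₁ e₂ k k'
    obtain ⟨h, c₁, c₂, rfl, rfl⟩ := A.exactness _ _ _ _ e₁ e₂ (k.trans k'.symm)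
    have c₃ : h ≫ H.s = Q.ract q (w ≫ c) (A.ract_cond e k) ≫ Q.l := by rw [Q.ract_l, c₂]
    rw [A.balanced _ h _ c₁ c₃ _ (by rw [Q.lact_l, c₁])]
    exact A.ten_congr rfl (Q.comm _ _ _ _ _ _ _).symm _ _

noncomputable def lact {T : C} (g : T ⟶ G.mor) (n : T ⟶ A.N) (e : g ≫ G.s = n ≫ A.g) : T ⟶ A.N :=
  (A.exists_lact g n e).choose

noncomputable def ract {T : C} (n : T ⟶ A.N) (c : T ⟶ K.mor) (e : n ≫ A.r = c ≫ K.t) : T ⟶ A.N :=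
  (A.exists_ract n c e).choose

theorem lact_spec {T : C} (g : T ⟶ G.mor) (n : T ⟶ A.N) (e : g ≫ G.s = n ≫ A.g)
    {T' : C} (w : T' ⟶ T) (p : T' ⟶ P.X) (q : T' ⟶ Q.X)
    (e' : p ≫ P.r = q ≫ Q.l) (k : A.ten p q e' = w ≫ n) (e₁ : (w ≫ g) ≫ G.s = p ≫ P.l)
    (e₂ : P.lact (w ≫ g) p e₁ ≫ P.r = q ≫ Q.l) :
    w ≫ A.lact g n e = A.ten (P.lact (w ≫ g) p e₁) q e₂ :=
  (A.exists_lact g n e).choose_spec w p q e' k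

theorem ract_spec {T : C} (n : T ⟶ A.N) (c : T ⟶ K.mor) (e : n ≫ A.r = c ≫ K.t)
    {T' : C} (w : T' ⟶ T) (p : T' ⟶ P.X) (q : T' ⟶ Q.X)
    (e' : p ≫ P.r = q ≫ Q.l) (k : A.ten p q e' = w ≫ n) (e₁ : q ≫ Q.r = (w ≫ c) ≫ K.t)
    (e₂ : p ≫ P.r = Q.ract q (w ≫ c) e₁ ≫ Q.l) :
    w ≫ A.ract n c e = A.ten p (Q.ract q (w ≫ c) e₁) e₂ :=
  (A.exists_ract n c e).choose_spec w p q e' k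

theorem lact_ten {T : C} (g : T ⟶ G.mor) (p : T ⟶ P.X) (q : T ⟶ Q.X) (e : p ≫ P.r = q ≫ Q.l)
    (e₁ : g ≫ G.s = p ≫ P.l) (e₂ : g ≫ G.s = A.ten p q e ≫ A.g)
    (e₃ : P.lact g p e₁ ≫ P.r = q ≫ Q.l) :
    A.lact g (A.ten p q e) e₂ = A.ten (P.lact g p e₁) q e₃ := by
  have := A.lact_spec g _ e₂ (𝟙 T) p q e (by simp) (by simpa using e₁)
    (by rw [P.lact_r, e])
  rw [Category.id_comp] at this
  rw [this]
  exact A.ten_congr (P.lact_congr (by simp) rfl _ _) rfl _ _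

theorem ten_ract {T : C} (p : T ⟶ P.X) (q : T ⟶ Q.X) (c : T ⟶ K.mor) (e : p ≫ P.r = q ≫ Q.l)
    (e₁ : q ≫ Q.r = c ≫ K.t) (e₂ : A.ten p q e ≫ A.r = c ≫ K.t)
    (e₃ : p ≫ P.r = Q.ract q c e₁ ≫ Q.l) :
    A.ract (A.ten p q e) c e₂ = A.ten p (Q.ract q c e₁) e₃ := by
  have := A.ract_spec _ c e₂ (𝟙 T) p q e (by simp) (by simpa using e₁)
    (by rw [Q.ract_l, e])
  rw [Category.id_comp] at this
  rw [this]
  exact A.ten_congr rfl (Q.ract_congr rfl (by simp) _ _) _ _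

theorem lact_nat {T T' : C} (v : T' ⟶ T) (g : T ⟶ G.mor) (n : T ⟶ A.N) (e : g ≫ G.s = n ≫ A.g)
    (e' : (v ≫ g) ≫ G.s = (v ≫ n) ≫ A.g) : A.lact (v ≫ g) (v ≫ n) e' = v ≫ A.lact g n e := by
  refine A.hom_ext (v ≫ n) (fun w p q e₀ k => ?_)
  have k' : A.ten p q e₀ = (w ≫ v) ≫ n := by rw [k, Category.assoc]
  rw [A.lact_spec _ _ e' w p q e₀ k (A.lact_cond e' k) (by rw [P.lact_r, e₀]),
    ← Category.assoc w v (A.lact g n e), A.lact_spec _ _ e (w ≫ v) p q e₀ k' (A.lact_cond e k') (by rw [P.lact_r, e₀])]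
  exact A.ten_congr (P.lact_congr (by simp) rfl _ _) rfl _ _

theorem ract_nat {T T' : C} (v : T' ⟶ T) (n : T ⟶ A.N) (c : T ⟶ K.mor) (e : n ≫ A.r = c ≫ K.t)
    (e' : (v ≫ n) ≫ A.r = (v ≫ c) ≫ K.t) : A.ract (v ≫ n) (v ≫ c) e' = v ≫ A.ract n c e := by
  refine A.hom_ext (v ≫ n) (fun w p q e₀ k => ?_)
  have k' : A.ten p q e₀ = (w ≫ v) ≫ n := by rw [k, Category.assoc]
  rw [A.ract_spec _ _ e' w p q e₀ k (A.ract_cond e' k) (by rw [Q.ract_l, e₀]),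
    ← Category.assoc w v (A.ract n c e), A.ract_spec _ _ e (w ≫ v) p q e₀ k' (A.ract_cond e k') (by rw [Q.ract_l, e₀])]
  exact A.ten_congr rfl (Q.ract_congr rfl (by simp) _ _) _ _

theorem lact_congr {T : C} {g g' : T ⟶ G.mor}
    {p p' : T ⟶ A.N} (hg : g = g') (hp : p = p') (e : g ≫ G.s = p ≫ A.g)
    (e' : g' ≫ G.s = p' ≫ A.g) : A.lact g p e = A.lact g' p' e' := by
  subst hg hp; rfl

theorem ract_congr {T : C} {h h' : T ⟶ K.mor}
    {p p' : T ⟶ A.N} (hp : p = p') (hh : h = h') (e : p ≫ A.r = h ≫ K.t)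
    (e' : p' ≫ A.r = h' ≫ K.t) : A.ract p h e = A.ract p' h' e' := by
  subst hh hp; rfl

/-- The composite bibundle. -/
noncomputable def bibundle : HSBibundle G K where
  X := A.N
  l := A.g
  r := A.r
  lact := A.lact
  ract := A.ract
  lact_nat := A.lact_nat
  ract_nat := A.ract_nat
  lact_l g n e := by
    refine A.hom_ext n (fun w p q e₀ k => ?_)
    rw [← Category.assoc, A.lact_spec g n e w p q e₀ k (A.lact_cond e k) (by rw [P.lact_r, e₀]),
      A.ten_g, P.lact_l, Category.assoc]
  lact_r g n e := by
    refine A.hom_ext n (fun w p q e₀ k => ?_)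
    rw [← Category.assoc, A.lact_spec g n e w p q e₀ k (A.lact_cond e k) (by rw [P.lact_r, e₀]),
      A.ten_r, ← Category.assoc, ← k, A.ten_r]
  one_lact n e := by
    refine A.hom_ext n (fun w p q e₀ k => ?_)
    rw [A.lact_spec _ n e w p q e₀ k (A.lact_cond e k) (by rw [P.lact_r, e₀]), ← k]
    have c : (p ≫ P.l ≫ G.one) ≫ G.s = p ≫ P.l := by simp [G.one_s]
    refine A.ten_congr ((P.lact_congr ?_ rfl _ c).trans (P.one_lact p c)) rfl _ _
    rw [← Category.assoc, ← k, ← Category.assoc, A.ten_g, Category.assoc]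
  mul_lact g g' n e₁ e₂ e₃ e₄ := by
    refine A.hom_ext n (fun w p q e₀ k => ?_)
    have c₁ : (w ≫ g) ≫ G.s = (w ≫ g') ≫ G.t := by simpa using w ≫= e₁
    have c₂ := A.lact_cond e₂ k
    have c₄ : (w ≫ g) ≫ G.s = P.lact (w ≫ g') p c₂ ≫ P.l := by rw [P.lact_l, c₁]
    have s₂ := A.lact_spec _ n e₂ w p q e₀ k c₂ (by rw [P.lact_r, e₀])
    rw [A.lact_spec _ n e₃ w p q e₀ k (A.lact_cond e₃ k) (by rw [P.lact_r, e₀]),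
      A.lact_spec _ _ e₄ w _ q _ s₂.symm c₄ (by rw [P.lact_r, P.lact_r, e₀])]
    refine A.ten_congr ?_ rfl _ _
    refine (P.lact_congr (G.mul_nat w g g' e₁ c₁).symm rfl _ ?_).trans
      (P.mul_lact _ _ p c₁ c₂ ?_ c₄)
    all_goals rw [G.mul_s, c₂]
  ract_r n c e := by
    refine A.hom_ext n (fun w p q e₀ k => ?_)
    rw [← Category.assoc, A.ract_spec n c e w p q e₀ k (A.ract_cond e k) (by rw [Q.ract_l, e₀]),
      A.ten_r, Q.ract_r, Category.assoc]
  ract_l n c e := by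
    refine A.hom_ext n (fun w p q e₀ k => ?_)
    rw [← Category.assoc, A.ract_spec n c e w p q e₀ k (A.ract_cond e k) (by rw [Q.ract_l, e₀]),
      A.ten_g, ← Category.assoc, ← k, A.ten_g]
  ract_one n e := by
    refine A.hom_ext n (fun w p q e₀ k => ?_)
    rw [A.ract_spec n _ e w p q e₀ k (A.ract_cond e k) (by rw [Q.ract_l, e₀]), ← k]
    have c : q ≫ Q.r = (q ≫ Q.r ≫ K.one) ≫ K.t := by simp [K.one_t]
    refine A.ten_congr rfl ((Q.ract_congr rfl ?_ _ c).trans (Q.ract_one q c)) _ _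
    rw [← Category.assoc, ← k, ← Category.assoc, A.ten_r, Category.assoc]
  ract_mul n c c' e₁ e₂ e₃ e₄ := by
    refine A.hom_ext n (fun w p q e₀ k => ?_)
    have d₁ := A.ract_cond e₁ k
    have d₃ : (w ≫ c) ≫ K.s = (w ≫ c') ≫ K.t := by simpa using w ≫= e₃
    have d₂ : Q.ract q (w ≫ c) d₁ ≫ Q.r = (w ≫ c') ≫ K.t := by rw [Q.ract_r, d₃]
    have s₁ := A.ract_spec n c e₁ w p q e₀ k d₁ (by rw [Q.ract_l, e₀])
    rw [A.ract_spec n _ e₄ w p q e₀ k (A.ract_cond e₄ k) (by rw [Q.ract_l, e₀]),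
      A.ract_spec _ _ e₂ w p _ _ s₁.symm d₂ (by rw [Q.ract_l, Q.ract_l, e₀])]
    refine A.ten_congr rfl ?_ _ _
    refine (Q.ract_mul q _ _ d₁ d₂ d₃ ?_).trans (Q.ract_congr rfl (K.mul_nat w c c' e₃ d₃) _ _)
    rw [K.mul_t, d₁]
  comm g n c e₁ e₂ e₃ e₄ := by
    refine A.hom_ext n (fun w p q e₀ k => ?_)
    have d₁ := A.lact_cond e₁ k
    have d₃ := A.ract_cond e₃ k
    have s₁ := A.lact_spec g n e₁ w p q e₀ k d₁ (by rw [P.lact_r, e₀])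
    have s₃ := A.ract_spec n c e₃ w p q e₀ k d₃ (by rw [Q.ract_l, e₀])
    rw [A.ract_spec _ _ e₂ w _ q _ s₁.symm d₃ (by rw [P.lact_r, Q.ract_l, e₀]),
      A.lact_spec _ _ e₄ w p _ _ s₃.symm d₁ (by rw [P.lact_r, Q.ract_l, e₀])]
  l_cover := A.g_cover
  shear := by
    have uniq : ∀ {T : C} (n n' : T ⟶ A.N) (c c' : T ⟶ K.mor) (e : n ≫ A.r = c ≫ K.t)
        (e' : n ≫ A.r = c' ≫ K.t), A.ract n c e = n' → A.ract n c' e' = n' → c = c' := by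
      intro T n n' c c' e e' h h'
      refine A.hom_ext n (fun w p q e₀ k => ?_)
      have d := A.ract_cond e k
      have d' := A.ract_cond e' k
      have s := A.ract_spec n c e w p q e₀ k d (by rw [Q.ract_l, e₀])
      have s' := A.ract_spec n c' e' w p q e₀ k d' (by rw [Q.ract_l, e₀])
      rw [h] at s
      rw [h'] at s'
      obtain ⟨x, x₁, x₂, x₃, x₄⟩ := A.exactness _ _ _ _ _ _ (s.symm.trans s')
      have y : p ≫ P.r = (p ≫ P.r ≫ H.one) ≫ H.t := by simp [H.one_t]
      have z : x = p ≫ P.r ≫ H.one := P.div_unique x₁ y x₃.symm (P.ract_one p y)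
      refine Q.div_unique d d' rfl ?_
      rw [x₄]
      have v : ((Q.ract q (w ≫ c) d) ≫ Q.l ≫ H.one) ≫ H.s = (Q.ract q (w ≫ c) d) ≫ Q.l := by
        simp [H.one_s]
      refine (Q.lact_congr ?_ rfl _ v).trans (Q.one_lact _ v)
      rw [z, ← Category.assoc, ← Category.assoc, Q.ract_l, e₀]
    intro T n n' e
    obtain ⟨T₁, w₁, p₁, q, e₁, hw₁, k₁⟩ := A.surj n
    obtain ⟨T', w₂, p', q', e', hw₂, k'⟩ := A.surj (w₁ ≫ n')
    have e₂ : (w₂ ≫ p₁) ≫ P.r = (w₂ ≫ q) ≫ Q.l := by simpa using w₂ ≫= e₁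
    have k₂ : A.ten (w₂ ≫ p₁) (w₂ ≫ q) e₂ = (w₂ ≫ w₁) ≫ n := by
      rw [A.ten_nat w₂ p₁ q e₁, k₁, Category.assoc]
    have k₂' : A.ten p' q' e' = (w₂ ≫ w₁) ≫ n' := by rw [k', Category.assoc]
    have hl : (w₂ ≫ p₁) ≫ P.l = p' ≫ P.l := by
      rw [← A.ten_g _ _ e₂, k₂, ← A.ten_g _ _ e', k₂', Category.assoc _ n, e,
        Category.assoc _ n']
    have t₁ := P.div_t _ _ hl
    have t₂ : P.div _ _ hl ≫ H.s = q' ≫ Q.l := by rw [P.div_s, e']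
    have hq : (w₂ ≫ q) ≫ Q.l = Q.lact (P.div _ _ hl) q' t₂ ≫ Q.l := by rw [Q.lact_l, ← t₁, e₂]
    have hn : A.ten (w₂ ≫ p₁) (Q.lact (P.div _ _ hl) q' t₂) (e₂.trans hq) = (w₂ ≫ w₁) ≫ n' := by
      rw [← k₂', ← A.balanced _ _ _ t₁ t₂ (by rw [P.ract_div, e'])]
      exact A.ten_congr (P.ract_div _ _ _ _) rfl _ _
    have t₃ := Q.div_t _ _ hq
    have t₄ : ((w₂ ≫ w₁) ≫ n) ≫ A.r = Q.div _ _ hq ≫ K.t := by rw [← k₂, A.ten_r, t₃]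
    have hc : A.ract ((w₂ ≫ w₁) ≫ n) (Q.div _ _ hq) t₄ = (w₂ ≫ w₁) ≫ n' := by
      rw [← hn]
      refine (A.ract_congr k₂.symm rfl _ (by rw [A.ten_r, t₃])).trans ((A.ten_ract _ _ _ e₂ t₃ _
        (by rw [Q.ract_div, e₂, hq])).trans (A.ten_congr rfl (Q.ract_div _ _ _ _) _ _))
    have hw := cover_comp hw₂ hw₁
    obtain ⟨c, hcc⟩ := cover_desc hw (Q.div _ _ hq) (by
      intro S x y exy
      have aux : ∀ (x : S ⟶ T'), (x ≫ (w₂ ≫ w₁) ≫ n) ≫ A.r = (x ≫ Q.div _ _ hq) ≫ K.t := by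
        intro x; simpa using x ≫= t₄
      have exn : ∀ {Z : C} (m : T ⟶ Z), x ≫ (w₂ ≫ w₁) ≫ m = y ≫ (w₂ ≫ w₁) ≫ m := by
        intro Z m
        rw [← Category.assoc, exy, Category.assoc]
      refine uniq _ (x ≫ (w₂ ≫ w₁) ≫ n') _ _ (aux x) (by rw [exn, aux y]) ?_ ?_
      · rw [A.ract_nat x _ _ t₄, hc]
      · rw [exn n', ← hc, ← A.ract_nat y _ _ t₄ (aux y)]
        exact A.ract_congr (exn n) rfl _ _)
    have ec : n ≫ A.r = c ≫ K.t := by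
      refine cover_cancel hw ?_
      rw [← Category.assoc, t₄, ← hcc, Category.assoc]
    refine ⟨c, ⟨ec, ?_⟩, ?_⟩
    · refine cover_cancel hw ?_
      rw [← A.ract_nat (w₂ ≫ w₁) n c ec (by simpa using (w₂ ≫ w₁) ≫= ec), ← hc]
      exact A.ract_congr rfl hcc _ _
    · rintro c' ⟨ec', hc'⟩
      refine uniq n n' c' c ec' ec hc' ?_
      refine cover_cancel hw ?_
      rw [← A.ract_nat (w₂ ≫ w₁) n c ec (by simpa using (w₂ ≫ w₁) ≫= ec), ← hc]
      exact A.ract_congr rfl hcc _ _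

/-- The composite. -/
noncomputable def composite : Composite P Q where
  R := A.bibundle
  ten := A.ten
  ten_nat := A.ten_nat
  ten_l := A.ten_g
  ten_r := A.ten_r
  lact_ten := A.lact_ten
  ten_ract := A.ten_ract
  balanced := A.balanced

end TensorObj

/-- Hilsum–Skandalis bibundles can be composed. -/
theorem exists_composite {G H K : Gpd W} (P : HSBibundle G H) (Q : HSBibundle H K) :
    Nonempty (Composite P Q) := (exists_tensorObj P Q).map TensorObj.composite

/-- The composite of two HS bibundles. -/
noncomputable def comp {G H K : Gpd W} (P : HSBibundle G H) (Q : HSBibundle H K) :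
    Composite P Q := Classical.choice (exists_composite P Q)

/-! ## Categorified groupoids and their categorified actions -/

/-- The first component of a point of a product bibundle. -/
noncomputable def prodFst {G G' H H' : Gpd W} {M : C} {a : G.ToTriv M} {a' : G'.ToTriv M}
    {b : H.ToTriv M} {b' : H'.ToTriv M} {hb : W b.map} {hb' : W b'.map}
    {P : HSBibundle G G'} {Q : HSBibundle H H'}
    {hP : P.l ≫ a.map = P.r ≫ a'.map} {hQ : Q.l ≫ b.map = Q.r ≫ b'.map} :
    (prodBibundle a a' b b' hb hb' P Q hP hQ).X ⟶ P.X := Fp.fst (cover_comp Q.l_cover hb)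

/-- The second component of a point of a product bibundle. -/
noncomputable def prodSnd {G G' H H' : Gpd W} {M : C} {a : G.ToTriv M} {a' : G'.ToTriv M}
    {b : H.ToTriv M} {b' : H'.ToTriv M} {hb : W b.map} {hb' : W b'.map}
    {P : HSBibundle G G'} {Q : HSBibundle H H'}
    {hP : P.l ≫ a.map = P.r ≫ a'.map} {hQ : Q.l ≫ b.map = Q.r ≫ b'.map} :
    (prodBibundle a a' b b' hb hb' P Q hP hQ).X ⟶ Q.X := Fp.snd (cover_comp Q.l_cover hb)

/-- The projection from the restriction of a bibundle along a functor to the bibundle. -/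
noncomputable def restrictSnd {G' G H : Gpd W} {F : Gpd.Fun G' G} {P : HSBibundle G H} :
    (restrict F P).X ⟶ P.X := Fp.snd P.l_cover

variable (W) in
/-- A groupoid `G` (of arrows) with source and target morphisms to an object `M` (regarded as a
trivial groupoid). -/
structure CatGraph where
  M : C
  G : Gpd W
  s : G.ToTriv M
  t : G.ToTriv M
  s_cover : W s.map
  t_cover : W t.map

namespace CatGraph

variable (𝒢 : CatGraph W) {E : Gpd W} (J : E.ToTriv 𝒢.M)

/-- The groupoid `E ×_{J,M,t} G`. -/
noncomputable abbrev prod : Gpd W := fiberProd J 𝒢.t 𝒢.t_cover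

/-- The morphism `s ∘ pr₂ : E ×_{J,M,t} G ⟶ M`. -/
noncomputable abbrev prodJ : (𝒢.prod J).ToTriv 𝒢.M := toTrivSnd J 𝒢.t 𝒢.t_cover 𝒢.s

/-- The projection to the objects of `E`. -/
noncomputable abbrev pr₁ : (𝒢.prod J).ob ⟶ E.ob := (fpFst J 𝒢.t 𝒢.t_cover).ob

/-- The projection to the objects of `G`. -/
noncomputable abbrev pr₂ : (𝒢.prod J).ob ⟶ 𝒢.G.ob := (fpSnd J 𝒢.t 𝒢.t_cover).ob

theorem toTrivFst_cover : W (toTrivFst 𝒢.s 𝒢.t 𝒢.t_cover 𝒢.t).map :=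
  cover_comp (Fp.fst_cover 𝒢.t_cover) 𝒢.t_cover

/-- An action morphism: an HS bibundle from `E ×_{J,M,t} G` to `E`, with
`J ∘ act = s ∘ pr₂`. -/
structure ActionMorphism where
  bun : HSBibundle (𝒢.prod J) E
  hJ : bun.l ≫ (𝒢.prodJ J).map = bun.r ≫ J.map

/-- A multiplication: an HS bibundle from `G ×_{s,M,t} G` to `G`, with `s ∘ mul = s ∘ pr₂` and
`t ∘ mul = t ∘ pr₁`. -/
structure MulMorphism extends 𝒢.ActionMorphism 𝒢.s where
  ht : bun.l ≫ (toTrivFst 𝒢.s 𝒢.t 𝒢.t_cover 𝒢.t).map = bun.r ≫ 𝒢.t.map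

variable {𝒢 J} (act : 𝒢.ActionMorphism J) (mul : 𝒢.MulMorphism)

/-- The product bibundle `act × id : (E ×_M G) ×_M G ⟶ E ×_M G`. -/
noncomputable abbrev actId : HSBibundle (𝒢.prod (𝒢.prodJ J)) (𝒢.prod J) :=
  prodBibundle (𝒢.prodJ J) J 𝒢.t 𝒢.t 𝒢.t_cover 𝒢.t_cover act.bun (unitBibundle 𝒢.G) act.hJ
    𝒢.t.inv.symm

/-- The product bibundle `id × mul : E ×_M (G ×_M G) ⟶ E ×_M G`. -/
noncomputable abbrev idMul : HSBibundle (fiberProd J (toTrivFst 𝒢.s 𝒢.t 𝒢.t_cover 𝒢.t)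
    𝒢.toTrivFst_cover) (𝒢.prod J) :=
  prodBibundle J J (toTrivFst 𝒢.s 𝒢.t 𝒢.t_cover 𝒢.t) 𝒢.t 𝒢.toTrivFst_cover 𝒢.t_cover
    (unitBibundle E) mul.bun J.inv.symm mul.ht

/-- An associator: a 2-morphism `act ∘ (act × id) ⇒ act ∘ (id × mul)`. -/
abbrev Associator : Type _ :=
  HSHom (comp (actId act) act.bun).R
    (restrict (assocFun J 𝒢.t 𝒢.t_cover 𝒢.s 𝒢.t 𝒢.t_cover 𝒢.toTrivFst_cover)
      (comp (idMul (J := J) mul) act.bun).R)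

variable {act mul}

/-- The relation `α ((a, 1) ⊗ b) = (1, m) ⊗ c` for an associator `α` and generalized elements
`a`, `b`, `c` of the bibundle `act` and `m` of the bibundle `mul`. Locally, every element of
`act ∘ (act × id)` is of the form `(a, 1) ⊗ b` and every element of `act ∘ (id × mul)` is of the
form `(1, m) ⊗ c`. -/
def AssocRel (α : Associator act mul) {T : C} (a b : T ⟶ act.bun.X) (m : T ⟶ mul.bun.X)
    (c : T ⟶ act.bun.X) : Prop :=
  ∃ (x : T ⟶ (actId act).X) (y : T ⟶ (idMul (J := J) mul).X)
    (hx : x ≫ (actId act).r = b ≫ act.bun.l) (hy : y ≫ (idMul mul).r = c ≫ act.bun.l),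
    x ≫ prodFst = a ∧ x ≫ prodSnd = (b ≫ act.bun.l ≫ 𝒢.pr₂ J) ≫ 𝒢.G.one ∧
    y ≫ prodFst = (c ≫ act.bun.l ≫ 𝒢.pr₁ J) ≫ E.one ∧ y ≫ prodSnd = m ∧
    (comp (actId act) act.bun).ten x b hx ≫ α.map ≫ restrictSnd
      = (comp (idMul mul) act.bun).ten y c hy

variable (act mul)

variable (𝒢) in
/-- A unit: a functor from the trivial groupoid on `M` to `G`, with `s ∘ u = id = t ∘ u`. -/
structure UnitMorphism where
  u : 𝒢.M ⟶ 𝒢.G.ob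
  us : u ≫ 𝒢.s.map = 𝟙 𝒢.M
  ut : u ≫ 𝒢.t.map = 𝟙 𝒢.M

variable (one : 𝒢.UnitMorphism)

variable (J) in
/-- The functor `(id, u ∘ J) : E ⟶ E ×_M G`. -/
noncomputable def idUnit : Gpd.Fun E (𝒢.prod J) :=
  pairFun J 𝒢.t 𝒢.t_cover (Gpd.Fun.id E) (constFun J one.u)
    (by simp [Gpd.Fun.id, constFun, one.ut])

/-- The functor `(u ∘ t, id) : G ⟶ G ×_M G`. -/
noncomputable def unitId : Gpd.Fun 𝒢.G (𝒢.prod 𝒢.s) :=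
  pairFun 𝒢.s 𝒢.t 𝒢.t_cover (constFun 𝒢.t one.u) (Gpd.Fun.id 𝒢.G)
    (by simp [Gpd.Fun.id, constFun, one.us])

/-- A (right) unitor: a 2-morphism `act ∘ (id, u ∘ J) ⇒ id`. -/
abbrev Unitor : Type _ := HSHom (restrict (idUnit J one) act.bun) (unitBibundle E)

/-- A left unitor: a 2-morphism `mul ∘ (u ∘ t, id) ⇒ id`. -/
abbrev LeftUnitor : Type _ := HSHom (restrict (unitId one) mul.bun) (unitBibundle 𝒢.G)

variable {act mul one}

/-- The relation `ρ a = ε` for a unitor `ρ` and generalized elements `a` of the bibundle `act`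
and `ε` of `E`. -/
def UnitorRel (ρ : Unitor act one) {T : C} (a : T ⟶ act.bun.X) (ε : T ⟶ E.mor) : Prop :=
  ∃ x : T ⟶ (restrict (idUnit J one) act.bun).X, x ≫ restrictSnd = a ∧ x ≫ ρ.map = ε

/-- The relation `lam m = g` for a left unitor `lam` and generalized elements `m` of the bibundle
`mul` and `g` of `G`. -/
def LeftUnitorRel (lam : LeftUnitor mul one) {T : C} (m : T ⟶ mul.bun.X) (g : T ⟶ 𝒢.G.mor) :
    Prop :=
  ∃ x : T ⟶ (restrict (unitId one) mul.bun).X, x ≫ restrictSnd = m ∧ x ≫ lam.map = g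

/-- The pentagon condition for the associator `α` of an action, where `αG` is the associator of
the multiplication. Both ways from `act ∘ (act × id) ∘ (act × id × id)` to
`act ∘ (id × mul) ∘ (id × id × mul)` agree on the element `a ⊗ b ⊗ c`: one way takes it to
`m ⊗ d ⊗ c`, to `m ⊗ n ⊗ f` and to `p ⊗ o ⊗ f`; the other takes it to `a ⊗ p ⊗ b'` and, applying
`α` to `a ⊗ b'`, to `p ⊗ o ⊗ f`. -/
def Pentagon (α : Associator act mul) (αG : Associator mul.toActionMorphism mul) : Prop :=
  ∀ {T : C} (a b c d f b' : T ⟶ act.bun.X) (m n p o : T ⟶ mul.bun.X),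
    AssocRel α a b m d → AssocRel α d c n f → AssocRel αG m n p o → AssocRel α b c p b' →
    AssocRel α a b' o f

/-- The triangle condition: the 2-morphisms `ρ × id` and `(id × lam) ∘ α` from
`act ∘ (act × id) ∘ ((id, u ∘ J) × id)` to `act` agree. Here `x` and `l` are the elements that
`ρ` and `lam` take to identities. -/
def Triangle (α : Associator act mul) (ρ : Unitor act one) (lam : LeftUnitor mul one) : Prop :=
  ∀ {T : C} (a x : T ⟶ act.bun.X) (l : T ⟶ mul.bun.X),
    UnitorRel ρ x ((a ≫ act.bun.l ≫ 𝒢.pr₁ J) ≫ E.one) →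
    LeftUnitorRel lam l ((a ≫ act.bun.l ≫ 𝒢.pr₂ J) ≫ 𝒢.G.one) →
    AssocRel α x a l a

variable (𝒢) in
/-- An inversion: an HS bibundle from `G` to `G` which exchanges the source and the target. -/
structure InvMorphism where
  bun : HSBibundle 𝒢.G 𝒢.G
  hs : bun.l ≫ 𝒢.s.map = bun.r ≫ 𝒢.t.map
  ht : bun.l ≫ 𝒢.t.map = bun.r ≫ 𝒢.s.map

/-- The HS bibundle `(id, i) : G ⟶ G ×_{s,M,t} G`. -/
noncomputable def idInv (i : 𝒢.InvMorphism) : HSBibundle 𝒢.G (𝒢.prod 𝒢.s) :=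
  restrict (pairFun 𝒢.s 𝒢.s 𝒢.s_cover (Gpd.Fun.id 𝒢.G) (Gpd.Fun.id 𝒢.G) rfl)
    (prodBibundle 𝒢.s 𝒢.s 𝒢.s 𝒢.t 𝒢.s_cover 𝒢.t_cover (unitBibundle 𝒢.G) i.bun
      𝒢.s.inv.symm i.hs)

/-- The HS bibundle `(i, id) : G ⟶ G ×_{s,M,t} G`. -/
noncomputable def invId (i : 𝒢.InvMorphism) : HSBibundle 𝒢.G (𝒢.prod 𝒢.s) :=
  restrict (pairFun 𝒢.t 𝒢.t 𝒢.t_cover (Gpd.Fun.id 𝒢.G) (Gpd.Fun.id 𝒢.G) rfl)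
    (prodBibundle 𝒢.t 𝒢.s 𝒢.t 𝒢.t 𝒢.t_cover 𝒢.t_cover i.bun (unitBibundle 𝒢.G)
      i.ht 𝒢.t.inv.symm)

end CatGraph

variable (W) in
/-- A categorified groupoid in `(C, W)`: a groupoid `G` of arrows over an object `M`, with
multiplication, inversion (HS bibundles) and unit, and with associator, unitors and inversors
satisfying the pentagon and triangle conditions. -/
structure CatGroupoid extends CatGraph W where
  mul : toCatGraph.MulMorphism
  one : toCatGraph.UnitMorphism
  inv : toCatGraph.InvMorphism
  α : CatGraph.Associator mul.toActionMorphism mul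
  ρ : CatGraph.Unitor mul.toActionMorphism one
  lam : CatGraph.LeftUnitor mul one
  η : HSHom (comp (CatGraph.idInv inv) mul.bun).R
    (restrict (constFun toCatGraph.t one.u) (unitBibundle G))
  ε : HSHom (comp (CatGraph.invId inv) mul.bun).R
    (restrict (constFun toCatGraph.s one.u) (unitBibundle G))
  pentagon : CatGraph.Pentagon α α
  triangle : CatGraph.Triangle α ρ lam

/-- A categorified (right) action of a categorified groupoid on a groupoid `E` along a moment
morphism `J : E ⟶ M`: an HS bibundle action morphism with an associator and a unitor satisfying
the pentagon and triangle conditions. -/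
structure CatAction (𝒢 : CatGroupoid W) where
  E : Gpd W
  J : E.ToTriv 𝒢.M
  act : 𝒢.ActionMorphism J
  α : CatGraph.Associator act 𝒢.mul
  ρ : CatGraph.Unitor act 𝒢.one
  pentagon : CatGraph.Pentagon α 𝒢.α
  triangle : CatGraph.Triangle α ρ 𝒢.lam

/-- An isomorphism of categorified actions of `𝒢`: an isomorphism `F` of groupoids over `M` and
an `F`-equivariant isomorphism `φ` of the action bibundles which respects the associators and the
unitors. -/
structure CatAction.Iso {𝒢 : CatGroupoid W} (A A' : CatAction 𝒢) where
  F : Gpd.Fun A.E A'.E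
  isIso_ob : IsIso F.ob
  isIso_mor : IsIso F.mor
  F_J : F.ob ≫ A'.J.map = A.J.map
  φ : A.act.bun.X ≅ A'.act.bun.X
  φ_fst : φ.hom ≫ A'.act.bun.l ≫ 𝒢.pr₁ A'.J = A.act.bun.l ≫ 𝒢.pr₁ A.J ≫ F.ob
  φ_snd : φ.hom ≫ A'.act.bun.l ≫ 𝒢.pr₂ A'.J = A.act.bun.l ≫ 𝒢.pr₂ A.J
  φ_r : φ.hom ≫ A'.act.bun.r = A.act.bun.r ≫ F.ob
  φ_lact : ∀ {T : C} (g : T ⟶ (𝒢.prod A.J).mor) (g' : T ⟶ (𝒢.prod A'.J).mor)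
    (p : T ⟶ A.act.bun.X)
    (e : g ≫ (𝒢.prod A.J).s = p ≫ A.act.bun.l)
    (e' : g' ≫ (𝒢.prod A'.J).s = (p ≫ φ.hom) ≫ A'.act.bun.l),
    g' ≫ (fpFst A'.J 𝒢.t 𝒢.t_cover).mor = g ≫ (fpFst A.J 𝒢.t 𝒢.t_cover).mor ≫ F.mor →
    g' ≫ (fpSnd A'.J 𝒢.t 𝒢.t_cover).mor = g ≫ (fpSnd A.J 𝒢.t 𝒢.t_cover).mor →
    A.act.bun.lact g p e ≫ φ.hom = A'.act.bun.lact g' (p ≫ φ.hom) e'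
  φ_ract : ∀ {T : C} (p : T ⟶ A.act.bun.X) (h : T ⟶ A.E.mor)
    (e : p ≫ A.act.bun.r = h ≫ A.E.t)
    (e' : (p ≫ φ.hom) ≫ A'.act.bun.r = (h ≫ F.mor) ≫ A'.E.t),
    A.act.bun.ract p h e ≫ φ.hom = A'.act.bun.ract (p ≫ φ.hom) (h ≫ F.mor) e'
  φ_α : ∀ {T : C} (a b : T ⟶ A.act.bun.X) (m : T ⟶ 𝒢.mul.bun.X) (c : T ⟶ A.act.bun.X),
    CatGraph.AssocRel A.α a b m c ↔
      CatGraph.AssocRel A'.α (a ≫ φ.hom) (b ≫ φ.hom) m (c ≫ φ.hom)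
  φ_ρ : ∀ {T : C} (a : T ⟶ A.act.bun.X) (x : T ⟶ A.E.mor),
    CatGraph.UnitorRel A.ρ a x ↔ CatGraph.UnitorRel A'.ρ (a ≫ φ.hom) (x ≫ F.mor)

namespace CatAction

variable {𝒢 : CatGroupoid W}

theorem Iso.refl (A : CatAction 𝒢) : Nonempty (Iso A A) := ⟨{
  F := Gpd.Fun.id _
  isIso_ob := by dsimp [Gpd.Fun.id]; infer_instance
  isIso_mor := by dsimp [Gpd.Fun.id]; infer_instance
  F_J := by simp [Gpd.Fun.id]
  φ := CategoryTheory.Iso.refl _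
  φ_fst := by simp [Gpd.Fun.id]
  φ_snd := by simp
  φ_r := by simp [Gpd.Fun.id]
  φ_lact := by
    intro T g g' p e e' h₁ h₂
    have : g' = g := fp_mor_ext (by simpa [Gpd.Fun.id] using h₁) h₂
    subst this
    simp
  φ_ract := by
    intro T p h e e'
    refine (Category.comp_id _).trans ?_
    exact A.act.bun.ract_congr (by simp) (by simp [Gpd.Fun.id]) _ _
  φ_α := by intros; simp
  φ_ρ := by intros; simp [Gpd.Fun.id] }⟩

theorem Iso.symm {A A' : CatAction 𝒢} (i : Iso A A') : Nonempty (Iso A' A) := by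
  have := i.isIso_ob
  have := i.isIso_mor
  let F' : Gpd.Fun A'.E A.E := {
    ob := inv i.F.ob
    mor := inv i.F.mor
    mor_s := by rw [IsIso.inv_comp_eq, ← Category.assoc, IsIso.eq_comp_inv, i.F.mor_s]
    mor_t := by rw [IsIso.inv_comp_eq, ← Category.assoc, IsIso.eq_comp_inv, i.F.mor_t]
    mor_one := by rw [IsIso.comp_inv_eq, Category.assoc, i.F.mor_one, IsIso.inv_hom_id_assoc]
    mor_mul := by
      intro T g h e e'
      rw [IsIso.eq_comp_inv, i.F.mul_mor]
      exact A'.E.mul_congr (by simp) (by simp) _ _ }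
  refine ⟨{ F := F', isIso_ob := ?_, isIso_mor := ?_, F_J := ?_, φ := i.φ.symm, φ_fst := ?_
            φ_snd := ?_, φ_r := ?_, φ_lact := ?_, φ_ract := ?_, φ_α := ?_, φ_ρ := ?_ }⟩
  · dsimp [F']; infer_instance
  · dsimp [F']; infer_instance
  · simp [F', ← i.F_J]
  · rw [CategoryTheory.Iso.symm_hom, Iso.inv_comp_eq]
    have := i.φ_fst =≫ inv i.F.ob
    simpa [F'] using this.symm
  · rw [CategoryTheory.Iso.symm_hom, Iso.inv_comp_eq, i.φ_snd]
  · rw [CategoryTheory.Iso.symm_hom, Iso.inv_comp_eq]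
    have := i.φ_r =≫ inv i.F.ob
    simpa [F'] using this.symm
  · intro T g g' p e e' h₁ h₂
    change g' ≫ (𝒢.prod A.J).s = (p ≫ i.φ.inv) ≫ A.act.bun.l at e'
    change A'.act.bun.lact g p e ≫ i.φ.inv = A.act.bun.lact g' (p ≫ i.φ.inv) e'
    rw [Iso.comp_inv_eq]
    rw [i.φ_lact g' g (p ≫ i.φ.inv) e' (by simpa using e) (by
      rw [← Category.assoc, h₁]; simp [F'])
      h₂.symm]
    exact A'.act.bun.lact_congr rfl (by simp) _ _
  · intro T p h e e'
    simp only [CategoryTheory.Iso.symm_hom] at e' ⊢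
    rw [Iso.comp_inv_eq]
    rw [i.φ_ract (p ≫ i.φ.inv) (h ≫ F'.mor) e' (by simpa [F'] using e)]
    exact A'.act.bun.ract_congr (by simp) (by simp [F']) _ _
  · intro T a b m c
    rw [i.φ_α]
    simp
  · intro T a x
    rw [i.φ_ρ]
    simp [F']

theorem Iso.trans {A A' A'' : CatAction 𝒢} (i : Iso A A') (j : Iso A' A'') :
    Nonempty (Iso A A'') := by
  have := i.isIso_ob
  have := i.isIso_mor
  have := j.isIso_ob
  have := j.isIso_mor
  refine ⟨{ F := i.F.comp j.F, isIso_ob := ?_, isIso_mor := ?_, F_J := ?_, φ := i.φ ≪≫ j.φ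
            φ_fst := ?_
            φ_snd := ?_, φ_r := ?_, φ_lact := ?_, φ_ract := ?_, φ_α := ?_, φ_ρ := ?_ }⟩
  · dsimp [Gpd.Fun.comp]; infer_instance
  · dsimp [Gpd.Fun.comp]; infer_instance
  · simp [Gpd.Fun.comp, j.F_J, i.F_J]
  · rw [CategoryTheory.Iso.trans_hom, Category.assoc, j.φ_fst]
    simpa [Gpd.Fun.comp] using i.φ_fst =≫ j.F.ob
  · rw [CategoryTheory.Iso.trans_hom, Category.assoc, j.φ_snd, i.φ_snd]
  · rw [CategoryTheory.Iso.trans_hom, Category.assoc, j.φ_r]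
    simpa [Gpd.Fun.comp] using i.φ_r =≫ j.F.ob
  · intro T g g' p e e' h₁ h₂
    let k : T ⟶ (𝒢.prod A'.J).mor := fpMor _ _ _ (g ≫ (fpFst _ _ _).mor ≫ i.F.mor)
      (g ≫ (fpSnd _ _ _).mor) (by
        have h := g ≫= fp_mor_cond (a := A.J) (b := 𝒢.t) (hb := 𝒢.t_cover)
        rw [← i.F_J, i.F.s_ob_assoc] at h
        simpa using h)
    have k₁ : k ≫ (fpFst _ _ _).mor = g ≫ (fpFst _ _ _).mor ≫ i.F.mor := fpMor_fst _ _ _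
    have k₂ : k ≫ (fpSnd _ _ _).mor = g ≫ (fpSnd _ _ _).mor := fpMor_snd _ _ _
    have c : k ≫ (𝒢.prod A'.J).s = (p ≫ i.φ.hom) ≫ A'.act.bun.l := by
      refine fp_ob_ext ?_ ?_
      · rw [Category.assoc, Gpd.Fun.s_ob, ← Category.assoc, k₁]
        simp only [Category.assoc]
        rw [i.φ_fst, ← Gpd.Fun.s_ob, ← Gpd.Fun.s_ob_assoc]
        simpa using e =≫ ((fpFst _ _ _).ob ≫ i.F.ob)
      · rw [Category.assoc, Gpd.Fun.s_ob, ← Category.assoc, k₂]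
        simp only [Category.assoc]
        rw [i.φ_snd, ← Gpd.Fun.s_ob]
        simpa using e =≫ (fpSnd _ _ _).ob
    change A.act.bun.lact g p e ≫ (i.φ.hom ≫ j.φ.hom) = A''.act.bun.lact g'
      (p ≫ i.φ.hom ≫ j.φ.hom) e'
    rw [← Category.assoc (A.act.bun.lact g p e), i.φ_lact g k p e c k₁ k₂,
      j.φ_lact k g' (p ≫ i.φ.hom) c (by simpa using e') (by
        rw [h₁, ← Category.assoc k, k₁]; simp [Gpd.Fun.comp]) (by rw [h₂, k₂])]
    exact A''.act.bun.lact_congr rfl (by simp) _ _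
  · intro T p h e e'
    have c : (p ≫ i.φ.hom) ≫ A'.act.bun.r = (h ≫ i.F.mor) ≫ A'.E.t := by
      rw [Category.assoc, i.φ_r, Category.assoc, i.F.mor_t, ← Category.assoc, e, Category.assoc]
    change A.act.bun.ract p h e ≫ (i.φ.hom ≫ j.φ.hom) = A''.act.bun.ract (p ≫ i.φ.hom ≫ j.φ.hom)
      (h ≫ i.F.mor ≫ j.F.mor) e'
    rw [← Category.assoc (A.act.bun.ract p h e), i.φ_ract p h e c,
      j.φ_ract _ _ c (by simpa [Gpd.Fun.comp] using e')]
    exact A''.act.bun.ract_congr (by simp) (by simp) _ _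
  · intro T a b m c
    rw [i.φ_α, j.φ_α]
    simp
  · intro T a x
    rw [i.φ_ρ, j.φ_ρ]
    simp [Gpd.Fun.comp]

/-- Isomorphism of categorified actions. -/
instance isoSetoid (𝒢 : CatGroupoid W) : Setoid (CatAction 𝒢) where
  r A A' := Nonempty (Iso A A')
  iseqv := ⟨Iso.refl, fun ⟨i⟩ => i.symm, fun ⟨i⟩ ⟨j⟩ => i.trans j⟩

end CatAction


end Constructions

/-! ## Kan conditions, `n`-groupoid objects and Kan fibrations

For a simplicial object `X` and a simplicial set `S`, the presheaf `Hom(S, X)` on `C` has the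
`T`-points `S ⟶ X(T)`, where `X(T)` is the simplicial set of `T`-points of `X`. -/

section Simplicial

variable {C : Type u} [Category.{v} C]

/-- The simplicial set `X(T)` of `T`-points of a simplicial object. -/
def pts (X : SimplicialObject C) (T : C) : SSet.{v} := X ⋙ coyoneda.obj (op T)

/-- The map `X(T) ⟶ X(T')` induced by `w : T' ⟶ T`. -/
def ptsPre (X : SimplicialObject C) {T T' : C} (w : T' ⟶ T) : pts X T ⟶ pts X T' :=
  Functor.whiskerLeft X (coyoneda.map w.op)

/-- The map `A(T) ⟶ X(T)` induced by `π : A ⟶ X`. -/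
def ptsMap {A X : SimplicialObject C} (π : A ⟶ X) (T : C) : pts A T ⟶ pts X T :=
  Functor.whiskerRight π (coyoneda.obj (op T))

/-- The map `Δ[m] ⟶ X(T)` given by an `m`-simplex. -/
def simplexMap {X : SimplicialObject C} {T : C} {m : ℕ} (x : T ⟶ X _⦋m⦌) :
    (Δ[m] : SSet.{v}) ⟶ pts X T :=
  SSet.yonedaEquiv.symm x

/-- An object `H` representing `Hom(Λ[m,i], X)`, with its universal horn `h`, and the map
`p : X_m ⟶ Hom(Λ[m,i], X)` given by restriction to the horn. -/
structure HornObject (X : SimplicialObject C) (m : ℕ) (i : Fin (m + 1)) where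
  H : C
  h : (Λ[m, i] : SSet.{v}) ⟶ pts X H
  univ : ∀ {T : C} (h' : (Λ[m, i] : SSet.{v}) ⟶ pts X T), ∃! w : T ⟶ H, h ≫ ptsPre X w = h'
  p : X _⦋m⦌ ⟶ H
  p_h : h ≫ ptsPre X p = Λ[m, i].ι ≫ simplexMap (𝟙 (X _⦋m⦌))

/-- An object `H` representing `Hom(Λ[m,i], A) ×_{Hom(Λ[m,i], X)} X_m`, with its universal point
`(h, σ)`, and the map `p` from `A_m` to it. -/
structure RelHornObject {A X : SimplicialObject C} (π : A ⟶ X) (m : ℕ) (i : Fin (m + 1)) where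
  H : C
  h : (Λ[m, i] : SSet.{v}) ⟶ pts A H
  σ : H ⟶ X _⦋m⦌
  comm : h ≫ ptsMap π H = Λ[m, i].ι ≫ simplexMap σ
  univ : ∀ {T : C} (h' : (Λ[m, i] : SSet.{v}) ⟶ pts A T) (σ' : T ⟶ X _⦋m⦌),
    h' ≫ ptsMap π T = Λ[m, i].ι ≫ simplexMap σ' →
    ∃! w : T ⟶ H, h ≫ ptsPre A w = h' ∧ w ≫ σ = σ'
  p : A _⦋m⦌ ⟶ H
  p_h : h ≫ ptsPre A p = Λ[m, i].ι ≫ simplexMap (𝟙 (A _⦋m⦌))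
  p_σ : p ≫ σ = π.app (op ⦋m⦌)

/-- The Kan condition `Kan(m,i)` for `W` the covers, and `Kan!(m,i)` for `W` the isomorphisms: the
horn object is representable and the map from `X_m` to it is in `W`. -/
def Kan (W : MorphismProperty C) (X : SimplicialObject C) (m : ℕ) (i : Fin (m + 1)) : Prop :=
  ∃ D : HornObject X m i, W D.p

/-- The relative Kan condition `Kan(m,i)` (or `Kan!(m,i)`) for `π : A ⟶ X`. -/
def RelKan (W : MorphismProperty C) {A X : SimplicialObject C} (π : A ⟶ X) (m : ℕ)
    (i : Fin (m + 1)) : Prop :=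
  ∃ D : RelHornObject π m i, W D.p

/-- An `n`-groupoid object in `(C, W)`. -/
structure IsNGroupoid (W : MorphismProperty C) (n : ℕ) (X : SimplicialObject C) : Prop where
  kan : ∀ (m : ℕ) (i : Fin (m + 1)), 1 ≤ m → Kan W X m i
  kan_unique : ∀ (m : ℕ) (i : Fin (m + 1)), n < m → Kan (MorphismProperty.isomorphisms C) X m i

/-- An `n`-groupoid Kan fibration in `(C, W)`. -/
structure IsNGroupoidKanFibration (W : MorphismProperty C) (n : ℕ) {A X : SimplicialObject C}
    (π : A ⟶ X) : Prop where
  source : IsNGroupoid W n A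
  target : IsNGroupoid W n X
  kan : ∀ (m : ℕ) (i : Fin (m + 1)), 1 ≤ m → RelKan W π m i
  kan_unique : ∀ i : Fin (n + 1), RelKan (MorphismProperty.isomorphisms C) π n i

/-- The `2`-groupoid Kan fibrations `A ⟶ X` with given target `X`. -/
def TwoGroupoidKanFibration (W : MorphismProperty C) (X : SimplicialObject C) :=
  { π : Over X // IsNGroupoidKanFibration W 2 π.hom }

/-- Isomorphism of `2`-groupoid Kan fibrations over `X`. -/
instance TwoGroupoidKanFibration.isoSetoid (W : MorphismProperty C) (X : SimplicialObject C) :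
    Setoid (TwoGroupoidKanFibration W X) where
  r π π' := Nonempty (π.1 ≅ π'.1)
  iseqv := ⟨fun π => ⟨Iso.refl π.1⟩, fun ⟨i⟩ => ⟨i.symm⟩, fun ⟨i⟩ ⟨j⟩ => ⟨i.trans j⟩⟩

end Simplicial

/-! ## The correspondence between the categorified and the simplicial picture

A `1`-simplex `g` of a simplicial object is regarded as an arrow with target `d₁ g` (its vertex
`0`) and source `d₀ g` (its vertex `1`). -/

section Nerve

variable {C : Type u} [Category.{v} C] {W : MorphismProperty C} [NicePretopology W]

/-- An identification of the `2`-groupoid object `X` with the nerve of the categorified groupoid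
`𝒢`: `X₀ = M`, `X₁ = G₀`, `X₂` is the bibundle of the multiplication, with left moment map
`(d₂, d₀)` and right moment map `d₁`, the degeneracies are given by the unit and the unitors, and
`X₃` is given by the associator. (The higher `Xₙ` are determined by these.) -/
structure NerveData (𝒢 : CatGroupoid W) (X : SimplicialObject C) where
  e₀ : 𝒢.M ≅ X _⦋0⦌
  e₁ : 𝒢.G.ob ≅ X _⦋1⦌
  e₂ : 𝒢.mul.bun.X ≅ X _⦋2⦌
  target : e₁.hom ≫ X.δ 1 = 𝒢.t.map ≫ e₀.hom
  source : e₁.hom ≫ X.δ 0 = 𝒢.s.map ≫ e₀.hom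
  left₁ : e₂.hom ≫ X.δ 2 = 𝒢.mul.bun.l ≫ 𝒢.pr₁ 𝒢.s ≫ e₁.hom
  left₂ : e₂.hom ≫ X.δ 0 = 𝒢.mul.bun.l ≫ 𝒢.pr₂ 𝒢.s ≫ e₁.hom
  right : e₂.hom ≫ X.δ 1 = 𝒢.mul.bun.r ≫ e₁.hom
  unit : 𝒢.one.u ≫ e₁.hom = e₀.hom ≫ X.σ 0
  unitor : ∀ {T : C} (g : T ⟶ 𝒢.G.ob) (m : T ⟶ 𝒢.mul.bun.X),
    CatGraph.UnitorRel 𝒢.ρ m (g ≫ 𝒢.G.one) ↔ m ≫ e₂.hom = (g ≫ e₁.hom) ≫ X.σ 1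
  leftUnitor : ∀ {T : C} (g : T ⟶ 𝒢.G.ob) (m : T ⟶ 𝒢.mul.bun.X),
    CatGraph.LeftUnitorRel 𝒢.lam m (g ≫ 𝒢.G.one) ↔ m ≫ e₂.hom = (g ≫ e₁.hom) ≫ X.σ 0
  associator : ∀ {T : C} (m₀₁₂ m₀₂₃ m₁₂₃ m₀₁₃ : T ⟶ 𝒢.mul.bun.X),
    CatGraph.AssocRel 𝒢.α m₀₁₂ m₀₂₃ m₁₂₃ m₀₁₃ ↔
      ∃ x : T ⟶ X _⦋3⦌, x ≫ X.δ 3 = m₀₁₂ ≫ e₂.hom ∧ x ≫ X.δ 1 = m₀₂₃ ≫ e₂.hom ∧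
        x ≫ X.δ 0 = m₁₂₃ ≫ e₂.hom ∧ x ≫ X.δ 2 = m₀₁₃ ≫ e₂.hom

/-- An identification of `A` with the action `2`-groupoid of the categorified action `a` of the
categorified groupoid `𝒢` with nerve `X`, and of `π` with its projection to `X`: `A₀ = E₀`, `A₁`
is the bibundle of the action, `d₁ = pr₁ ∘ l`, `d₀ = r`, `π₀ = J`, `π₁ = pr₂ ∘ l`, the degeneracy
`A₀ ⟶ A₁` is given by the unitor, and `A₂` is given by the associator. (The higher `Aₙ` are
determined by these.) -/
structure ActionNerve {𝒢 : CatGroupoid W} {X : SimplicialObject C} (n : NerveData 𝒢 X)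
    (a : CatAction 𝒢) {A : SimplicialObject C} (π : A ⟶ X) where
  φ₀ : a.E.ob ≅ A _⦋0⦌
  φ₁ : a.act.bun.X ≅ A _⦋1⦌
  moment : φ₀.hom ≫ π.app (op ⦋0⦌) = a.J.map ≫ n.e₀.hom
  left₁ : φ₁.hom ≫ A.δ 1 = a.act.bun.l ≫ 𝒢.pr₁ a.J ≫ φ₀.hom
  left₂ : φ₁.hom ≫ π.app (op ⦋1⦌) = a.act.bun.l ≫ 𝒢.pr₂ a.J ≫ n.e₁.hom
  right : φ₁.hom ≫ A.δ 0 = a.act.bun.r ≫ φ₀.hom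
  unitor : ∀ {T : C} (e : T ⟶ a.E.ob) (x : T ⟶ a.act.bun.X),
    CatGraph.UnitorRel a.ρ x (e ≫ a.E.one) ↔ x ≫ φ₁.hom = (e ≫ φ₀.hom) ≫ A.σ 0
  associator : ∀ {T : C} (a₀₁ a₁₂ : T ⟶ a.act.bun.X) (m : T ⟶ 𝒢.mul.bun.X)
    (a₀₂ : T ⟶ a.act.bun.X),
    CatGraph.AssocRel a.α a₀₁ a₁₂ m a₀₂ ↔
      ∃ x : T ⟶ A _⦋2⦌, x ≫ A.δ 2 = a₀₁ ≫ φ₁.hom ∧ x ≫ A.δ 0 = a₁₂ ≫ φ₁.hom ∧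
        x ≫ π.app (op ⦋2⦌) = m ≫ n.e₂.hom ∧ x ≫ A.δ 1 = a₀₂ ≫ φ₁.hom

end Nerve

end HigherGpd

namespace HigherGpd

section Horns

variable {Y : SSet.{v}}

/-- The compatibility condition for the faces of a horn of dimension at least two. -/
def IsHornFamily {n : ℕ} {i : Fin (n + 3)} (y : ∀ j : Fin (n + 3), j ≠ i → Y _⦋n + 1⦌) : Prop :=
  ∀ (j k : Fin (n + 3)) (hj : j ≠ i) (hk : k ≠ i) (hjk : j < k),
    Y.δ (k.pred (Fin.ne_zero_of_lt hjk)) (y j hj) = Y.δ (j.castPred (Fin.ne_last_of_lt hjk)) (y k hk)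

theorem exists_horn {n : ℕ} {i : Fin (n + 3)} (y : ∀ j : Fin (n + 3), j ≠ i → Y _⦋n + 1⦌)
    (hy : IsHornFamily y) :
    ∃ h : (Λ[n + 2, i] : SSet.{v}) ⟶ Y, ∀ j hj, h.app _ (SSet.horn.face i j hj) = y j hj := by
  have hf : SSet.horn.IsCompatible (i := i) (fun j hj => SSet.yonedaEquiv.symm (y j hj)) := by
    rw [SSet.horn.isCompatible_iff]
    intro j k hj hk hjk
    rw [SSet.stdSimplex.δ_comp_yonedaEquiv_symm, SSet.stdSimplex.δ_comp_yonedaEquiv_symm,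
      hy j k hj hk hjk]
  obtain ⟨h, hh⟩ := hf.exists_desc
  refine ⟨h, fun j hj => ?_⟩
  have := congrArg SSet.yonedaEquiv (hh j hj)
  rw [SSet.yonedaEquiv_comp, SSet.horn.yonedaEquiv_ι, Equiv.apply_symm_apply] at this
  exact this

theorem exists_horn_one {i : Fin 2} (y : ∀ j : Fin 2, j ≠ i → Y _⦋0⦌) :
    ∃ h : (Λ[1, i] : SSet.{v}) ⟶ Y, ∀ j hj, h.app _ (SSet.horn.face i j hj) = y j hj := by
  have hf : SSet.horn.IsCompatible (n := 0) (i := i)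
      (fun j hj => SSet.yonedaEquiv.symm (y j hj)) := trivial
  obtain ⟨h, hh⟩ := hf.exists_desc
  refine ⟨h, fun j hj => ?_⟩
  have := congrArg SSet.yonedaEquiv (hh j hj)
  rw [SSet.yonedaEquiv_comp, SSet.horn.yonedaEquiv_ι, Equiv.apply_symm_apply] at this
  exact this

theorem isHornFamily_of_hom {n : ℕ} {i : Fin (n + 3)} (h : (Λ[n + 2, i] : SSet.{v}) ⟶ Y) :
    IsHornFamily (i := i) (fun j hj => h.app _ (SSet.horn.face i j hj)) := by
  have := SSet.horn.IsCompatible.of_hom h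
  rw [SSet.horn.isCompatible_iff] at this
  intro j k hj hk hjk
  have h2 := congrArg SSet.yonedaEquiv (this j k hj hk hjk)
  rw [SSet.stdSimplex.yonedaEquiv_δ_comp, SSet.stdSimplex.yonedaEquiv_δ_comp,
    SSet.yonedaEquiv_comp, SSet.yonedaEquiv_comp, SSet.horn.yonedaEquiv_ι,
    SSet.horn.yonedaEquiv_ι] at h2
  exact h2

end Horns

section Points

variable {C : Type u} [Category.{v} C] {X A : SimplicialObject C}

theorem simplexMap_face {T : C} {n : ℕ} {i : Fin (n + 2)} (x : T ⟶ X _⦋n + 1⦌) (j : Fin (n + 2))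
    (hj : j ≠ i) :
    (Λ[n + 1, i].ι ≫ simplexMap x).app _ (SSet.horn.face i j hj) = x ≫ X.δ j := by
  have h : SSet.yonedaEquiv (SSet.horn.ι i j hj ≫ Λ[n + 1, i].ι ≫ simplexMap x) = x ≫ X.δ j := by
    rw [SSet.horn.ι_ι_assoc]
    refine (SSet.stdSimplex.yonedaEquiv_δ_comp _ _).trans ?_
    exact congrArg ((pts X T).δ j) (Equiv.apply_symm_apply _ _)
  rw [SSet.yonedaEquiv_comp, SSet.horn.yonedaEquiv_ι] at h
  exact h

theorem ptsPre_face {T T' : C} (w : T' ⟶ T) {n : ℕ} {i : Fin (n + 2)}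
    (h : (Λ[n + 1, i] : SSet.{v}) ⟶ pts X T) (j : Fin (n + 2)) (hj : j ≠ i) :
    (h ≫ ptsPre X w).app _ (SSet.horn.face i j hj)
      = (w ≫ (show T ⟶ X _⦋n⦌ from h.app _ (SSet.horn.face i j hj))) := rfl

theorem ptsMap_face {T : C} (π : A ⟶ X) {n : ℕ} {i : Fin (n + 2)}
    (h : (Λ[n + 1, i] : SSet.{v}) ⟶ pts A T) (j : Fin (n + 2)) (hj : j ≠ i) :
    (h ≫ ptsMap π T).app _ (SSet.horn.face i j hj)
      = ((show T ⟶ A _⦋n⦌ from h.app _ (SSet.horn.face i j hj)) ≫ π.app (op ⦋n⦌)) := rfl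

/-- Unique horn fillers on points. -/
theorem Kan.existsUnique {n : ℕ} {i : Fin (n + 3)}
    (hK : Kan (MorphismProperty.isomorphisms C) X (n + 2) i) {T : C}
    (y : ∀ j : Fin (n + 3), j ≠ i → (T ⟶ X _⦋n + 1⦌))
    (hy : ∀ (j k : Fin (n + 3)) (hj : j ≠ i) (hk : k ≠ i) (hjk : j < k),
      y j hj ≫ X.δ (k.pred (Fin.ne_zero_of_lt hjk))
        = y k hk ≫ X.δ (j.castPred (Fin.ne_last_of_lt hjk))) :
    ∃! x : T ⟶ X _⦋n + 2⦌, ∀ j hj, x ≫ X.δ j = y j hj := by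
  obtain ⟨D, hD⟩ := hK
  have hD' : IsIso D.p := hD
  obtain ⟨h, hh⟩ := exists_horn (Y := pts X T) (i := i) y hy
  have key : ∀ x : T ⟶ X _⦋n + 2⦌, (∀ j hj, x ≫ X.δ j = y j hj) ↔ D.h ≫ ptsPre X (x ≫ D.p) = h := by
    intro x
    have e : D.h ≫ ptsPre X (x ≫ D.p) = Λ[n + 2, i].ι ≫ simplexMap x := by
      refine SSet.horn.hom_ext _ _ fun j hj => ?_
      have h1 := congrArg (fun f => f.app _ (SSet.horn.face i j hj)) D.p_h
      dsimp only at h1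
      rw [simplexMap_face, ptsPre_face] at h1
      rw [simplexMap_face, ptsPre_face]
      refine (Category.assoc _ _ _).trans ?_
      rw [h1, Category.id_comp]
    rw [e]
    constructor
    · intro hx
      refine SSet.horn.hom_ext _ _ fun j hj => ?_
      rw [simplexMap_face, hh]
      exact hx j hj
    · rintro rfl j hj
      rw [← hh, simplexMap_face]
  obtain ⟨w, hw, hw'⟩ := D.univ h
  refine ⟨w ≫ inv D.p, (key _).2 (by simpa using hw), fun x hx => ?_⟩
  rw [← hw' (x ≫ D.p) ((key x).1 hx)]
  simp

/-- A commutative square whose comparison map to the fibre product is a cover. -/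
def CoverSq (W : MorphismProperty C) {Z A B S : C} (f : Z ⟶ A) (g : Z ⟶ B) (a : A ⟶ S)
    (b : B ⟶ S) : Prop :=
  ∃ (P : C) (p : P ⟶ A) (q : P ⟶ B) (l : Z ⟶ P), IsPullback p q a b ∧ l ≫ p = f ∧ l ≫ q = g ∧ W l

theorem Kan.of_existsUnique {n : ℕ} {i : Fin (n + 3)}
    (hX : ∀ {T : C} (y : ∀ j : Fin (n + 3), j ≠ i → (T ⟶ X _⦋n + 1⦌)),
      (∀ (j k : Fin (n + 3)) (hj : j ≠ i) (hk : k ≠ i) (hjk : j < k),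
      y j hj ≫ X.δ (k.pred (Fin.ne_zero_of_lt hjk))
        = y k hk ≫ X.δ (j.castPred (Fin.ne_last_of_lt hjk))) →
      ∃! x : T ⟶ X _⦋n + 2⦌, ∀ j hj, x ≫ X.δ j = y j hj) :
    Kan (MorphismProperty.isomorphisms C) X (n + 2) i := by
  refine ⟨⟨X _⦋n + 2⦌, Λ[n + 2, i].ι ≫ simplexMap (𝟙 _), ?_, 𝟙 _, ?_⟩, ?_⟩
  · intro T h'
    obtain ⟨w, hw, hw'⟩ := hX (fun j hj => h'.app _ (SSet.horn.face i j hj))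
      (isHornFamily_of_hom h')
    have e : ∀ w : T ⟶ X _⦋n + 2⦌, (∀ j hj, w ≫ X.δ j = h'.app _ (SSet.horn.face i j hj)) ↔
        (Λ[n + 2, i].ι ≫ simplexMap (𝟙 (X _⦋n + 2⦌))) ≫ ptsPre X w = h' := by
      intro w
      constructor
      · intro hw
        refine SSet.horn.hom_ext _ _ fun j hj => ?_
        rw [ptsPre_face, simplexMap_face, Category.id_comp]
        exact hw j hj
      · rintro rfl j hj
        rw [ptsPre_face, simplexMap_face, Category.id_comp]
    exact ⟨w, (e w).1 hw, fun w' h => hw' w' ((e w').2 h)⟩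
  · refine SSet.horn.hom_ext _ _ fun j hj => ?_
    rw [ptsPre_face]
    exact Category.id_comp _
  · exact inferInstanceAs (IsIso (𝟙 _))

theorem RelKan.existsUnique {π : A ⟶ X} {n : ℕ} {i : Fin (n + 3)}
    (hK : RelKan (MorphismProperty.isomorphisms C) π (n + 2) i) {T : C}
    (y : ∀ j : Fin (n + 3), j ≠ i → (T ⟶ A _⦋n + 1⦌)) (σ : T ⟶ X _⦋n + 2⦌)
    (hy : ∀ (j k : Fin (n + 3)) (hj : j ≠ i) (hk : k ≠ i) (hjk : j < k),
      y j hj ≫ A.δ (k.pred (Fin.ne_zero_of_lt hjk))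
        = y k hk ≫ A.δ (j.castPred (Fin.ne_last_of_lt hjk)))
    (hσ : ∀ j hj, y j hj ≫ π.app (op ⦋n + 1⦌) = σ ≫ X.δ j) :
    ∃! x : T ⟶ A _⦋n + 2⦌, (∀ j hj, x ≫ A.δ j = y j hj) ∧ x ≫ π.app (op ⦋n + 2⦌) = σ := by
  obtain ⟨D, hD⟩ := hK
  have hD' : IsIso D.p := hD
  obtain ⟨h, hh⟩ := exists_horn (Y := pts A T) (i := i) y hy
  have key : ∀ x : T ⟶ A _⦋n + 2⦌, (∀ j hj, x ≫ A.δ j = y j hj) ↔ D.h ≫ ptsPre A (x ≫ D.p) = h := by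
    intro x
    have e : D.h ≫ ptsPre A (x ≫ D.p) = Λ[n + 2, i].ι ≫ simplexMap x := by
      refine SSet.horn.hom_ext _ _ fun j hj => ?_
      have h1 := congrArg (fun f => f.app _ (SSet.horn.face i j hj)) D.p_h
      dsimp only at h1
      rw [simplexMap_face, ptsPre_face] at h1
      rw [simplexMap_face, ptsPre_face]
      refine (Category.assoc _ _ _).trans ?_
      rw [h1, Category.id_comp]
    rw [e]
    constructor
    · intro hx
      refine SSet.horn.hom_ext _ _ fun j hj => ?_
      rw [simplexMap_face, hh]
      exact hx j hj
    · rintro rfl j hj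
      rw [← hh, simplexMap_face]
  obtain ⟨w, ⟨hw₁, hw₂⟩, hw'⟩ := D.univ h σ (by
    refine SSet.horn.hom_ext _ _ fun j hj => ?_
    rw [ptsMap_face, simplexMap_face, hh]
    exact hσ j hj)
  have hp : inv D.p ≫ π.app (op ⦋n + 2⦌) = D.σ := by rw [IsIso.inv_comp_eq, D.p_σ]
  refine ⟨w ≫ inv D.p, ⟨(key _).2 (by simpa using hw₁), by rw [Category.assoc, hp, hw₂]⟩,
    fun x hx => ?_⟩
  rw [← hw' (x ≫ D.p) ⟨(key x).1 hx.1, by rw [Category.assoc, D.p_σ, hx.2]⟩]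
  simp

theorem RelKan.of_existsUnique {π : A ⟶ X} {n : ℕ} {i : Fin (n + 3)}
    (hX : ∀ {T : C} (y : ∀ j : Fin (n + 3), j ≠ i → (T ⟶ A _⦋n + 1⦌)) (σ : T ⟶ X _⦋n + 2⦌),
      (∀ (j k : Fin (n + 3)) (hj : j ≠ i) (hk : k ≠ i) (hjk : j < k),
      y j hj ≫ A.δ (k.pred (Fin.ne_zero_of_lt hjk))
        = y k hk ≫ A.δ (j.castPred (Fin.ne_last_of_lt hjk))) →
      (∀ j hj, y j hj ≫ π.app (op ⦋n + 1⦌) = σ ≫ X.δ j) →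
      ∃! x : T ⟶ A _⦋n + 2⦌, (∀ j hj, x ≫ A.δ j = y j hj) ∧ x ≫ π.app (op ⦋n + 2⦌) = σ) :
    RelKan (MorphismProperty.isomorphisms C) π (n + 2) i := by
  refine ⟨⟨A _⦋n + 2⦌, Λ[n + 2, i].ι ≫ simplexMap (𝟙 _), π.app _, ?_, ?_, 𝟙 _, ?_, ?_⟩, ?_⟩
  · refine SSet.horn.hom_ext _ _ fun j hj => ?_
    rw [ptsMap_face, simplexMap_face, simplexMap_face, Category.id_comp]
    exact π.naturality _
  · intro T h' σ' hσ'
    obtain ⟨w, hw, hw'⟩ := hX (fun j hj => h'.app _ (SSet.horn.face i j hj)) σ'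
      (isHornFamily_of_hom h') (fun j hj => by
        have := congrArg (fun f => f.app _ (SSet.horn.face i j hj)) hσ'
        dsimp only at this
        rw [simplexMap_face, ptsMap_face] at this
        exact this)
    have e : ∀ w : T ⟶ A _⦋n + 2⦌, (∀ j hj, w ≫ A.δ j = h'.app _ (SSet.horn.face i j hj)) ↔
        (Λ[n + 2, i].ι ≫ simplexMap (𝟙 (A _⦋n + 2⦌))) ≫ ptsPre A w = h' := by
      intro w
      constructor
      · intro hw
        refine SSet.horn.hom_ext _ _ fun j hj => ?_
        rw [ptsPre_face, simplexMap_face, Category.id_comp]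
        exact hw j hj
      · rintro rfl j hj
        rw [ptsPre_face, simplexMap_face, Category.id_comp]
    exact ⟨w, ⟨(e w).1 hw.1, hw.2⟩, fun w' h => hw' w' ⟨(e w').2 h.1, h.2⟩⟩
  · refine SSet.horn.hom_ext _ _ fun j hj => ?_
    rw [ptsPre_face]
    exact Category.id_comp _
  · exact Category.id_comp _
  · exact inferInstanceAs (IsIso (𝟙 _))

variable {W : MorphismProperty C}

theorem eq_of_ne_fin_two {i j k : Fin 2} (hj : j ≠ i) (hk : k ≠ i) : k = j := by omega

theorem Kan.cover [NicePretopology W] {i : Fin 2} (hK : Kan W X 1 i) {j : Fin 2} (hj : j ≠ i) :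
    W (X.δ j) := by
  obtain ⟨D, hD⟩ := hK
  let y : D.H ⟶ X _⦋0⦌ := D.h.app _ (SSet.horn.face (n := 0) i j hj)
  have hy : IsIso y := by
    obtain ⟨h, hh⟩ := exists_horn_one (Y := pts X (X _⦋0⦌)) (i := i) (fun j hj => 𝟙 _)
    obtain ⟨w, hw, -⟩ := D.univ h
    have e : w ≫ y = 𝟙 _ := by
      rw [← hh j hj, ← hw]
      rfl
    refine ⟨w, ?_, e⟩
    refine (D.univ D.h).unique ?_ ?_
    · refine SSet.horn.hom_ext (n := 0) _ _ fun k hk => ?_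
      obtain rfl := eq_of_ne_fin_two hj hk
      rw [ptsPre_face (n := 0)]
      change (y ≫ w) ≫ y = y
      rw [Category.assoc, e, Category.comp_id]
    · refine SSet.horn.hom_ext (n := 0) _ _ fun k hk => ?_
      rw [ptsPre_face (n := 0)]
      exact Category.id_comp _
  have e : D.p ≫ y = X.δ j := by
    have := congrArg (fun f => f.app _ (SSet.horn.face (n := 0) i j hj)) D.p_h
    dsimp only at this
    rw [simplexMap_face (n := 0), ptsPre_face (n := 0), Category.id_comp] at this
    exact this
  rw [← e]
  exact SingletonPretopology.comp _ _ hD (SingletonPretopology.of_isIso _ hy)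

theorem Kan.of_cover {i : Fin 2} {j : Fin 2} (hj : j ≠ i) (h : W (X.δ j)) : Kan W X 1 i := by
  obtain ⟨u, hu⟩ := exists_horn_one (Y := pts X (X _⦋0⦌)) (i := i) (fun j hj => 𝟙 _)
  refine ⟨⟨X _⦋0⦌, u, ?_, X.δ j, ?_⟩, h⟩
  · intro T h'
    refine ⟨h'.app _ (SSet.horn.face (n := 0) i j hj), ?_, ?_⟩
    · refine SSet.horn.hom_ext (n := 0) _ _ fun k hk => ?_
      obtain rfl := eq_of_ne_fin_two hj hk
      refine (ptsPre_face (n := 0) _ _ _ _).trans ?_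
      rw [hu]
      exact Category.comp_id _
    · rintro w rfl
      rw [ptsPre_face (n := 0), hu]
      exact (Category.comp_id _).symm
  · refine SSet.horn.hom_ext (n := 0) _ _ fun k hk => ?_
    obtain rfl := eq_of_ne_fin_two hj hk
    rw [ptsPre_face (n := 0), hu, simplexMap_face (n := 0)]
    refine (Category.comp_id _).trans (Category.id_comp _).symm

theorem RelKan.coverSq {π : A ⟶ X} {i : Fin 2} (hK : RelKan W π 1 i) {j : Fin 2} (hj : j ≠ i) :
    CoverSq W (A.δ j) (π.app (op ⦋1⦌)) (π.app (op ⦋0⦌)) (X.δ j) := by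
  obtain ⟨D, hD⟩ := hK
  let y : D.H ⟶ A _⦋0⦌ := D.h.app _ (SSet.horn.face (n := 0) i j hj)
  have e : D.p ≫ y = A.δ j := by
    have := congrArg (fun f => f.app _ (SSet.horn.face (n := 0) i j hj)) D.p_h
    dsimp only at this
    rw [simplexMap_face (n := 0), ptsPre_face (n := 0), Category.id_comp] at this
    exact this
  have hc : y ≫ π.app (op ⦋0⦌) = D.σ ≫ X.δ j := by
    have := congrArg (fun f => f.app _ (SSet.horn.face (n := 0) i j hj)) D.comm
    dsimp only at this
    rw [simplexMap_face (n := 0), ptsMap_face (n := 0)] at this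
    exact this
  have hu : ∀ {T : C} (w : T ⟶ D.H) (h : (Λ[1, i] : SSet.{v}) ⟶ pts A T),
      D.h ≫ ptsPre A w = h ↔ w ≫ y = h.app _ (SSet.horn.face (n := 0) i j hj) := by
    intro T w h
    constructor
    · rintro rfl
      rfl
    · intro hh
      refine SSet.horn.hom_ext (n := 0) _ _ fun k hk => ?_
      obtain rfl := eq_of_ne_fin_two hj hk
      rw [ptsPre_face (n := 0), ← hh]
  refine ⟨D.H, y, D.σ, D.p, ⟨⟨hc⟩, ⟨PullbackCone.IsLimit.mk hc ?_ ?_ ?_ ?_⟩⟩, e, D.p_σ, hD⟩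
  all_goals
    have hex : ∀ s : PullbackCone (π.app (op ⦋0⦌)) (X.δ j), ∃! w : s.pt ⟶ D.H,
        w ≫ y = s.fst ∧ w ≫ D.σ = s.snd := by
      intro s
      obtain ⟨h, hh⟩ := exists_horn_one (Y := pts A s.pt) (i := i) (fun j hj => s.fst)
      have := D.univ h s.snd (by
        refine SSet.horn.hom_ext (n := 0) _ _ fun k hk => ?_
        obtain rfl := eq_of_ne_fin_two hj hk
        rw [ptsMap_face (n := 0), simplexMap_face (n := 0), hh]
        exact s.condition)
      simpa only [hu, hh] using this
  · exact fun s => (hex s).choose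
  · exact fun s => (hex s).choose_spec.1.1
  · exact fun s => (hex s).choose_spec.1.2
  · exact fun s m h₁ h₂ => (hex s).choose_spec.2 m ⟨h₁, h₂⟩

theorem RelKan.of_coverSq {π : A ⟶ X} {i j : Fin 2} (hj : j ≠ i)
    (h : CoverSq W (A.δ j) (π.app (op ⦋1⦌)) (π.app (op ⦋0⦌)) (X.δ j)) : RelKan W π 1 i := by
  obtain ⟨P, p, q, l, hP, hp, hq, hl⟩ := h
  obtain ⟨u, hu⟩ := exists_horn_one (Y := pts A P) (i := i) (fun j hj => p)
  refine ⟨⟨P, u, q, ?_, ?_, l, ?_, hq⟩, hl⟩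
  · refine SSet.horn.hom_ext (n := 0) _ _ fun k hk => ?_
    obtain rfl := eq_of_ne_fin_two hj hk
    rw [ptsMap_face (n := 0), simplexMap_face (n := 0), hu]
    exact hP.w
  · intro T h' σ' hσ'
    have e := congrArg (fun f => f.app _ (SSet.horn.face (n := 0) i j hj)) hσ'
    dsimp only at e
    rw [simplexMap_face (n := 0), ptsMap_face (n := 0)] at e
    refine ⟨hP.lift _ _ e, ⟨?_, hP.lift_snd _ _ _⟩, ?_⟩
    · refine SSet.horn.hom_ext (n := 0) _ _ fun k hk => ?_
      obtain rfl := eq_of_ne_fin_two hj hk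
      rw [ptsPre_face (n := 0), hu]
      exact hP.lift_fst _ _ _
    · rintro w ⟨rfl, rfl⟩
      refine hP.hom_ext ((?_ : w ≫ p = _).trans (hP.lift_fst _ _ _).symm)
        (hP.lift_snd _ _ _).symm
      rw [ptsPre_face (n := 0), hu]
  · refine SSet.horn.hom_ext (n := 0) _ _ fun k hk => ?_
    obtain rfl := eq_of_ne_fin_two hj hk
    rw [ptsPre_face (n := 0), hu, simplexMap_face (n := 0)]
    exact hp.trans (Category.id_comp _).symm

theorem exists_horn_two {T : C} {i j k : Fin 3} (hj : j ≠ i) (hk : k ≠ i) (hjk : j < k)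
    (a b : T ⟶ X _⦋1⦌) (e : a ≫ X.δ (k.pred (Fin.ne_zero_of_lt hjk))
      = b ≫ X.δ (j.castPred (Fin.ne_last_of_lt hjk))) :
    ∃ h : (Λ[2, i] : SSet.{v}) ⟶ pts X T, h.app _ (SSet.horn.face (n := 1) i j hj) = a ∧
      h.app _ (SSet.horn.face (n := 1) i k hk) = b := by
  obtain ⟨h, hh⟩ := exists_horn (n := 0) (Y := pts X T) (i := i)
    (fun l hl => (show T ⟶ X _⦋1⦌ from if l = j then a else b)) (by
      intro l l' hl hl' hll'
      have h1 : l = j := by omega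
      have h2 : l' = k := by omega
      subst h1 h2
      change (if l = l then a else b) ≫ _ = (if l' = l then a else b) ≫ _
      rw [if_pos rfl, if_neg hjk.ne']
      exact e)
  exact ⟨h, (hh j hj).trans (if_pos rfl), (hh k hk).trans (if_neg hjk.ne')⟩

theorem Kan.coverSq {i j k : Fin 3} (hK : Kan W X 2 i) (hj : j ≠ i) (hk : k ≠ i) (hjk : j < k) :
    CoverSq W (X.δ j) (X.δ k) (X.δ (k.pred (Fin.ne_zero_of_lt hjk)))
      (X.δ (j.castPred (Fin.ne_last_of_lt hjk))) := by
  obtain ⟨D, hD⟩ := hK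
  have hcase : ∀ l : Fin 3, l ≠ i → l = j ∨ l = k := by omega
  let y : ∀ l, l ≠ i → (D.H ⟶ X _⦋1⦌) := fun l hl => D.h.app _ (SSet.horn.face (n := 1) i l hl)
  have e : ∀ l hl, D.p ≫ y l hl = X.δ l := by
    intro l hl
    have := congrArg (fun f => f.app _ (SSet.horn.face (n := 1) i l hl)) D.p_h
    dsimp only at this
    rw [simplexMap_face (n := 1), ptsPre_face (n := 1), Category.id_comp] at this
    exact this
  have hc := isHornFamily_of_hom (n := 0) D.h j k hj hk hjk
  have hu : ∀ {T : C} (w : T ⟶ D.H) (h : (Λ[2, i] : SSet.{v}) ⟶ pts X T),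
      D.h ≫ ptsPre X w = h ↔ w ≫ y j hj = h.app _ (SSet.horn.face (n := 1) i j hj) ∧
        w ≫ y k hk = h.app _ (SSet.horn.face (n := 1) i k hk) := by
    intro T w h
    constructor
    · rintro rfl
      exact ⟨rfl, rfl⟩
    · rintro ⟨h₁, h₂⟩
      refine SSet.horn.hom_ext (n := 1) _ _ fun l hl => ?_
      rcases hcase l hl with rfl | rfl
      · exact h₁
      · exact h₂
  refine ⟨D.H, y j hj, y k hk, D.p, ⟨⟨hc⟩, ⟨PullbackCone.IsLimit.mk hc ?_ ?_ ?_ ?_⟩⟩,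
    e j hj, e k hk, hD⟩
  all_goals
    have hex : ∀ s : PullbackCone (X.δ (k.pred (Fin.ne_zero_of_lt hjk)))
        (X.δ (j.castPred (Fin.ne_last_of_lt hjk))), ∃! w : s.pt ⟶ D.H,
        w ≫ y j hj = s.fst ∧ w ≫ y k hk = s.snd := by
      intro s
      obtain ⟨h, h₁, h₂⟩ := exists_horn_two hj hk hjk s.fst s.snd s.condition
      have := D.univ h
      simpa only [hu, h₁, h₂] using this
  · exact fun s => (hex s).choose
  · exact fun s => (hex s).choose_spec.1.1
  · exact fun s => (hex s).choose_spec.1.2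
  · exact fun s m h₁ h₂ => (hex s).choose_spec.2 m ⟨h₁, h₂⟩

theorem Kan.of_coverSq {i j k : Fin 3} (hj : j ≠ i) (hk : k ≠ i) (hjk : j < k)
    (h : CoverSq W (X.δ j) (X.δ k) (X.δ (k.pred (Fin.ne_zero_of_lt hjk)))
      (X.δ (j.castPred (Fin.ne_last_of_lt hjk)))) : Kan W X 2 i := by
  obtain ⟨P, p, q, l, hP, hp, hq, hl⟩ := h
  have hcase : ∀ l : Fin 3, l ≠ i → l = j ∨ l = k := by omega
  obtain ⟨u, huj, huk⟩ := exists_horn_two hj hk hjk p q hP.w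
  refine ⟨⟨P, u, ?_, l, ?_⟩, hl⟩
  · intro T h'
    refine ⟨hP.lift _ _ (isHornFamily_of_hom (n := 0) h' j k hj hk hjk), ?_, ?_⟩
    · refine SSet.horn.hom_ext (n := 1) _ _ fun l hl => ?_
      rcases hcase l hl with rfl | rfl
      · rw [ptsPre_face (n := 1), huj]
        exact hP.lift_fst _ _ _
      · rw [ptsPre_face (n := 1), huk]
        exact hP.lift_snd _ _ _
    · rintro w rfl
      refine hP.hom_ext ((?_ : w ≫ p = _).trans (hP.lift_fst _ _ _).symm)
        ((?_ : w ≫ q = _).trans (hP.lift_snd _ _ _).symm)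
      · exact congrArg (w ≫ ·) huj.symm
      · exact congrArg (w ≫ ·) huk.symm
  · refine SSet.horn.hom_ext (n := 1) _ _ fun l hl => ?_
    rcases hcase l hl with rfl | rfl
    · rw [ptsPre_face (n := 1), huj, simplexMap_face (n := 1)]
      exact hp.trans (Category.id_comp _).symm
    · rw [ptsPre_face (n := 1), huk, simplexMap_face (n := 1)]
      exact hq.trans (Category.id_comp _).symm

theorem Kan.of_iso [NicePretopology W] {n : ℕ} {i : Fin (n + 1)}
    (h : Kan (MorphismProperty.isomorphisms C) X n i) : Kan W X n i := by
  obtain ⟨D, hD⟩ := h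
  exact ⟨D, SingletonPretopology.of_isIso _ hD⟩

theorem RelKan.of_iso [NicePretopology W] {π : A ⟶ X} {n : ℕ} {i : Fin (n + 1)}
    (h : RelKan (MorphismProperty.isomorphisms C) π n i) : RelKan W π n i := by
  obtain ⟨D, hD⟩ := h
  exact ⟨D, SingletonPretopology.of_isIso _ hD⟩

end Points

end HigherGpd

namespace HigherGpd

section SimplicialIdentities

variable {C : Type u} [Category.{v} C] (X : SimplicialObject C)

namespace SimplicialIdentities

@[simp] theorem σ0_δ0_0 :
    X.σ (0 : Fin 1) ≫ X.δ (0 : Fin 2) = 𝟙 _ :=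
  X.δ_comp_σ_self (i := 0)

@[simp] theorem σ0_δ0_0_assoc {Z : C} (h : X _⦋0⦌ ⟶ Z) :
    X.σ (0 : Fin 1) ≫ X.δ (0 : Fin 2) ≫ h = h := by
  rw [← Category.assoc, σ0_δ0_0]; simp

@[simp] theorem σ0_δ1_0 :
    X.σ (0 : Fin 1) ≫ X.δ (1 : Fin 2) = 𝟙 _ :=
  X.δ_comp_σ_succ (i := 0)

@[simp] theorem σ0_δ1_0_assoc {Z : C} (h : X _⦋0⦌ ⟶ Z) :
    X.σ (0 : Fin 1) ≫ X.δ (1 : Fin 2) ≫ h = h := by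
  rw [← Category.assoc, σ0_δ1_0]; simp

@[simp] theorem σ0_δ0_1 :
    X.σ (0 : Fin 2) ≫ X.δ (0 : Fin 3) = 𝟙 _ :=
  X.δ_comp_σ_self (i := 0)

@[simp] theorem σ0_δ0_1_assoc {Z : C} (h : X _⦋1⦌ ⟶ Z) :
    X.σ (0 : Fin 2) ≫ X.δ (0 : Fin 3) ≫ h = h := by
  rw [← Category.assoc, σ0_δ0_1]; simp

@[simp] theorem σ0_δ1_1 :
    X.σ (0 : Fin 2) ≫ X.δ (1 : Fin 3) = 𝟙 _ :=
  X.δ_comp_σ_succ (i := 0)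

@[simp] theorem σ0_δ1_1_assoc {Z : C} (h : X _⦋1⦌ ⟶ Z) :
    X.σ (0 : Fin 2) ≫ X.δ (1 : Fin 3) ≫ h = h := by
  rw [← Category.assoc, σ0_δ1_1]; simp

@[simp] theorem σ0_δ2_1 :
    X.σ (0 : Fin 2) ≫ X.δ (2 : Fin 3) = X.δ (1 : Fin 2) ≫ X.σ (0 : Fin 1) :=
  X.δ_comp_σ_of_gt (i := 1) (j := 0) (by decide)

@[simp] theorem σ0_δ2_1_assoc {Z : C} (h : X _⦋1⦌ ⟶ Z) :
    X.σ (0 : Fin 2) ≫ X.δ (2 : Fin 3) ≫ h = X.δ (1 : Fin 2) ≫ X.σ (0 : Fin 1) ≫ h := by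
  rw [← Category.assoc, σ0_δ2_1]; simp

@[simp] theorem σ1_δ0_1 :
    X.σ (1 : Fin 2) ≫ X.δ (0 : Fin 3) = X.δ (0 : Fin 2) ≫ X.σ (0 : Fin 1) :=
  X.δ_comp_σ_of_le (i := 0) (j := 0) (by decide)

@[simp] theorem σ1_δ0_1_assoc {Z : C} (h : X _⦋1⦌ ⟶ Z) :
    X.σ (1 : Fin 2) ≫ X.δ (0 : Fin 3) ≫ h = X.δ (0 : Fin 2) ≫ X.σ (0 : Fin 1) ≫ h := by
  rw [← Category.assoc, σ1_δ0_1]; simp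

@[simp] theorem σ1_δ1_1 :
    X.σ (1 : Fin 2) ≫ X.δ (1 : Fin 3) = 𝟙 _ :=
  X.δ_comp_σ_self (i := 1)

@[simp] theorem σ1_δ1_1_assoc {Z : C} (h : X _⦋1⦌ ⟶ Z) :
    X.σ (1 : Fin 2) ≫ X.δ (1 : Fin 3) ≫ h = h := by
  rw [← Category.assoc, σ1_δ1_1]; simp

@[simp] theorem σ1_δ2_1 :
    X.σ (1 : Fin 2) ≫ X.δ (2 : Fin 3) = 𝟙 _ :=
  X.δ_comp_σ_succ (i := 1)

@[simp] theorem σ0_δ0_2 :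
    X.σ (0 : Fin 3) ≫ X.δ (0 : Fin 4) = 𝟙 _ :=
  X.δ_comp_σ_self (i := 0)

@[simp] theorem σ0_δ1_2 :
    X.σ (0 : Fin 3) ≫ X.δ (1 : Fin 4) = 𝟙 _ :=
  X.δ_comp_σ_succ (i := 0)

@[simp] theorem σ0_δ2_2 :
    X.σ (0 : Fin 3) ≫ X.δ (2 : Fin 4) = X.δ (1 : Fin 3) ≫ X.σ (0 : Fin 2) :=
  X.δ_comp_σ_of_gt (i := 1) (j := 0) (by decide)

@[simp] theorem σ0_δ3_2 :
    X.σ (0 : Fin 3) ≫ X.δ (3 : Fin 4) = X.δ (2 : Fin 3) ≫ X.σ (0 : Fin 2) :=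
  X.δ_comp_σ_of_gt (i := 2) (j := 0) (by decide)

@[simp] theorem σ1_δ0_2 :
    X.σ (1 : Fin 3) ≫ X.δ (0 : Fin 4) = X.δ (0 : Fin 3) ≫ X.σ (0 : Fin 2) :=
  X.δ_comp_σ_of_le (i := 0) (j := 0) (by decide)

@[simp] theorem σ1_δ1_2 :
    X.σ (1 : Fin 3) ≫ X.δ (1 : Fin 4) = 𝟙 _ :=
  X.δ_comp_σ_self (i := 1)

@[simp] theorem σ1_δ2_2 :
    X.σ (1 : Fin 3) ≫ X.δ (2 : Fin 4) = 𝟙 _ :=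
  X.δ_comp_σ_succ (i := 1)

@[simp] theorem σ1_δ3_2 :
    X.σ (1 : Fin 3) ≫ X.δ (3 : Fin 4) = X.δ (2 : Fin 3) ≫ X.σ (1 : Fin 2) :=
  X.δ_comp_σ_of_gt (i := 2) (j := 1) (by decide)

@[simp] theorem σ2_δ0_2 :
    X.σ (2 : Fin 3) ≫ X.δ (0 : Fin 4) = X.δ (0 : Fin 3) ≫ X.σ (1 : Fin 2) :=
  X.δ_comp_σ_of_le (i := 0) (j := 1) (by decide)

@[simp] theorem σ2_δ1_2 :
    X.σ (2 : Fin 3) ≫ X.δ (1 : Fin 4) = X.δ (1 : Fin 3) ≫ X.σ (1 : Fin 2) :=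
  X.δ_comp_σ_of_le (i := 1) (j := 1) (by decide)

@[simp] theorem σ2_δ2_2 :
    X.σ (2 : Fin 3) ≫ X.δ (2 : Fin 4) = 𝟙 _ :=
  X.δ_comp_σ_self (i := 2)

@[simp] theorem σ2_δ3_2 :
    X.σ (2 : Fin 3) ≫ X.δ (3 : Fin 4) = 𝟙 _ :=
  X.δ_comp_σ_succ (i := 2)

@[simp] theorem σ0_σ1 : X.σ (0 : Fin 1) ≫ X.σ (1 : Fin 2) = X.σ (0 : Fin 1) ≫ X.σ (0 : Fin 2) :=
  (X.σ_comp_σ (i := 0) (j := 0) (by decide)).symm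

@[simp] theorem δ1_δ0_2 :
    X.δ (1 : Fin 3) ≫ X.δ (0 : Fin 2) = X.δ (0 : Fin 3) ≫ X.δ (0 : Fin 2) :=
  X.δ_comp_δ (i := 0) (j := 0) (by decide)

@[simp] theorem δ1_δ0_2_assoc {Z : C} (h : X _⦋0⦌ ⟶ Z) :
    X.δ (1 : Fin 3) ≫ X.δ (0 : Fin 2) ≫ h = X.δ (0 : Fin 3) ≫ X.δ (0 : Fin 2) ≫ h := by
  rw [← Category.assoc, δ1_δ0_2, Category.assoc]

@[simp] theorem δ2_δ0_2 :
    X.δ (2 : Fin 3) ≫ X.δ (0 : Fin 2) = X.δ (0 : Fin 3) ≫ X.δ (1 : Fin 2) :=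
  X.δ_comp_δ (i := 0) (j := 1) (by decide)

@[simp] theorem δ2_δ0_2_assoc {Z : C} (h : X _⦋0⦌ ⟶ Z) :
    X.δ (2 : Fin 3) ≫ X.δ (0 : Fin 2) ≫ h = X.δ (0 : Fin 3) ≫ X.δ (1 : Fin 2) ≫ h := by
  rw [← Category.assoc, δ2_δ0_2, Category.assoc]

@[simp] theorem δ2_δ1_2 :
    X.δ (2 : Fin 3) ≫ X.δ (1 : Fin 2) = X.δ (1 : Fin 3) ≫ X.δ (1 : Fin 2) :=
  X.δ_comp_δ (i := 1) (j := 1) (by decide)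

@[simp] theorem δ2_δ1_2_assoc {Z : C} (h : X _⦋0⦌ ⟶ Z) :
    X.δ (2 : Fin 3) ≫ X.δ (1 : Fin 2) ≫ h = X.δ (1 : Fin 3) ≫ X.δ (1 : Fin 2) ≫ h := by
  rw [← Category.assoc, δ2_δ1_2, Category.assoc]

@[simp] theorem δ1_δ0_3 :
    X.δ (1 : Fin 4) ≫ X.δ (0 : Fin 3) = X.δ (0 : Fin 4) ≫ X.δ (0 : Fin 3) :=
  X.δ_comp_δ (i := 0) (j := 0) (by decide)

@[simp] theorem δ2_δ0_3 :
    X.δ (2 : Fin 4) ≫ X.δ (0 : Fin 3) = X.δ (0 : Fin 4) ≫ X.δ (1 : Fin 3) :=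
  X.δ_comp_δ (i := 0) (j := 1) (by decide)

@[simp] theorem δ2_δ1_3 :
    X.δ (2 : Fin 4) ≫ X.δ (1 : Fin 3) = X.δ (1 : Fin 4) ≫ X.δ (1 : Fin 3) :=
  X.δ_comp_δ (i := 1) (j := 1) (by decide)

@[simp] theorem δ3_δ0_3 :
    X.δ (3 : Fin 4) ≫ X.δ (0 : Fin 3) = X.δ (0 : Fin 4) ≫ X.δ (2 : Fin 3) :=
  X.δ_comp_δ (i := 0) (j := 2) (by decide)

@[simp] theorem δ3_δ1_3 :
    X.δ (3 : Fin 4) ≫ X.δ (1 : Fin 3) = X.δ (1 : Fin 4) ≫ X.δ (2 : Fin 3) :=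
  X.δ_comp_δ (i := 1) (j := 2) (by decide)

@[simp] theorem δ3_δ2_3 :
    X.δ (3 : Fin 4) ≫ X.δ (2 : Fin 3) = X.δ (2 : Fin 4) ≫ X.δ (2 : Fin 3) :=
  X.δ_comp_δ (i := 2) (j := 2) (by decide)

end SimplicialIdentities

end SimplicialIdentities

end HigherGpd

namespace HigherGpd

section CoverSquares

variable {C : Type u} [Category.{v} C] {W : MorphismProperty C} [NicePretopology W]
variable {Z A B S : C} {f : Z ⟶ A} {g : Z ⟶ B} {a : A ⟶ S} {b : B ⟶ S}

theorem CoverSq.exists_univ (h : CoverSq W f g a b) {T : C} (α : T ⟶ A) (β : T ⟶ B)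
    (e : α ≫ a = β ≫ b) :
    ∃ (T' : C) (w : T' ⟶ T) (z : T' ⟶ Z), W w ∧ z ≫ f = w ≫ α ∧ z ≫ g = w ≫ β ∧
      ∀ {Q : C} (x : Q ⟶ T) (ζ : Q ⟶ Z), ζ ≫ f = x ≫ α → ζ ≫ g = x ≫ β →
        ∃! k : Q ⟶ T', k ≫ w = x ∧ k ≫ z = ζ := by
  obtain ⟨P, p, q, l, hP, rfl, rfl, hl⟩ := h
  let c := hP.lift α β e
  have hc₁ : c ≫ p = α := hP.lift_fst _ _ _
  have hc₂ : c ≫ q = β := hP.lift_snd _ _ _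
  refine ⟨Fp c l hl, Fp.fst hl, Fp.snd hl, Fp.fst_cover hl, ?_, ?_, ?_⟩
  · rw [← Category.assoc, ← Fp.cond, Category.assoc, hc₁]
  · rw [← Category.assoc, ← Fp.cond, Category.assoc, hc₂]
  · intro Q x ζ h₁ h₂
    have e : x ≫ c = ζ ≫ l := hP.hom_ext (by simp [hc₁, h₁]) (by simp [hc₂, h₂])
    refine ⟨Fp.lift hl x ζ e, ⟨by simp, by simp⟩, ?_⟩
    rintro k ⟨rfl, rfl⟩
    exact Fp.ext hl (by simp) (by simp)

theorem CoverSq.exists_local (h : CoverSq W f g a b) {T : C} (α : T ⟶ A) (β : T ⟶ B)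
    (e : α ≫ a = β ≫ b) :
    ∃ (T' : C) (w : T' ⟶ T) (z : T' ⟶ Z), W w ∧ z ≫ f = w ≫ α ∧ z ≫ g = w ≫ β := by
  obtain ⟨T', w, z, hw, h₁, h₂, -⟩ := h.exists_univ α β e
  exact ⟨T', w, z, hw, h₁, h₂⟩

/-- A natural relation which is functional and locally total defines a morphism. -/
theorem exists_hom_of_local {Y V : C} (Q : ∀ {T : C}, (T ⟶ Y) → (T ⟶ V) → Prop)
    (nat : ∀ {T T' : C} (w : T' ⟶ T) {y : T ⟶ Y} {v : T ⟶ V}, Q y v → Q (w ≫ y) (w ≫ v))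
    (tot : ∃ (T' : C) (w : T' ⟶ Y) (v : T' ⟶ V), W w ∧ Q w v)
    (func : ∀ {T : C} {y : T ⟶ Y} {v v' : T ⟶ V}, Q y v → Q y v' → v = v') :
    ∃ F : Y ⟶ V, ∀ {T : C} {y : T ⟶ Y} {v : T ⟶ V}, Q y v → y ≫ F = v := by
  obtain ⟨T', w, v, hw, hv⟩ := tot
  obtain ⟨F, hF⟩ := cover_desc hw v (fun {R} x y e => by
    have h₁ := nat x hv
    rw [e] at h₁
    exact func h₁ (nat y hv))
  refine ⟨F, fun {T} y v' h => ?_⟩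
  refine cover_cancel (Fp.fst_cover (f := y) hw) ?_
  have h₁ := nat (Fp.fst (f := y) hw) h
  have h₂ := nat (Fp.snd (f := y) hw) hv
  rw [← Fp.cond] at h₂
  rw [← func h₂ h₁, ← Category.assoc, Fp.cond, Category.assoc, hF]

/-- A morphism is determined by a natural condition having locally a solution, solutions being
unique. -/
theorem exists_point_of_local {T V : C} (Q : ∀ {T' : C}, (T' ⟶ T) → (T' ⟶ V) → Prop)
    (nat : ∀ {T₁ T₂ : C} (w : T₂ ⟶ T₁) {y : T₁ ⟶ T} {v : T₁ ⟶ V}, Q y v → Q (w ≫ y) (w ≫ v))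
    (func : ∀ {T₁ : C} {y : T₁ ⟶ T} {v v' : T₁ ⟶ V}, Q y v → Q y v' → v = v')
    {T' : C} {w : T' ⟶ T} {v : T' ⟶ V} (hw : W w) (hv : Q w v) : ∃ F : T ⟶ V, w ≫ F = v := by
  obtain ⟨F, hF⟩ := exists_hom_of_local (W := W) Q nat ⟨T', w, v, hw, hv⟩ func
  exact ⟨F, hF hv⟩

end CoverSquares

section TwoGroupoid

variable {C : Type u} [Category.{v} C] {W : MorphismProperty C} [NicePretopology W]
  {X : SimplicialObject C}

namespace IsNGroupoid

theorem δ0_cover (hX : IsNGroupoid W 2 X) : W (X.δ (0 : Fin 2)) :=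
  (hX.kan 1 1 le_rfl).cover (j := 0) (by decide)

theorem δ1_cover (hX : IsNGroupoid W 2 X) : W (X.δ (1 : Fin 2)) :=
  (hX.kan 1 0 le_rfl).cover (j := 1) (by decide)

theorem sq0 (hX : IsNGroupoid W 2 X) :
    CoverSq W (X.δ (1 : Fin 3)) (X.δ (2 : Fin 3)) (X.δ (1 : Fin 2)) (X.δ (1 : Fin 2)) :=
  (hX.kan 2 0 (by decide)).coverSq (j := 1) (k := 2) (by decide) (by decide) (by decide)

theorem sq1 (hX : IsNGroupoid W 2 X) :
    CoverSq W (X.δ (0 : Fin 3)) (X.δ (2 : Fin 3)) (X.δ (1 : Fin 2)) (X.δ (0 : Fin 2)) :=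
  (hX.kan 2 1 (by decide)).coverSq (j := 0) (k := 2) (by decide) (by decide) (by decide)

theorem sq2 (hX : IsNGroupoid W 2 X) :
    CoverSq W (X.δ (0 : Fin 3)) (X.δ (1 : Fin 3)) (X.δ (0 : Fin 2)) (X.δ (0 : Fin 2)) :=
  (hX.kan 2 2 (by decide)).coverSq (j := 0) (k := 1) (by decide) (by decide) (by decide)

theorem fill3 (hX : IsNGroupoid W 2 X) (i : Fin 4) {T : C} (x : Fin 4 → (T ⟶ X _⦋2⦌))
    (h01 : 0 ≠ i → 1 ≠ i → x 0 ≫ X.δ 0 = x 1 ≫ X.δ 0)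
    (h02 : 0 ≠ i → 2 ≠ i → x 0 ≫ X.δ 1 = x 2 ≫ X.δ 0)
    (h03 : 0 ≠ i → 3 ≠ i → x 0 ≫ X.δ 2 = x 3 ≫ X.δ 0)
    (h12 : 1 ≠ i → 2 ≠ i → x 1 ≫ X.δ 1 = x 2 ≫ X.δ 1)
    (h13 : 1 ≠ i → 3 ≠ i → x 1 ≫ X.δ 2 = x 3 ≫ X.δ 1)
    (h23 : 2 ≠ i → 3 ≠ i → x 2 ≫ X.δ 2 = x 3 ≫ X.δ 2) :
    ∃! y : T ⟶ X _⦋3⦌, ∀ j, j ≠ i → y ≫ X.δ j = x j := by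
  refine (hX.kan_unique 3 i (by decide)).existsUnique (n := 1) (fun j _ => x j) ?_
  intro j k hj hk hjk
  fin_cases j <;> fin_cases k <;> try (exact absurd hjk (by decide))
  · exact h01 hj hk
  · exact h02 hj hk
  · exact h03 hj hk
  · exact h12 hj hk
  · exact h13 hj hk
  · exact h23 hj hk

theorem exists_fill3_0 (hX : IsNGroupoid W 2 X) {T : C} (x1 x2 x3 : T ⟶ X _⦋2⦌)
    (h12 : x1 ≫ X.δ 1 = x2 ≫ X.δ 1) (h13 : x1 ≫ X.δ 2 = x3 ≫ X.δ 1)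
    (h23 : x2 ≫ X.δ 2 = x3 ≫ X.δ 2) :
    ∃ y : T ⟶ X _⦋3⦌, y ≫ X.δ 1 = x1 ∧ y ≫ X.δ 2 = x2 ∧ y ≫ X.δ 3 = x3 := by
  obtain ⟨y, hy, -⟩ := hX.fill3 0 ![x1, x1, x2, x3] (by simp) (by simp) (by simp)
    (fun _ _ => h12) (fun _ _ => h13) (fun _ _ => h23)
  exact ⟨y, hy 1 (by decide), hy 2 (by decide), hy 3 (by decide)⟩

theorem exists_fill3_1 (hX : IsNGroupoid W 2 X) {T : C} (x0 x2 x3 : T ⟶ X _⦋2⦌)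
    (h02 : x0 ≫ X.δ 1 = x2 ≫ X.δ 0) (h03 : x0 ≫ X.δ 2 = x3 ≫ X.δ 0)
    (h23 : x2 ≫ X.δ 2 = x3 ≫ X.δ 2) :
    ∃ y : T ⟶ X _⦋3⦌, y ≫ X.δ 0 = x0 ∧ y ≫ X.δ 2 = x2 ∧ y ≫ X.δ 3 = x3 := by
  obtain ⟨y, hy, -⟩ := hX.fill3 1 ![x0, x0, x2, x3] (by simp) (fun _ _ => h02) (fun _ _ => h03)
    (by simp) (by simp) (fun _ _ => h23)
  exact ⟨y, hy 0 (by decide), hy 2 (by decide), hy 3 (by decide)⟩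

theorem exists_fill3_2 (hX : IsNGroupoid W 2 X) {T : C} (x0 x1 x3 : T ⟶ X _⦋2⦌)
    (h01 : x0 ≫ X.δ 0 = x1 ≫ X.δ 0) (h03 : x0 ≫ X.δ 2 = x3 ≫ X.δ 0)
    (h13 : x1 ≫ X.δ 2 = x3 ≫ X.δ 1) :
    ∃ y : T ⟶ X _⦋3⦌, y ≫ X.δ 0 = x0 ∧ y ≫ X.δ 1 = x1 ∧ y ≫ X.δ 3 = x3 := by
  obtain ⟨y, hy, -⟩ := hX.fill3 2 ![x0, x1, x1, x3] (fun _ _ => h01) (by simp) (fun _ _ => h03)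
    (by simp) (fun _ _ => h13) (by simp)
  exact ⟨y, hy 0 (by decide), hy 1 (by decide), hy 3 (by decide)⟩

/-- Three-simplices are determined by the faces of any of their horns. -/
theorem ext3 (hX : IsNGroupoid W 2 X) (i : Fin 4) {T : C} {y y' : T ⟶ X _⦋3⦌}
    (h : ∀ j, j ≠ i → y ≫ X.δ j = y' ≫ X.δ j) : y = y' := by
  refine ((hX.kan_unique 3 i (by decide)).existsUnique (n := 1) (fun j _ => y' ≫ X.δ j) ?_).unique
    (fun j hj => h j hj) (fun j hj => rfl)
  exact isHornFamily_of_hom (n := 1) (i := i) (Λ[3, i].ι ≫ simplexMap y') |> fun H => by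
    intro j k hj hk hjk
    have := H j k hj hk hjk
    dsimp only at this
    rw [simplexMap_face (n := 2), simplexMap_face (n := 2)] at this
    exact this

theorem exists_fill4 (hX : IsNGroupoid W 2 X) {T : C} (x0 x1 x2 x4 : T ⟶ X _⦋3⦌)
    (h01 : x0 ≫ X.δ 0 = x1 ≫ X.δ 0) (h02 : x0 ≫ X.δ 1 = x2 ≫ X.δ 0)
    (h04 : x0 ≫ X.δ 3 = x4 ≫ X.δ 0) (h12 : x1 ≫ X.δ 1 = x2 ≫ X.δ 1)
    (h14 : x1 ≫ X.δ 3 = x4 ≫ X.δ 1) (h24 : x2 ≫ X.δ 3 = x4 ≫ X.δ 2) :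
    ∃ y : T ⟶ X _⦋4⦌, y ≫ X.δ 0 = x0 ∧ y ≫ X.δ 1 = x1 ∧ y ≫ X.δ 2 = x2 ∧ y ≫ X.δ 4 = x4 := by
  obtain ⟨y, hy, -⟩ := (hX.kan_unique 4 3 (by decide)).existsUnique (n := 2)
    (fun j _ => ![x0, x1, x2, x4, x4] j) (by
      intro j k hj hk hjk
      fin_cases j <;> fin_cases k <;>
        try first
          | exact absurd hjk (by decide)
          | exact absurd rfl hj
          | exact absurd rfl hk
      · exact h01
      · exact h02
      · exact h04
      · exact h12
      · exact h14
      · exact h24)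
  exact ⟨y, hy 0 (by decide), hy 1 (by decide), hy 2 (by decide), hy 4 (by decide)⟩

end IsNGroupoid

end TwoGroupoid

end HigherGpd

namespace HigherGpd

open SimplicialIdentities

section ActData

variable {C : Type u} [Category.{v} C] {W : MorphismProperty C} [NicePretopology W]

/-- The truncation of a Kan fibration of two-groupoid objects `A ⟶ X` to simplices of dimension at
most two: the relation `R a₀₁ a₁₂ a₀₂ x` says that there is a two-simplex of `A` over the
two-simplex `x` of `X` with the given edges. -/
structure ActData (W : MorphismProperty C) (X : SimplicialObject C) where
  A0 : C
  A1 : C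
  d0 : A1 ⟶ A0
  d1 : A1 ⟶ A0
  s0 : A0 ⟶ A1
  p0 : A0 ⟶ X _⦋0⦌
  p1 : A1 ⟶ X _⦋1⦌
  s0_d0 : s0 ≫ d0 = 𝟙 A0
  s0_d1 : s0 ≫ d1 = 𝟙 A0
  s0_p1 : s0 ≫ p1 = p0 ≫ X.σ (0 : Fin 1)
  d0_p0 : d0 ≫ p0 = p1 ≫ X.δ (0 : Fin 2)
  d1_p0 : d1 ≫ p0 = p1 ≫ X.δ (1 : Fin 2)
  R : ∀ {T : C}, (T ⟶ A1) → (T ⟶ A1) → (T ⟶ A1) → (T ⟶ X _⦋2⦌) → Prop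
  R_nat : ∀ {T T' : C} (w : T' ⟶ T) {a b c : T ⟶ A1} {x : T ⟶ X _⦋2⦌}, R a b c x →
    R (w ≫ a) (w ≫ b) (w ≫ c) (w ≫ x)
  R_v1 : ∀ {T : C} {a b c : T ⟶ A1} {x : T ⟶ X _⦋2⦌}, R a b c x → a ≫ d0 = b ≫ d1
  R_v0 : ∀ {T : C} {a b c : T ⟶ A1} {x : T ⟶ X _⦋2⦌}, R a b c x → a ≫ d1 = c ≫ d1
  R_v2 : ∀ {T : C} {a b c : T ⟶ A1} {x : T ⟶ X _⦋2⦌}, R a b c x → b ≫ d0 = c ≫ d0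
  R_e01 : ∀ {T : C} {a b c : T ⟶ A1} {x : T ⟶ X _⦋2⦌}, R a b c x → a ≫ p1 = x ≫ X.δ (2 : Fin 3)
  R_e12 : ∀ {T : C} {a b c : T ⟶ A1} {x : T ⟶ X _⦋2⦌}, R a b c x → b ≫ p1 = x ≫ X.δ (0 : Fin 3)
  R_e02 : ∀ {T : C} {a b c : T ⟶ A1} {x : T ⟶ X _⦋2⦌}, R a b c x → c ≫ p1 = x ≫ X.δ (1 : Fin 3)
  fill_c : ∀ {T : C} {a b : T ⟶ A1} {x : T ⟶ X _⦋2⦌}, a ≫ d0 = b ≫ d1 →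
    a ≫ p1 = x ≫ X.δ (2 : Fin 3) → b ≫ p1 = x ≫ X.δ (0 : Fin 3) → ∃! c, R a b c x
  fill_b : ∀ {T : C} {a c : T ⟶ A1} {x : T ⟶ X _⦋2⦌}, a ≫ d1 = c ≫ d1 →
    a ≫ p1 = x ≫ X.δ (2 : Fin 3) → c ≫ p1 = x ≫ X.δ (1 : Fin 3) → ∃! b, R a b c x
  unit_r : ∀ {T : C} (a : T ⟶ A1), R a (a ≫ d0 ≫ s0) a (a ≫ p1 ≫ X.σ (1 : Fin 2))
  unit_l : ∀ {T : C} (a : T ⟶ A1), R (a ≫ d1 ≫ s0) a a (a ≫ p1 ≫ X.σ (0 : Fin 2))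
  pent : ∀ {T : C} (y : T ⟶ X _⦋3⦌) {a₀₁ a₁₂ a₀₂ a₂₃ a₀₃ a₁₃ : T ⟶ A1},
    R a₀₁ a₁₂ a₀₂ (y ≫ X.δ (3 : Fin 4)) → R a₀₂ a₂₃ a₀₃ (y ≫ X.δ (1 : Fin 4)) →
    R a₁₂ a₂₃ a₁₃ (y ≫ X.δ (0 : Fin 4)) → R a₀₁ a₁₃ a₀₃ (y ≫ X.δ (2 : Fin 4))
  l_cover : CoverSq W d1 p1 p0 (X.δ (1 : Fin 2))

namespace ActData

variable {X : SimplicialObject C} (D : ActData W X)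

attribute [simp] s0_d0 s0_d1 s0_p1 d0_p0 d1_p0

@[simp] theorem s0_d0_assoc {Z : C} (h : D.A0 ⟶ Z) : D.s0 ≫ D.d0 ≫ h = h := by
  rw [← Category.assoc, s0_d0, Category.id_comp]

@[simp] theorem s0_p1_assoc {Z : C} (h : X _⦋1⦌ ⟶ Z) :
    D.s0 ≫ D.p1 ≫ h = D.p0 ≫ X.σ (0 : Fin 1) ≫ h := by
  rw [← Category.assoc, s0_p1, Category.assoc]

@[simp] theorem d0_p0_assoc {Z : C} (h : X _⦋0⦌ ⟶ Z) :
    D.d0 ≫ D.p0 ≫ h = D.p1 ≫ X.δ (0 : Fin 2) ≫ h := by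
  rw [← Category.assoc, d0_p0, Category.assoc]

@[simp] theorem d1_p0_assoc {Z : C} (h : X _⦋0⦌ ⟶ Z) :
    D.d1 ≫ D.p0 ≫ h = D.p1 ≫ X.δ (1 : Fin 2) ≫ h := by
  rw [← Category.assoc, d1_p0, Category.assoc]

variable {D} {T : C}

theorem R_congr {a a' b b' c c' : T ⟶ D.A1} {x x' : T ⟶ X _⦋2⦌} (h : D.R a b c x)
    (ha : a = a') (hb : b = b') (hc : c = c') (hx : x = x') : D.R a' b' c' x' := by
  subst ha hb hc hx; exact h

theorem uniq_c {a b c c' : T ⟶ D.A1} {x : T ⟶ X _⦋2⦌} (h : D.R a b c x) (h' : D.R a b c' x) :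
    c = c' :=
  (D.fill_c (D.R_v1 h) (D.R_e01 h) (D.R_e12 h)).unique h h'

theorem uniq_b {a b b' c : T ⟶ D.A1} {x : T ⟶ X _⦋2⦌} (h : D.R a b c x) (h' : D.R a b' c x) :
    b = b' :=
  (D.fill_b (D.R_v0 h) (D.R_e01 h) (D.R_e02 h)).unique h h'

theorem unit_r' {a e : T ⟶ D.A1} {x : T ⟶ X _⦋2⦌} (he : e = a ≫ D.d0 ≫ D.s0)
    (hx : x = a ≫ D.p1 ≫ X.σ (1 : Fin 2)) : D.R a e a x := by
  subst he hx; exact D.unit_r a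

theorem unit_l' {a e : T ⟶ D.A1} {x : T ⟶ X _⦋2⦌} (he : e = a ≫ D.d1 ≫ D.s0)
    (hx : x = a ≫ D.p1 ≫ X.σ (0 : Fin 2)) : D.R e a a x := by
  subst he hx; exact D.unit_l a

theorem R_of_local {a b c : T ⟶ D.A1} {x : T ⟶ X _⦋2⦌} {T' : C} {w : T' ⟶ T} (hw : W w)
    (h : D.R (w ≫ a) (w ≫ b) (w ≫ c) (w ≫ x)) : D.R a b c x := by
  obtain ⟨c', hc', -⟩ := D.fill_c (a := a) (b := b) (x := x)
    (cover_cancel hw (by simpa using D.R_v1 h)) (cover_cancel hw (by simpa using D.R_e01 h))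
    (cover_cancel hw (by simpa using D.R_e12 h))
  obtain rfl : c' = c := cover_cancel hw (uniq_c (D.R_nat w hc') h)
  exact hc'

/-- The version of the pentagon with faces replaced by equal ones. -/
theorem pent' (y : T ⟶ X _⦋3⦌) {a₀₁ a₁₂ a₀₂ a₂₃ a₀₃ a₁₃ : T ⟶ D.A1} {x₀ x₁ x₂ x₃ : T ⟶ X _⦋2⦌}
    (h₃ : D.R a₀₁ a₁₂ a₀₂ x₃) (h₁ : D.R a₀₂ a₂₃ a₀₃ x₁) (h₀ : D.R a₁₂ a₂₃ a₁₃ x₀)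
    (e₃ : y ≫ X.δ (3 : Fin 4) = x₃) (e₁ : y ≫ X.δ (1 : Fin 4) = x₁)
    (e₀ : y ≫ X.δ (0 : Fin 4) = x₀) (e₂ : y ≫ X.δ (2 : Fin 4) = x₂) : D.R a₀₁ a₁₃ a₀₃ x₂ := by
  subst e₃ e₁ e₀ e₂
  exact D.pent y h₃ h₁ h₀

/-- The pentagon solved for the face opposite to the vertex `1`. -/
theorem pent₁ (y : T ⟶ X _⦋3⦌) {a₀₁ a₁₂ a₀₂ a₂₃ a₀₃ a₁₃ : T ⟶ D.A1} {x₀ x₁ x₂ x₃ : T ⟶ X _⦋2⦌}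
    (h₃ : D.R a₀₁ a₁₂ a₀₂ x₃) (h₂ : D.R a₀₁ a₁₃ a₀₃ x₂) (h₀ : D.R a₁₂ a₂₃ a₁₃ x₀)
    (e₃ : y ≫ X.δ (3 : Fin 4) = x₃) (e₁ : y ≫ X.δ (1 : Fin 4) = x₁)
    (e₀ : y ≫ X.δ (0 : Fin 4) = x₀) (e₂ : y ≫ X.δ (2 : Fin 4) = x₂) : D.R a₀₂ a₂₃ a₀₃ x₁ := by
  subst e₃ e₁ e₀ e₂
  obtain ⟨c, hc, -⟩ := D.fill_c (a := a₀₂) (b := a₂₃) (x := y ≫ X.δ (1 : Fin 4))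
    (by rw [← D.R_v2 h₃, D.R_v1 h₀]) (by rw [D.R_e02 h₃]; simp) (by rw [D.R_e12 h₀]; simp)
  obtain rfl := uniq_c (D.pent y h₃ hc h₀) h₂
  exact hc

/-- The pentagon solved for the face opposite to the vertex `0`. -/
theorem pent₀ (y : T ⟶ X _⦋3⦌) {a₀₁ a₁₂ a₀₂ a₂₃ a₀₃ a₁₃ : T ⟶ D.A1} {x₀ x₁ x₂ x₃ : T ⟶ X _⦋2⦌}
    (h₃ : D.R a₀₁ a₁₂ a₀₂ x₃) (h₂ : D.R a₀₁ a₁₃ a₀₃ x₂) (h₁ : D.R a₀₂ a₂₃ a₀₃ x₁)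
    (e₃ : y ≫ X.δ (3 : Fin 4) = x₃) (e₁ : y ≫ X.δ (1 : Fin 4) = x₁)
    (e₀ : y ≫ X.δ (0 : Fin 4) = x₀) (e₂ : y ≫ X.δ (2 : Fin 4) = x₂) : D.R a₁₂ a₂₃ a₁₃ x₀ := by
  subst e₃ e₁ e₀ e₂
  obtain ⟨c, hc, -⟩ := D.fill_c (a := a₁₂) (b := a₂₃) (x := y ≫ X.δ (0 : Fin 4))
    (by rw [D.R_v2 h₃, D.R_v1 h₁]) (by rw [D.R_e12 h₃]; simp) (by rw [D.R_e12 h₁]; simp)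
  obtain rfl := uniq_b (D.pent y h₃ h₁ hc) h₂
  exact hc

section Fillers

variable (hX : IsNGroupoid W 2 X)
include hX

/-- Locally, the data which reduces the fillers of the third kind to those of the second kind. -/
theorem exists_aux_fill {b c : T ⟶ D.A1} {x : T ⟶ X _⦋2⦌} (h₂ : b ≫ D.d0 = c ≫ D.d0)
    (hb : b ≫ D.p1 = x ≫ X.δ (0 : Fin 3)) (hc : c ≫ D.p1 = x ≫ X.δ (1 : Fin 3)) :
    ∃ (T' : C) (w : T' ⟶ T) (y : T' ⟶ X _⦋3⦌) (b' a₀ : T' ⟶ D.A1), W w ∧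
      y ≫ X.δ (3 : Fin 4) = w ≫ x ∧
      y ≫ X.δ (2 : Fin 4) = (w ≫ x ≫ X.δ (2 : Fin 3)) ≫ X.σ (1 : Fin 2) ∧
      D.R (w ≫ b) b' ((w ≫ b) ≫ D.d1 ≫ D.s0) (y ≫ X.δ (0 : Fin 4)) ∧
      D.R (w ≫ c) b' a₀ (y ≫ X.δ (1 : Fin 4)) := by
  obtain ⟨T', w, z, hw, hz₁, hz₂⟩ := hX.sq0.exists_local
    (b ≫ D.p1 ≫ X.δ (1 : Fin 2) ≫ X.σ (0 : Fin 1)) (b ≫ D.p1) (by simp)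
  obtain ⟨y, hy₀, hy₂, hy₃⟩ := hX.exists_fill3_1 z ((w ≫ x ≫ X.δ (2 : Fin 3)) ≫ X.σ (1 : Fin 2))
    (w ≫ x) (by rw [hz₁]; simp [reassoc_of% hb]) (by rw [hz₂, hb]; simp) (by simp)
  obtain ⟨b', hb', -⟩ := D.fill_b (a := w ≫ b) (c := (w ≫ b) ≫ D.d1 ≫ D.s0) (x := z) (by simp)
    (by rw [hz₂]; simp) (by rw [hz₁]; simp)
  obtain ⟨a₀, ha₀, -⟩ := D.fill_c (a := w ≫ c) (b := b') (x := y ≫ X.δ (1 : Fin 4))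
    (by rw [← D.R_v1 hb']; simp [h₂]) (by
      have := hy₃ =≫ X.δ (1 : Fin 3)
      simp only [Category.assoc, δ3_δ1_3] at this
      simp [hc, this])
    (by rw [D.R_e12 hb', ← hy₀]; simp)
  exact ⟨T', w, y, b', a₀, hw, hy₃, hy₂, hy₀ ▸ hb', ha₀⟩

theorem uniq_a_aux {a b c b' a₀ : T ⟶ D.A1} {x : T ⟶ X _⦋2⦌} (h : D.R a b c x) (y : T ⟶ X _⦋3⦌)
    (h₃ : y ≫ X.δ (3 : Fin 4) = x) (h₂ : y ≫ X.δ (2 : Fin 4) = (x ≫ X.δ (2 : Fin 3)) ≫ X.σ (1 : Fin 2))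
    (hb : D.R b b' (b ≫ D.d1 ≫ D.s0) (y ≫ X.δ (0 : Fin 4)))
    (hc : D.R c b' a₀ (y ≫ X.δ (1 : Fin 4))) : a₀ = a := by
  have := D.pent y (h₃.symm ▸ h) hc hb
  refine uniq_c this (unit_r' ?_ ?_)
  · rw [← Category.assoc, ← D.R_v1 h, Category.assoc]
  · rw [h₂, ← D.R_e01 h, Category.assoc]

theorem uniq_a {a a' b c : T ⟶ D.A1} {x : T ⟶ X _⦋2⦌} (h : D.R a b c x) (h' : D.R a' b c x) :
    a = a' := by
  obtain ⟨T', w, y, b', a₀, hw, h₃, h₂, hb, hc⟩ :=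
    exists_aux_fill hX (D.R_v2 h) (D.R_e12 h) (D.R_e02 h)
  refine cover_cancel hw ?_
  rw [← uniq_a_aux hX (D.R_nat w h) y h₃ (by simpa using h₂) hb hc,
    ← uniq_a_aux hX (D.R_nat w h') y h₃ (by simpa using h₂) hb hc]

theorem fill_a {b c : T ⟶ D.A1} {x : T ⟶ X _⦋2⦌} (h₂ : b ≫ D.d0 = c ≫ D.d0)
    (hb : b ≫ D.p1 = x ≫ X.δ (0 : Fin 3)) (hc : c ≫ D.p1 = x ≫ X.δ (1 : Fin 3)) :
    ∃! a, D.R a b c x := by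
  obtain ⟨T', w, y, b', a₀, hw, hy₃, hy₂, hb', hc'⟩ := exists_aux_fill hX h₂ hb hc
  have k₁ : a₀ ≫ D.d0 = (w ≫ b) ≫ D.d1 := by
    rw [← D.R_v2 hc', D.R_v2 hb']; simp
  have k₂ : a₀ ≫ D.p1 = (w ≫ x) ≫ X.δ (2 : Fin 3) := by
    rw [D.R_e02 hc']
    have := hy₂ =≫ X.δ (1 : Fin 3)
    simpa using this
  obtain ⟨c', h', -⟩ := D.fill_c (a := a₀) (b := w ≫ b) (x := w ≫ x) k₁ k₂ (by simp [hb])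
  obtain ⟨f, hf, -⟩ := D.fill_c (a := c') (b := b') (x := y ≫ X.δ (1 : Fin 4))
    (by rw [← D.R_v2 h', D.R_v1 hb']) (by rw [D.R_e02 h', ← hy₃]; simp)
    (by rw [D.R_e12 hb']; simp)
  obtain rfl := uniq_a_aux hX h' y hy₃ (by simpa using hy₂) hb' hf
  obtain rfl := uniq_a hX hc' hf
  obtain ⟨a, ha⟩ := exists_point_of_local (W := W) (T := T) (V := D.A1)
    (fun {T'} w a => D.R a (w ≫ b) (w ≫ c) (w ≫ x))
    (fun w y v h => by simpa using D.R_nat w h) (fun h h' => uniq_a hX h h') hw h'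
  refine ⟨a, R_of_local hw (ha.symm ▸ h'), fun a' h => ?_⟩
  refine cover_cancel hw ?_
  rw [ha]
  exact uniq_a hX (D.R_nat w h) h'

/-- The pentagon solved for the face opposite to the vertex `3`. -/
theorem pent₃ (y : T ⟶ X _⦋3⦌) {a₀₁ a₁₂ a₀₂ a₂₃ a₀₃ a₁₃ : T ⟶ D.A1} {x₀ x₁ x₂ x₃ : T ⟶ X _⦋2⦌}
    (h₂ : D.R a₀₁ a₁₃ a₀₃ x₂) (h₁ : D.R a₀₂ a₂₃ a₀₃ x₁) (h₀ : D.R a₁₂ a₂₃ a₁₃ x₀)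
    (e₃ : y ≫ X.δ (3 : Fin 4) = x₃) (e₁ : y ≫ X.δ (1 : Fin 4) = x₁)
    (e₀ : y ≫ X.δ (0 : Fin 4) = x₀) (e₂ : y ≫ X.δ (2 : Fin 4) = x₂) : D.R a₀₁ a₁₂ a₀₂ x₃ := by
  subst e₃ e₁ e₀ e₂
  obtain ⟨c, hc, -⟩ := D.fill_c (a := a₀₁) (b := a₁₂) (x := y ≫ X.δ (3 : Fin 4))
    (by rw [D.R_v1 h₂, D.R_v0 h₀]) (by rw [D.R_e01 h₂]; simp) (by rw [D.R_e01 h₀]; simp)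
  obtain ⟨f, hf, -⟩ := D.fill_c (a := c) (b := a₂₃) (x := y ≫ X.δ (1 : Fin 4))
    (by rw [← D.R_v2 hc, D.R_v1 h₀]) (by rw [D.R_e02 hc]; simp) (by rw [D.R_e12 h₁])
  obtain rfl := uniq_c (D.pent y hc hf h₀) h₂
  obtain rfl := uniq_a hX h₁ hf
  exact hc

/-- The comparison map of the source square is a cover. -/
theorem r_cover : CoverSq W D.d0 D.p1 D.p0 (X.δ (0 : Fin 2)) := by
  let Q := Fp D.p0 (X.δ (0 : Fin 2)) hX.δ0_cover
  let e : Q ⟶ D.A0 := Fp.fst _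
  let x : Q ⟶ X _⦋1⦌ := Fp.snd _
  have hex : e ≫ D.p0 = x ≫ X.δ (0 : Fin 2) := Fp.cond _
  let q : D.A1 ⟶ Q := Fp.lift _ D.d0 D.p1 D.d0_p0
  have qe : q ≫ e = D.d0 := Fp.lift_fst _ _ _ _
  have qx : q ≫ x = D.p1 := Fp.lift_snd _ _ _ _
  refine ⟨Q, e, x, q, Fp.isPullback _, qe, qx, ?_⟩
  obtain ⟨Q₁, w₁, z, hw₁, hz₀, hz₁, uz⟩ := hX.sq2.exists_univ x
    (x ≫ X.δ (0 : Fin 2) ≫ X.σ (0 : Fin 1)) (by simp)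
  have hk : (w₁ ≫ e) ≫ D.p0 = (z ≫ X.δ (2 : Fin 3)) ≫ X.δ (1 : Fin 2) := by
    have h := hz₁ =≫ X.δ (1 : Fin 2)
    simp only [Category.assoc, σ0_δ1_0, Category.comp_id] at h
    rw [Category.assoc, hex, ← h]
    simp
  obtain ⟨Q₂, w₂, a', hw₂, ha₁, ha₂, ua⟩ := D.l_cover.exists_univ (w₁ ≫ e)
    (z ≫ X.δ (2 : Fin 3)) hk
  obtain ⟨f, hf, -⟩ := D.fill_b (a := a') (c := w₂ ≫ w₁ ≫ e ≫ D.s0) (x := w₂ ≫ z)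
    (by simp [ha₁]) (by simp [ha₂]) (by simp [hz₁, reassoc_of% hex])
  have fq : f ≫ q = w₂ ≫ w₁ := by
    refine Fp.ext hX.δ0_cover ?_ ?_
    · change (f ≫ q) ≫ e = (w₂ ≫ w₁) ≫ e
      rw [Category.assoc, qe, D.R_v2 hf]; simp
    · change (f ≫ q) ≫ x = (w₂ ≫ w₁) ≫ x
      rw [Category.assoc, qx, D.R_e12 hf]; simp [hz₀]
  refine NicePretopology.of_comp f q ?_ (fq ▸ cover_comp hw₂ hw₁)
  obtain ⟨Q₃, w₃, z', hw₃, hz₀', hz₁', uz'⟩ := hX.sq2.exists_univ D.p1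
    (D.p1 ≫ X.δ (0 : Fin 2) ≫ X.σ (0 : Fin 1)) (by simp)
  obtain ⟨k, ⟨hk₁, hk₂⟩, -⟩ := uz' f (w₂ ≫ z) (by rw [D.R_e12 hf])
    (by
      have h := D.R_e12 hf
      rw [Category.assoc, hz₀] at h
      rw [reassoc_of% h]
      simp [hz₁])
  obtain ⟨a'', ha'', -⟩ := fill_a hX (D := D) (b := w₃) (c := w₃ ≫ D.d0 ≫ D.s0) (x := z')
    (by simp) hz₀'.symm (by simp [hz₁'])
  obtain ⟨j₁, ⟨hj₁, hj₁'⟩, -⟩ := uz (w₃ ≫ q) z' (by simp [hz₀', qx]) (by simp [hz₁', reassoc_of% qx])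
  obtain ⟨j, ⟨hj, hj'⟩, -⟩ := ua j₁ a'' (by
      rw [reassoc_of% hj₁, qe, D.R_v0 ha'']; simp)
    (by rw [D.R_e01 ha'', reassoc_of% hj₁'])
  have jf : j ≫ f = w₃ := by
    refine uniq_b (D.R_congr (D.R_nat j hf) hj' rfl ?_ ?_) ha''
    · rw [← Category.assoc, hj, reassoc_of% hj₁, reassoc_of% qe]
    · rw [← Category.assoc, hj, hj₁']
  have kj₁ : k ≫ j₁ = w₂ := by
    refine (uz (w₂ ≫ w₁) (w₂ ≫ z) (by simp [hz₀]) (by simp [hz₁])).unique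
      ⟨?_, ?_⟩ ⟨rfl, rfl⟩
    · rw [Category.assoc, hj₁, reassoc_of% hk₁, fq]
    · rw [Category.assoc, hj₁', hk₂]
  have kj : k ≫ j = 𝟙 _ := by
    refine (ua w₂ a' ha₁ ha₂).unique ⟨?_, ?_⟩
      ⟨Category.id_comp _, Category.id_comp _⟩
    · rw [Category.assoc, hj, kj₁]
    · rw [Category.assoc, hj']
      refine uniq_a hX (D.R_congr (D.R_nat k ha'') rfl hk₁ ?_ hk₂) hf
      rw [reassoc_of% hk₁, ← qe, Category.assoc, reassoc_of% fq]
  have jk : j ≫ k = 𝟙 _ := by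
    refine (uz' w₃ z' hz₀' hz₁').unique ⟨?_, ?_⟩
      ⟨Category.id_comp _, Category.id_comp _⟩
    · rw [Category.assoc, hk₁, jf]
    · rw [Category.assoc, hk₂, reassoc_of% hj, hj₁']
  rw [← hk₁]
  exact cover_comp (SingletonPretopology.of_isIso _ ⟨j, kj, jk⟩) hw₃

end Fillers

end ActData

end ActData

end HigherGpd

namespace HigherGpd

open SimplicialIdentities

section Chains

/-- The edge from `i` to `j`. -/
def edge {n : SimplexCategory} (i j : Fin (n.len + 1)) (h : i ≤ j) : ⦋1⦌ ⟶ n :=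
  SimplexCategory.Hom.mk ⟨![i, j], by
    rw [Fin.monotone_iff_le_succ]
    intro a
    fin_cases a
    exact h⟩

/-- The triangle with vertices `i ≤ j ≤ k`. -/
def tri {n : SimplexCategory} (i j k : Fin (n.len + 1)) (h : i ≤ j) (h' : j ≤ k) : ⦋2⦌ ⟶ n :=
  SimplexCategory.Hom.mk ⟨![i, j, k], by
    rw [Fin.monotone_iff_le_succ]
    intro a
    fin_cases a
    · exact h
    · exact h'⟩

/-- The tetrahedron with vertices `i ≤ j ≤ k ≤ l`. -/
def quad {n : SimplexCategory} (i j k l : Fin (n.len + 1)) (h : i ≤ j) (h' : j ≤ k) (h'' : k ≤ l) :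
    ⦋3⦌ ⟶ n :=
  SimplexCategory.Hom.mk ⟨![i, j, k, l], by
    rw [Fin.monotone_iff_le_succ]
    intro a
    fin_cases a
    · exact h
    · exact h'
    · exact h''⟩

theorem simplex_hom_ext {m n : SimplexCategory} {f g : m ⟶ n}
    (h : ∀ i, f.toOrderHom i = g.toOrderHom i) : f = g :=
  SimplexCategory.Hom.ext _ _ (OrderHom.ext _ _ (funext h))

variable {n m : SimplexCategory}

theorem edge_comp (θ : n ⟶ m) (i j : Fin (n.len + 1)) (h : i ≤ j) :
    edge i j h ≫ θ = edge (θ.toOrderHom i) (θ.toOrderHom j) (θ.toOrderHom.monotone h) :=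
  simplex_hom_ext fun a => by fin_cases a <;> rfl

theorem tri_comp (θ : n ⟶ m) (i j k : Fin (n.len + 1)) (h : i ≤ j) (h' : j ≤ k) :
    tri i j k h h' ≫ θ = tri (θ.toOrderHom i) (θ.toOrderHom j) (θ.toOrderHom k)
      (θ.toOrderHom.monotone h) (θ.toOrderHom.monotone h') :=
  simplex_hom_ext fun a => by fin_cases a <;> rfl

theorem δ2_tri (i j k : Fin (n.len + 1)) (h : i ≤ j) (h' : j ≤ k) :
    SimplexCategory.δ (2 : Fin 3) ≫ tri i j k h h' = edge i j h :=
  simplex_hom_ext fun a => by fin_cases a <;> rfl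

theorem δ1_tri (i j k : Fin (n.len + 1)) (h : i ≤ j) (h' : j ≤ k) :
    SimplexCategory.δ (1 : Fin 3) ≫ tri i j k h h' = edge i k (h.trans h') :=
  simplex_hom_ext fun a => by fin_cases a <;> rfl

theorem δ0_tri (i j k : Fin (n.len + 1)) (h : i ≤ j) (h' : j ≤ k) :
    SimplexCategory.δ (0 : Fin 3) ≫ tri i j k h h' = edge j k h' :=
  simplex_hom_ext fun a => by fin_cases a <;> rfl

theorem δ3_quad (i j k l : Fin (n.len + 1)) (h : i ≤ j) (h' : j ≤ k) (h'' : k ≤ l) :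
    SimplexCategory.δ (3 : Fin 4) ≫ quad i j k l h h' h'' = tri i j k h h' :=
  simplex_hom_ext fun a => by fin_cases a <;> rfl

theorem δ2_quad (i j k l : Fin (n.len + 1)) (h : i ≤ j) (h' : j ≤ k) (h'' : k ≤ l) :
    SimplexCategory.δ (2 : Fin 4) ≫ quad i j k l h h' h'' = tri i j l h (h'.trans h'') :=
  simplex_hom_ext fun a => by fin_cases a <;> rfl

theorem δ1_quad (i j k l : Fin (n.len + 1)) (h : i ≤ j) (h' : j ≤ k) (h'' : k ≤ l) :
    SimplexCategory.δ (1 : Fin 4) ≫ quad i j k l h h' h'' = tri i k l (h.trans h') h'' :=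
  simplex_hom_ext fun a => by fin_cases a <;> rfl

theorem δ0_quad (i j k l : Fin (n.len + 1)) (h : i ≤ j) (h' : j ≤ k) (h'' : k ≤ l) :
    SimplexCategory.δ (0 : Fin 4) ≫ quad i j k l h h' h'' = tri j k l h' h'' :=
  simplex_hom_ext fun a => by fin_cases a <;> rfl

theorem σ0_edge (i j : Fin (n.len + 1)) (h : i ≤ j) :
    SimplexCategory.σ (0 : Fin 2) ≫ edge i j h = tri i i j le_rfl h :=
  simplex_hom_ext fun a => by fin_cases a <;> rfl

theorem σ1_edge (i j : Fin (n.len + 1)) (h : i ≤ j) :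
    SimplexCategory.σ (1 : Fin 2) ≫ edge i j h = tri i j j h le_rfl :=
  simplex_hom_ext fun a => by fin_cases a <;> rfl

theorem tri_012 : tri (n := ⦋2⦌) 0 1 2 (by decide) (by decide) = 𝟙 _ :=
  simplex_hom_ext fun a => by fin_cases a <;> rfl

theorem edge_01 : edge (n := ⦋1⦌) 0 1 (by decide) = 𝟙 _ :=
  simplex_hom_ext fun a => by fin_cases a <;> rfl

variable {C : Type u} [Category.{v} C] (X : SimplicialObject C)

theorem map_comp_op {k : SimplexCategory} (f : k ⟶ n) (g : n ⟶ m) :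
    X.map g.op ≫ X.map f.op = X.map (f ≫ g).op := by rw [op_comp, X.map_comp]

theorem map_tri_δ2 (i j k : Fin (n.len + 1)) (h : i ≤ j) (h' : j ≤ k) :
    X.map (tri i j k h h').op ≫ X.δ (2 : Fin 3) = X.map (edge i j h).op :=
  (map_comp_op X _ _).trans (by rw [δ2_tri])

theorem map_tri_δ1 (i j k : Fin (n.len + 1)) (h : i ≤ j) (h' : j ≤ k) :
    X.map (tri i j k h h').op ≫ X.δ (1 : Fin 3) = X.map (edge i k (h.trans h')).op :=
  (map_comp_op X _ _).trans (by rw [δ1_tri])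

theorem map_tri_δ0 (i j k : Fin (n.len + 1)) (h : i ≤ j) (h' : j ≤ k) :
    X.map (tri i j k h h').op ≫ X.δ (0 : Fin 3) = X.map (edge j k h').op :=
  (map_comp_op X _ _).trans (by rw [δ0_tri])

theorem map_quad_δ3 (i j k l : Fin (n.len + 1)) (h : i ≤ j) (h' : j ≤ k) (h'' : k ≤ l) :
    X.map (quad i j k l h h' h'').op ≫ X.δ (3 : Fin 4) = X.map (tri i j k h h').op :=
  (map_comp_op X _ _).trans (by rw [δ3_quad])

theorem map_quad_δ2 (i j k l : Fin (n.len + 1)) (h : i ≤ j) (h' : j ≤ k) (h'' : k ≤ l) :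
    X.map (quad i j k l h h' h'').op ≫ X.δ (2 : Fin 4) = X.map (tri i j l h (h'.trans h'')).op :=
  (map_comp_op X _ _).trans (by rw [δ2_quad])

theorem map_quad_δ1 (i j k l : Fin (n.len + 1)) (h : i ≤ j) (h' : j ≤ k) (h'' : k ≤ l) :
    X.map (quad i j k l h h' h'').op ≫ X.δ (1 : Fin 4) = X.map (tri i k l (h.trans h') h'').op :=
  (map_comp_op X _ _).trans (by rw [δ1_quad])

theorem map_quad_δ0 (i j k l : Fin (n.len + 1)) (h : i ≤ j) (h' : j ≤ k) (h'' : k ≤ l) :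
    X.map (quad i j k l h h' h'').op ≫ X.δ (0 : Fin 4) = X.map (tri j k l h' h'').op :=
  (map_comp_op X _ _).trans (by rw [δ0_quad])

theorem map_edge_σ0 (i j : Fin (n.len + 1)) (h : i ≤ j) :
    X.map (edge i j h).op ≫ X.σ (0 : Fin 2) = X.map (tri i i j le_rfl h).op :=
  (map_comp_op X _ _).trans (by rw [σ0_edge])

theorem map_edge_σ1 (i j : Fin (n.len + 1)) (h : i ≤ j) :
    X.map (edge i j h).op ≫ X.σ (1 : Fin 2) = X.map (tri i j j h le_rfl).op :=
  (map_comp_op X _ _).trans (by rw [σ1_edge])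

end Chains

section Dec

variable {C : Type u} [Category.{v} C] {W : MorphismProperty C} [NicePretopology W]

theorem CoverSq.symm {Z A B S : C} {f : Z ⟶ A} {g : Z ⟶ B} {a : A ⟶ S} {b : B ⟶ S}
    (h : CoverSq W f g a b) : CoverSq W g f b a := by
  obtain ⟨P, p, q, l, hP, hf, hg, hl⟩ := h
  exact ⟨P, q, p, l, hP.flip, hg, hf, hl⟩

theorem CoverSq.fst_cover {Z A B S : C} {f : Z ⟶ A} {g : Z ⟶ B} {a : A ⟶ S} {b : B ⟶ S}
    (h : CoverSq W f g a b) (hb : W b) : W f := by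
  obtain ⟨P, p, q, l, hP, rfl, rfl, hl⟩ := h
  exact cover_comp hl (SingletonPretopology.base_change hP hb)

/-- The data of the décalage of `X`: an `n`-simplex is an `(n+1)`-simplex of `X`, which lies over
its zeroth face. -/
def decData {X : SimplicialObject C} (hX : IsNGroupoid W 2 X) : ActData W X where
  A0 := X _⦋1⦌
  A1 := X _⦋2⦌
  d0 := X.δ (1 : Fin 3)
  d1 := X.δ (2 : Fin 3)
  s0 := X.σ (1 : Fin 2)
  p0 := X.δ (0 : Fin 2)
  p1 := X.δ (0 : Fin 3)
  s0_d0 := by simp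
  s0_d1 := by simp
  s0_p1 := by simp
  d0_p0 := by simp
  d1_p0 := by simp
  R {T} a b c x := ∃ y : T ⟶ X _⦋3⦌, y ≫ X.δ (3 : Fin 4) = a ∧ y ≫ X.δ (1 : Fin 4) = b ∧
    y ≫ X.δ (2 : Fin 4) = c ∧ y ≫ X.δ (0 : Fin 4) = x
  R_nat w _ _ _ _ := by
    rintro ⟨y, rfl, rfl, rfl, rfl⟩
    exact ⟨w ≫ y, by simp, by simp, by simp, by simp⟩
  R_v1 := by rintro T _ _ _ _ ⟨y, rfl, rfl, rfl, rfl⟩; simp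
  R_v0 := by rintro T _ _ _ _ ⟨y, rfl, rfl, rfl, rfl⟩; simp
  R_v2 := by rintro T _ _ _ _ ⟨y, rfl, rfl, rfl, rfl⟩; simp
  R_e01 := by rintro T _ _ _ _ ⟨y, rfl, rfl, rfl, rfl⟩; simp
  R_e12 := by rintro T _ _ _ _ ⟨y, rfl, rfl, rfl, rfl⟩; simp
  R_e02 := by rintro T _ _ _ _ ⟨y, rfl, rfl, rfl, rfl⟩; simp
  fill_c {T a b x} h₁ h₂ h₃ := by
    obtain ⟨y, hy₀, hy₁, hy₃⟩ := hX.exists_fill3_2 x b a h₃.symm h₂.symm h₁.symm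
    refine ⟨_, ⟨y, hy₃, hy₁, rfl, hy₀⟩, ?_⟩
    rintro c ⟨y', hy₃', hy₁', rfl, hy₀'⟩
    rw [hX.ext3 2 (y := y') (y' := y)]
    intro j hj
    fin_cases j
    · exact hy₀'.trans hy₀.symm
    · exact hy₁'.trans hy₁.symm
    · exact absurd rfl hj
    · exact hy₃'.trans hy₃.symm
  fill_b {T a c x} h₁ h₂ h₃ := by
    obtain ⟨y, hy₀, hy₂, hy₃⟩ := hX.exists_fill3_1 x c a h₃.symm h₂.symm h₁.symm
    refine ⟨_, ⟨y, hy₃, rfl, hy₂, hy₀⟩, ?_⟩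
    rintro b ⟨y', hy₃', rfl, hy₂', hy₀'⟩
    rw [hX.ext3 1 (y := y') (y' := y)]
    intro j hj
    fin_cases j
    · exact hy₀'.trans hy₀.symm
    · exact absurd rfl hj
    · exact hy₂'.trans hy₂.symm
    · exact hy₃'.trans hy₃.symm
  unit_r a := ⟨a ≫ X.σ (2 : Fin 3), by simp, by simp, by simp, by simp⟩
  unit_l a := ⟨a ≫ X.σ (1 : Fin 3), by simp, by simp, by simp, by simp⟩
  pent := by
    rintro T y a₀₁ a₁₂ a₀₂ a₂₃ a₀₃ a₁₃ ⟨y₄, p3, p1, p2, p0⟩ ⟨y₂, q3, q1, q2, q0⟩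
      ⟨y₁, r3, r1, r2, r0⟩
    obtain ⟨z, h₀, h₁, h₂, h₄⟩ := hX.exists_fill4 y y₁ y₂ y₄ r0.symm q0.symm p0.symm
      (r1.trans q1.symm) (r3.trans p1.symm) (q3.trans p2.symm)
    refine ⟨z ≫ X.δ 3, ?_, ?_, ?_, ?_⟩
    · have := X.δ_comp_δ (n := 2) (i := 3) (j := 3) le_rfl
      refine (Category.assoc _ _ _).trans ((congrArg (z ≫ ·) this.symm).trans ?_)
      rw [← p3, ← h₄, Category.assoc]; rfl
    · have := X.δ_comp_δ (n := 2) (i := 1) (j := 2) (by decide)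
      refine (Category.assoc _ _ _).trans ((congrArg (z ≫ ·) this).trans ?_)
      rw [← r2, ← h₁, Category.assoc]; rfl
    · have := X.δ_comp_δ (n := 2) (i := 2) (j := 2) (by decide)
      refine (Category.assoc _ _ _).trans ((congrArg (z ≫ ·) this).trans ?_)
      rw [← q2, ← h₂, Category.assoc]; rfl
    · have := X.δ_comp_δ (n := 2) (i := 0) (j := 2) (by decide)
      refine (Category.assoc _ _ _).trans ((congrArg (z ≫ ·) this).trans ?_)
      rw [← h₀, Category.assoc]; rfl
  l_cover := hX.sq1.symm

end Dec

section Points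

variable {C : Type u} [Category.{v} C] {W : MorphismProperty C} [NicePretopology W]
  {X : SimplicialObject C}

/-- A `T`-point of the `n`-simplices of the two-coskeletal simplicial object over `X` with given
truncation `D`. -/
@[ext] structure ActData.Pt (D : ActData W X) (n : SimplexCategory) (T : C) where
  x : T ⟶ X.obj (op n)
  a : ∀ i j : Fin (n.len + 1), i ≤ j → (T ⟶ D.A1)
  deg : ∀ i, a i i le_rfl = a i i le_rfl ≫ D.d0 ≫ D.s0
  rel : ∀ (i j k : Fin (n.len + 1)) (h : i ≤ j) (h' : j ≤ k),
    D.R (a i j h) (a j k h') (a i k (h.trans h')) (x ≫ X.map (tri i j k h h').op)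

namespace ActData.Pt

variable {D : ActData W X} {n m : SimplexCategory} {T T' : C}

theorem a_p1 (P : D.Pt n T) (i j : Fin (n.len + 1)) (h : i ≤ j) :
    P.a i j h ≫ D.p1 = P.x ≫ X.map (edge i j h).op := by
  rw [D.R_e01 (P.rel i j j h le_rfl), Category.assoc, map_tri_δ2]

theorem a_d1 (P : D.Pt n T) (i j : Fin (n.len + 1)) (h : i ≤ j) :
    P.a i j h ≫ D.d1 = P.a i i le_rfl ≫ D.d0 := (D.R_v1 (P.rel i i j le_rfl h)).symm

theorem a_d0 (P : D.Pt n T) (i j : Fin (n.len + 1)) (h : i ≤ j) :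
    P.a i j h ≫ D.d0 = P.a j j le_rfl ≫ D.d0 := by
  rw [D.R_v1 (P.rel i j j h le_rfl), P.deg]; simp

/-- The action of a monotone map. -/
def map (P : D.Pt n T) (θ : m ⟶ n) : D.Pt m T where
  x := P.x ≫ X.map θ.op
  a i j h := P.a (θ.toOrderHom i) (θ.toOrderHom j) (θ.toOrderHom.monotone h)
  deg i := P.deg _
  rel i j k h h' := by
    rw [Category.assoc, map_comp_op, tri_comp]
    exact P.rel _ _ _ _ _

/-- Precomposition. -/
def pre (w : T' ⟶ T) (P : D.Pt n T) : D.Pt n T' where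
  x := w ≫ P.x
  a i j h := w ≫ P.a i j h
  deg i := by simpa using w ≫= P.deg i
  rel i j k h h' := by
    rw [Category.assoc]
    exact D.R_nat w (P.rel i j k h h')

theorem ext_of {P Q : D.Pt n T} (hx : P.x = Q.x) (ha : ∀ i j h, P.a i j h = Q.a i j h) : P = Q :=
  Pt.ext hx (by funext i j h; exact ha i j h)

theorem ext_lt {P Q : D.Pt n T} (hx : P.x = Q.x) (hn : 0 < n.len)
    (ha : ∀ i j (h : i < j), P.a i j h.le = Q.a i j h.le) : P = Q := by
  refine ext_of hx fun i j h => ?_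
  rcases h.lt_or_eq with h | rfl
  · exact ha i j h
  by_cases hi : i = 0
  · have h0 : i < Fin.last _ := by rw [hi]; exact hn
    rw [P.deg, Q.deg, ← Category.assoc, ← P.a_d1 i _ h0.le, ha i _ h0, Q.a_d1, Category.assoc]
  · have h0 : 0 < i := Fin.pos_iff_ne_zero.2 hi
    rw [P.deg, Q.deg, ← Category.assoc, ← P.a_d0 0 _ h0.le, ha _ i h0, Q.a_d0, Category.assoc]

theorem pre_pre {T'' : C} (w' : T'' ⟶ T') (w : T' ⟶ T) (P : D.Pt n T) :
    P.pre (w' ≫ w) = (P.pre w).pre w' := ext_of (Category.assoc _ _ _) fun _ _ _ => Category.assoc _ _ _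

theorem pre_id (P : D.Pt n T) : P.pre (𝟙 T) = P := ext_of (Category.id_comp _) fun _ _ _ => Category.id_comp _

theorem map_pre (w : T' ⟶ T) (P : D.Pt n T) (θ : m ⟶ n) : (P.pre w).map θ = (P.map θ).pre w :=
  ext_of (Category.assoc _ _ _) fun _ _ _ => rfl

theorem map_id (P : D.Pt n T) : P.map (𝟙 n) = P :=
  ext_of (by change P.x ≫ X.map _ = _; rw [op_id, X.map_id, Category.comp_id]) fun _ _ _ => rfl

theorem map_comp {k : SimplexCategory} (P : D.Pt n T) (θ : k ⟶ m) (θ' : m ⟶ n) :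
    P.map (θ ≫ θ') = (P.map θ').map θ :=
  ext_of (by change P.x ≫ X.map _ = (P.x ≫ X.map _) ≫ X.map _; simp) fun _ _ _ => rfl

end ActData.Pt

variable (D : ActData W X)

/-- The presheaves of points of the simplicial object with truncation `D`. -/
def ActData.ptFunctor : SimplexCategoryᵒᵖ ⥤ Cᵒᵖ ⥤ Type v where
  obj n := {
    obj T := D.Pt n.unop T.unop
    map w := TypeCat.ofHom fun P => P.pre w.unop
    map_id T := ConcreteCategory.hom_ext _ _ fun P => P.pre_id
    map_comp w w' := ConcreteCategory.hom_ext _ _ fun P => P.pre_pre _ _ }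
  map θ := {
    app T := TypeCat.ofHom fun P => P.map θ.unop
    naturality T T' w := ConcreteCategory.hom_ext _ _ fun P => P.map_pre _ _ }
  map_id n := by
    ext T : 2
    apply ConcreteCategory.hom_ext
    intro P
    exact P.map_id
  map_comp θ θ' := by
    ext T : 2
    apply ConcreteCategory.hom_ext
    intro P
    exact P.map_comp _ _

end Points

end HigherGpd

namespace HigherGpd

open SimplicialIdentities

section Representability

variable {C : Type u} [Category.{v} C] {W : MorphismProperty C} [NicePretopology W]
  {X : SimplicialObject C}

theorem map_edge_δ1_σ0 {n : SimplexCategory} (i j : Fin (n.len + 1)) (h : i ≤ j) :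
    X.map (edge i j h).op ≫ X.δ (1 : Fin 2) ≫ X.σ (0 : Fin 1) = X.map (edge i i le_rfl).op := by
  have e : SimplexCategory.σ (0 : Fin 1) ≫ SimplexCategory.δ (1 : Fin 2) ≫ edge i j h
      = edge i i le_rfl := simplex_hom_ext fun a => by fin_cases a <;> rfl
  rw [← e, ← map_comp_op, ← map_comp_op, Category.assoc]
  rfl

theorem δ0_edge {n : ℕ} (i j : Fin (n + 1)) (h : i ≤ j) :
    edge (n := ⦋n⦌) i j h ≫ SimplexCategory.δ 0
      = edge (n := ⦋n + 1⦌) i.succ j.succ (Fin.succ_le_succ_iff.2 h) := by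
  rw [edge_comp]; rfl

theorem δ0_tri' {n : ℕ} (i j k : Fin (n + 1)) (h : i ≤ j) (h' : j ≤ k) :
    tri (n := ⦋n⦌) i j k h h' ≫ SimplexCategory.δ 0
      = tri (n := ⦋n + 1⦌) i.succ j.succ k.succ (Fin.succ_le_succ_iff.2 h)
        (Fin.succ_le_succ_iff.2 h') := by
  rw [tri_comp]; rfl

namespace ActData.Pt

variable {D : ActData W X} {n : ℕ} {T : C}

variable (hX : IsNGroupoid W 2 X)
include hX

theorem eq_of_cone {P P' : D.Pt ⦋n + 1⦌ T}
    (h₀ : P.map (SimplexCategory.δ 0) = P'.map (SimplexCategory.δ 0)) (hx : P.x = P'.x)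
    (ha : P.a 0 (Fin.last _) (Fin.zero_le _) = P'.a 0 (Fin.last _) (Fin.zero_le _)) : P = P' := by
  have h₁ : ∀ (i j : Fin (n + 1)) h h', P.a i.succ j.succ h = P'.a i.succ j.succ h' := by
    intro i j h h'
    have := congrArg (fun Q => Q.a i j (Fin.succ_le_succ_iff.1 h)) h₀
    exact this
  refine ext_lt hx (Nat.succ_pos n) fun i j h => ?_
  change Fin (n + 2) at i j
  obtain ⟨j, rfl⟩ := Fin.exists_succ_eq.2 (Fin.ne_zero_of_lt h)
  cases i using Fin.cases with
  | succ i => exact h₁ i j _ _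
  | zero =>
    have r := P.rel 0 j.succ (Fin.last n).succ (Fin.zero_le _)
      (Fin.succ_le_succ_iff.2 (Fin.le_last _))
    have r' := P'.rel 0 j.succ (Fin.last n).succ (Fin.zero_le _)
      (Fin.succ_le_succ_iff.2 (Fin.le_last _))
    refine uniq_a hX r (R_congr r' rfl (h₁ _ _ _ _).symm ha.symm ?_)
    rw [hx]

theorem exists_cone (Q : D.Pt ⦋n⦌ T) (x : T ⟶ X _⦋n + 1⦌) (hx : x ≫ X.δ 0 = Q.x) (b : T ⟶ D.A1)
    (hb₀ : b ≫ D.d0 = Q.a (Fin.last _) (Fin.last _) le_rfl ≫ D.d0)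
    (hb₁ : b ≫ D.p1 = x ≫ X.map (edge (n := ⦋n + 1⦌) 0 (Fin.last _) (Fin.zero_le _)).op) :
    ∃ P : D.Pt ⦋n + 1⦌ T, P.map (SimplexCategory.δ 0) = Q ∧ P.x = x ∧
      P.a 0 (Fin.last _) (Fin.zero_le _) = b := by
  have hxQ : ∀ {k : SimplexCategory} (f : k ⟶ ⦋n⦌), Q.x ≫ X.map f.op
      = x ≫ X.map (f ≫ SimplexCategory.δ 0).op := by
    intro k f
    rw [← hx, Category.assoc, ← map_comp_op]; rfl
  have hl : ∀ j : Fin (n + 1), j.succ ≤ Fin.last (n + 1) := fun j => Fin.le_last _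
  have hf : ∀ j : Fin (n + 1), ∃ a, D.R a (Q.a j (Fin.last _) (Fin.le_last j)) b
      (x ≫ X.map (tri (n := ⦋n + 1⦌) 0 j.succ (Fin.last (n + 1)) (Fin.zero_le _) (hl j)).op) := by
    intro j
    refine (fill_a hX ?_ ?_ ?_).exists
    · rw [a_d0, hb₀]
    · rw [a_p1, Category.assoc, map_tri_δ0, hxQ, δ0_edge]; rfl
    · rw [hb₁, Category.assoc, map_tri_δ1]
  choose f hf using hf
  have hbd : ∀ j, f j ≫ D.d1 = b ≫ D.d1 := fun j => D.R_v0 (hf j)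
  have hfp : ∀ j, f j ≫ D.p1 = x ≫ X.map (edge (n := ⦋n + 1⦌) 0 j.succ (Fin.zero_le _)).op := by
    intro j
    rw [D.R_e01 (hf j), Category.assoc, map_tri_δ2]
  let g : Fin (n + 2) → Fin (n + 2) → (T ⟶ D.A1) := Fin.cases (Fin.cases (b ≫ D.d1 ≫ D.s0) f)
    (fun i => Fin.cases b (fun j => if h : i ≤ j then Q.a i j h else b))
  have g₀₀ : g 0 0 = b ≫ D.d1 ≫ D.s0 := rfl
  have g₀ : ∀ j : Fin (n + 1), g 0 j.succ = f j := fun j => rfl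
  have g₁ : ∀ (i j : Fin (n + 1)) (h : i ≤ j), g i.succ j.succ = Q.a i j h := fun i j h => dif_pos h
  have hfb : f (Fin.last n) = b := by
    refine uniq_a hX (hf _) (unit_r' ?_ ?_)
    · rw [Q.deg, ← Category.assoc, ← hb₀, Category.assoc]
    · rw [← Category.assoc, hb₁, Category.assoc, map_edge_σ1]; rfl
  refine ⟨⟨x, fun i j _ => g i j, ?_, ?_⟩, ext_of hx ?_, rfl, hfb⟩
  · intro i
    change Fin (n + 2) at i
    cases i using Fin.cases with
    | zero => rw [g₀₀]; simp
    | succ i => rw [g₁ i i le_rfl]; exact Q.deg i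
  · intro i j k h h'
    change Fin (n + 2) at i j k
    cases i using Fin.cases with
    | zero =>
      cases j using Fin.cases with
      | zero =>
        cases k using Fin.cases with
        | zero =>
          refine unit_r' (by rw [g₀₀]; simp) ?_
          rw [g₀₀]
          simp only [Category.assoc, s0_p1_assoc, d1_p0_assoc]
          rw [reassoc_of% hb₁, ← map_edge_σ1, ← map_edge_δ1_σ0 (n := ⦋n + 1⦌) 0 (Fin.last (n + 1)) (Fin.zero_le _)]
          simp
        | succ k =>
          refine unit_l' (by rw [g₀₀, g₀, reassoc_of% hbd]) ?_
          rw [g₀, ← Category.assoc, hfp, Category.assoc, map_edge_σ0]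
      | succ j =>
        cases k using Fin.cases with
        | zero => exact absurd h' (by simp)
        | succ k =>
          have hjk := Fin.succ_le_succ_iff.1 h'
          rw [g₀, g₀, g₁ j k hjk]
          refine pent₃ hX (x ≫ X.map (quad (n := ⦋n + 1⦌) 0 j.succ k.succ (Fin.last (n + 1)) h h'
            (hl k)).op) (hf j) (hf k) (Q.rel j k (Fin.last n) hjk (Fin.le_last k)) ?_ ?_ ?_ ?_
          · rw [Category.assoc, map_quad_δ3]
          · rw [Category.assoc, map_quad_δ1]
          · rw [Category.assoc, map_quad_δ0, hxQ, δ0_tri']; rfl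
          · rw [Category.assoc, map_quad_δ2]
    | succ i =>
      cases j using Fin.cases with
      | zero => exact absurd h (by simp)
      | succ j =>
        cases k using Fin.cases with
        | zero => exact absurd h' (by simp)
        | succ k =>
          have hij := Fin.succ_le_succ_iff.1 h
          have hjk := Fin.succ_le_succ_iff.1 h'
          rw [g₁ _ _ hij, g₁ _ _ hjk, g₁ _ _ (hij.trans hjk)]
          refine R_congr (Q.rel i j k hij hjk) rfl rfl rfl ?_
          rw [hxQ, δ0_tri']
  · exact fun i j h => g₁ i j h

end ActData.Pt

/-- The point `u` is universal, that is, its domain represents the functor of points. -/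
def ActData.IsRep {D : ActData W X} {n : SimplexCategory} {Y : C} (u : D.Pt n Y) : Prop :=
  ∀ {T : C} (P : D.Pt n T), ∃! w : T ⟶ Y, u.pre w = P

namespace ActData

variable (D : ActData W X)

theorem exists_rep_zero : ∃ u : D.Pt ⦋0⦌ D.A0, IsRep u ∧ u.x = D.p0 ∧
    u.a 0 0 le_rfl = D.s0 := by
  have hz : ∀ i : Fin (SimplexCategory.len ⦋0⦌ + 1), i = 0 := fun i => Fin.fin_one_eq_zero i
  refine ⟨⟨D.p0, fun _ _ _ => D.s0, fun _ => by simp, ?_⟩, ?_, rfl, rfl⟩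
  · intro i j k h h'
    refine unit_r' (by simp) ?_
    have e : tri i j k h h' = SimplexCategory.σ (1 : Fin 2) ≫ SimplexCategory.σ (0 : Fin 1) :=
      simplex_hom_ext fun a => (hz _).trans (hz _).symm
    rw [e, ← map_comp_op, s0_p1_assoc]
    rfl
  · intro T P
    refine ⟨P.a 0 0 le_rfl ≫ D.d0, Pt.ext_of ?_ ?_, ?_⟩
    · change (P.a 0 0 le_rfl ≫ D.d0) ≫ D.p0 = P.x
      rw [Category.assoc, d0_p0, ← Category.assoc, P.a_p1, Category.assoc]
      have e : SimplexCategory.δ (0 : Fin 2) ≫ edge (n := ⦋0⦌) 0 0 le_rfl = 𝟙 _ :=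
        simplex_hom_ext fun a => (hz _).trans (hz _).symm
      refine (congrArg (P.x ≫ ·) ((map_comp_op X _ _).trans ?_)).trans (Category.comp_id P.x)
      rw [e, op_id, X.map_id]
    · intro i j h
      obtain rfl := hz i
      obtain rfl := hz j
      exact (Category.assoc _ _ _).trans (P.deg 0).symm
    · rintro w rfl
      change w = (w ≫ D.s0) ≫ D.d0
      simp

variable {D}

theorem IsRep.exists_succ (hX : IsNGroupoid W 2 X) {n : ℕ} {Y : C} {u : D.Pt ⦋n⦌ Y}
    (hu : IsRep u) (h : W u.x ∨ W (X.δ (0 : Fin (n + 2)))) :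
    ∃ (Y' : C) (u' : D.Pt ⦋n + 1⦌ Y'), IsRep u' ∧ (W u.x → W u'.x) := by
  obtain ⟨Z, q, x, hZ⟩ : ∃ (Z : C) (q : Z ⟶ Y) (x : Z ⟶ X _⦋n + 1⦌),
      IsPullback q x u.x (X.δ (0 : Fin (n + 2))) := by
    rcases h with h | h
    · exact ⟨_, _, _, (Fp.isPullback (f := X.δ (0 : Fin (n + 2))) h).flip⟩
    · exact ⟨_, _, _, Fp.isPullback (f := u.x) h⟩
  have hv : (q ≫ u.a (Fin.last _) (Fin.last _) le_rfl ≫ D.d0) ≫ D.p0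
      = (x ≫ X.map (edge (n := ⦋n + 1⦌) 0 (Fin.last _) (Fin.zero_le _)).op)
        ≫ X.δ (0 : Fin 2) := by
    have e : SimplexCategory.δ (0 : Fin 2) ≫ edge (n := ⦋n⦌) (Fin.last _) (Fin.last _) le_rfl
        ≫ SimplexCategory.δ 0 = SimplexCategory.δ (0 : Fin 2) ≫
          edge (n := ⦋n + 1⦌) 0 (Fin.last _) (Fin.zero_le _) :=
      simplex_hom_ext fun a => by fin_cases a; rfl
    simp only [Category.assoc, d0_p0]
    rw [← Category.assoc (u.a _ _ _), u.a_p1, Category.assoc, reassoc_of% hZ.w]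
    refine congrArg (x ≫ ·) ?_
    refine Eq.trans ?_ (map_comp_op X _ _).symm
    rw [← e, ← map_comp_op, ← map_comp_op, Category.assoc]
    rfl
  obtain ⟨Y', w, b, hw, hb₀, hb₁, hun⟩ := (r_cover hX).exists_univ _ _ hv
  obtain ⟨u', h₁, h₂, h₃⟩ := Pt.exists_cone hX (u.pre (w ≫ q)) (w ≫ x)
    (by rw [Category.assoc, ← hZ.w, ← Category.assoc]; rfl) b
    (by
      rw [hb₀]
      change _ = ((w ≫ q) ≫ u.a _ _ _) ≫ D.d0
      simp only [Category.assoc])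
    (by rw [hb₁, Category.assoc])
  refine ⟨Y', u', ?_, ?_⟩
  · intro T P
    obtain ⟨z, hz, hz'⟩ := hu (P.map (SimplexCategory.δ 0))
    have hzx : z ≫ u.x = P.x ≫ X.δ 0 := congrArg Pt.x hz
    obtain ⟨k, ⟨hk₁, hk₂⟩, hk₃⟩ := hun (hZ.lift z P.x hzx) (P.a 0 (Fin.last _) (Fin.zero_le _))
      (by
        rw [hZ.lift_fst_assoc, P.a_d0]
        have := congrArg (fun Q : D.Pt ⦋n⦌ T => Q.a (Fin.last _) (Fin.last _) le_rfl ≫ D.d0) hz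
        exact this.symm.trans (Category.assoc _ _ _))
      (by rw [hZ.lift_snd_assoc, P.a_p1])
    refine ⟨k, Pt.eq_of_cone hX ?_ ?_ ?_, ?_⟩
    · rw [Pt.map_pre, h₁, ← Pt.pre_pre, ← Category.assoc, hk₁, hZ.lift_fst, hz]
    · change k ≫ u'.x = _
      rw [h₂, ← Category.assoc, hk₁, hZ.lift_snd]
    · change k ≫ u'.a _ _ _ = _
      rw [h₃, hk₂]
    · rintro k' rfl
      refine hk₃ k' ⟨hZ.hom_ext ?_ ?_, ?_⟩
      · rw [hZ.lift_fst]
        refine (hz' _ ?_)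
        change u.pre _ = (u'.pre k').map _
        rw [Pt.map_pre, h₁, ← Pt.pre_pre, Category.assoc]
      · rw [hZ.lift_snd, Category.assoc, ← h₂]; rfl
      · rw [← h₃]; rfl
  · intro h
    rw [h₂]
    exact cover_comp hw (SingletonPretopology.base_change hZ.flip h)

theorem exists_rep (hX : IsNGroupoid W 2 X)
    (h : W D.p0 ∨ ∀ n, W (X.δ (0 : Fin (n + 2)))) (n : ℕ) :
    ∃ (Y : C) (u : D.Pt ⦋n⦌ Y), IsRep u ∧ (W D.p0 → W u.x) := by
  induction n with
  | zero =>
    obtain ⟨u, hu, hx, -⟩ := D.exists_rep_zero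
    exact ⟨_, u, hu, fun h => hx ▸ h⟩
  | succ n ih =>
    obtain ⟨Y, u, hu, hux⟩ := ih
    obtain ⟨Y', u', hu', hux'⟩ := hu.exists_succ hX (h.imp hux fun h => h n)
    exact ⟨Y', u', hu', fun h => hux' (hux h)⟩

end ActData

end Representability

end HigherGpd

namespace HigherGpd

open SimplicialIdentities

section Coskeletal

variable {C : Type u} [Category.{v} C] {W : MorphismProperty C} [NicePretopology W]
  {X : SimplicialObject C}

/-- Simplices are determined by the faces of a horn having a unique filler. -/
theorem Kan.ext {n : ℕ} {i : Fin (n + 3)} (hK : Kan (MorphismProperty.isomorphisms C) X (n + 2) i)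
    {T : C} {y y' : T ⟶ X _⦋n + 2⦌} (h : ∀ j, j ≠ i → y ≫ X.δ j = y' ≫ X.δ j) : y = y' := by
  refine (hK.existsUnique (fun j _ => y' ≫ X.δ j) ?_).unique h fun j hj => rfl
  intro j k hj hk hjk
  have := isHornFamily_of_hom (i := i) (Λ[n + 2, i].ι ≫ simplexMap y') j k hj hk hjk
  dsimp only at this
  rw [simplexMap_face, simplexMap_face] at this
  exact this

theorem exists_ne_three {n : ℕ} (i j k : Fin (n + 4)) : ∃ l, l ≠ i ∧ l ≠ j ∧ l ≠ k := by
  by_contra! H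
  have h0 := H ⟨0, by omega⟩
  have h1 := H ⟨1, by omega⟩
  have h2 := H ⟨2, by omega⟩
  have h3 := H ⟨3, by omega⟩
  simp only [ne_eq, Fin.ext_iff] at h0 h1 h2 h3
  omega

namespace ActData

variable {D : ActData W X} {T : C}

theorem Pt.ext_faces {n : ℕ} (i : Fin (n + 4)) {P P' : D.Pt ⦋n + 3⦌ T} (hx : P.x = P'.x)
    (h : ∀ j, j ≠ i → P.map (SimplexCategory.δ j) = P'.map (SimplexCategory.δ j)) : P = P' := by
  refine Pt.ext_of hx fun j k hjk => ?_
  change Fin (n + 4) at j k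
  obtain ⟨l, hl, hj, hk⟩ := exists_ne_three i j k
  obtain ⟨j', rfl⟩ := Fin.exists_succAbove_eq hj.symm
  obtain ⟨k', rfl⟩ := Fin.exists_succAbove_eq hk.symm
  exact congrArg (fun Q => Q.a j' k' ((Fin.succAbove_le_succAbove_iff).1 hjk)) (h l hl)

/-- A map to the points of a two-coskeletal object which is bijective in dimensions at most two is
bijective if its source has fillers of horns of dimension at least three. -/
theorem bijective_of_faces {S : ℕ → Type*} (f : ∀ n, Fin (n + 2) → S (n + 1) → S n)
    (Ψ : ∀ n, S n → D.Pt ⦋n⦌ T)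
    (hΨ : ∀ n j s, Ψ n (f n j s) = (Ψ (n + 1) s).map (SimplexCategory.δ j))
    (h₀ : Function.Bijective (Ψ 0)) (h₁ : Function.Bijective (Ψ 1))
    (h₂ : Function.Bijective (Ψ 2))
    (inj : ∀ n (s s' : S (n + 3)), (Ψ _ s).x = (Ψ _ s').x → (∀ j, f (n + 2) j s = f (n + 2) j s') →
      s = s')
    (fill : ∀ n (x : T ⟶ X _⦋n + 3⦌) (y : ∀ j : Fin (n + 4), j ≠ 0 → S (n + 2)),
      (∀ (j k : Fin (n + 4)) (hj : j ≠ 0) (hk : k ≠ 0) (hjk : j < k),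
        f (n + 1) (k.pred (Fin.ne_zero_of_lt hjk)) (y j hj)
          = f (n + 1) (j.castPred (Fin.ne_last_of_lt hjk)) (y k hk)) →
      (∀ j hj, (Ψ _ (y j hj)).x = x ≫ X.δ j) →
      ∃ s, (Ψ _ s).x = x ∧ ∀ j hj, f (n + 2) j s = y j hj) (n : ℕ) :
    Function.Bijective (Ψ n) := by
  induction n using Nat.strong_induction_on with
  | _ n ih =>
    match n, ih with
    | 0, _ => exact h₀
    | 1, _ => exact h₁
    | 2, _ => exact h₂
    | n + 3, ih =>
      have b₂ := ih (n + 2) (by omega)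
      have b₁ := ih (n + 1) (by omega)
      constructor
      · intro s s' e
        refine inj n s s' (congrArg Pt.x e) fun j => b₂.1 ?_
        rw [hΨ, hΨ, e]
      · intro P
        choose y hy using fun j : Fin (n + 4) => b₂.2 (P.map (SimplexCategory.δ j))
        obtain ⟨s, hs, hs'⟩ := fill n P.x (fun j _ => y j) (by
          intro j k hj hk hjk
          refine b₁.1 ?_
          rw [hΨ, hΨ, hy, hy, ← Pt.map_comp, ← Pt.map_comp]
          have e := SimplexCategory.δ_comp_δ' (n := n + 1) (i := j.castPred (Fin.ne_last_of_lt hjk))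
            (j := k) (by rwa [Fin.castSucc_castPred])
          simp only [Fin.castSucc_castPred] at e
          rw [e]) (fun j hj => congrArg Pt.x (hy j))
        refine ⟨s, Pt.ext_faces 0 hs fun j hj => ?_⟩
        rw [← hΨ, hs' j hj, hy]

end ActData

end Coskeletal

section DecCovers

variable {C : Type u} [Category.{v} C] {W : MorphismProperty C} [NicePretopology W]
  {X : SimplicialObject C} (hX : IsNGroupoid W 2 X)

theorem tri_succ_comp {n : ℕ} (l : Fin (n + 2)) (i j : Fin (n + 1)) (h : i ≤ j) :
    tri (n := ⦋n + 1⦌) 0 i.succ j.succ (Fin.zero_le _) (Fin.succ_le_succ_iff.2 h)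
      ≫ SimplexCategory.δ l.succ = tri (n := ⦋n + 2⦌) 0 (l.succAbove i).succ (l.succAbove j).succ
        (Fin.zero_le _) (Fin.succ_le_succ_iff.2 (Fin.succAbove_le_succAbove_iff.2 h)) := by
  rw [tri_comp]
  refine simplex_hom_ext fun a => ?_
  fin_cases a
  · exact Fin.succ_succAbove_zero l
  · exact Fin.succ_succAbove_succ l i
  · exact Fin.succ_succAbove_succ l j

theorem len_zero (i : Fin (SimplexCategory.len ⦋0⦌ + 1)) : i = 0 := Fin.fin_one_eq_zero i

theorem edge_00_δ0 : X.map (edge (n := ⦋0⦌) 0 0 le_rfl).op ≫ X.δ (0 : Fin 2) = 𝟙 _ := by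
  have e : SimplexCategory.δ (0 : Fin 2) ≫ edge (n := ⦋0⦌) 0 0 le_rfl = 𝟙 _ :=
    simplex_hom_ext fun a => (len_zero _).trans (len_zero _).symm
  refine (map_comp_op X _ _).trans ?_
  rw [e, op_id, X.map_id]

/-- The point of the two-coskeletal object given by a simplex of the décalage. -/
def decPt {T : C} (n : ℕ) (y : T ⟶ X _⦋n + 1⦌) : (decData hX).Pt ⦋n⦌ T where
  x := y ≫ X.δ 0
  a i j h := y ≫ X.map (tri (n := ⦋n + 1⦌) 0 (Fin.succ i) (Fin.succ j) (Fin.zero_le _)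
    (Fin.succ_le_succ_iff.2 h)).op
  deg i := by
    change _ = (y ≫ _) ≫ X.δ (1 : Fin 3) ≫ X.σ (1 : Fin 2)
    rw [Category.assoc, ← Category.assoc (X.map _), map_tri_δ1, map_edge_σ1]; rfl
  rel i j k h h' := by
    refine ⟨y ≫ X.map (quad (n := ⦋n + 1⦌) 0 (Fin.succ i) (Fin.succ j) (Fin.succ k)
      (Fin.zero_le _) (Fin.succ_le_succ_iff.2 h) (Fin.succ_le_succ_iff.2 h')).op, ?_, ?_, ?_, ?_⟩
    · rw [Category.assoc, map_quad_δ3]; rfl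
    · rw [Category.assoc, map_quad_δ1]; rfl
    · rw [Category.assoc, map_quad_δ2]; rfl
    · rw [Category.assoc, map_quad_δ0, Category.assoc]
      refine congrArg (y ≫ ·) ?_
      refine Eq.trans ?_ (map_comp_op X _ _).symm
      rw [δ0_tri']

theorem decPt_pre {T T' : C} (w : T' ⟶ T) (n : ℕ) (y : T ⟶ X _⦋n + 1⦌) :
    decPt hX n (w ≫ y) = (decPt hX n y).pre w :=
  ActData.Pt.ext_of (Category.assoc _ _ _) fun _ _ _ => Category.assoc _ _ _

theorem decPt_face {T : C} (n : ℕ) (j : Fin (n + 2)) (y : T ⟶ X _⦋n + 2⦌) :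
    decPt hX n (y ≫ X.δ j.succ) = (decPt hX (n + 1) y).map (SimplexCategory.δ j) := by
  refine ActData.Pt.ext_of ?_ fun i k h => ?_
  · change (y ≫ _) ≫ _ = (y ≫ _) ≫ X.δ j
    rw [Category.assoc, Category.assoc]
    exact congrArg (y ≫ ·) (X.δ_comp_δ (Fin.zero_le j))
  · refine (Category.assoc _ _ _).trans (congrArg (y ≫ ·) ?_)
    refine (map_comp_op X _ _).trans ?_
    rw [tri_succ_comp j i k h]
    rfl

theorem decPt_bijective {T : C} (n : ℕ) :
    Function.Bijective (decPt hX n : (T ⟶ X _⦋n + 1⦌) → _) := by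
  refine ActData.bijective_of_faces (S := fun n => T ⟶ X _⦋n + 1⦌)
    (fun n j y => y ≫ X.δ j.succ) (decPt hX) (decPt_face hX) ?_ ?_ ?_ ?_ ?_ n
  · have e : X.map (tri (n := ⦋1⦌) 0 (Fin.succ 0) (Fin.succ 0) (Fin.zero_le _)
        le_rfl).op ≫ X.δ (1 : Fin 3) = 𝟙 _ := by
      rw [map_tri_δ1]
      exact (congrArg (fun f => X.map (Quiver.Hom.op f)) edge_01).trans (X.map_id _)
    constructor
    · intro y y' h
      have := congrArg (fun P => P.a 0 0 le_rfl ≫ X.δ (1 : Fin 3)) h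
      have h1 : (y ≫ _) ≫ X.δ (1 : Fin 3) = (y' ≫ _) ≫ X.δ (1 : Fin 3) := this
      rw [Category.assoc, Category.assoc] at h1
      exact (Category.comp_id _).symm.trans ((congrArg (y ≫ ·) e).symm.trans
        (h1.trans ((congrArg (y' ≫ ·) e).trans (Category.comp_id _))))
    · intro P
      have hx : (P.a 0 0 le_rfl ≫ X.δ (1 : Fin 3)) ≫ X.δ (0 : Fin 2) = P.x := by
        have h1 := P.a_p1 0 0 le_rfl =≫ X.δ (0 : Fin 2)
        rw [Category.assoc, Category.assoc, edge_00_δ0] at h1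
        exact (Category.assoc _ _ _).trans ((congrArg (P.a 0 0 le_rfl ≫ ·) (δ1_δ0_2 X)).trans
          (h1.trans (Category.comp_id _)))
      refine ⟨P.a 0 0 le_rfl ≫ X.δ (1 : Fin 3), ActData.Pt.ext_of hx ?_⟩
      intro i j h
      obtain rfl := len_zero i
      obtain rfl := len_zero j
      refine Eq.trans ?_ (P.deg 0).symm
      refine (Category.assoc _ _ _).trans ?_
      refine congrArg (fun z => P.a 0 0 le_rfl ≫ X.δ (1 : Fin 3) ≫ X.map (Quiver.Hom.op z)) ?_
      exact simplex_hom_ext fun a => by fin_cases a <;> rfl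
  · have e : X.map (tri (n := ⦋2⦌) 0 (Fin.succ 0) (Fin.succ 1) (Fin.zero_le _)
        (by decide)).op = 𝟙 _ :=
      (congrArg (fun f => X.map (Quiver.Hom.op f)) tri_012).trans (X.map_id _)
    constructor
    · intro y y' h
      have h1 := congrArg (fun P => P.a 0 1 (by decide)) h
      have h2 : y ≫ _ = y' ≫ _ := h1
      exact (Category.comp_id _).symm.trans ((congrArg (y ≫ ·) e).symm.trans
        (h2.trans ((congrArg (y' ≫ ·) e).trans (Category.comp_id _))))
    · intro P
      refine ⟨P.a 0 1 (by decide), ActData.Pt.ext_lt ?_ (by decide) ?_⟩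
      · refine (P.a_p1 0 1 (by decide)).trans ?_
        rw [edge_01, op_id, X.map_id, Category.comp_id]
      · intro i j h
        have hj : j.val < 2 := j.isLt
        have hij : i.val < j.val := h
        obtain rfl : i = 0 := Fin.ext (show i.val = 0 by omega)
        obtain rfl : j = 1 := Fin.ext (show j.val = 1 by omega)
        exact (congrArg (P.a 0 1 (by decide) ≫ ·) e).trans (Category.comp_id _)
  · have e3 : tri (n := ⦋3⦌) 0 (Fin.succ 0) (Fin.succ 1) (Fin.zero_le _) (by decide)
        = SimplexCategory.δ 3 := simplex_hom_ext fun a => by fin_cases a <;> rfl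
    have e2 : tri (n := ⦋3⦌) 0 (Fin.succ 0) (Fin.succ 2) (Fin.zero_le _) (by decide)
        = SimplexCategory.δ 2 := simplex_hom_ext fun a => by fin_cases a <;> rfl
    have e1 : tri (n := ⦋3⦌) 0 (Fin.succ 1) (Fin.succ 2) (Fin.zero_le _) (by decide)
        = SimplexCategory.δ 1 := simplex_hom_ext fun a => by fin_cases a <;> rfl
    have f3 : ∀ y : T ⟶ X _⦋3⦌, (decPt hX 2 y).a 0 1 (by decide) = y ≫ X.δ 3 := fun y =>
      congrArg (fun f => y ≫ X.map (Quiver.Hom.op f)) e3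
    have f2 : ∀ y : T ⟶ X _⦋3⦌, (decPt hX 2 y).a 0 2 (by decide) = y ≫ X.δ 2 := fun y =>
      congrArg (fun f => y ≫ X.map (Quiver.Hom.op f)) e2
    have f1 : ∀ y : T ⟶ X _⦋3⦌, (decPt hX 2 y).a 1 2 (by decide) = y ≫ X.δ 1 := fun y =>
      congrArg (fun f => y ≫ X.map (Quiver.Hom.op f)) e1
    constructor
    · intro y y' h
      refine hX.ext3 0 fun j hj => ?_
      fin_cases j
      · exact absurd rfl hj
      · exact (f1 y).symm.trans ((congrArg (fun P => P.a 1 2 (by decide)) h).trans (f1 y'))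
      · exact (f2 y).symm.trans ((congrArg (fun P => P.a 0 2 (by decide)) h).trans (f2 y'))
      · exact (f3 y).symm.trans ((congrArg (fun P => P.a 0 1 (by decide)) h).trans (f3 y'))
    · intro P
      obtain ⟨y, h3, h1, h2, h0⟩ := P.rel 0 1 2 (by decide) (by decide)
      refine ⟨y, ActData.Pt.ext_lt ?_ (by decide) ?_⟩
      · refine h0.trans ?_
        rw [tri_012, op_id, X.map_id, Category.comp_id]
      · intro i j h
        change Fin 3 at i j
        fin_cases i <;> fin_cases j <;> try exact absurd h (by decide)
        · exact (f3 y).trans h3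
        · exact (f2 y).trans h2
        · exact (f1 y).trans h1
  · intro n y y' hx h
    refine (hX.kan_unique (n + 4) 1 (by omega)).ext (n := n + 2) fun j hj => ?_
    cases j using Fin.cases with
    | zero => exact hx
    | succ j => exact h j
  · intro n x y hy hxy
    obtain ⟨s, hs, -⟩ := (hX.kan_unique (n + 4) 1 (by omega)).existsUnique (n := n + 2)
      (fun j => Fin.cases (motive := fun j : Fin (n + 5) => j ≠ 1 → (T ⟶ X _⦋n + 3⦌))
        (fun _ => x) (fun j hj => y j (fun h => hj (h ▸ Fin.succ_zero_eq_one))) j) (by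
        intro j k hj hk hjk
        cases k using Fin.cases with
        | zero => exact absurd hjk (by simp)
        | succ k =>
          cases j using Fin.cases with
          | zero => exact (hxy k _).symm
          | succ j =>
            have := hy j k (fun h => hj (h ▸ Fin.succ_zero_eq_one))
              (fun h => hk (h ▸ Fin.succ_zero_eq_one)) (Fin.succ_lt_succ_iff.1 hjk)
            have e₁ : k.succ.pred (Fin.ne_zero_of_lt hjk)
                = (k.pred (Fin.ne_zero_of_lt (Fin.succ_lt_succ_iff.1 hjk))).succ := by
              rw [Fin.succ_pred, Fin.pred_succ]
            have e₂ : j.succ.castPred (Fin.ne_last_of_lt hjk)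
                = (j.castPred (Fin.ne_last_of_lt (Fin.succ_lt_succ_iff.1 hjk))).succ := by
              ext; simp
            exact (congrArg (fun l => y j _ ≫ X.δ l) e₁).trans
              (this.trans (congrArg (fun l => y k _ ≫ X.δ l) e₂.symm)))
    exact ⟨s, hs 0 (by simp), fun j hj => hs j.succ (by
      rw [← Fin.succ_zero_eq_one]
      exact fun h => hj (Fin.succ_injective _ h))⟩

include hX in
theorem IsNGroupoid.δ0_cover_all (n : ℕ) : W (X.δ (0 : Fin (n + 2))) := by
  obtain ⟨Y, u, hu, hux⟩ := ActData.exists_rep (D := decData hX) hX (Or.inl hX.δ0_cover) n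
  obtain ⟨w, hw, -⟩ := hu (decPt hX n (𝟙 _))
  obtain ⟨y, hy⟩ := (decPt_bijective hX n).2 u
  have h₁ : w ≫ y = 𝟙 _ := (decPt_bijective hX n).1 (by rw [decPt_pre, hy, hw])
  have h₂ : y ≫ w = 𝟙 _ := (hu u).unique
    (by rw [ActData.Pt.pre_pre, hw, ← decPt_pre, Category.comp_id, hy]) u.pre_id
  have e : X.δ (0 : Fin (n + 2)) = w ≫ u.x :=
    ((congrArg ActData.Pt.x hw).trans (Category.id_comp _)).symm
  rw [e]
  exact cover_comp (SingletonPretopology.of_isIso _ ⟨y, h₁, h₂⟩) (hux hX.δ0_cover)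

end DecCovers

end HigherGpd

namespace HigherGpd

open SimplicialIdentities

section HornFilling

theorem horn_face_eq {Y : SSet.{v}} {n : ℕ} {i : Fin (n + 2)} (h : (Λ[n + 1, i] : SSet.{v}) ⟶ Y)
    {k : SimplexCategory} (θ θ' : k ⟶ ⦋n⦌) {l l' : Fin (n + 2)} (hl : l ≠ i) (hl' : l' ≠ i)
    (e : θ ≫ SimplexCategory.δ l = θ' ≫ SimplexCategory.δ l') :
    Y.map θ.op (h.app _ (SSet.horn.face i l hl)) = Y.map θ'.op (h.app _ (SSet.horn.face i l' hl')) := by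
  have nat : ∀ (θ : k ⟶ ⦋n⦌) (s : (Λ[n + 1, i] : SSet.{v}) _⦋n⦌),
      Y.map θ.op (h.app _ s) = h.app _ ((Λ[n + 1, i] : SSet.{v}).map θ.op s) := fun θ s =>
    (NatTrans.naturality_apply h θ.op s).symm
  rw [nat, nat]
  refine congrArg (h.app _) (Subtype.ext ?_)
  have key : ∀ (θ : k ⟶ ⦋n⦌) (l : Fin (n + 2)) (hl : l ≠ i),
      ((Λ[n + 1, i] : SSet.{v}).map θ.op (SSet.horn.face i l hl)).1
        = SSet.stdSimplex.objEquiv.symm (θ ≫ SimplexCategory.δ l) := fun θ l hl => rfl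
  rw [key, key, e]

variable {C : Type u} [Category.{v} C] {W : MorphismProperty C} [NicePretopology W]
  {X : SimplicialObject C} {D : ActData W X} {T : C}

namespace ActData

theorem Pt.horn_eq {n : ℕ} {i : Fin (n + 4)} (P : ∀ j : Fin (n + 4), j ≠ i → D.Pt ⦋n + 2⦌ T)
    (hP : ∀ (j k : Fin (n + 4)) (hj : j ≠ i) (hk : k ≠ i) (hjk : j < k),
      (P j hj).map (SimplexCategory.δ (k.pred (Fin.ne_zero_of_lt hjk)))
        = (P k hk).map (SimplexCategory.δ (j.castPred (Fin.ne_last_of_lt hjk))))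
    {k : SimplexCategory} (θ θ' : k ⟶ ⦋n + 2⦌) {l l' : Fin (n + 4)} (hl : l ≠ i) (hl' : l' ≠ i)
    (e : θ ≫ SimplexCategory.δ l = θ' ≫ SimplexCategory.δ l') :
    (P l hl).map θ = (P l' hl').map θ' := by
  let Y : SSet.{v} := D.ptFunctor ⋙ (evaluation _ _).obj (op T)
  obtain ⟨h, hh⟩ := exists_horn (Y := Y) (i := i) P hP
  have := horn_face_eq h θ θ' hl hl' e
  rw [hh, hh] at this
  exact this

variable (hX : IsNGroupoid W 2 X)
include hX

theorem Pt.exists_horn_filler {n : ℕ} {i : Fin (n + 4)}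
    (P : ∀ j : Fin (n + 4), j ≠ i → D.Pt ⦋n + 2⦌ T)
    (hP : ∀ (j k : Fin (n + 4)) (hj : j ≠ i) (hk : k ≠ i) (hjk : j < k),
      (P j hj).map (SimplexCategory.δ (k.pred (Fin.ne_zero_of_lt hjk)))
        = (P k hk).map (SimplexCategory.δ (j.castPred (Fin.ne_last_of_lt hjk))))
    (x : T ⟶ X _⦋n + 3⦌) (hx : ∀ j hj, (P j hj).x = x ≫ X.δ j) :
    ∃ Q : D.Pt ⦋n + 3⦌ T, Q.x = x ∧ ∀ j hj, Q.map (SimplexCategory.δ j) = P j hj := by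
  have key : ∀ (j k : Fin (n + 4)) (h : j ≤ k), ∃ e : T ⟶ D.A1, ∀ (m : Fin (n + 4)) (hm : m ≠ i)
      (j' k' : Fin (n + 3)) (h' : j' ≤ k'), m.succAbove j' = j → m.succAbove k' = k →
        (P m hm).a j' k' h' = e := by
    intro j k h
    obtain ⟨l, hl, hj, hk⟩ := exists_ne_three i j k
    obtain ⟨j', rfl⟩ := Fin.exists_succAbove_eq hj.symm
    obtain ⟨k', rfl⟩ := Fin.exists_succAbove_eq hk.symm
    refine ⟨(P l hl).a j' k' (Fin.succAbove_le_succAbove_iff.1 h), ?_⟩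
    intro m hm j'' k'' h' ej ek
    have := Pt.horn_eq P hP (edge (n := ⦋n + 2⦌) j'' k'' h')
      (edge (n := ⦋n + 2⦌) j' k' (Fin.succAbove_le_succAbove_iff.1 h)) hm hl (by
        rw [edge_comp, edge_comp]
        refine simplex_hom_ext fun a => ?_
        fin_cases a
        · exact ej
        · exact ek)
    exact congrArg (fun Q : D.Pt ⦋1⦌ T => Q.a 0 1 (by decide)) this
  choose a ha using key
  have pos : ∀ (j k l : Fin (n + 4)) (h : j ≤ k) (h' : k ≤ l) (m : Fin (n + 4)), m ≠ i → m ≠ j →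
      m ≠ k → m ≠ l → D.R (a j k h) (a k l h') (a j l (h.trans h'))
        (x ≫ X.map (tri (n := ⦋n + 3⦌) j k l h h').op) := by
    intro j k l h h' m hm hj hk hl
    obtain ⟨j', rfl⟩ := Fin.exists_succAbove_eq hj.symm
    obtain ⟨k', rfl⟩ := Fin.exists_succAbove_eq hk.symm
    obtain ⟨l', rfl⟩ := Fin.exists_succAbove_eq hl.symm
    have h₁ := Fin.succAbove_le_succAbove_iff.1 h
    have h₂ := Fin.succAbove_le_succAbove_iff.1 h'
    refine R_congr ((P m hm).rel j' k' l' h₁ h₂) (ha _ _ h m hm j' k' h₁ rfl rfl)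
      (ha _ _ h' m hm k' l' h₂ rfl rfl)
      (ha _ _ (h.trans h') m hm j' l' (h₁.trans h₂) rfl rfl) ?_
    rw [hx, Category.assoc]
    refine congrArg (x ≫ ·) ((map_comp_op X _ _).trans ?_)
    rw [tri_comp]
    rfl
  refine ⟨⟨x, a, ?_, ?_⟩, rfl, fun j hj => Pt.ext_of (hx j hj).symm fun k l h =>
    (ha _ _ _ j hj k l h rfl rfl).symm⟩
  · intro j
    obtain ⟨l, hl, hj, -⟩ := exists_ne_three i j j
    obtain ⟨j', rfl⟩ := Fin.exists_succAbove_eq hj.symm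
    rw [← ha _ _ le_rfl l hl j' j' le_rfl rfl rfl]
    exact (P l hl).deg j'
  · intro j k l h h'
    change Fin (n + 4) at j k l
    by_cases hm : ∃ m : Fin (n + 4), m ≠ i ∧ m ≠ j ∧ m ≠ k ∧ m ≠ l
    · obtain ⟨m, h₁, h₂, h₃, h₄⟩ := hm
      exact pos j k l h h' m h₁ h₂ h₃ h₄
    · push Not at hm
      have hjk : j.val ≤ k.val := h
      have hkl : k.val ≤ l.val := h'
      have hn : n = 0 := by
        by_contra hn
        have h0 := hm ⟨0, by omega⟩
        have h1 := hm ⟨1, by omega⟩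
        have h2 := hm ⟨2, by omega⟩
        have h3 := hm ⟨3, by omega⟩
        have h4 := hm ⟨4, by omega⟩
        simp only [ne_eq, Fin.ext_iff] at h0 h1 h2 h3 h4
        omega
      subst hn
      have e3 : tri (n := ⦋3⦌) 0 1 2 (by decide) (by decide)
          = SimplexCategory.δ 3 := simplex_hom_ext fun a => by fin_cases a <;> rfl
      have e2 : tri (n := ⦋3⦌) 0 1 3 (by decide) (by decide)
          = SimplexCategory.δ 2 := simplex_hom_ext fun a => by fin_cases a <;> rfl
      have e1 : tri (n := ⦋3⦌) 0 2 3 (by decide) (by decide)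
          = SimplexCategory.δ 1 := simplex_hom_ext fun a => by fin_cases a <;> rfl
      have e0 : tri (n := ⦋3⦌) 1 2 3 (by decide) (by decide)
          = SimplexCategory.δ 0 := simplex_hom_ext fun a => by fin_cases a <;> rfl
      have r3 := pos 0 1 2 (by decide) (by decide) 3
      have r2 := pos 0 1 3 (by decide) (by decide) 2
      have r1 := pos 0 2 3 (by decide) (by decide) 1
      have r0 := pos 1 2 3 (by decide) (by decide) 0
      have h0 := hm 0
      have h1 := hm 1
      have h2 := hm 2
      have h3 := hm 3
      have hcase : (i = 0 ∧ j = 1 ∧ k = 2 ∧ l = 3) ∨ (i = 1 ∧ j = 0 ∧ k = 2 ∧ l = 3) ∨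
          (i = 2 ∧ j = 0 ∧ k = 1 ∧ l = 3) ∨ (i = 3 ∧ j = 0 ∧ k = 1 ∧ l = 2) := by
        clear r0 r1 r2 r3 pos ha a hP hx P h h'
        simp only [ne_eq, Fin.ext_iff] at *
        simp only [Fin.isValue, Fin.val_zero, Fin.val_one, Fin.val_two,
          show ((3 : Fin 4) : ℕ) = 3 from rfl] at *
        omega
      rcases hcase with ⟨rfl, rfl, rfl, rfl⟩ | ⟨rfl, rfl, rfl, rfl⟩ | ⟨rfl, rfl, rfl, rfl⟩ |
        ⟨rfl, rfl, rfl, rfl⟩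
      · exact pent₀ x (r3 (by decide) (by decide) (by decide) (by decide))
          (r2 (by decide) (by decide) (by decide) (by decide))
          (r1 (by decide) (by decide) (by decide) (by decide))
          (by rw [e3]; rfl) (by rw [e1]; rfl) (by rw [e0]; rfl) (by rw [e2]; rfl)
      · exact pent₁ x (r3 (by decide) (by decide) (by decide) (by decide))
          (r2 (by decide) (by decide) (by decide) (by decide))
          (r0 (by decide) (by decide) (by decide) (by decide))
          (by rw [e3]; rfl) (by rw [e1]; rfl) (by rw [e0]; rfl) (by rw [e2]; rfl)
      · exact pent' x (r3 (by decide) (by decide) (by decide) (by decide))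
          (r1 (by decide) (by decide) (by decide) (by decide))
          (r0 (by decide) (by decide) (by decide) (by decide))
          (by rw [e3]; rfl) (by rw [e1]; rfl) (by rw [e0]; rfl) (by rw [e2]; rfl)
      · exact pent₃ hX x (r2 (by decide) (by decide) (by decide) (by decide))
          (r1 (by decide) (by decide) (by decide) (by decide))
          (r0 (by decide) (by decide) (by decide) (by decide))
          (by rw [e3]; rfl) (by rw [e1]; rfl) (by rw [e0]; rfl) (by rw [e2]; rfl)

end ActData

end HornFilling

section Realization

variable {C : Type u} [Category.{v} C] {W : MorphismProperty C} [NicePretopology W]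
  {X : SimplicialObject C}

/-- An identification of the simplicial object `A` over `X` with the two-coskeletal simplicial
object with truncation `D`. -/
structure ActData.Realization (D : ActData W X) {A : SimplicialObject C} (π : A ⟶ X) where
  pt : ∀ {n : SimplexCategory} {T : C}, (T ⟶ A.obj (op n)) → D.Pt n T
  pt_pre : ∀ {n : SimplexCategory} {T T' : C} (w : T' ⟶ T) (y : T ⟶ A.obj (op n)),
    pt (w ≫ y) = (pt y).pre w
  pt_map : ∀ {n m : SimplexCategory} {T : C} (θ : m ⟶ n) (y : T ⟶ A.obj (op n)),
    pt (y ≫ A.map θ.op) = (pt y).map θ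
  pt_bij : ∀ (n : SimplexCategory) (T : C), Function.Bijective (pt : (T ⟶ A.obj (op n)) → D.Pt n T)
  pt_x : ∀ {n : SimplexCategory} {T : C} (y : T ⟶ A.obj (op n)), (pt y).x = y ≫ π.app (op n)

namespace ActData

variable (D : ActData W X)

theorem exists_realization (hX : IsNGroupoid W 2 X) :
    ∃ (A : SimplicialObject C) (π : A ⟶ X), Nonempty (D.Realization π) := by
  choose Y u hu hu' using D.exists_rep hX (Or.inr hX.δ0_cover_all)
  have hu₁ : ∀ n, ∃ f : ∀ {T : C} (P : D.Pt ⦋n⦌ T), T ⟶ Y n, (∀ {T : C} (P : D.Pt ⦋n⦌ T),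
      (u n).pre (f P) = P) ∧ ∀ {T : C} (w : T ⟶ Y n), f ((u n).pre w) = w := fun n =>
    ⟨fun P => (hu n P).choose, fun P => (hu n P).choose_spec.1, fun w =>
      ((hu n _).choose_spec.2 w rfl).symm⟩
  choose f hf hf' using hu₁
  have inj : ∀ n {T : C} {w w' : T ⟶ Y n}, (u n).pre w = (u n).pre w' → w = w' := fun n _ w w' h =>
    (hu n _).unique rfl h.symm
  let A : SimplicialObject C := {
    obj n := Y n.unop.len
    map {n m} θ := f m.unop.len ((u n.unop.len).map (n := n.unop) (m := m.unop) θ.unop)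
    map_id n := inj _ (by
      rw [hf, Pt.pre_id]; exact Pt.map_id _)
    map_comp {n m k} θ θ' := inj _ (by
      rw [hf, Pt.pre_pre, hf, ← Pt.map_pre, hf]
      exact Pt.map_comp _ _ _) }
  let π : A ⟶ X := {
    app n := (u n.unop.len).x
    naturality n m θ := congrArg Pt.x (hf m.unop.len ((u n.unop.len).map (n := n.unop) (m := m.unop) θ.unop)) }
  refine ⟨A, π, ⟨{
    pt := fun {n T} y => (u n.len).pre y
    pt_pre := fun w y => Pt.pre_pre _ _ _
    pt_map := ?_
    pt_bij := fun n T => ⟨fun w w' h => inj _ h, fun P => ⟨f n.len P, hf _ P⟩⟩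
    pt_x := fun y => rfl }⟩⟩
  intro n m T θ y
  rw [Pt.pre_pre]
  rw [Pt.map_pre]
  congr 1
  exact hf m.len ((u n.len).map (n := n) (m := m) θ)

end ActData

end Realization

end HigherGpd

namespace HigherGpd

open SimplicialIdentities

section LowDimensions

variable {C : Type u} [Category.{v} C] {W : MorphismProperty C} [NicePretopology W]
  {X : SimplicialObject C}

theorem map_edge_01 : X.map (edge (n := ⦋1⦌) 0 1 (by decide)).op = 𝟙 _ := by
  rw [edge_01, op_id, X.map_id]

theorem map_tri_012 : X.map (tri (n := ⦋2⦌) 0 1 2 (by decide) (by decide)).op = 𝟙 _ := by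
  rw [tri_012, op_id, X.map_id]

namespace ActData.Pt

variable {D : ActData W X} {T : C}

theorem x_one (P : D.Pt ⦋1⦌ T) : P.x = P.a 0 1 (by decide) ≫ D.p1 := by
  rw [P.a_p1, map_edge_01]; exact (Category.comp_id _).symm

theorem ext_one {P Q : D.Pt ⦋1⦌ T} (h : P.a 0 1 (by decide) = Q.a 0 1 (by decide)) : P = Q := by
  refine ext_lt (by rw [x_one, x_one, h]) (by decide) fun i j hij => ?_
  have hj : j.val < 2 := j.isLt
  have hij' : i.val < j.val := hij
  obtain rfl : i = 0 := Fin.ext (show i.val = 0 by omega)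
  obtain rfl : j = 1 := Fin.ext (show j.val = 1 by omega)
  exact h

theorem ext_two {P Q : D.Pt ⦋2⦌ T} (hx : P.x = Q.x)
    (h₀₁ : P.a 0 1 (by decide) = Q.a 0 1 (by decide))
    (h₁₂ : P.a 1 2 (by decide) = Q.a 1 2 (by decide))
    (h₀₂ : P.a 0 2 (by decide) = Q.a 0 2 (by decide)) : P = Q := by
  refine ext_lt hx (by decide) fun i j hij => ?_
  change Fin 3 at i j
  fin_cases i <;> fin_cases j <;> try exact absurd hij (by decide)
  · exact h₀₁
  · exact h₀₂
  · exact h₁₂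

theorem rel_two (P : D.Pt ⦋2⦌ T) : D.R (P.a 0 1 (by decide)) (P.a 1 2 (by decide))
    (P.a 0 2 (by decide)) P.x := by
  refine R_congr (P.rel 0 1 2 (by decide) (by decide)) rfl rfl rfl ?_
  rw [map_tri_012]
  exact Category.comp_id _

theorem exists_zero (v : T ⟶ D.A0) : ∃ P : D.Pt ⦋0⦌ T, P.a 0 0 le_rfl = v ≫ D.s0 := by
  obtain ⟨u, -, -, hu⟩ := D.exists_rep_zero
  exact ⟨u.pre v, congrArg (v ≫ ·) hu⟩

variable (hX : IsNGroupoid W 2 X)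
include hX

theorem exists_one (a : T ⟶ D.A1) : ∃ P : D.Pt ⦋1⦌ T, P.a 0 1 (by decide) = a := by
  obtain ⟨Q, hQ⟩ := exists_zero (D := D) (a ≫ D.d0)
  have hQx : Q.x = (a ≫ D.d0) ≫ D.p0 := by
    have h := Q.a_p1 0 0 le_rfl =≫ X.δ (0 : Fin 2)
    rw [Category.assoc, Category.assoc, edge_00_δ0, hQ] at h
    refine (Category.comp_id _).symm.trans (h.symm.trans ?_)
    simp
  obtain ⟨P, -, -, h⟩ := exists_cone hX Q (a ≫ D.p1) (by rw [hQx]; simp) a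
    (by
      have := hQ =≫ D.d0
      simp only [Category.assoc, s0_d0, Category.comp_id] at this
      exact this.symm) (by
      refine (Category.comp_id _).symm.trans (congrArg ((a ≫ D.p1) ≫ ·) ?_)
      exact map_edge_01.symm)
  exact ⟨P, h⟩

theorem exists_two {a b c : T ⟶ D.A1} {x : T ⟶ X _⦋2⦌} (h : D.R a b c x) :
    ∃ P : D.Pt ⦋2⦌ T, P.x = x ∧ P.a 0 1 (by decide) = a ∧ P.a 1 2 (by decide) = b ∧
      P.a 0 2 (by decide) = c := by
  obtain ⟨Q, hQ⟩ := exists_one hX b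
  have e : edge (n := ⦋2⦌) 0 (Fin.last 2) (Fin.zero_le _) = SimplexCategory.δ 1 :=
    simplex_hom_ext fun a => by fin_cases a <;> rfl
  obtain ⟨P, h₀, h₁, h₂⟩ := exists_cone hX Q x (by rw [x_one, hQ]; exact (D.R_e12 h).symm) c
    (by
      refine (D.R_v2 h).symm.trans ?_
      rw [← hQ]
      exact Q.a_d0 0 1 (by decide))
    ((D.R_e02 h).trans (congrArg (fun f => x ≫ X.map (Quiver.Hom.op f)) e.symm))
  have hb : P.a 1 2 (by decide) = b :=
    (congrArg (fun Q => Q.a 0 1 (by decide)) h₀).trans hQ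
  exact ⟨P, h₁, uniq_a hX (R_congr P.rel_two rfl hb h₂ h₁) h, hb, h₂⟩

end ActData.Pt

/-- An isomorphism of truncations over `X`. -/
structure ActData.DataIso (D D' : ActData W X) where
  φ₀ : D.A0 ≅ D'.A0
  φ₁ : D.A1 ≅ D'.A1
  d0 : φ₁.hom ≫ D'.d0 = D.d0 ≫ φ₀.hom
  d1 : φ₁.hom ≫ D'.d1 = D.d1 ≫ φ₀.hom
  s0 : φ₀.hom ≫ D'.s0 = D.s0 ≫ φ₁.hom
  p0 : φ₀.hom ≫ D'.p0 = D.p0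
  p1 : φ₁.hom ≫ D'.p1 = D.p1
  R : ∀ {T : C} (a b c : T ⟶ D.A1) (x : T ⟶ X _⦋2⦌),
    D.R a b c x ↔ D'.R (a ≫ φ₁.hom) (b ≫ φ₁.hom) (c ≫ φ₁.hom) x

namespace ActData.Realization

variable {D : ActData W X} {A : SimplicialObject C} {π : A ⟶ X} (r : D.Realization π)

/-- The identification of the objects of vertices. -/
noncomputable def e₀ : A _⦋0⦌ ⟶ D.A0 := (r.pt (𝟙 _)).a 0 0 le_rfl ≫ D.d0

/-- The identification of the objects of edges. -/
noncomputable def e₁ : A _⦋1⦌ ⟶ D.A1 := (r.pt (𝟙 _)).a 0 1 (by decide)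

variable {T : C}

theorem comp_e₀ (y : T ⟶ A _⦋0⦌) : y ≫ r.e₀ = (r.pt y).a 0 0 le_rfl ≫ D.d0 := by
  conv_rhs => rw [← Category.comp_id y, r.pt_pre]
  exact (Category.assoc _ _ _).symm

theorem comp_e₀_s0 (y : T ⟶ A _⦋0⦌) : y ≫ r.e₀ ≫ D.s0 = (r.pt y).a 0 0 le_rfl := by
  rw [reassoc_of% r.comp_e₀ y]
  exact ((r.pt y).deg 0).symm

theorem comp_e₁ (y : T ⟶ A _⦋1⦌) : y ≫ r.e₁ = (r.pt y).a 0 1 (by decide) := by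
  conv_rhs => rw [← Category.comp_id y, r.pt_pre]
  rfl

theorem e₀_inj {y y' : T ⟶ A _⦋0⦌} (h : y ≫ r.e₀ = y' ≫ r.e₀) : y = y' := by
  have ha : (r.pt y).a 0 0 le_rfl = (r.pt y').a 0 0 le_rfl := by
    rw [← comp_e₀_s0, ← comp_e₀_s0, reassoc_of% h]
  refine (r.pt_bij _ _).1 (Pt.ext_of ?_ ?_)
  · have h₁ := (r.pt y).a_p1 0 0 le_rfl =≫ X.δ (0 : Fin 2)
    have h₂ := (r.pt y').a_p1 0 0 le_rfl =≫ X.δ (0 : Fin 2)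
    rw [Category.assoc _ _ (X.δ 0), Category.assoc _ _ (X.δ 0), edge_00_δ0] at h₁ h₂
    rw [ha] at h₁
    exact (Category.comp_id _).symm.trans ((h₁.symm.trans h₂).trans (Category.comp_id _))
  · intro i j h
    obtain rfl := len_zero i
    obtain rfl := len_zero j
    exact ha

theorem e₁_inj {y y' : T ⟶ A _⦋1⦌} (h : y ≫ r.e₁ = y' ≫ r.e₁) : y = y' := by
  rw [comp_e₁, comp_e₁] at h
  exact (r.pt_bij _ _).1 (Pt.ext_one h)

theorem isIso_e₀ : IsIso r.e₀ := by
  obtain ⟨P, hP⟩ := Pt.exists_zero (D := D) (𝟙 D.A0)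
  obtain ⟨g, hg⟩ := (r.pt_bij ⦋0⦌ D.A0).2 P
  have h : g ≫ r.e₀ = 𝟙 _ := by rw [comp_e₀, hg, hP]; simp
  exact ⟨g, r.e₀_inj (by rw [Category.assoc, h]; simp), h⟩

theorem isIso_e₁ (hX : IsNGroupoid W 2 X) : IsIso r.e₁ := by
  obtain ⟨P, hP⟩ := Pt.exists_one hX (𝟙 D.A1)
  obtain ⟨g, hg⟩ := (r.pt_bij ⦋1⦌ D.A1).2 P
  have h : g ≫ r.e₁ = 𝟙 _ := by rw [comp_e₁, hg, hP]
  exact ⟨g, r.e₁_inj (by rw [Category.assoc, h]; simp), h⟩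

theorem δ0_e₀ : A.δ (0 : Fin 2) ≫ r.e₀ = r.e₁ ≫ D.d0 := by
  rw [← Category.id_comp (A.δ (0 : Fin 2)), ← Category.id_comp r.e₁, comp_e₁, comp_e₀]
  change (r.pt (𝟙 _ ≫ A.map (SimplexCategory.δ (0 : Fin 2)).op)).a 0 0 _ ≫ _ = _
  rw [r.pt_map]
  exact ((r.pt (𝟙 _)).a_d0 0 1 (by decide)).symm

theorem δ1_e₀ : A.δ (1 : Fin 2) ≫ r.e₀ = r.e₁ ≫ D.d1 := by
  rw [← Category.id_comp (A.δ (1 : Fin 2)), ← Category.id_comp r.e₁, comp_e₁, comp_e₀]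
  change (r.pt (𝟙 _ ≫ A.map (SimplexCategory.δ (1 : Fin 2)).op)).a 0 0 _ ≫ _ = _
  rw [r.pt_map]
  exact ((r.pt (𝟙 _)).a_d1 0 1 (by decide)).symm

theorem σ0_e₁ : A.σ (0 : Fin 1) ≫ r.e₁ = r.e₀ ≫ D.s0 := by
  rw [← Category.id_comp (A.σ (0 : Fin 1)), ← Category.id_comp r.e₀, comp_e₁, Category.assoc,
    comp_e₀_s0]
  change (r.pt (𝟙 _ ≫ A.map (SimplexCategory.σ (0 : Fin 1)).op)).a 0 1 _ = _
  rw [r.pt_map]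
  rfl

theorem e₀_p0 : r.e₀ ≫ D.p0 = π.app (op ⦋0⦌) := by
  rw [← Category.id_comp r.e₀, comp_e₀, Category.assoc, d0_p0, ← Category.assoc, Pt.a_p1,
    Category.assoc, edge_00_δ0, r.pt_x]
  exact (Category.comp_id _).trans (Category.id_comp _)

theorem e₁_p1 : r.e₁ ≫ D.p1 = π.app (op ⦋1⦌) := by
  rw [← Category.id_comp r.e₁, comp_e₁, ← Pt.x_one, r.pt_x, Category.id_comp]

theorem pt_two (z : T ⟶ A _⦋2⦌) :
    (r.pt z).a 0 1 (by decide) = (z ≫ A.δ 2) ≫ r.e₁ ∧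
    (r.pt z).a 1 2 (by decide) = (z ≫ A.δ 0) ≫ r.e₁ ∧
    (r.pt z).a 0 2 (by decide) = (z ≫ A.δ 1) ≫ r.e₁ := by
  rw [comp_e₁, comp_e₁, comp_e₁]
  refine ⟨?_, ?_, ?_⟩
  · have := r.pt_map (SimplexCategory.δ (2 : Fin 3)) z
    exact (congrArg (fun Q => Q.a 0 1 (by decide)) this).symm
  · have := r.pt_map (SimplexCategory.δ (0 : Fin 3)) z
    exact (congrArg (fun Q => Q.a 0 1 (by decide)) this).symm
  · have := r.pt_map (SimplexCategory.δ (1 : Fin 3)) z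
    exact (congrArg (fun Q => Q.a 0 1 (by decide)) this).symm

theorem rel_iff (hX : IsNGroupoid W 2 X) (a b c : T ⟶ A _⦋1⦌) (x : T ⟶ X _⦋2⦌) :
    D.R (a ≫ r.e₁) (b ≫ r.e₁) (c ≫ r.e₁) x ↔ ∃ z : T ⟶ A _⦋2⦌, z ≫ A.δ 2 = a ∧ z ≫ A.δ 0 = b ∧
      z ≫ A.δ 1 = c ∧ z ≫ π.app (op ⦋2⦌) = x := by
  constructor
  · intro h
    obtain ⟨P, hx, h₁, h₂, h₃⟩ := Pt.exists_two hX h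
    obtain ⟨z, rfl⟩ := (r.pt_bij ⦋2⦌ T).2 P
    obtain ⟨k₁, k₂, k₃⟩ := r.pt_two z
    exact ⟨z, r.e₁_inj (k₁.symm.trans h₁), r.e₁_inj (k₂.symm.trans h₂),
      r.e₁_inj (k₃.symm.trans h₃), (r.pt_x z).symm.trans hx⟩
  · rintro ⟨z, rfl, rfl, rfl, rfl⟩
    obtain ⟨k₁, k₂, k₃⟩ := r.pt_two z
    exact R_congr (r.pt z).rel_two k₁ k₂ k₃ (r.pt_x z)

include r in
theorem ext_two {z z' : T ⟶ A _⦋2⦌} (h₀ : z ≫ A.δ 0 = z' ≫ A.δ 0) (h₁ : z ≫ A.δ 1 = z' ≫ A.δ 1)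
    (h₂ : z ≫ A.δ 2 = z' ≫ A.δ 2) (hx : z ≫ π.app (op ⦋2⦌) = z' ≫ π.app (op ⦋2⦌)) : z = z' := by
  obtain ⟨k₁, k₂, k₃⟩ := r.pt_two z
  obtain ⟨k₁', k₂', k₃'⟩ := r.pt_two z'
  refine (r.pt_bij _ _).1 (Pt.ext_two ?_ ?_ ?_ ?_)
  · rw [r.pt_x, r.pt_x, hx]
  · rw [k₁, k₁', h₂]
  · rw [k₂, k₂', h₀]
  · rw [k₃, k₃', h₁]

end ActData.Realization

end LowDimensions

end HigherGpd

namespace HigherGpd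

open SimplicialIdentities

section Fibration

variable {C : Type u} [Category.{v} C] {W : MorphismProperty C} [NicePretopology W]

theorem CoverSq.of_iso {Z A B S Z' A' : C} {f : Z ⟶ A} {g : Z ⟶ B} {a : A ⟶ S} {b : B ⟶ S}
    (h : CoverSq W f g a b) {f' : Z' ⟶ A'} {g' : Z' ⟶ B} {a' : A' ⟶ S} (e : Z' ⟶ Z) (e₀ : A' ⟶ A)
    [IsIso e] [IsIso e₀] (hf : f' ≫ e₀ = e ≫ f) (hg : g' = e ≫ g) (ha : a' = e₀ ≫ a) :
    CoverSq W f' g' a' b := by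
  obtain ⟨P, p, q, l, hP, rfl, rfl, hl⟩ := h
  refine ⟨P, p ≫ inv e₀, q, e ≫ l, ?_, ?_, by simp [hg],
    cover_comp (SingletonPretopology.of_isIso _ inferInstance) hl⟩
  · refine IsPullback.of_iso hP (Iso.refl _) (asIso (inv e₀)) (Iso.refl _) (Iso.refl _) ?_ ?_ ?_ ?_
    all_goals simp [ha]
  · rw [Category.assoc, ← reassoc_of% hf]; simp

variable {A X : SimplicialObject C} {π : A ⟶ X}

theorem Kan.of_relKan_two {i j k : Fin 3} (hX : Kan W X 2 i)
    (hπ : RelKan (MorphismProperty.isomorphisms C) π 2 i) (h₀ : W (A.δ (0 : Fin 2)))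
    (h₁ : W (A.δ (1 : Fin 2))) (hj : j ≠ i) (hk : k ≠ i) (hjk : j < k) : Kan W A 2 i := by
  refine Kan.of_coverSq hj hk hjk ?_
  have hW : ∀ l : Fin 2, W (A.δ l) := fun l => by fin_cases l <;> assumption
  have hw : A.δ j ≫ A.δ (k.pred (Fin.ne_zero_of_lt hjk)) =
      A.δ k ≫ A.δ (j.castPred (Fin.ne_last_of_lt hjk)) := by
    have := A.δ_comp_δ' (i := j.castPred (Fin.ne_last_of_lt hjk)) (j := k) (by simpa using hjk)
    simpa using this.symm
  have hcase : ∀ l : Fin 3, l ≠ i → l = j ∨ l = k := by omega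
  let p := Fp.fst (f := A.δ (k.pred (Fin.ne_zero_of_lt hjk))) (hW (j.castPred (Fin.ne_last_of_lt hjk)))
  let q := Fp.snd (f := A.δ (k.pred (Fin.ne_zero_of_lt hjk))) (hW (j.castPred (Fin.ne_last_of_lt hjk)))
  have hpq : p ≫ A.δ _ = q ≫ A.δ _ := Fp.cond _
  let l := Fp.lift (hW (j.castPred (Fin.ne_last_of_lt hjk))) (A.δ j) (A.δ k) hw
  have hl₁ : l ≫ p = A.δ j := Fp.lift_fst _ _ _ _
  have hl₂ : l ≫ q = A.δ k := Fp.lift_snd _ _ _ _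
  refine ⟨_, p, q, l, Fp.isPullback _, hl₁, hl₂, ?_⟩
  have nat : ∀ {n : ℕ} (m : Fin (n + 2)), A.δ m ≫ π.app (op ⦋n⦌) = π.app (op ⦋n + 1⦌) ≫ X.δ m :=
    fun m => SimplicialObject.δ_naturality π m
  obtain ⟨T', w, z, hw, hz₁, hz₂, uz⟩ := (hX.coverSq hj hk hjk).exists_univ
    (p ≫ π.app (op ⦋1⦌)) (q ≫ π.app (op ⦋1⦌)) (by
      rw [Category.assoc, Category.assoc, ← nat, ← nat, reassoc_of% hpq])
  obtain ⟨f, ⟨hf₁, hf₂⟩, -⟩ := uz l (π.app (op ⦋2⦌)) (by rw [← nat, reassoc_of% hl₁])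
    (by rw [← nat, reassoc_of% hl₂])
  let y : ∀ m : Fin 3, m ≠ i → (T' ⟶ A _⦋1⦌) := fun m _ => if m = j then w ≫ p else w ≫ q
  have yj : y j hj = w ≫ p := if_pos rfl
  have yk : y k hk = w ≫ q := if_neg hjk.ne'
  obtain ⟨g, ⟨hg₁, hg₂⟩, -⟩ := hπ.existsUnique (n := 0) y z (by
      intro j' k' hj' hk' hjk'
      obtain rfl : j' = j := by
        rcases hcase _ hj' with rfl | rfl
        · rfl
        · rcases hcase _ hk' with rfl | rfl <;> omega
      obtain rfl : k' = k := (hcase _ hk').resolve_left (by omega)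
      rw [yj, yk, Category.assoc, Category.assoc, hpq])
    (by
      intro m hm
      rcases hcase m hm with rfl | rfl
      · rw [yj, hz₁, Category.assoc]
      · rw [yk, hz₂, Category.assoc])
  have hgl : g ≫ l = w := by
    refine Fp.ext (hW (j.castPred (Fin.ne_last_of_lt hjk))) ?_ ?_
    · change (g ≫ l) ≫ p = w ≫ p
      rw [Category.assoc, hl₁, hg₁ j hj, yj]
    · change (g ≫ l) ≫ q = w ≫ q
      rw [Category.assoc, hl₂, hg₁ k hk, yk]
  have hgf : g ≫ f = 𝟙 _ := (uz w z (by simp [hz₁]) (by simp [hz₂])).unique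
    ⟨by rw [Category.assoc, hf₁, hgl], by rw [Category.assoc, hf₂, hg₂]⟩ ⟨by simp, by simp⟩
  have hfg : f ≫ g = 𝟙 _ := by
    refine (hπ.existsUnique (n := 0) (fun m _ => A.δ m) (π.app (op ⦋2⦌)) ?_ ?_).unique
      ⟨?_, ?_⟩ ⟨fun m hm => by simp, by simp⟩
    · intro j' k' hj' hk' hjk'
      have := A.δ_comp_δ' (i := j'.castPred (Fin.ne_last_of_lt hjk')) (j := k') (by simpa using hjk')
      simpa using this.symm
    · intro m hm
      exact nat m
    · intro m hm
      rw [Category.assoc, hg₁ m hm]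
      rcases hcase m hm with rfl | rfl
      · rw [yj, reassoc_of% hf₁, hl₁]
      · rw [yk, reassoc_of% hf₁, hl₂]
    · rw [Category.assoc, hg₂, hf₂]
  rw [← hf₁]
  exact cover_comp (SingletonPretopology.of_isIso _ ⟨g, hfg, hgf⟩) hw

theorem RelKan.of_kan {n : ℕ} {i : Fin (n + 3)}
    (hA : Kan (MorphismProperty.isomorphisms C) A (n + 2) i)
    (hX : Kan (MorphismProperty.isomorphisms C) X (n + 2) i) :
    RelKan (MorphismProperty.isomorphisms C) π (n + 2) i := by
  refine RelKan.of_existsUnique fun {T} y σ hy hσ => ?_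
  obtain ⟨x, hx, hx'⟩ := hA.existsUnique y hy
  refine ⟨x, ⟨hx, hX.ext fun j hj => ?_⟩, fun x' h => hx' x' h.1⟩
  rw [← hσ j hj, ← hx j hj, Category.assoc, Category.assoc, SimplicialObject.δ_naturality]

namespace ActData.Realization

variable {D : ActData W X} (r : D.Realization π) (hX : IsNGroupoid W 2 X)
include r hX

theorem relKan_one (i : Fin 2) : RelKan W π 1 i := by
  have := r.isIso_e₀
  have := r.isIso_e₁ hX
  fin_cases i
  · exact RelKan.of_coverSq (j := 1) (by decide)
      (D.l_cover.of_iso r.e₁ r.e₀ r.δ1_e₀ r.e₁_p1.symm r.e₀_p0.symm)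
  · exact RelKan.of_coverSq (j := 0) (by decide)
      ((r_cover hX).of_iso r.e₁ r.e₀ r.δ0_e₀ r.e₁_p1.symm r.e₀_p0.symm)

theorem δ_cover (i : Fin 2) : W (A.δ i) := by
  fin_cases i
  · exact ((r.relKan_one hX 1).coverSq (j := 0) (by decide)).fst_cover hX.δ0_cover
  · exact ((r.relKan_one hX 0).coverSq (j := 1) (by decide)).fst_cover hX.δ1_cover

theorem relKan_two (i : Fin 3) : RelKan (MorphismProperty.isomorphisms C) π 2 i := by
  have h₁ := r.isIso_e₁ hX
  have lift : ∀ {T : C} (b : T ⟶ D.A1), ∃ b' : T ⟶ A _⦋1⦌, b' ≫ r.e₁ = b := fun b =>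
    ⟨b ≫ inv r.e₁, by simp⟩
  refine RelKan.of_existsUnique (n := 0) fun {T} y σ hy hσ => ?_
  fin_cases i
  · have c := hy 1 2 (by decide) (by decide) (by decide)
    change y 1 _ ≫ A.δ (1 : Fin 2) = y 2 _ ≫ A.δ (1 : Fin 2) at c
    obtain ⟨b, hb, -⟩ := D.fill_b (a := y 2 (by decide) ≫ r.e₁) (c := y 1 (by decide) ≫ r.e₁) (x := σ)
      (by rw [Category.assoc, Category.assoc, ← δ1_e₀, reassoc_of% c])
      (by rw [Category.assoc, e₁_p1, ← hσ]) (by rw [Category.assoc, e₁_p1, ← hσ])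
    obtain ⟨b, rfl⟩ := lift b
    obtain ⟨z, h2, h0, h1, hz⟩ := (r.rel_iff hX _ _ _ _).1 hb
    refine ⟨z, ⟨?_, hz⟩, ?_⟩
    · intro j hj
      fin_cases j
      · exact absurd rfl hj
      · exact h1
      · exact h2
    · rintro z' ⟨h, hz'⟩
      have h1' := h 1 (by decide)
      have h2' := h 2 (by decide)
      refine r.ext_two (r.e₁_inj (uniq_b ((r.rel_iff hX _ _ _ _).2 ⟨z', h2', rfl, h1', hz'⟩)
        (h0 ▸ hb))) (h1'.trans h1.symm) (h2'.trans h2.symm) (hz'.trans hz.symm)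
  · have c := hy 0 2 (by decide) (by decide) (by decide)
    change y 0 _ ≫ A.δ (1 : Fin 2) = y 2 _ ≫ A.δ (0 : Fin 2) at c
    obtain ⟨b, hb, -⟩ := D.fill_c (a := y 2 (by decide) ≫ r.e₁) (b := y 0 (by decide) ≫ r.e₁) (x := σ)
      (by rw [Category.assoc, Category.assoc, ← δ1_e₀, ← δ0_e₀, reassoc_of% c])
      (by rw [Category.assoc, e₁_p1, ← hσ]) (by rw [Category.assoc, e₁_p1, ← hσ])
    obtain ⟨b, rfl⟩ := lift b
    obtain ⟨z, h2, h0, h1, hz⟩ := (r.rel_iff hX _ _ _ _).1 hb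
    refine ⟨z, ⟨?_, hz⟩, ?_⟩
    · intro j hj
      fin_cases j
      · exact h0
      · exact absurd rfl hj
      · exact h2
    · rintro z' ⟨h, hz'⟩
      have h0' := h 0 (by decide)
      have h2' := h 2 (by decide)
      refine r.ext_two (h0'.trans h0.symm) (r.e₁_inj (uniq_c ((r.rel_iff hX _ _ _ _).2
        ⟨z', h2', h0', rfl, hz'⟩) (h1 ▸ hb))) (h2'.trans h2.symm) (hz'.trans hz.symm)
  · have c := hy 0 1 (by decide) (by decide) (by decide)
    change y 0 _ ≫ A.δ (0 : Fin 2) = y 1 _ ≫ A.δ (0 : Fin 2) at c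
    obtain ⟨b, hb, -⟩ := fill_a hX (D := D) (b := y 0 (by decide) ≫ r.e₁) (c := y 1 (by decide) ≫ r.e₁)
      (x := σ)
      (by rw [Category.assoc, Category.assoc, ← δ0_e₀, reassoc_of% c])
      (by rw [Category.assoc, e₁_p1, ← hσ]) (by rw [Category.assoc, e₁_p1, ← hσ])
    obtain ⟨b, rfl⟩ := lift b
    obtain ⟨z, h2, h0, h1, hz⟩ := (r.rel_iff hX _ _ _ _).1 hb
    refine ⟨z, ⟨?_, hz⟩, ?_⟩
    · intro j hj
      fin_cases j
      · exact h0
      · exact h1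
      · exact absurd rfl hj
    · rintro z' ⟨h, hz'⟩
      have h0' := h 0 (by decide)
      have h1' := h 1 (by decide)
      refine r.ext_two (h0'.trans h0.symm) (h1'.trans h1.symm) (r.e₁_inj (uniq_a hX
        ((r.rel_iff hX _ _ _ _).2 ⟨z', rfl, h0', h1', hz'⟩) (h2 ▸ hb))) (hz'.trans hz.symm)

theorem kan_unique (n : ℕ) (i : Fin (n + 4)) : Kan (MorphismProperty.isomorphisms C) A (n + 3) i := by
  have hKX := hX.kan_unique (n + 3) i (by omega)
  have ext : ∀ {T : C} {y y' : T ⟶ A _⦋n + 3⦌}, (∀ j, j ≠ i → y ≫ A.δ j = y' ≫ A.δ j) → y = y' := by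
    intro T y y' h
    refine (r.pt_bij _ _).1 (Pt.ext_faces i ?_ fun j hj => ?_)
    · rw [r.pt_x, r.pt_x]
      refine hKX.ext (n := n + 1) fun j hj => ?_
      rw [Category.assoc, Category.assoc, ← SimplicialObject.δ_naturality, reassoc_of% h j hj]
    · rw [← r.pt_map, ← r.pt_map]
      exact congrArg r.pt (h j hj)
  refine Kan.of_existsUnique (n := n + 1) fun {T} y hy => ?_
  obtain ⟨x, hx, -⟩ := hKX.existsUnique (n := n + 1) (fun j hj => y j hj ≫ π.app (op ⦋n + 2⦌)) (by
    intro j k hj hk hjk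
    have := hy j k hj hk hjk
    rw [Category.assoc, Category.assoc]
    refine (congrArg (y j hj ≫ ·) (SimplicialObject.δ_naturality π _).symm).trans
      (Eq.trans ?_ (congrArg (y k hk ≫ ·) (SimplicialObject.δ_naturality π _)))
    rw [reassoc_of% this])
  obtain ⟨Q, hQx, hQ⟩ := Pt.exists_horn_filler hX (i := i) (fun j hj => r.pt (y j hj)) (by
    intro j k hj hk hjk
    refine (r.pt_map _ _).symm.trans (Eq.trans ?_ (r.pt_map _ _))
    exact congrArg r.pt (hy j k hj hk hjk)) x (fun j hj => (r.pt_x _).trans (hx j hj).symm)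
  obtain ⟨z, rfl⟩ := (r.pt_bij _ _).2 Q
  have hz : ∀ j hj, z ≫ A.δ j = y j hj := fun j hj =>
    (r.pt_bij _ _).1 ((r.pt_map (SimplexCategory.δ j) z).trans (hQ j hj))
  exact ⟨z, hz, fun z' h => ext fun j hj => (h j hj).trans (hz j hj).symm⟩

/-- A simplicial object over `X` with a two-truncation is a two-groupoid Kan fibration. -/
theorem isKanFibration : IsNGroupoidKanFibration W 2 π := by
  have hu : ∀ (m : ℕ) (i : Fin (m + 1)), 2 < m → Kan (MorphismProperty.isomorphisms C) A m i := by
    intro m i hm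
    obtain ⟨n, rfl⟩ : ∃ n, m = n + 3 := ⟨m - 3, by omega⟩
    exact r.kan_unique hX n i
  refine ⟨⟨?_, hu⟩, hX, ?_, r.relKan_two hX⟩
  · intro m i hm
    obtain rfl | rfl | hm : m = 1 ∨ m = 2 ∨ 2 < m := by omega
    · fin_cases i
      · exact Kan.of_cover (j := 1) (by decide) (r.δ_cover hX 1)
      · exact Kan.of_cover (j := 0) (by decide) (r.δ_cover hX 0)
    · have := r.relKan_two hX i
      have hK := hX.kan 2 i (by decide)
      fin_cases i
      · exact Kan.of_relKan_two (j := 1) (k := 2) hK this (r.δ_cover hX 0) (r.δ_cover hX 1)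
          (by decide) (by decide) (by decide)
      · exact Kan.of_relKan_two (j := 0) (k := 2) hK this (r.δ_cover hX 0) (r.δ_cover hX 1)
          (by decide) (by decide) (by decide)
      · exact Kan.of_relKan_two (j := 0) (k := 1) hK this (r.δ_cover hX 0) (r.δ_cover hX 1)
          (by decide) (by decide) (by decide)
    · exact Kan.of_iso (hu m i hm)
  · intro m i hm
    obtain rfl | rfl | hm : m = 1 ∨ m = 2 ∨ 2 < m := by omega
    · exact r.relKan_one hX i
    · exact RelKan.of_iso (r.relKan_two hX i)
    · obtain ⟨n, rfl⟩ : ∃ n, m = n + 2 := ⟨m - 2, by omega⟩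
      exact RelKan.of_iso (RelKan.of_kan (hu _ i hm) (hX.kan_unique _ i hm))

end ActData.Realization

end Fibration

end HigherGpd

namespace HigherGpd

open SimplicialIdentities

section Truncation

variable {C : Type u} [Category.{v} C] {W : MorphismProperty C} [NicePretopology W]
  {A X : SimplicialObject C} {π : A ⟶ X}

namespace IsNGroupoidKanFibration

variable (hπ : IsNGroupoidKanFibration W 2 π)
include hπ

theorem ext_two (i : Fin 3) {T : C} {z z' : T ⟶ A _⦋2⦌} (h : ∀ j, j ≠ i → z ≫ A.δ j = z' ≫ A.δ j)
    (hx : z ≫ π.app (op ⦋2⦌) = z' ≫ π.app (op ⦋2⦌)) : z = z' := by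
  refine ((hπ.kan_unique i).existsUnique (n := 0) (fun j _ => z' ≫ A.δ j) (z' ≫ π.app (op ⦋2⦌))
    ?_ ?_).unique ⟨h, hx⟩ ⟨fun j hj => rfl, rfl⟩
  · intro j k hj hk hjk
    have := A.δ_comp_δ' (i := j.castPred (Fin.ne_last_of_lt hjk)) (j := k) (by simpa using hjk)
    simpa using z' ≫= this.symm
  · intro j hj
    rw [Category.assoc, Category.assoc, SimplicialObject.δ_naturality]

theorem exists_fill_one {T : C} {a b : T ⟶ A _⦋1⦌} {x : T ⟶ X _⦋2⦌}
    (h : a ≫ A.δ (0 : Fin 2) = b ≫ A.δ (1 : Fin 2)) (ha : a ≫ π.app (op ⦋1⦌) = x ≫ X.δ 2)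
    (hb : b ≫ π.app (op ⦋1⦌) = x ≫ X.δ 0) :
    ∃ z : T ⟶ A _⦋2⦌, z ≫ A.δ 2 = a ∧ z ≫ A.δ 0 = b ∧ z ≫ π.app (op ⦋2⦌) = x := by
  obtain ⟨z, ⟨hz, hz'⟩, -⟩ := (hπ.kan_unique 1).existsUnique (n := 0) (fun j _ => ![b, b, a] j) x (by
      intro j k hj hk hjk
      fin_cases j <;> fin_cases k <;>
        try first
          | exact absurd hjk (by decide)
          | exact absurd rfl hj
          | exact absurd rfl hk
      exact h.symm) (by
      intro j hj
      fin_cases j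
      · exact hb
      · exact absurd rfl hj
      · exact ha)
  exact ⟨z, hz 2 (by decide), hz 0 (by decide), hz'⟩

theorem exists_fill_zero {T : C} {a c : T ⟶ A _⦋1⦌} {x : T ⟶ X _⦋2⦌}
    (h : a ≫ A.δ (1 : Fin 2) = c ≫ A.δ (1 : Fin 2)) (ha : a ≫ π.app (op ⦋1⦌) = x ≫ X.δ 2)
    (hc : c ≫ π.app (op ⦋1⦌) = x ≫ X.δ 1) :
    ∃ z : T ⟶ A _⦋2⦌, z ≫ A.δ 2 = a ∧ z ≫ A.δ 1 = c ∧ z ≫ π.app (op ⦋2⦌) = x := by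
  obtain ⟨z, ⟨hz, hz'⟩, -⟩ := (hπ.kan_unique 0).existsUnique (n := 0) (fun j _ => ![c, c, a] j) x (by
      intro j k hj hk hjk
      fin_cases j <;> fin_cases k <;>
        try first
          | exact absurd hjk (by decide)
          | exact absurd rfl hj
          | exact absurd rfl hk
      exact h.symm) (by
      intro j hj
      fin_cases j
      · exact absurd rfl hj
      · exact hc
      · exact ha)
  exact ⟨z, hz 2 (by decide), hz 1 (by decide), hz'⟩

end IsNGroupoidKanFibration

/-- The two-truncation of a two-groupoid Kan fibration. -/
def IsNGroupoidKanFibration.toData (hπ : IsNGroupoidKanFibration W 2 π) : ActData W X where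
  A0 := A _⦋0⦌
  A1 := A _⦋1⦌
  d0 := A.δ 0
  d1 := A.δ 1
  s0 := A.σ 0
  p0 := π.app (op ⦋0⦌)
  p1 := π.app (op ⦋1⦌)
  s0_d0 := A.δ_comp_σ_self' rfl
  s0_d1 := A.δ_comp_σ_succ' rfl
  s0_p1 := SimplicialObject.σ_naturality π 0
  d0_p0 := SimplicialObject.δ_naturality π 0
  d1_p0 := SimplicialObject.δ_naturality π 1
  R a b c x := ∃ z, z ≫ A.δ (2 : Fin 3) = a ∧ z ≫ A.δ (0 : Fin 3) = b ∧ z ≫ A.δ (1 : Fin 3) = c ∧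
    z ≫ π.app (op ⦋2⦌) = x
  R_nat w := by
    rintro a b c x ⟨z, rfl, rfl, rfl, rfl⟩
    exact ⟨w ≫ z, by simp, by simp, by simp, by simp⟩
  R_v1 := by rintro T a b c x ⟨z, rfl, rfl, rfl, rfl⟩; simp
  R_v0 := by rintro T a b c x ⟨z, rfl, rfl, rfl, rfl⟩; simp
  R_v2 := by rintro T a b c x ⟨z, rfl, rfl, rfl, rfl⟩; simp
  R_e01 := by
    rintro T a b c x ⟨z, rfl, rfl, rfl, rfl⟩; rw [Category.assoc, Category.assoc]
    exact congrArg (z ≫ ·) (SimplicialObject.δ_naturality π _)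
  R_e12 := by
    rintro T a b c x ⟨z, rfl, rfl, rfl, rfl⟩; rw [Category.assoc, Category.assoc]
    exact congrArg (z ≫ ·) (SimplicialObject.δ_naturality π _)
  R_e02 := by
    rintro T a b c x ⟨z, rfl, rfl, rfl, rfl⟩; rw [Category.assoc, Category.assoc]
    exact congrArg (z ≫ ·) (SimplicialObject.δ_naturality π _)
  fill_c {T a b x} h ha hb := by
    obtain ⟨z, h2, h0, hz⟩ := hπ.exists_fill_one h ha hb
    refine ⟨z ≫ A.δ 1, ⟨z, h2, h0, rfl, hz⟩, ?_⟩
    rintro c' ⟨z', h2', h0', rfl, hz'⟩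
    rw [hπ.ext_two 1 (z := z') (z' := z) (fun j hj => by
      fin_cases j
      · exact h0'.trans h0.symm
      · exact absurd rfl hj
      · exact h2'.trans h2.symm) (hz'.trans hz.symm)]
  fill_b {T a c x} h ha hc := by
    obtain ⟨z, h2, h1, hz⟩ := hπ.exists_fill_zero h ha hc
    refine ⟨z ≫ A.δ 0, ⟨z, h2, rfl, h1, hz⟩, ?_⟩
    rintro c' ⟨z', h2', rfl, h1', hz'⟩
    rw [hπ.ext_two 0 (z := z') (z' := z) (fun j hj => by
      fin_cases j
      · exact absurd rfl hj
      · exact h1'.trans h1.symm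
      · exact h2'.trans h2.symm) (hz'.trans hz.symm)]
  unit_r a := ⟨a ≫ A.σ (1 : Fin 2), by simp, by simp, by simp, by
    rw [Category.assoc]; exact congrArg (a ≫ ·) (SimplicialObject.σ_naturality π _)⟩
  unit_l a := ⟨a ≫ A.σ (0 : Fin 2), by simp, by simp, by simp, by
    rw [Category.assoc]; exact congrArg (a ≫ ·) (SimplicialObject.σ_naturality π _)⟩
  pent := by
    rintro T y a₀₁ a₁₂ a₀₂ a₂₃ a₀₃ a₁₃ ⟨z₃, h₃₂, h₃₀, h₃₁, h₃⟩ ⟨z₁, h₁₂, h₁₀, h₁₁, h₁⟩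
      ⟨z₀, h₀₂, h₀₀, h₀₁, h₀⟩
    obtain ⟨t, k₀, k₁, k₃⟩ := hπ.source.exists_fill3_2 z₀ z₁ z₃ (h₀₀.trans h₁₀.symm)
      (h₀₂.trans h₃₀.symm) (h₁₂.trans h₃₁.symm)
    have nat : ∀ {n : ℕ} (m : Fin (n + 2)), A.δ m ≫ π.app (op ⦋n⦌) = π.app (op ⦋n + 1⦌) ≫ X.δ m :=
      fun m => SimplicialObject.δ_naturality π m
    have hy : t ≫ π.app (op ⦋3⦌) = y := by
      refine hπ.target.ext3 2 fun j hj => ?_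
      rw [Category.assoc, ← nat]
      fin_cases j
      · exact (Category.assoc _ _ _).symm.trans ((congrArg (· ≫ π.app (op ⦋2⦌)) k₀).trans h₀)
      · exact (Category.assoc _ _ _).symm.trans ((congrArg (· ≫ π.app (op ⦋2⦌)) k₁).trans h₁)
      · exact absurd rfl hj
      · exact (Category.assoc _ _ _).symm.trans ((congrArg (· ≫ π.app (op ⦋2⦌)) k₃).trans h₃)
    refine ⟨t ≫ A.δ 2, ?_, ?_, ?_, ?_⟩
    · rw [← h₃₂, ← k₃]; simp
    · rw [← h₀₁, ← k₀]; simp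
    · rw [← h₁₁, ← k₁]; simp
    · rw [Category.assoc, nat, reassoc_of% hy]
  l_cover := (hπ.kan 1 0 le_rfl).coverSq (j := 1) (by decide)

end Truncation

end HigherGpd

namespace HigherGpd

open SimplicialIdentities

section Truncation

variable {C : Type u} [Category.{v} C] {W : MorphismProperty C} [NicePretopology W]
  {A X : SimplicialObject C} {π : A ⟶ X}

/-- The point of the two-coskeletal object given by a simplex of a Kan fibration. -/
def IsNGroupoidKanFibration.toPt (hπ : IsNGroupoidKanFibration W 2 π) {n : SimplexCategory} {T : C}
    (y : T ⟶ A.obj (op n)) : hπ.toData.Pt n T where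
  x := y ≫ π.app (op n)
  a i j h := y ≫ A.map (edge i j h).op
  deg i := by
    change _ = (y ≫ _) ≫ A.δ (0 : Fin 2) ≫ A.σ (0 : Fin 1)
    rw [Category.assoc]
    refine congrArg (y ≫ ·) ?_
    refine Eq.trans ?_ (congrArg (A.map (edge i i le_rfl).op ≫ ·)
      (map_comp_op A (SimplexCategory.σ (0 : Fin 1)) (SimplexCategory.δ (0 : Fin 2)))).symm
    refine Eq.trans ?_ (map_comp_op A _ _).symm
    exact congrArg (fun f => A.map (Quiver.Hom.op f)) (simplex_hom_ext fun a => by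
      fin_cases a <;> rfl)
  rel i j k h h' := by
    refine ⟨y ≫ A.map (tri i j k h h').op, ?_, ?_, ?_, ?_⟩
    · rw [Category.assoc, map_tri_δ2]; rfl
    · rw [Category.assoc, map_tri_δ0]; rfl
    · rw [Category.assoc, map_tri_δ1]; rfl
    · rw [Category.assoc, Category.assoc, π.naturality]

namespace IsNGroupoidKanFibration

variable (hπ : IsNGroupoidKanFibration W 2 π)

theorem toPt_pre {n : SimplexCategory} {T T' : C} (w : T' ⟶ T) (y : T ⟶ A.obj (op n)) :
    hπ.toPt (w ≫ y) = (hπ.toPt y).pre w :=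
  ActData.Pt.ext_of (Category.assoc _ _ _) fun _ _ _ => Category.assoc _ _ _

theorem toPt_map {n m : SimplexCategory} {T : C} (θ : m ⟶ n) (y : T ⟶ A.obj (op n)) :
    hπ.toPt (y ≫ A.map θ.op) = (hπ.toPt y).map θ := by
  refine ActData.Pt.ext_of ?_ fun i k h => ?_
  · change (y ≫ _) ≫ _ = (y ≫ _) ≫ _
    rw [Category.assoc, Category.assoc, π.naturality]
  · refine (Category.assoc _ _ _).trans (congrArg (y ≫ ·) ?_)
    refine (map_comp_op A _ _).trans ?_
    rw [edge_comp]

theorem toPt_a_zero {T : C} (y : T ⟶ A _⦋0⦌) :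
    (hπ.toPt y).a 0 0 le_rfl ≫ A.δ (0 : Fin 2) = y := by
  exact (Category.assoc _ _ _).trans ((congrArg (y ≫ ·) edge_00_δ0).trans (Category.comp_id y))

theorem toPt_a_one {T : C} (y : T ⟶ A _⦋1⦌) : (hπ.toPt y).a 0 1 (by decide) = y := by
  change y ≫ _ = _
  rw [map_edge_01]
  exact Category.comp_id y

theorem toPt_a_two {T : C} (y : T ⟶ A _⦋2⦌) : (hπ.toPt y).a 0 1 (by decide) = y ≫ A.δ 2 ∧
    (hπ.toPt y).a 1 2 (by decide) = y ≫ A.δ 0 ∧ (hπ.toPt y).a 0 2 (by decide) = y ≫ A.δ 1 := by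
  have e₂ : edge (n := ⦋2⦌) 0 1 (by decide) = SimplexCategory.δ 2 :=
    simplex_hom_ext fun a => by fin_cases a <;> rfl
  have e₁ : edge (n := ⦋2⦌) 0 2 (by decide) = SimplexCategory.δ 1 :=
    simplex_hom_ext fun a => by fin_cases a <;> rfl
  have e₀ : edge (n := ⦋2⦌) 1 2 (by decide) = SimplexCategory.δ 0 :=
    simplex_hom_ext fun a => by fin_cases a <;> rfl
  exact ⟨congrArg (fun f => y ≫ A.map (Quiver.Hom.op f)) e₂,
    congrArg (fun f => y ≫ A.map (Quiver.Hom.op f)) e₀,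
    congrArg (fun f => y ≫ A.map (Quiver.Hom.op f)) e₁⟩

theorem toPt_bijective (n : SimplexCategory) (T : C) :
    Function.Bijective (hπ.toPt : (T ⟶ A.obj (op n)) → _) := by
  obtain ⟨n, rfl⟩ : ∃ k : ℕ, n = ⦋k⦌ := ⟨n.len, rfl⟩
  have nat : ∀ {n : ℕ} (m : Fin (n + 2)), A.δ m ≫ π.app (op ⦋n⦌) = π.app (op ⦋n + 1⦌) ≫ X.δ m :=
    fun m => SimplicialObject.δ_naturality π m
  refine ActData.bijective_of_faces (D := hπ.toData) (S := fun n => T ⟶ A _⦋n⦌)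
    (fun n j y => y ≫ A.δ j) (fun n => hπ.toPt) (fun n j y => hπ.toPt_map _ y) ?_ ?_ ?_ ?_ ?_ n
  · constructor
    · intro y y' h
      rw [← hπ.toPt_a_zero y, h, hπ.toPt_a_zero]
    · intro P
      refine ⟨P.a 0 0 le_rfl ≫ A.δ (0 : Fin 2), ?_⟩
      have h : ((hπ.toPt (P.a 0 0 le_rfl ≫ A.δ (0 : Fin 2))).a 0 0 le_rfl) = P.a 0 0 le_rfl := by
        refine ((hπ.toPt _).deg 0).trans (Eq.trans ?_ (P.deg 0).symm)
        refine (Category.assoc _ _ _).symm.trans ((congrArg (· ≫ A.σ (0 : Fin 1))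
          (hπ.toPt_a_zero _)).trans (Category.assoc _ _ _))
      refine ActData.Pt.ext_of ?_ fun i j h' => ?_
      · have h₁ := P.a_p1 0 0 le_rfl =≫ X.δ (0 : Fin 2)
        rw [Category.assoc P.x, edge_00_δ0] at h₁
        refine Eq.trans ?_ (h₁.trans (Category.comp_id _))
        exact (Category.assoc _ _ _).trans ((congrArg (P.a 0 0 le_rfl ≫ ·) (nat _)).trans
          (Category.assoc _ _ _).symm)
      · obtain rfl := len_zero i
        obtain rfl := len_zero j
        exact h
  · exact ⟨fun y y' h => by rw [← hπ.toPt_a_one y, h, hπ.toPt_a_one],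
      fun P => ⟨P.a 0 1 (by decide), ActData.Pt.ext_one (hπ.toPt_a_one _)⟩⟩
  · constructor
    · intro y y' h
      obtain ⟨h₂, h₀, h₁⟩ := hπ.toPt_a_two y
      obtain ⟨h₂', h₀', h₁'⟩ := hπ.toPt_a_two y'
      refine hπ.ext_two 1 (fun j hj => ?_) (congrArg ActData.Pt.x h)
      fin_cases j
      · exact h₀.symm.trans ((congrArg (fun P => P.a 1 2 (by decide)) h).trans h₀')
      · exact absurd rfl hj
      · exact h₂.symm.trans ((congrArg (fun P => P.a 0 1 (by decide)) h).trans h₂')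
    · intro P
      obtain ⟨z, h₂, h₀, h₁, hx⟩ := P.rel_two
      obtain ⟨k₂, k₀, k₁⟩ := hπ.toPt_a_two z
      exact ⟨z, ActData.Pt.ext_two hx (k₂.trans h₂) (k₀.trans h₀) (k₁.trans h₁)⟩
  · intro n s s' hx h
    exact (hπ.source.kan_unique (n + 3) 0 (by omega)).ext (n := n + 1) fun j _ => h j
  · intro n x y hy hx
    obtain ⟨s, hs, -⟩ := (hπ.source.kan_unique (n + 3) 0 (by omega)).existsUnique (n := n + 1) y hy
    refine ⟨s, (hπ.target.kan_unique (n + 3) 0 (by omega)).ext (n := n + 1) fun j hj => ?_, hs⟩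
    rw [← hx j hj, ← hs j hj]
    exact (Category.assoc _ _ _).trans ((congrArg (s ≫ ·) (nat j).symm).trans
      (Category.assoc _ _ _).symm)

/-- A two-groupoid Kan fibration is the two-coskeletal object of its truncation. -/
def realization : hπ.toData.Realization π where
  pt := hπ.toPt
  pt_pre := hπ.toPt_pre
  pt_map := hπ.toPt_map
  pt_bij := hπ.toPt_bijective
  pt_x _ := rfl

end IsNGroupoidKanFibration

namespace ActData

variable {D D' : ActData W X}

namespace DataIso

/-- The inverse isomorphism. -/
def symm (f : DataIso D D') : DataIso D' D where
  φ₀ := f.φ₀.symm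
  φ₁ := f.φ₁.symm
  d0 := by
    have := f.d0
    simp only [Iso.symm_hom]
    rw [Iso.inv_comp_eq, ← Category.assoc, this]; simp
  d1 := by
    have := f.d1
    simp only [Iso.symm_hom]
    rw [Iso.inv_comp_eq, ← Category.assoc, this]; simp
  s0 := by
    have := f.s0
    simp only [Iso.symm_hom]
    rw [Iso.inv_comp_eq, ← Category.assoc, this]; simp
  p0 := by simp [← f.p0]
  p1 := by simp [← f.p1]
  R a b c x := by
    rw [f.R]
    simp

/-- The induced map on points. -/
def mapPt (f : DataIso D D') {n : SimplexCategory} {T : C} (P : D.Pt n T) : D'.Pt n T where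
  x := P.x
  a i j h := P.a i j h ≫ f.φ₁.hom
  deg i := by
    conv_lhs => rw [P.deg i]
    simp only [Category.assoc]
    rw [← f.s0, ← reassoc_of% f.d0]
  rel i j k h h' := (f.R _ _ _ _).1 (P.rel i j k h h')

theorem mapPt_bijective (f : DataIso D D') (n : SimplexCategory) (T : C) :
    Function.Bijective (f.mapPt : D.Pt n T → D'.Pt n T) := by
  refine ⟨fun P Q h => Pt.ext_of (congrArg (fun P => P.x) h) fun i j h' => ?_, fun P =>
    ⟨f.symm.mapPt P, Pt.ext_of rfl fun i j h => ?_⟩⟩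
  · have := congrArg (fun P => P.a i j h') h
    exact (cancel_mono f.φ₁.hom).1 this
  · change (P.a i j h ≫ f.φ₁.inv) ≫ f.φ₁.hom = _
    simp

end DataIso

namespace Realization

variable {A' : SimplicialObject C} {π' : A' ⟶ X}

/-- Transport of a realization along an isomorphism of truncations. -/
def transport (r : D.Realization π) (f : DataIso D D') : D'.Realization π where
  pt y := f.mapPt (r.pt y)
  pt_pre w y := by
    rw [r.pt_pre]
    exact Pt.ext_of rfl fun _ _ _ => Category.assoc _ _ _
  pt_map θ y := by
    rw [r.pt_map]; rfl
  pt_bij n T := (f.mapPt_bijective n T).comp (r.pt_bij n T)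
  pt_x y := r.pt_x y

theorem nonempty_iso (r : D.Realization π) (r' : D.Realization π') :
    Nonempty (Over.mk π ≅ Over.mk π') := by
  choose f hf using fun n : SimplexCategoryᵒᵖ =>
    (r'.pt_bij n.unop (A.obj n)).2 (r.pt (𝟙 (A.obj n)))
  choose g hg using fun n : SimplexCategoryᵒᵖ =>
    (r.pt_bij n.unop (A'.obj n)).2 (r'.pt (𝟙 (A'.obj n)))
  have hf' : ∀ {n : SimplexCategoryᵒᵖ} {T : C} (y : T ⟶ A.obj n), r'.pt (n := n.unop) (y ≫ f n) = r.pt y := by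
    intro n T y
    rw [r'.pt_pre (n := n.unop), hf, ← r.pt_pre, Category.comp_id]
  have hg' : ∀ {n : SimplexCategoryᵒᵖ} {T : C} (y : T ⟶ A'.obj n), r.pt (n := n.unop) (y ≫ g n) = r'.pt y := by
    intro n T y
    rw [r.pt_pre (n := n.unop), hg, ← r'.pt_pre, Category.comp_id]
  let e : A ≅ A' := NatIso.ofComponents (fun n => ⟨f n, g n,
      (r.pt_bij _ _).1 (by rw [hg', hf]), (r'.pt_bij _ _).1 (by rw [hf', hg])⟩) (by
    intro n m θ
    refine (r'.pt_bij m.unop _).1 ?_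
    have h₁ := r.pt_map θ.unop (𝟙 (A.obj n))
    have h₂ := r'.pt_map θ.unop (f n)
    rw [hf, ← h₁, Category.id_comp] at h₂
    exact (hf' _).trans h₂.symm)
  refine ⟨Over.isoMk e ?_⟩
  ext n
  change f n ≫ π'.app n = π.app n
  rw [← Category.id_comp (π.app n)]
  refine (r'.pt_x (n := n.unop) (f n)).symm.trans (Eq.trans ?_ (r.pt_x (n := n.unop) _))
  rw [hf]

/-- The truncation of a realization. -/
noncomputable def dataIso (r : D.Realization π) (hπ : IsNGroupoidKanFibration W 2 π) :
    DataIso hπ.toData D :=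
  { φ₀ := @asIso _ _ (A _⦋0⦌) _ r.e₀ r.isIso_e₀
    φ₁ := @asIso _ _ (A _⦋1⦌) _ r.e₁ (r.isIso_e₁ hπ.target)
    d0 := r.δ0_e₀.symm
    d1 := r.δ1_e₀.symm
    s0 := r.σ0_e₁.symm
    p0 := r.e₀_p0
    p1 := r.e₁_p1
    R := fun a b c x => (r.rel_iff hπ.target a b c x).symm }

end Realization

/-- Every truncation is the truncation of a two-groupoid Kan fibration. -/
theorem exists_dataIso (D : ActData W X) (hX : IsNGroupoid W 2 X) :
    ∃ (A : SimplicialObject C) (π : A ⟶ X) (hπ : IsNGroupoidKanFibration W 2 π),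
      Nonempty (DataIso hπ.toData D) := by
  obtain ⟨A, π, ⟨r⟩⟩ := D.exists_realization hX
  exact ⟨A, π, r.isKanFibration hX, ⟨r.dataIso _⟩⟩

/-- Kan fibrations with isomorphic truncations are isomorphic. -/
theorem nonempty_iso_of_dataIso {A' : SimplicialObject C} {π' : A' ⟶ X}
    {hπ : IsNGroupoidKanFibration W 2 π} {hπ' : IsNGroupoidKanFibration W 2 π'}
    (f : DataIso hπ.toData hπ'.toData) : Nonempty (Over.mk π ≅ Over.mk π') :=
  (hπ.realization.transport f).nonempty_iso hπ'.realization

end ActData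

end Truncation

end HigherGpd

namespace HigherGpd

section Relational

variable {C : Type u} [Category.{v} C] {W : MorphismProperty C}

/-- The relation `g * h = k`. -/
def Gpd.IsMul (G : Gpd W) {T : C} (g h k : T ⟶ G.mor) : Prop := ∃ e, G.mul g h e = k

/-- The relation `p * h = p'`. -/
def HSBibundle.IsRact {G H : Gpd W} (P : HSBibundle G H) {T : C} (p : T ⟶ P.X) (h : T ⟶ H.mor)
    (p' : T ⟶ P.X) : Prop := ∃ e, P.ract p h e = p'

/-- The relation `g * p = p'`. -/
def HSBibundle.IsLact {G H : Gpd W} (P : HSBibundle G H) {T : C} (g : T ⟶ G.mor) (p : T ⟶ P.X)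
    (p' : T ⟶ P.X) : Prop := ∃ e, P.lact g p e = p'

variable {G H K : Gpd W} {T T' : C}

namespace Gpd.IsMul

variable {g h k : T ⟶ G.mor}

theorem w (i : G.IsMul g h k) : g ≫ G.s = h ≫ G.t := i.choose

end Gpd.IsMul

theorem Gpd.exists_isMul {g h : T ⟶ G.mor} (e : g ≫ G.s = h ≫ G.t) : ∃ k, G.IsMul g h k :=
  ⟨_, e, rfl⟩

theorem Gpd.isMul_one (g : T ⟶ G.mor) : G.IsMul g (g ≫ G.s ≫ G.one) g :=
  ⟨by simp [G.one_t], G.mul_one _ _⟩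

theorem Gpd.one_isMul (g : T ⟶ G.mor) : G.IsMul (g ≫ G.t ≫ G.one) g g :=
  ⟨by simp [G.one_s], G.one_mul _ _⟩

namespace HSBibundle

variable {P : HSBibundle G H} {p p' p'' : T ⟶ P.X} {g g' g'' : T ⟶ G.mor} {h h' h'' : T ⟶ H.mor}

theorem exists_isRact (e : p ≫ P.r = h ≫ H.t) : ∃ p', P.IsRact p h p' := ⟨_, e, rfl⟩

theorem exists_isLact (e : g ≫ G.s = p ≫ P.l) : ∃ p', P.IsLact g p p' := ⟨_, e, rfl⟩

namespace IsRact

theorem w (i : P.IsRact p h p') : p ≫ P.r = h ≫ H.t := i.choose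

theorem l (i : P.IsRact p h p') : p' ≫ P.l = p ≫ P.l := by
  obtain ⟨e, rfl⟩ := i; exact P.ract_l _ _ _

theorem r (i : P.IsRact p h p') : p' ≫ P.r = h ≫ H.s := by
  obtain ⟨e, rfl⟩ := i; exact P.ract_r _ _ _

theorem nat (i : P.IsRact p h p') (v : T' ⟶ T) : P.IsRact (v ≫ p) (v ≫ h) (v ≫ p') := by
  obtain ⟨e, rfl⟩ := i
  exact ⟨by simpa using v ≫= e, P.ract_nat v p h e _⟩

theorem unique (i : P.IsRact p h p') (j : P.IsRact p h p'') : p' = p'' := by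
  obtain ⟨e, rfl⟩ := i; obtain ⟨e', rfl⟩ := j; rfl

theorem unique_right (i : P.IsRact p h p') (j : P.IsRact p h' p') : h = h' := by
  obtain ⟨e, k⟩ := i; obtain ⟨e', k'⟩ := j
  exact P.div_unique e e' k k'

theorem mul (i : P.IsRact p h p') (j : P.IsRact p' h' p'') (k : H.IsMul h h' h'') :
    P.IsRact p h'' p'' := by
  obtain ⟨e, rfl⟩ := i; obtain ⟨e', rfl⟩ := j; obtain ⟨e'', rfl⟩ := k
  exact ⟨by rw [H.mul_t, e], (P.ract_mul p h h' e e' e'' _).symm⟩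

end IsRact

theorem isRact_one (p : T ⟶ P.X) : P.IsRact p (p ≫ P.r ≫ H.one) p :=
  ⟨by simp [H.one_t], P.ract_one _ _⟩

theorem IsRact.eq_one (i : P.IsRact p h p) : h = p ≫ P.r ≫ H.one := i.unique_right (isRact_one p)

theorem exists_div (e : p ≫ P.l = p' ≫ P.l) : ∃ h, P.IsRact p h p' :=
  ⟨_, P.div_t p p' e, P.ract_div _ _ _ _⟩

namespace IsLact

theorem w (i : P.IsLact g p p') : g ≫ G.s = p ≫ P.l := i.choose

theorem l (i : P.IsLact g p p') : p' ≫ P.l = g ≫ G.t := by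
  obtain ⟨e, rfl⟩ := i; exact P.lact_l _ _ _

theorem r (i : P.IsLact g p p') : p' ≫ P.r = p ≫ P.r := by
  obtain ⟨e, rfl⟩ := i; exact P.lact_r _ _ _

theorem nat (i : P.IsLact g p p') (v : T' ⟶ T) : P.IsLact (v ≫ g) (v ≫ p) (v ≫ p') := by
  obtain ⟨e, rfl⟩ := i
  exact ⟨by simpa using v ≫= e, P.lact_nat v g p e _⟩

theorem unique (i : P.IsLact g p p') (j : P.IsLact g p p'') : p' = p'' := by
  obtain ⟨e, rfl⟩ := i; obtain ⟨e', rfl⟩ := j; rfl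

theorem mul (i : P.IsLact g p p') (j : P.IsLact g' p' p'') (k : G.IsMul g' g g'') :
    P.IsLact g'' p p'' := by
  obtain ⟨e, rfl⟩ := i; obtain ⟨e', rfl⟩ := j; obtain ⟨e'', rfl⟩ := k
  exact ⟨by rw [G.mul_s, e], P.mul_lact g' g p e'' e _ e'⟩

theorem comm (i : P.IsLact g p p') (j : P.IsRact p' h p'') :
    ∃ q, P.IsRact p h q ∧ P.IsLact g q p'' := by
  obtain ⟨e, rfl⟩ := i; obtain ⟨e', rfl⟩ := j
  have e₃ : p ≫ P.r = h ≫ H.t := by rw [← e', P.lact_r]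
  have e₄ : g ≫ G.s = P.ract p h e₃ ≫ P.l := by rw [P.ract_l, e]
  exact ⟨_, ⟨e₃, rfl⟩, e₄, (P.comm g p h e e' e₃ e₄).symm⟩

end IsLact

theorem one_isLact (p : T ⟶ P.X) : P.IsLact (p ≫ P.l ≫ G.one) p p :=
  ⟨by simp [G.one_s], P.one_lact _ _⟩

/-- The actions commute. -/
theorem IsLact.isRact (i : P.IsLact g p p') {q q' : T ⟶ P.X} (j : P.IsRact p h q)
    (k : P.IsLact g q q') : P.IsRact p' h q' := by
  obtain ⟨x, hx⟩ := exists_isRact (P := P) (p := p') (h := h) (by rw [i.r, j.w])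
  obtain ⟨y, hy, hy'⟩ := i.comm hx
  obtain rfl := hy.unique j
  obtain rfl := k.unique hy'
  exact hx

end HSBibundle

namespace HSHom

variable {P Q : HSBibundle G H} (f : HSHom P Q)

theorem isRact {p p' : T ⟶ P.X} {h : T ⟶ H.mor} (i : P.IsRact p h p') :
    Q.IsRact (p ≫ f.map) h (p' ≫ f.map) := by
  obtain ⟨e, rfl⟩ := i
  exact ⟨by rw [Category.assoc, f.map_r, e], (f.map_ract _ _ _ _).symm⟩

theorem isLact {p p' : T ⟶ P.X} {g : T ⟶ G.mor} (i : P.IsLact g p p') :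
    Q.IsLact g (p ≫ f.map) (p' ≫ f.map) := by
  obtain ⟨e, rfl⟩ := i
  exact ⟨by rw [Category.assoc, f.map_l, e], (f.map_lact _ _ _ _).symm⟩

theorem map_inj {p p' : T ⟶ P.X} (e : p ≫ f.map = p' ≫ f.map) : p = p' := by
  obtain ⟨h, hh⟩ := HSBibundle.exists_div (P := P) (p := p) (p' := p')
    (by rw [← f.map_l, reassoc_of% e])
  have h₁ := f.isRact hh
  rw [← e] at h₁
  have h₂ := h₁.eq_one
  rw [Category.assoc, reassoc_of% f.map_r] at h₂
  subst h₂
  exact (HSBibundle.isRact_one p).unique hh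

variable [NicePretopology W]

theorem map_surj (q : T ⟶ Q.X) : ∃ p : T ⟶ P.X, p ≫ f.map = q := by
  let w : Fp (q ≫ Q.l) P.l P.l_cover ⟶ T := Fp.fst _
  let p : Fp (q ≫ Q.l) P.l P.l_cover ⟶ P.X := Fp.snd _
  have hw : W w := Fp.fst_cover _
  have e : w ≫ q ≫ Q.l = p ≫ P.l := Fp.cond _
  obtain ⟨h, hh⟩ := HSBibundle.exists_div (P := Q) (p := p ≫ f.map) (p' := w ≫ q)
    (by rw [Category.assoc, f.map_l, Category.assoc, e])
  obtain ⟨p', hp'⟩ := HSBibundle.exists_isRact (P := P) (p := p) (h := h)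
    (by rw [← hh.w, Category.assoc, f.map_r])
  have k : p' ≫ f.map = w ≫ q := (f.isRact hp').unique hh
  obtain ⟨F, hF⟩ := exists_point_of_local (W := W) (T := T) (V := P.X)
    (fun w p => p ≫ f.map = w ≫ q) (fun v y x e => by rw [Category.assoc, e, Category.assoc])
    (fun e e' => f.map_inj (e.trans e'.symm)) hw k
  exact ⟨F, cover_cancel hw (by rw [reassoc_of% hF, k])⟩

end HSHom

namespace Composite

/-- The relation `p ⊗ q = n`. -/
def IsTen {P : HSBibundle G H} {Q : HSBibundle H K} (A : Composite P Q) (p : T ⟶ P.X)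
    (q : T ⟶ Q.X) (n : T ⟶ A.R.X) : Prop := ∃ e, A.ten p q e = n

variable {P : HSBibundle G H} {Q : HSBibundle H K} {A : Composite P Q} {p p' : T ⟶ P.X}
  {q q' : T ⟶ Q.X} {n n' : T ⟶ A.R.X}

theorem exists_isTen (e : p ≫ P.r = q ≫ Q.l) : ∃ n, A.IsTen p q n := ⟨_, e, rfl⟩

namespace IsTen

theorem w (i : A.IsTen p q n) : p ≫ P.r = q ≫ Q.l := i.choose

theorem l (i : A.IsTen p q n) : n ≫ A.R.l = p ≫ P.l := by
  obtain ⟨e, rfl⟩ := i; exact A.ten_l _ _ _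

theorem r (i : A.IsTen p q n) : n ≫ A.R.r = q ≫ Q.r := by
  obtain ⟨e, rfl⟩ := i; exact A.ten_r _ _ _

theorem nat (i : A.IsTen p q n) (v : T' ⟶ T) : A.IsTen (v ≫ p) (v ≫ q) (v ≫ n) := by
  obtain ⟨e, rfl⟩ := i
  exact ⟨by simpa using v ≫= e, A.ten_nat v p q e _⟩

theorem unique (i : A.IsTen p q n) (j : A.IsTen p q n') : n = n' := by
  obtain ⟨e, rfl⟩ := i; obtain ⟨e', rfl⟩ := j; rfl

theorem lact (i : A.IsTen p q n) {g : T ⟶ G.mor} (hp : P.IsLact g p p')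
    (hn : A.R.IsLact g n n') : A.IsTen p' q n' := by
  obtain ⟨e, rfl⟩ := i; obtain ⟨e₁, rfl⟩ := hp; obtain ⟨e₂, rfl⟩ := hn
  exact ⟨by rw [P.lact_r, e], (A.lact_ten g p q e e₁ e₂ _).symm⟩

theorem ract (i : A.IsTen p q n) {k : T ⟶ K.mor} (hq : Q.IsRact q k q')
    (hn : A.R.IsRact n k n') : A.IsTen p q' n' := by
  obtain ⟨e, rfl⟩ := i; obtain ⟨e₁, rfl⟩ := hq; obtain ⟨e₂, rfl⟩ := hn
  exact ⟨by rw [Q.ract_l, e], (A.ten_ract p q k e e₁ e₂ _).symm⟩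

theorem balanced {h : T ⟶ H.mor} (hp : P.IsRact p h p') (hq : Q.IsLact h q q')
    (i : A.IsTen p' q n) : A.IsTen p q' n := by
  obtain ⟨e, rfl⟩ := i; obtain ⟨e₁, rfl⟩ := hp; obtain ⟨e₂, rfl⟩ := hq
  exact ⟨by rw [Q.lact_l, e₁], (A.balanced p h q e₁ e₂ e _).symm⟩

end IsTen

variable [NicePretopology W] (A)

theorem exists_hom_tensorObj (B : TensorObj P Q) :
    ∃ f : HSHom B.composite.R A.R, ∀ {T : C} {p : T ⟶ P.X} {q : T ⟶ Q.X} {n : T ⟶ B.composite.R.X},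
      B.composite.IsTen p q n → A.IsTen p q (n ≫ f.map) := by
  obtain ⟨b, hb⟩ := B.desc (𝟙 B.N) (Z := A.R.X) (fun w p q e k => A.ten p q e)
    (by intros; exact A.ten_nat _ _ _ _ _) (by
      intro T' w p p' q q' e e' k k'
      obtain ⟨h, e₁, e₂, h₁, h₂⟩ := B.exactness _ _ _ _ e e' (k.trans k'.symm)
      have i : A.IsTen p q (A.ten p q e) := ⟨e, rfl⟩
      exact (i.balanced (h := h) ⟨e₁, h₁.symm⟩ ⟨e₂, h₂.symm⟩).unique ⟨e', rfl⟩)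
  obtain ⟨b, hb'⟩ : ∃ b : B.composite.R.X ⟶ A.R.X, ∀ {T : C} {p : T ⟶ P.X} {q : T ⟶ Q.X}
      {n : T ⟶ B.composite.R.X}, B.composite.IsTen p q n → A.IsTen p q (n ≫ b) := by
    refine ⟨b, ?_⟩
    rintro T p q n ⟨e, rfl⟩
    exact ⟨e, (hb _ p q e (Category.comp_id _).symm).symm⟩
  have surj : ∀ {T : C} (n : T ⟶ B.composite.R.X), ∃ (T' : C) (w : T' ⟶ T) (p : T' ⟶ P.X) (q : T' ⟶ Q.X),
      W w ∧ B.composite.IsTen p q (w ≫ n) := by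
    intro T n
    obtain ⟨T', w, p, q, e, hw, h⟩ := B.surj n
    exact ⟨T', w, p, q, hw, e, h⟩
  have hl : b ≫ A.R.l = B.composite.R.l := by
    obtain ⟨T', w, p, q, hw, h⟩ := surj (𝟙 B.composite.R.X)
    refine cover_cancel hw ?_
    rw [Category.comp_id] at h
    rw [← Category.assoc, (hb' h).l, h.l]
  have hr : b ≫ A.R.r = B.composite.R.r := by
    obtain ⟨T', w, p, q, hw, h⟩ := surj (𝟙 B.composite.R.X)
    refine cover_cancel hw ?_
    rw [Category.comp_id] at h
    rw [← Category.assoc, (hb' h).r, h.r]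
  refine ⟨⟨b, hl, hr, ?_, ?_⟩, hb'⟩
  · intro T g n e e'
    obtain ⟨T', w, p, q, hw, h⟩ := surj n
    obtain ⟨p', hp'⟩ := HSBibundle.exists_isLact (P := P) (g := w ≫ g) (p := p)
      (by rw [← h.l, Category.assoc, e, Category.assoc])
    refine cover_cancel hw ?_
    have i₁ : B.composite.R.IsLact g n (B.composite.R.lact g n e) := ⟨e, rfl⟩
    have i₂ : A.R.IsLact g (n ≫ b) (A.R.lact g (n ≫ b) e') := ⟨e', rfl⟩
    have j₁ := hb' (h.lact hp' (i₁.nat w))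
    have h₂ := hb' h
    rw [Category.assoc] at h₂
    have j₂ := h₂.lact hp' (i₂.nat w)
    exact (Category.assoc _ _ _).symm.trans (j₁.unique j₂)
  · intro T n g e e'
    obtain ⟨T', w, p, q, hw, h⟩ := surj n
    obtain ⟨p', hp'⟩ := HSBibundle.exists_isRact (P := Q) (h := w ≫ g) (p := q)
      (by rw [← h.r, Category.assoc, e, Category.assoc])
    refine cover_cancel hw ?_
    have i₁ : B.composite.R.IsRact n g (B.composite.R.ract n g e) := ⟨e, rfl⟩
    have i₂ : A.R.IsRact (n ≫ b) g (A.R.ract (n ≫ b) g e') := ⟨e', rfl⟩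
    have j₁ := hb' (h.ract hp' (i₁.nat w))
    have h₂ := hb' h
    rw [Category.assoc] at h₂
    have j₂ := h₂.ract hp' (i₂.nat w)
    exact (Category.assoc _ _ _).symm.trans (j₁.unique j₂)

variable {A}

theorem IsTen.exact (i : A.IsTen p q n) (j : A.IsTen p' q' n) :
    ∃ h, P.IsRact p' h p ∧ Q.IsLact h q q' := by
  obtain ⟨B⟩ := exists_tensorObj P Q
  obtain ⟨f, hf⟩ := A.exists_hom_tensorObj B
  obtain ⟨m, hm⟩ := exists_isTen (A := B.composite) i.w
  obtain ⟨m', hm'⟩ := exists_isTen (A := B.composite) j.w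
  have e : m = m' := f.map_inj (((hf hm).unique i).trans (j.unique (hf hm')))
  obtain ⟨h, e₁, e₂, h₁, h₂⟩ := B.exactness p p' q q' i.w j.w (by
    obtain ⟨_, k⟩ := hm
    obtain ⟨_, k'⟩ := hm'
    exact k.trans (e.trans k'.symm))
  exact ⟨h, ⟨e₁, h₁.symm⟩, e₂, h₂.symm⟩

variable (A) in
theorem surj (n : T ⟶ A.R.X) : ∃ (T' : C) (w : T' ⟶ T) (p : T' ⟶ P.X) (q : T' ⟶ Q.X),
    W w ∧ A.IsTen p q (w ≫ n) := by
  obtain ⟨B⟩ := exists_tensorObj P Q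
  obtain ⟨f, hf⟩ := A.exists_hom_tensorObj B
  obtain ⟨m, rfl⟩ := f.map_surj n
  obtain ⟨T', w, p, q, e, hw, h⟩ := B.surj m
  have : A.IsTen p q ((show T' ⟶ B.composite.R.X from w ≫ m) ≫ f.map) := hf ⟨e, h⟩
  change A.IsTen p q ((w ≫ m) ≫ f.map) at this
  rw [Category.assoc] at this
  exact ⟨T', w, p, q, hw, this⟩

end Composite

section Constructions

variable [NicePretopology W]

section Restrict

variable {F : Gpd.Fun K G} {P : HSBibundle G H}

theorem restrict_ext {x y : T ⟶ (restrict F P).X} (h₁ : x ≫ (restrict F P).l = y ≫ (restrict F P).l)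
    (h₂ : x ≫ restrictSnd = y ≫ restrictSnd) : x = y := Fp.ext _ h₁ h₂

theorem restrictSnd_l : (restrictSnd : (restrict F P).X ⟶ _) ≫ P.l = (restrict F P).l ≫ F.ob :=
  (Fp.cond _).symm

theorem restrictSnd_r : (restrictSnd : (restrict F P).X ⟶ _) ≫ P.r = (restrict F P).r := rfl

theorem exists_restrict (k : T ⟶ K.ob) (p : T ⟶ P.X) (e : k ≫ F.ob = p ≫ P.l) :
    ∃ x : T ⟶ (restrict F P).X, x ≫ (restrict F P).l = k ∧ x ≫ restrictSnd = p :=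
  ⟨Fp.lift _ k p e, Fp.lift_fst _ _ _ _, Fp.lift_snd _ _ _ _⟩

theorem restrict_isLact {k : T ⟶ K.mor} {x x' : T ⟶ (restrict F P).X}
    (i : (restrict F P).IsLact k x x') :
    P.IsLact (k ≫ F.mor) (x ≫ restrictSnd) (x' ≫ restrictSnd) := by
  obtain ⟨e, rfl⟩ := i
  exact ⟨by rw [Category.assoc, F.mor_s, Category.assoc, restrictSnd_l, reassoc_of% e],
    (Fp.lift_snd _ _ _ _).symm⟩

theorem restrict_isRact {h : T ⟶ H.mor} {x x' : T ⟶ (restrict F P).X}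
    (i : (restrict F P).IsRact x h x') :
    P.IsRact (x ≫ restrictSnd) h (x' ≫ restrictSnd) := by
  obtain ⟨e, rfl⟩ := i
  exact ⟨(Category.assoc _ _ _).trans e, (Fp.lift_snd _ _ _ _).symm⟩

theorem restrict_isLact_iff {k : T ⟶ K.mor} {x x' : T ⟶ (restrict F P).X} :
    (restrict F P).IsLact k x x' ↔ k ≫ K.s = x ≫ (restrict F P).l ∧
      x' ≫ (restrict F P).l = k ≫ K.t ∧
      P.IsLact (k ≫ F.mor) (x ≫ restrictSnd) (x' ≫ restrictSnd) := by
  refine ⟨fun i => ⟨i.w, i.l, restrict_isLact i⟩, fun ⟨h₁, h₂, h₃⟩ => ?_⟩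
  obtain ⟨y, hy⟩ := HSBibundle.exists_isLact h₁
  obtain rfl : y = x' := restrict_ext (hy.l.trans h₂.symm) ((restrict_isLact hy).unique h₃)
  exact hy

theorem restrict_isRact_iff {h : T ⟶ H.mor} {x x' : T ⟶ (restrict F P).X} :
    (restrict F P).IsRact x h x' ↔ x' ≫ (restrict F P).l = x ≫ (restrict F P).l ∧
      P.IsRact (x ≫ restrictSnd) h (x' ≫ restrictSnd) := by
  refine ⟨fun i => ⟨i.l, restrict_isRact i⟩, fun ⟨h₁, h₂⟩ => ?_⟩
  obtain ⟨y, hy⟩ := HSBibundle.exists_isRact (P := restrict F P) (p := x) (h := h)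
    ((Category.assoc _ _ _).symm.trans h₂.w)
  obtain rfl : y = x' := restrict_ext (hy.l.trans h₁.symm) ((restrict_isRact hy).unique h₂)
  exact hy

end Restrict

section Prod

variable {G' H' : Gpd W} {M : C} {a : G.ToTriv M} {a' : G'.ToTriv M}
    {b : H.ToTriv M} {b' : H'.ToTriv M} {hb : W b.map} {hb' : W b'.map}
    {P : HSBibundle G G'} {Q : HSBibundle H H'}
    {hP : P.l ≫ a.map = P.r ≫ a'.map} {hQ : Q.l ≫ b.map = Q.r ≫ b'.map}

local notation "PQ" => prodBibundle a a' b b' hb hb' P Q hP hQ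

theorem prod_ext {x y : T ⟶ (PQ).X} (h₁ : x ≫ prodFst = y ≫ prodFst)
    (h₂ : x ≫ prodSnd = y ≫ prodSnd) : x = y := Fp.ext _ h₁ h₂

theorem exists_prod (p : T ⟶ P.X) (q : T ⟶ Q.X) (e : p ≫ P.l ≫ a.map = q ≫ Q.l ≫ b.map) :
    ∃ x : T ⟶ (PQ).X, x ≫ prodFst = p ∧ x ≫ prodSnd = q :=
  ⟨Fp.lift _ p q e, Fp.lift_fst _ _ _ _, Fp.lift_snd _ _ _ _⟩

theorem prod_cond : (prodFst : (PQ).X ⟶ _) ≫ P.l ≫ a.map = prodSnd ≫ Q.l ≫ b.map := Fp.cond _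

theorem prod_l_fst : (PQ).l ≫ (fpFst a b hb).ob = prodFst ≫ P.l := fpOb_fst _ _ _

theorem prod_l_snd : (PQ).l ≫ (fpSnd a b hb).ob = prodSnd ≫ Q.l := fpOb_snd _ _ _

theorem prod_r_fst : (PQ).r ≫ (fpFst a' b' hb').ob = prodFst ≫ P.r := fpOb_fst _ _ _

theorem prod_r_snd : (PQ).r ≫ (fpSnd a' b' hb').ob = prodSnd ≫ Q.r := fpOb_snd _ _ _

theorem prod_isLact_iff {k : T ⟶ (fiberProd a b hb).mor} {x x' : T ⟶ (PQ).X} :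
    (PQ).IsLact k x x' ↔
      P.IsLact (k ≫ (fpFst a b hb).mor) (x ≫ prodFst) (x' ≫ prodFst) ∧
      Q.IsLact (k ≫ (fpSnd a b hb).mor) (x ≫ prodSnd) (x' ≫ prodSnd) := by
  constructor
  · rintro ⟨e, rfl⟩
    have e₁ := e =≫ (fpFst a b hb).ob
    have e₂ := e =≫ (fpSnd a b hb).ob
    simp only [Category.assoc, prod_l_fst, prod_l_snd, Gpd.Fun.s_ob] at e₁ e₂
    exact ⟨⟨by simpa using e₁, (Fp.lift_fst _ _ _ _).symm⟩,
      ⟨by simpa using e₂, (Fp.lift_snd _ _ _ _).symm⟩⟩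
  · rintro ⟨⟨e₁, h₁⟩, ⟨e₂, h₂⟩⟩
    refine ⟨fp_ob_ext ?_ ?_, prod_ext ((Fp.lift_fst _ _ _ _).trans h₁)
      ((Fp.lift_snd _ _ _ _).trans h₂)⟩
    · simpa [prod_l_fst, Gpd.Fun.s_ob] using e₁
    · simpa [prod_l_snd, Gpd.Fun.s_ob] using e₂

theorem prod_isRact_iff {k : T ⟶ (fiberProd a' b' hb').mor} {x x' : T ⟶ (PQ).X} :
    (PQ).IsRact x k x' ↔
      P.IsRact (x ≫ prodFst) (k ≫ (fpFst a' b' hb').mor) (x' ≫ prodFst) ∧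
      Q.IsRact (x ≫ prodSnd) (k ≫ (fpSnd a' b' hb').mor) (x' ≫ prodSnd) := by
  constructor
  · rintro ⟨e, rfl⟩
    have e₁ := e =≫ (fpFst a' b' hb').ob
    have e₂ := e =≫ (fpSnd a' b' hb').ob
    simp only [Category.assoc, prod_r_fst, prod_r_snd, Gpd.Fun.t_ob] at e₁ e₂
    exact ⟨⟨by simpa using e₁, (Fp.lift_fst _ _ _ _).symm⟩,
      ⟨by simpa using e₂, (Fp.lift_snd _ _ _ _).symm⟩⟩
  · rintro ⟨⟨e₁, h₁⟩, ⟨e₂, h₂⟩⟩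
    refine ⟨fp_ob_ext ?_ ?_, prod_ext ((Fp.lift_fst _ _ _ _).trans h₁)
      ((Fp.lift_snd _ _ _ _).trans h₂)⟩
    · simpa [prod_r_fst, Gpd.Fun.t_ob] using e₁
    · simpa [prod_r_snd, Gpd.Fun.t_ob] using e₂

end Prod

theorem exists_fpMor {M : C} {a : G.ToTriv M} {b : H.ToTriv M} {hb : W b.map} (g : T ⟶ G.mor)
    (h : T ⟶ H.mor) (e : g ≫ G.s ≫ a.map = h ≫ H.s ≫ b.map) :
    ∃ k : T ⟶ (fiberProd a b hb).mor, k ≫ (fpFst a b hb).mor = g ∧ k ≫ (fpSnd a b hb).mor = h :=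
  ⟨fpMor a b hb g h e, fpMor_fst _ _ _, fpMor_snd _ _ _⟩

theorem exists_fpOb {M : C} {a : G.ToTriv M} {b : H.ToTriv M} {hb : W b.map} (g : T ⟶ G.ob)
    (h : T ⟶ H.ob) (e : g ≫ a.map = h ≫ b.map) :
    ∃ k : T ⟶ (fiberProd a b hb).ob, k ≫ (fpFst a b hb).ob = g ∧ k ≫ (fpSnd a b hb).ob = h :=
  ⟨fpOb a b hb g h e, fpOb_fst _ _ _, fpOb_snd _ _ _⟩

theorem fiberProd_isMul_iff {M : C} {a : G.ToTriv M} {b : H.ToTriv M} {hb : W b.map}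
    {g h k : T ⟶ (fiberProd a b hb).mor} : (fiberProd a b hb).IsMul g h k ↔
      G.IsMul (g ≫ (fpFst a b hb).mor) (h ≫ (fpFst a b hb).mor) (k ≫ (fpFst a b hb).mor) ∧
      H.IsMul (g ≫ (fpSnd a b hb).mor) (h ≫ (fpSnd a b hb).mor) (k ≫ (fpSnd a b hb).mor) := by
  constructor
  · rintro ⟨e, rfl⟩
    exact ⟨⟨_, (Gpd.Fun.mul_mor _ _ _ _).symm⟩, ⟨_, (Gpd.Fun.mul_mor _ _ _ _).symm⟩⟩
  · rintro ⟨⟨e₁, h₁⟩, ⟨e₂, h₂⟩⟩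
    have e : g ≫ (fiberProd a b hb).s = h ≫ (fiberProd a b hb).t := fp_ob_ext
      (by simpa [Gpd.Fun.s_ob, Gpd.Fun.t_ob] using e₁)
      (by simpa [Gpd.Fun.s_ob, Gpd.Fun.t_ob] using e₂)
    exact ⟨e, fp_mor_ext ((Gpd.Fun.mul_mor _ _ _ _).trans h₁) ((Gpd.Fun.mul_mor _ _ _ _).trans h₂)⟩

end Constructions

end Relational

end HigherGpd

namespace HigherGpd

section Actions

variable {C : Type u} [Category.{v} C] {W : MorphismProperty C} [NicePretopology W]
  {𝒢 : CatGraph W} {E : Gpd W} {J : E.ToTriv 𝒢.M} {T T' : C}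

namespace CatGraph

namespace ActionMorphism

variable (act : 𝒢.ActionMorphism J)

/-- The left moment map to the objects of `E`. -/
noncomputable def l₁ : act.bun.X ⟶ E.ob := act.bun.l ≫ 𝒢.pr₁ J

/-- The left moment map to the objects of `G`. -/
noncomputable def l₂ : act.bun.X ⟶ 𝒢.G.ob := act.bun.l ≫ 𝒢.pr₂ J

theorem l₁_J : act.l₁ ≫ J.map = act.l₂ ≫ 𝒢.t.map := by
  rw [l₁, l₂, Category.assoc, Category.assoc]
  exact congrArg (act.bun.l ≫ ·) fp_cond

theorem l₂_s : act.l₂ ≫ 𝒢.s.map = act.bun.r ≫ J.map :=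
  (Category.assoc _ _ _).trans act.hJ

theorem l₂_s_assoc {Z : C} (f : 𝒢.M ⟶ Z) : act.l₂ ≫ 𝒢.s.map ≫ f = act.bun.r ≫ J.map ≫ f := by
  rw [← Category.assoc, l₂_s, Category.assoc]

variable {act}

theorem l_ext {p p' : T ⟶ act.bun.X} (h₁ : p ≫ act.l₁ = p' ≫ act.l₁)
    (h₂ : p ≫ act.l₂ = p' ≫ act.l₂) : p ≫ act.bun.l = p' ≫ act.bun.l :=
  fp_ob_ext ((Category.assoc _ _ _).trans (h₁.trans (Category.assoc _ _ _).symm))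
    ((Category.assoc _ _ _).trans (h₂.trans (Category.assoc _ _ _).symm))

theorem exists_local (e : T ⟶ E.ob) (g : T ⟶ 𝒢.G.ob) (h : e ≫ J.map = g ≫ 𝒢.t.map) :
    ∃ (T' : C) (w : T' ⟶ T) (p : T' ⟶ act.bun.X), W w ∧ p ≫ act.l₁ = w ≫ e ∧ p ≫ act.l₂ = w ≫ g := by
  obtain ⟨k, hk₁, hk₂⟩ := exists_fpOb (hb := 𝒢.t_cover) e g h
  refine ⟨_, Fp.fst (f := k) act.bun.l_cover, Fp.snd act.bun.l_cover, Fp.fst_cover _, ?_, ?_⟩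
  · rw [l₁, ← Category.assoc, ← Fp.cond, Category.assoc]
    exact congrArg (_ ≫ ·) hk₁
  · rw [l₂, ← Category.assoc, ← Fp.cond, Category.assoc]
    exact congrArg (_ ≫ ·) hk₂

variable (act)

/-- The relation `(ε, 1) * p = p'` for an arrow `ε` of `E`. -/
def IsLE (ε : T ⟶ E.mor) (p p' : T ⟶ act.bun.X) : Prop :=
  ∃ k : T ⟶ (𝒢.prod J).mor, k ≫ (fpFst J 𝒢.t 𝒢.t_cover).mor = ε ∧
    k ≫ (fpSnd J 𝒢.t 𝒢.t_cover).mor = (p ≫ act.l₂) ≫ 𝒢.G.one ∧ act.bun.IsLact k p p'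

/-- The relation `(1, g) * p = p'` for an arrow `g` of `G`. -/
def IsLG (g : T ⟶ 𝒢.G.mor) (p p' : T ⟶ act.bun.X) : Prop :=
  ∃ k : T ⟶ (𝒢.prod J).mor, k ≫ (fpFst J 𝒢.t 𝒢.t_cover).mor = (p ≫ act.l₁) ≫ E.one ∧
    k ≫ (fpSnd J 𝒢.t 𝒢.t_cover).mor = g ∧ act.bun.IsLact k p p'

variable {act}

section

variable {k : T ⟶ (𝒢.prod J).mor} {p p' p'' q q' : T ⟶ act.bun.X} {ε ε' ε'' : T ⟶ E.mor}
  {g g' g'' : T ⟶ 𝒢.G.mor}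

theorem isLact_w₁ (i : act.bun.IsLact k p p') :
    (k ≫ (fpFst J 𝒢.t 𝒢.t_cover).mor) ≫ E.s = p ≫ act.l₁ := by
  have := i.w =≫ (fpFst J 𝒢.t 𝒢.t_cover).ob
  simp only [Category.assoc, Gpd.Fun.s_ob] at this ⊢
  exact this

theorem isLact_w₂ (i : act.bun.IsLact k p p') :
    (k ≫ (fpSnd J 𝒢.t 𝒢.t_cover).mor) ≫ 𝒢.G.s = p ≫ act.l₂ := by
  have := i.w =≫ (fpSnd J 𝒢.t 𝒢.t_cover).ob
  simp only [Category.assoc, Gpd.Fun.s_ob] at this ⊢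
  exact this

theorem isLact_l₁ (i : act.bun.IsLact k p p') :
    p' ≫ act.l₁ = (k ≫ (fpFst J 𝒢.t 𝒢.t_cover).mor) ≫ E.t := by
  have := i.l =≫ (fpFst J 𝒢.t 𝒢.t_cover).ob
  simp only [Category.assoc, Gpd.Fun.t_ob] at this ⊢
  exact this

theorem isLact_l₂ (i : act.bun.IsLact k p p') :
    p' ≫ act.l₂ = (k ≫ (fpSnd J 𝒢.t 𝒢.t_cover).mor) ≫ 𝒢.G.t := by
  have := i.l =≫ (fpSnd J 𝒢.t 𝒢.t_cover).ob
  simp only [Category.assoc, Gpd.Fun.t_ob] at this ⊢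
  exact this

theorem exists_isLact (e : ε ≫ E.s = p ≫ act.l₁) (e' : g ≫ 𝒢.G.s = p ≫ act.l₂) :
    ∃ (k : T ⟶ (𝒢.prod J).mor) (p' : T ⟶ act.bun.X), k ≫ (fpFst J 𝒢.t 𝒢.t_cover).mor = ε ∧
      k ≫ (fpSnd J 𝒢.t 𝒢.t_cover).mor = g ∧ act.bun.IsLact k p p' := by
  obtain ⟨k, h₁, h₂⟩ := exists_fpMor (hb := 𝒢.t_cover) (a := J) (b := 𝒢.t) ε g (by
    rw [reassoc_of% e, reassoc_of% e', l₁_J])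
  obtain ⟨p', hp'⟩ := HSBibundle.exists_isLact (P := act.bun) (g := k) (p := p)
    (fp_ob_ext (by
      rw [Category.assoc, Category.assoc, Gpd.Fun.s_ob, ← Category.assoc, h₁]; exact e) (by
      rw [Category.assoc, Category.assoc, Gpd.Fun.s_ob, ← Category.assoc, h₂]; exact e'))
  exact ⟨k, p', h₁, h₂, hp'⟩

theorem exists_isLE (e : ε ≫ E.s = p ≫ act.l₁) : ∃ p', act.IsLE ε p p' := by
  obtain ⟨k, p', h₁, h₂, h⟩ := exists_isLact (g := (p ≫ act.l₂) ≫ 𝒢.G.one) e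
    (by simp [𝒢.G.one_s])
  exact ⟨p', k, h₁, h₂, h⟩

theorem exists_isLG (e : g ≫ 𝒢.G.s = p ≫ act.l₂) : ∃ p', act.IsLG g p p' := by
  obtain ⟨k, p', h₁, h₂, h⟩ := exists_isLact (ε := (p ≫ act.l₁) ≫ E.one) (by simp [E.one_s]) e
  exact ⟨p', k, h₁, h₂, h⟩

theorem isLact_ext {k k' : T ⟶ (𝒢.prod J).mor} (i : act.bun.IsLact k p p')
    (j : act.bun.IsLact k' p p'')
    (h₁ : k ≫ (fpFst J 𝒢.t 𝒢.t_cover).mor = k' ≫ (fpFst J 𝒢.t 𝒢.t_cover).mor)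
    (h₂ : k ≫ (fpSnd J 𝒢.t 𝒢.t_cover).mor = k' ≫ (fpSnd J 𝒢.t 𝒢.t_cover).mor) : p' = p'' := by
  obtain rfl := fp_mor_ext h₁ h₂
  exact i.unique j

namespace IsLE

theorem w (i : act.IsLE ε p p') : ε ≫ E.s = p ≫ act.l₁ := by
  obtain ⟨k, rfl, h, i⟩ := i; exact isLact_w₁ i

theorem l₁ (i : act.IsLE ε p p') : p' ≫ act.l₁ = ε ≫ E.t := by
  obtain ⟨k, rfl, h, i⟩ := i; exact isLact_l₁ i

theorem l₂ (i : act.IsLE ε p p') : p' ≫ act.l₂ = p ≫ act.l₂ := by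
  obtain ⟨k, rfl, h, i⟩ := i
  rw [isLact_l₂ i, h]; simp [𝒢.G.one_t]

theorem unique (i : act.IsLE ε p p') (j : act.IsLE ε p p'') : p' = p'' := by
  obtain ⟨k, rfl, h, i⟩ := i
  obtain ⟨k', h', h'', j⟩ := j
  exact isLact_ext i j h'.symm (h.trans h''.symm)

end IsLE

namespace IsLG

theorem w (i : act.IsLG g p p') : g ≫ 𝒢.G.s = p ≫ act.l₂ := by
  obtain ⟨k, h, rfl, i⟩ := i; exact isLact_w₂ i

theorem l₁ (i : act.IsLG g p p') : p' ≫ act.l₁ = p ≫ act.l₁ := by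
  obtain ⟨k, h, rfl, i⟩ := i
  rw [isLact_l₁ i, h]; simp [E.one_t]

theorem l₂ (i : act.IsLG g p p') : p' ≫ act.l₂ = g ≫ 𝒢.G.t := by
  obtain ⟨k, h, rfl, i⟩ := i; exact isLact_l₂ i

theorem r (i : act.IsLG g p p') : p' ≫ act.bun.r = p ≫ act.bun.r := by
  obtain ⟨k, h, rfl, i⟩ := i; exact i.r

theorem unique (i : act.IsLG g p p') (j : act.IsLG g p p'') : p' = p'' := by
  obtain ⟨k, h, rfl, i⟩ := i
  obtain ⟨k', h'', h', j⟩ := j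
  exact isLact_ext i j (h.trans h''.symm) h'.symm

end IsLG

theorem isLact_iff_LG_LE : act.bun.IsLact k p p' ↔
    ∃ q, act.IsLG (k ≫ (fpSnd J 𝒢.t 𝒢.t_cover).mor) p q ∧
      act.IsLE (k ≫ (fpFst J 𝒢.t 𝒢.t_cover).mor) q p' := by
  have key : ∀ {p p' q : T ⟶ act.bun.X}, act.IsLG (k ≫ (fpSnd J 𝒢.t 𝒢.t_cover).mor) p q →
      act.IsLE (k ≫ (fpFst J 𝒢.t 𝒢.t_cover).mor) q p' → act.bun.IsLact k p p' := by
    intro p p' q i j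
    have h₁ := j.w
    have h₂ := i.l₂
    have h₃ := i.l₁
    obtain ⟨k₂, a, b, i⟩ := i
    obtain ⟨k₁, c, d, j⟩ := j
    refine i.mul j (fiberProd_isMul_iff.2 ⟨?_, ?_⟩)
    · rw [c, a, ← h₃, ← h₁, Category.assoc]; exact Gpd.isMul_one _
    · rw [b, d, h₂, Category.assoc]; exact Gpd.one_isMul _
  refine ⟨fun i => ?_, fun ⟨q, i, j⟩ => key i j⟩
  obtain ⟨q, hq⟩ := exists_isLG (act := act) (isLact_w₂ i)
  obtain ⟨r, hr⟩ := exists_isLE (act := act) (p := q) (ε := k ≫ (fpFst J 𝒢.t 𝒢.t_cover).mor)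
    (by rw [hq.l₁, isLact_w₁ i])
  exact ⟨q, hq, (key hq hr).unique i ▸ hr⟩

theorem isLact_iff_LE_LG : act.bun.IsLact k p p' ↔
    ∃ q, act.IsLE (k ≫ (fpFst J 𝒢.t 𝒢.t_cover).mor) p q ∧
      act.IsLG (k ≫ (fpSnd J 𝒢.t 𝒢.t_cover).mor) q p' := by
  have key : ∀ {p p' q : T ⟶ act.bun.X}, act.IsLE (k ≫ (fpFst J 𝒢.t 𝒢.t_cover).mor) p q →
      act.IsLG (k ≫ (fpSnd J 𝒢.t 𝒢.t_cover).mor) q p' → act.bun.IsLact k p p' := by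
    intro p p' q i j
    have h₁ := j.w
    have h₂ := i.l₁
    have h₃ := i.l₂
    obtain ⟨k₂, a, b, i⟩ := i
    obtain ⟨k₁, c, d, j⟩ := j
    refine i.mul j (fiberProd_isMul_iff.2 ⟨?_, ?_⟩)
    · rw [c, a, h₂, Category.assoc]; exact Gpd.one_isMul _
    · rw [b, d, ← h₃, ← h₁, Category.assoc]; exact Gpd.isMul_one _
  refine ⟨fun i => ?_, fun ⟨q, i, j⟩ => key i j⟩
  obtain ⟨q, hq⟩ := exists_isLE (act := act) (isLact_w₁ i)
  obtain ⟨r, hr⟩ := exists_isLG (act := act) (p := q) (g := k ≫ (fpSnd J 𝒢.t 𝒢.t_cover).mor)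
    (by rw [hq.l₂, isLact_w₂ i])
  exact ⟨q, hq, (key hq hr).unique i ▸ hr⟩

theorem isRact_l₁ {h : T ⟶ E.mor} (j : act.bun.IsRact p h q) : q ≫ act.l₁ = p ≫ act.l₁ := by
  rw [ActionMorphism.l₁, ← Category.assoc, j.l, Category.assoc]

theorem isRact_l₂ {h : T ⟶ E.mor} (j : act.bun.IsRact p h q) : q ≫ act.l₂ = p ≫ act.l₂ := by
  rw [ActionMorphism.l₂, ← Category.assoc, j.l, Category.assoc]

end

end ActionMorphism

end CatGraph

end Actions

end HigherGpd

namespace HigherGpd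

section Relational

variable {C : Type u} [Category.{v} C] {W : MorphismProperty C} {G H : Gpd W} {T : C}

namespace Gpd

variable {g g' h h' k k' : T ⟶ G.mor}

theorem isMul_one_of {x : T ⟶ G.ob} (e : g ≫ G.s = x) : G.IsMul g (x ≫ G.one) g := by
  subst e; rw [Category.assoc]; exact isMul_one g

theorem one_isMul_of {x : T ⟶ G.ob} (e : g ≫ G.t = x) : G.IsMul (x ≫ G.one) g g := by
  subst e; rw [Category.assoc]; exact one_isMul g

theorem IsMul.unique (i : G.IsMul g h k) (j : G.IsMul g h k') : k = k' := by
  obtain ⟨e, rfl⟩ := i; obtain ⟨e', rfl⟩ := j; rfl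

theorem IsMul.assoc {gh hk ghk : T ⟶ G.mor} (i : G.IsMul g h gh) (j : G.IsMul gh k ghk)
    (l : G.IsMul h k hk) : G.IsMul g hk ghk := by
  obtain ⟨e₁, rfl⟩ := i; obtain ⟨e₂, rfl⟩ := j; obtain ⟨e₃, rfl⟩ := l
  exact ⟨by rw [e₁, G.mul_t], (G.mul_assoc _ _ _ _ _ _ _).symm⟩

theorem inv_isMul (g : T ⟶ G.mor) : G.IsMul (g ≫ G.inv) g ((g ≫ G.s) ≫ G.one) :=
  ⟨by rw [Category.assoc, G.inv_s], (G.inv_mul g _).trans (Category.assoc _ _ _).symm⟩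

theorem IsMul.left_inv (i : G.IsMul g h k) : G.IsMul (g ≫ G.inv) k h :=
  (inv_isMul g).assoc (one_isMul_of i.w.symm) i

theorem IsMul.unique_right (i : G.IsMul g h k) (j : G.IsMul g h' k) : h = h' :=
  i.left_inv.unique j.left_inv

theorem IsMul.eq_one {x : T ⟶ G.ob} (i : G.IsMul g h g) (e : g ≫ G.s = x) : h = x ≫ G.one :=
  i.unique_right (isMul_one_of e)

end Gpd

namespace HSBibundle

variable {P : HSBibundle G H} {p : T ⟶ P.X}

theorem isRact_one_of {x : T ⟶ H.ob} (e : p ≫ P.r = x) : P.IsRact p (x ≫ H.one) p := by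
  subst e; rw [Category.assoc]; exact isRact_one p

theorem one_isLact_of {x : T ⟶ G.ob} (e : p ≫ P.l = x) : P.IsLact (x ≫ G.one) p p := by
  subst e; rw [Category.assoc]; exact one_isLact p

end HSBibundle

end Relational


section Actions

variable {C : Type u} [Category.{v} C] {W : MorphismProperty C} [NicePretopology W]
  {𝒢 : CatGraph W} {E : Gpd W} {J : E.ToTriv 𝒢.M} {T T' : C}

namespace CatGraph

section Products

variable {act : 𝒢.ActionMorphism J} {mul : 𝒢.MulMorphism}

/-- The first component of an element of `act × id`. -/
noncomputable def actIdFst : (actId act).X ⟶ act.bun.X := prodFst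

/-- The second component of an element of `act × id`. -/
noncomputable def actIdSnd : (actId act).X ⟶ 𝒢.G.mor := prodSnd

/-- The first component of an element of `id × mul`. -/
noncomputable def idMulFst : (idMul (J := J) mul).X ⟶ E.mor := prodFst

/-- The second component of an element of `id × mul`. -/
noncomputable def idMulSnd : (idMul (J := J) mul).X ⟶ mul.bun.X := prodSnd

theorem actId_ext {x y : T ⟶ (actId act).X} (h₁ : x ≫ actIdFst = y ≫ actIdFst)
    (h₂ : x ≫ actIdSnd = y ≫ actIdSnd) : x = y := prod_ext h₁ h₂

theorem idMul_ext {x y : T ⟶ (idMul (J := J) mul).X} (h₁ : x ≫ idMulFst = y ≫ idMulFst)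
    (h₂ : x ≫ idMulSnd = y ≫ idMulSnd) : x = y := prod_ext h₁ h₂

theorem exists_actId (p : T ⟶ act.bun.X) (g : T ⟶ 𝒢.G.mor)
    (e : (p ≫ act.bun.r) ≫ J.map = (g ≫ 𝒢.G.t) ≫ 𝒢.t.map) :
    ∃ x : T ⟶ (actId act).X, x ≫ actIdFst = p ∧ x ≫ actIdSnd = g :=
  exists_prod (P := act.bun) (Q := unitBibundle 𝒢.G) p g (by
    rw [act.hJ, ← Category.assoc, e]; exact Category.assoc _ _ _)

theorem exists_idMul (f : T ⟶ E.mor) (m : T ⟶ mul.bun.X)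
    (e : (f ≫ E.t) ≫ J.map = (m ≫ mul.bun.r) ≫ 𝒢.t.map) :
    ∃ x : T ⟶ (idMul (J := J) mul).X, x ≫ idMulFst = f ∧ x ≫ idMulSnd = m :=
  exists_prod (P := unitBibundle E) (Q := mul.bun) f m (by
    rw [mul.ht, ← Category.assoc m, ← e]; exact (Category.assoc _ _ _).symm)

theorem actId_cond (x : T ⟶ (actId act).X) :
    ((x ≫ actIdFst) ≫ act.bun.r) ≫ J.map = ((x ≫ actIdSnd) ≫ 𝒢.G.t) ≫ 𝒢.t.map := by
  have := x ≫= prod_cond (P := act.bun) (Q := unitBibundle 𝒢.G) (a := 𝒢.prodJ J) (a' := J)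
    (b := 𝒢.t) (b' := 𝒢.t) (hb := 𝒢.t_cover) (hb' := 𝒢.t_cover) (hP := act.hJ)
    (hQ := 𝒢.t.inv.symm)
  rw [Category.assoc, ← act.hJ]
  refine (Category.assoc _ _ _).trans (this.trans ?_)
  simp only [Category.assoc]; rfl

theorem idMul_cond (x : T ⟶ (idMul (J := J) mul).X) :
    ((x ≫ idMulFst) ≫ E.t) ≫ J.map = ((x ≫ idMulSnd) ≫ mul.bun.r) ≫ 𝒢.t.map := by
  have := x ≫= prod_cond (P := unitBibundle E) (Q := mul.bun) (a := J) (a' := J)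
    (b := toTrivFst 𝒢.s 𝒢.t 𝒢.t_cover 𝒢.t) (b' := 𝒢.t) (hb := 𝒢.toTrivFst_cover)
    (hb' := 𝒢.t_cover) (hP := J.inv.symm) (hQ := mul.ht)
  rw [Category.assoc _ mul.bun.r, ← mul.ht]
  refine Eq.trans ?_ (this.trans (Category.assoc _ _ _).symm)
  simp only [Category.assoc]; rfl

theorem actId_r_fst (x : T ⟶ (actId act).X) :
    (x ≫ (actId act).r) ≫ 𝒢.pr₁ J = (x ≫ actIdFst) ≫ act.bun.r :=
  (Category.assoc _ _ _).trans ((x ≫= fpOb_fst _ _ _).trans (Category.assoc _ _ _).symm)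

theorem actId_r_snd (x : T ⟶ (actId act).X) :
    (x ≫ (actId act).r) ≫ 𝒢.pr₂ J = (x ≫ actIdSnd) ≫ 𝒢.G.s :=
  (Category.assoc _ _ _).trans ((x ≫= fpOb_snd _ _ _).trans (Category.assoc _ _ _).symm)

theorem actId_l_fst (x : T ⟶ (actId act).X) :
    (x ≫ (actId act).l) ≫ 𝒢.pr₁ (𝒢.prodJ J) = (x ≫ actIdFst) ≫ act.bun.l :=
  (Category.assoc _ _ _).trans ((x ≫= fpOb_fst _ _ _).trans (Category.assoc _ _ _).symm)

theorem actId_l_snd (x : T ⟶ (actId act).X) :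
    (x ≫ (actId act).l) ≫ 𝒢.pr₂ (𝒢.prodJ J) = (x ≫ actIdSnd) ≫ 𝒢.G.t :=
  (Category.assoc _ _ _).trans ((x ≫= fpOb_snd _ _ _).trans (Category.assoc _ _ _).symm)

theorem idMul_r_fst (x : T ⟶ (idMul (J := J) mul).X) :
    (x ≫ (idMul (J := J) mul).r) ≫ 𝒢.pr₁ J = (x ≫ idMulFst) ≫ E.s :=
  (Category.assoc _ _ _).trans ((x ≫= fpOb_fst _ _ _).trans (Category.assoc _ _ _).symm)

theorem idMul_r_snd (x : T ⟶ (idMul (J := J) mul).X) :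
    (x ≫ (idMul (J := J) mul).r) ≫ 𝒢.pr₂ J = (x ≫ idMulSnd) ≫ mul.bun.r :=
  (Category.assoc _ _ _).trans ((x ≫= fpOb_snd _ _ _).trans (Category.assoc _ _ _).symm)

theorem idMul_l_fst (x : T ⟶ (idMul (J := J) mul).X) :
    (x ≫ (idMul (J := J) mul).l) ≫
      (fpFst J (toTrivFst 𝒢.s 𝒢.t 𝒢.t_cover 𝒢.t) 𝒢.toTrivFst_cover).ob =
      (x ≫ idMulFst) ≫ E.t :=
  (Category.assoc _ _ _).trans ((x ≫= fpOb_fst _ _ _).trans (Category.assoc _ _ _).symm)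

theorem idMul_l_snd (x : T ⟶ (idMul (J := J) mul).X) :
    (x ≫ (idMul (J := J) mul).l) ≫
      (fpSnd J (toTrivFst 𝒢.s 𝒢.t 𝒢.t_cover 𝒢.t) 𝒢.toTrivFst_cover).ob =
      (x ≫ idMulSnd) ≫ mul.bun.l :=
  (Category.assoc _ _ _).trans ((x ≫= fpOb_snd _ _ _).trans (Category.assoc _ _ _).symm)

theorem actId_isRact_iff {k : T ⟶ (𝒢.prod J).mor} {x x' : T ⟶ (actId act).X} :
    (actId act).IsRact x k x' ↔
      act.bun.IsRact (x ≫ actIdFst) (k ≫ (fpFst J 𝒢.t 𝒢.t_cover).mor) (x' ≫ actIdFst) ∧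
      𝒢.G.IsMul (x ≫ actIdSnd) (k ≫ (fpSnd J 𝒢.t 𝒢.t_cover).mor) (x' ≫ actIdSnd) :=
  prod_isRact_iff

theorem actId_isLact_iff {k : T ⟶ (𝒢.prod (𝒢.prodJ J)).mor} {x x' : T ⟶ (actId act).X} :
    (actId act).IsLact k x x' ↔
      act.bun.IsLact (k ≫ (fpFst (𝒢.prodJ J) 𝒢.t 𝒢.t_cover).mor) (x ≫ actIdFst)
        (x' ≫ actIdFst) ∧
      𝒢.G.IsMul (k ≫ (fpSnd (𝒢.prodJ J) 𝒢.t 𝒢.t_cover).mor) (x ≫ actIdSnd) (x' ≫ actIdSnd) :=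
  prod_isLact_iff

theorem idMul_isRact_iff {k : T ⟶ (𝒢.prod J).mor} {x x' : T ⟶ (idMul (J := J) mul).X} :
    (idMul (J := J) mul).IsRact x k x' ↔
      E.IsMul (x ≫ idMulFst) (k ≫ (fpFst J 𝒢.t 𝒢.t_cover).mor) (x' ≫ idMulFst) ∧
      mul.bun.IsRact (x ≫ idMulSnd) (k ≫ (fpSnd J 𝒢.t 𝒢.t_cover).mor) (x' ≫ idMulSnd) :=
  prod_isRact_iff

theorem idMul_isLact_iff
    {k : T ⟶ (fiberProd J (toTrivFst 𝒢.s 𝒢.t 𝒢.t_cover 𝒢.t) 𝒢.toTrivFst_cover).mor}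
    {x x' : T ⟶ (idMul (J := J) mul).X} :
    (idMul (J := J) mul).IsLact k x x' ↔
      E.IsMul (k ≫ (fpFst J (toTrivFst 𝒢.s 𝒢.t 𝒢.t_cover 𝒢.t) 𝒢.toTrivFst_cover).mor)
        (x ≫ idMulFst) (x' ≫ idMulFst) ∧
      mul.bun.IsLact (k ≫ (fpSnd J (toTrivFst 𝒢.s 𝒢.t 𝒢.t_cover 𝒢.t) 𝒢.toTrivFst_cover).mor)
        (x ≫ idMulSnd) (x' ≫ idMulSnd) :=
  prod_isLact_iff

end Products

section Tensors

variable (act : 𝒢.ActionMorphism J) (mul : 𝒢.MulMorphism)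

/-- The relation `(a, 1) ⊗ b = n`. -/
def TenL (a b : T ⟶ act.bun.X) (n : T ⟶ (comp (actId act) act.bun).R.X) : Prop :=
  ∃ x : T ⟶ (actId act).X, x ≫ actIdFst = a ∧ x ≫ actIdSnd = (b ≫ act.l₂) ≫ 𝒢.G.one ∧
    (comp (actId act) act.bun).IsTen x b n

/-- The relation `(1, m) ⊗ c = n`. -/
def TenR (m : T ⟶ mul.bun.X) (c : T ⟶ act.bun.X)
    (n : T ⟶ (comp (idMul (J := J) mul) act.bun).R.X) : Prop :=
  ∃ y : T ⟶ (idMul (J := J) mul).X, y ≫ idMulFst = (c ≫ act.l₁) ≫ E.one ∧ y ≫ idMulSnd = m ∧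
    (comp (idMul mul) act.bun).IsTen y c n

variable {act mul} {a a' b b' c c' : T ⟶ act.bun.X} {m m' : T ⟶ mul.bun.X}

theorem isTen_actId_fst {x : T ⟶ (actId act).X} {n : T ⟶ (comp (actId act) act.bun).R.X}
    (i : (comp (actId act) act.bun).IsTen x b n) : (x ≫ actIdFst) ≫ act.bun.r = b ≫ act.l₁ := by
  rw [← actId_r_fst, i.w, Category.assoc]; rfl

theorem isTen_actId_snd {x : T ⟶ (actId act).X} {n : T ⟶ (comp (actId act) act.bun).R.X}
    (i : (comp (actId act) act.bun).IsTen x b n) : (x ≫ actIdSnd) ≫ 𝒢.G.s = b ≫ act.l₂ := by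
  rw [← actId_r_snd, i.w, Category.assoc]; rfl

theorem isTen_idMul_fst {x : T ⟶ (idMul (J := J) mul).X}
    {n : T ⟶ (comp (idMul (J := J) mul) act.bun).R.X}
    (i : (comp (idMul (J := J) mul) act.bun).IsTen x c n) :
    (x ≫ idMulFst) ≫ E.s = c ≫ act.l₁ := by
  rw [← idMul_r_fst, i.w, Category.assoc]; rfl

theorem isTen_idMul_snd {x : T ⟶ (idMul (J := J) mul).X}
    {n : T ⟶ (comp (idMul (J := J) mul) act.bun).R.X}
    (i : (comp (idMul (J := J) mul) act.bun).IsTen x c n) :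
    (x ≫ idMulSnd) ≫ mul.bun.r = c ≫ act.l₂ := by
  rw [← idMul_r_snd, i.w, Category.assoc]; rfl

namespace TenL

variable {n n' : T ⟶ (comp (actId act) act.bun).R.X}

theorem exists_of (h : a ≫ act.bun.r = b ≫ act.l₁) : ∃ n, TenL act a b n := by
  obtain ⟨x, h₁, h₂⟩ := exists_actId (act := act) a ((b ≫ act.l₂) ≫ 𝒢.G.one) (by
      simp [h, ActionMorphism.l₁_J, 𝒢.G.one_t])
  obtain ⟨n, hn⟩ := Composite.exists_isTen (A := comp (actId act) act.bun) (p := x) (q := b)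
    (fp_ob_ext ((actId_r_fst x).trans (by rw [h₁, h, Category.assoc]; rfl))
      ((actId_r_snd x).trans (by
        rw [h₂, Category.assoc, 𝒢.G.one_s, Category.comp_id, Category.assoc]; rfl)))
  exact ⟨n, x, h₁, h₂, hn⟩

theorem w (i : TenL act a b n) : a ≫ act.bun.r = b ≫ act.l₁ := by
  obtain ⟨x, rfl, h, i⟩ := i
  exact isTen_actId_fst i

theorem unique (i : TenL act a b n) (j : TenL act a b n') : n = n' := by
  obtain ⟨x, h₁, h₂, i⟩ := i
  obtain ⟨y, k₁, k₂, j⟩ := j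
  obtain rfl : x = y := actId_ext (h₁.trans k₁.symm) (h₂.trans k₂.symm)
  exact i.unique j

theorem nat (i : TenL act a b n) (v : T' ⟶ T) : TenL act (v ≫ a) (v ≫ b) (v ≫ n) := by
  obtain ⟨x, h₁, h₂, i⟩ := i
  exact ⟨v ≫ x, by rw [Category.assoc, h₁], by rw [Category.assoc, h₂]; simp, i.nat v⟩

theorem l_fst (i : TenL act a b n) :
    (n ≫ (comp (actId act) act.bun).R.l) ≫ 𝒢.pr₁ (𝒢.prodJ J) = a ≫ act.bun.l := by
  obtain ⟨x, rfl, h₂, i⟩ := i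
  rw [i.l, actId_l_fst]

theorem l_snd (i : TenL act a b n) :
    (n ≫ (comp (actId act) act.bun).R.l) ≫ 𝒢.pr₂ (𝒢.prodJ J) = b ≫ act.l₂ := by
  obtain ⟨x, h₁, h₂, i⟩ := i
  rw [i.l, actId_l_snd, h₂, Category.assoc, 𝒢.G.one_t, Category.comp_id]

theorem r (i : TenL act a b n) : n ≫ (comp (actId act) act.bun).R.r = b ≫ act.bun.r := by
  obtain ⟨x, h₁, h₂, i⟩ := i
  exact i.r

/-- An arrow of `G` in the second component of the first tensor factor can be moved across. -/
theorem of_isTen {x₀ : T ⟶ (actId act).X} {b₀ : T ⟶ act.bun.X}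
    (i : (comp (actId act) act.bun).IsTen x₀ b₀ n) (j : act.IsLG (x₀ ≫ actIdSnd) b₀ b) :
    TenL act (x₀ ≫ actIdFst) b n := by
  have j₂ := j.l₂
  obtain ⟨k, k₁, k₂, j⟩ := j
  obtain ⟨x, h₁, h₂⟩ := exists_actId (act := act) (x₀ ≫ actIdFst)
    ((x₀ ≫ actIdSnd) ≫ 𝒢.G.t ≫ 𝒢.G.one) (by
      rw [actId_cond]; simp [𝒢.G.one_t])
  refine ⟨x, h₁, ?_, i.balanced (actId_isRact_iff.2 ⟨?_, ?_⟩) j⟩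
  · rw [h₂, j₂, Category.assoc (x₀ ≫ actIdSnd)]
  · rw [h₁, k₁]
    exact HSBibundle.isRact_one_of (isTen_actId_fst i)
  · rw [h₂, k₂, ← Category.assoc (x₀ ≫ actIdSnd)]
    exact Gpd.one_isMul_of rfl

theorem surj (n : T ⟶ (comp (actId act) act.bun).R.X) :
    ∃ (T' : C) (w : T' ⟶ T) (a b : T' ⟶ act.bun.X), W w ∧ TenL act a b (w ≫ n) := by
  obtain ⟨T', w, x₀, b₀, hw, i⟩ := Composite.surj _ n
  obtain ⟨b, hb⟩ := ActionMorphism.exists_isLG (act := act) (isTen_actId_snd i)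
  exact ⟨T', w, _, b, hw, of_isTen i hb⟩

theorem exact (i : TenL act a b n) (j : TenL act a' b' n) :
    ∃ k, act.bun.IsRact a' k a ∧ act.IsLE k b b' := by
  have ib := i.l_snd.symm.trans j.l_snd
  obtain ⟨x, rfl, h₂, i⟩ := i
  obtain ⟨x', rfl, h₂', j⟩ := j
  obtain ⟨h, e₁, e₂⟩ := i.exact j
  obtain ⟨e₃, e₄⟩ := actId_isRact_iff.1 e₁
  refine ⟨_, e₃, h, rfl, ?_, e₂⟩
  rw [h₂, h₂', ib] at e₄
  rw [ib]
  exact Gpd.IsMul.eq_one e₄ (by simp [𝒢.G.one_s])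

theorem balanced {k : T ⟶ E.mor} (i : act.bun.IsRact a k a') (j : act.IsLE k b b')
    (t : TenL act a' b n) : TenL act a b' n := by
  obtain ⟨x', rfl, h, t⟩ := t
  have jl := j.l₂
  have jw := j.l₁
  obtain ⟨κ, rfl, k₂, j⟩ := j
  obtain ⟨n', x, h₁, h₂, t'⟩ := exists_of (act := act) (a := a) (b := b') (by rw [i.w, jw])
  have : (actId act).IsRact x κ x' := by
    refine actId_isRact_iff.2 ⟨h₁ ▸ i, ?_⟩
    rw [h₂, h, k₂, jl]
    exact Gpd.isMul_one_of (by simp [𝒢.G.one_s])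
  exact ⟨x, h₁, h₂, t.balanced this j⟩

theorem lact (i : TenL act a b n) {k : T ⟶ (𝒢.prod (𝒢.prodJ J)).mor}
    (hn : (comp (actId act) act.bun).R.IsLact k n n')
    (ha : act.bun.IsLact (k ≫ (fpFst (𝒢.prodJ J) 𝒢.t 𝒢.t_cover).mor) a a')
    (hb : act.IsLG (k ≫ (fpSnd (𝒢.prodJ J) 𝒢.t 𝒢.t_cover).mor) b b') : TenL act a' b' n' := by
  obtain ⟨x, rfl, h₂, i⟩ := i
  obtain ⟨x', hx'⟩ := HSBibundle.exists_isLact (P := actId act) (p := x) (g := k)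
    (by rw [hn.w, i.l])
  obtain ⟨e₁, e₂⟩ := actId_isLact_iff.1 hx'
  obtain rfl := e₁.unique ha
  refine of_isTen (i.lact hx' hn) ?_
  rw [h₂] at e₂
  have : x' ≫ actIdSnd = k ≫ (fpSnd (𝒢.prodJ J) 𝒢.t 𝒢.t_cover).mor := by
    exact Gpd.IsMul.unique e₂ (Gpd.isMul_one_of hb.w)
  exact this ▸ hb

theorem ract (i : TenL act a b n) {k : T ⟶ E.mor}
    (hn : (comp (actId act) act.bun).R.IsRact n k n') (hb : act.bun.IsRact b k b') :
    TenL act a b' n' := by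
  obtain ⟨x, rfl, h₂, i⟩ := i
  exact ⟨x, rfl, by rw [h₂, ActionMorphism.isRact_l₂ hb], i.ract hb hn⟩

end TenL

namespace TenR

variable {n n' : T ⟶ (comp (idMul (J := J) mul) act.bun).R.X}

theorem exists_of (h : m ≫ mul.bun.r = c ≫ act.l₂) : ∃ n, TenR act mul m c n := by
  obtain ⟨x, h₁, h₂⟩ := exists_idMul (J := J) (mul := mul) ((c ≫ act.l₁) ≫ E.one) m (by
      simp [h, ActionMorphism.l₁_J, E.one_t])
  obtain ⟨n, hn⟩ := Composite.exists_isTen (A := comp (idMul (J := J) mul) act.bun) (p := x)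
    (q := c) (fp_ob_ext ((idMul_r_fst x).trans (by
        rw [h₁, Category.assoc, E.one_s, Category.comp_id, Category.assoc]; rfl))
      ((idMul_r_snd x).trans (by rw [h₂, h, Category.assoc]; rfl)))
  exact ⟨n, x, h₁, h₂, hn⟩

theorem w (i : TenR act mul m c n) : m ≫ mul.bun.r = c ≫ act.l₂ := by
  obtain ⟨x, h, rfl, i⟩ := i
  exact isTen_idMul_snd i

theorem unique (i : TenR act mul m c n) (j : TenR act mul m c n') : n = n' := by
  obtain ⟨x, h₁, h₂, i⟩ := i
  obtain ⟨y, k₁, k₂, j⟩ := j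
  obtain rfl : x = y := idMul_ext (h₁.trans k₁.symm) (h₂.trans k₂.symm)
  exact i.unique j

theorem nat (i : TenR act mul m c n) (v : T' ⟶ T) : TenR act mul (v ≫ m) (v ≫ c) (v ≫ n) := by
  obtain ⟨x, h₁, h₂, i⟩ := i
  exact ⟨v ≫ x, by rw [Category.assoc, h₁]; simp, by rw [Category.assoc, h₂], i.nat v⟩

theorem l_fst (i : TenR act mul m c n) :
    (n ≫ (comp (idMul (J := J) mul) act.bun).R.l) ≫
      (fpFst J (toTrivFst 𝒢.s 𝒢.t 𝒢.t_cover 𝒢.t) 𝒢.toTrivFst_cover).ob = c ≫ act.l₁ := by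
  obtain ⟨x, h₁, h₂, i⟩ := i
  rw [i.l, idMul_l_fst, h₁, Category.assoc, E.one_t, Category.comp_id]

theorem l_snd (i : TenR act mul m c n) :
    (n ≫ (comp (idMul (J := J) mul) act.bun).R.l) ≫
      (fpSnd J (toTrivFst 𝒢.s 𝒢.t 𝒢.t_cover 𝒢.t) 𝒢.toTrivFst_cover).ob = m ≫ mul.bun.l := by
  obtain ⟨x, h₂, rfl, i⟩ := i
  rw [i.l, idMul_l_snd]

theorem r (i : TenR act mul m c n) :
    n ≫ (comp (idMul (J := J) mul) act.bun).R.r = c ≫ act.bun.r := by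
  obtain ⟨x, h₁, h₂, i⟩ := i
  exact i.r

/-- An arrow of `E` in the first component of the first tensor factor can be moved across. -/
theorem of_isTen {x₀ : T ⟶ (idMul (J := J) mul).X} {c₀ : T ⟶ act.bun.X}
    (i : (comp (idMul (J := J) mul) act.bun).IsTen x₀ c₀ n) (j : act.IsLE (x₀ ≫ idMulFst) c₀ c) :
    TenR act mul (x₀ ≫ idMulSnd) c n := by
  have j₂ := j.l₁
  obtain ⟨k, k₁, k₂, j⟩ := j
  obtain ⟨x, h₁, h₂⟩ := exists_idMul (J := J) (mul := mul) ((x₀ ≫ idMulFst) ≫ E.t ≫ E.one)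
    (x₀ ≫ idMulSnd) (by rw [← idMul_cond]; simp [E.one_t])
  refine ⟨x, ?_, h₂, i.balanced (idMul_isRact_iff.2 ⟨?_, ?_⟩) j⟩
  · rw [h₁, j₂, Category.assoc (x₀ ≫ idMulFst)]
  · rw [h₁, k₁, ← Category.assoc (x₀ ≫ idMulFst)]
    exact Gpd.one_isMul_of rfl
  · rw [h₂, k₂]
    exact HSBibundle.isRact_one_of (isTen_idMul_snd i)

theorem surj (n : T ⟶ (comp (idMul (J := J) mul) act.bun).R.X) :
    ∃ (T' : C) (w : T' ⟶ T) (m : T' ⟶ mul.bun.X) (c : T' ⟶ act.bun.X),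
      W w ∧ TenR act mul m c (w ≫ n) := by
  obtain ⟨T', w, x₀, c₀, hw, i⟩ := Composite.surj _ n
  obtain ⟨c, hc⟩ := ActionMorphism.exists_isLE (act := act) (isTen_idMul_fst i)
  exact ⟨T', w, _, c, hw, of_isTen i hc⟩

theorem exact (i : TenR act mul m c n) (j : TenR act mul m' c' n) :
    ∃ k, mul.bun.IsRact m' k m ∧ act.IsLG k c c' := by
  have ib := i.l_fst.symm.trans j.l_fst
  obtain ⟨x, h₂, rfl, i⟩ := i
  obtain ⟨x', h₂', rfl, j⟩ := j
  obtain ⟨h, e₁, e₂⟩ := i.exact j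
  obtain ⟨e₃, e₄⟩ := idMul_isRact_iff.1 e₁
  refine ⟨_, e₄, h, ?_, rfl, e₂⟩
  rw [h₂, h₂', ib] at e₃
  rw [ib]
  exact Gpd.IsMul.eq_one e₃ (by simp [E.one_s])

theorem balanced {k : T ⟶ 𝒢.G.mor} (i : mul.bun.IsRact m k m') (j : act.IsLG k c c')
    (t : TenR act mul m' c n) : TenR act mul m c' n := by
  obtain ⟨x', h, rfl, t⟩ := t
  have jl := j.l₁
  have jw := j.l₂
  obtain ⟨κ, k₂, rfl, j⟩ := j
  obtain ⟨n', x, h₁, h₂, t'⟩ := exists_of (act := act) (mul := mul) (m := m) (c := c')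
    (by rw [i.w, jw])
  have : (idMul (J := J) mul).IsRact x κ x' := by
    refine idMul_isRact_iff.2 ⟨?_, h₂ ▸ i⟩
    rw [h₁, h, k₂, jl]
    exact Gpd.isMul_one_of (by simp [E.one_s])
  exact ⟨x, h₁, h₂, t.balanced this j⟩

theorem lact (i : TenR act mul m c n)
    {k : T ⟶ (fiberProd J (toTrivFst 𝒢.s 𝒢.t 𝒢.t_cover 𝒢.t) 𝒢.toTrivFst_cover).mor}
    (hn : (comp (idMul (J := J) mul) act.bun).R.IsLact k n n')
    (hc : act.IsLE (k ≫ (fpFst J (toTrivFst 𝒢.s 𝒢.t 𝒢.t_cover 𝒢.t) 𝒢.toTrivFst_cover).mor) c c')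
    (hm : mul.bun.IsLact
      (k ≫ (fpSnd J (toTrivFst 𝒢.s 𝒢.t 𝒢.t_cover 𝒢.t) 𝒢.toTrivFst_cover).mor) m m') :
    TenR act mul m' c' n' := by
  obtain ⟨x, h₂, rfl, i⟩ := i
  obtain ⟨x', hx'⟩ := HSBibundle.exists_isLact (P := idMul (J := J) mul) (p := x) (g := k)
    (by rw [hn.w, i.l])
  obtain ⟨e₁, e₂⟩ := idMul_isLact_iff.1 hx'
  obtain rfl := e₂.unique hm
  refine of_isTen (i.lact hx' hn) ?_
  rw [h₂] at e₁
  have : x' ≫ idMulFst =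
      k ≫ (fpFst J (toTrivFst 𝒢.s 𝒢.t 𝒢.t_cover 𝒢.t) 𝒢.toTrivFst_cover).mor := by
    exact Gpd.IsMul.unique e₁ (Gpd.isMul_one_of hc.w)
  exact this ▸ hc

theorem ract (i : TenR act mul m c n) {k : T ⟶ E.mor}
    (hn : (comp (idMul (J := J) mul) act.bun).R.IsRact n k n') (hc : act.bun.IsRact c k c') :
    TenR act mul m c' n' := by
  obtain ⟨x, h₂, rfl, i⟩ := i
  exact ⟨x, by rw [h₂, ActionMorphism.isRact_l₁ hc], rfl, i.ract hc hn⟩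

end TenR

end Tensors

end CatGraph

end Actions

end HigherGpd

namespace HigherGpd

section Actions

variable {C : Type u} [Category.{v} C] {W : MorphismProperty C} [NicePretopology W]
  {𝒢 : CatGraph W} {E : Gpd W} {J : E.ToTriv 𝒢.M} {T T' : C}

namespace CatGraph

section AssocFun

variable (𝒢 J) in
/-- The associativity functor `(E ×_M G) ×_M G ⟶ E ×_M (G ×_M G)`. -/
noncomputable abbrev assocF : Gpd.Fun (𝒢.prod (𝒢.prodJ J))
    (fiberProd J (toTrivFst 𝒢.s 𝒢.t 𝒢.t_cover 𝒢.t) 𝒢.toTrivFst_cover) :=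
  assocFun J 𝒢.t 𝒢.t_cover 𝒢.s 𝒢.t 𝒢.t_cover 𝒢.toTrivFst_cover

theorem assocF_ob_fst (k : T ⟶ (𝒢.prod (𝒢.prodJ J)).ob) :
    (k ≫ (assocF 𝒢 J).ob) ≫ (fpFst J (toTrivFst 𝒢.s 𝒢.t 𝒢.t_cover 𝒢.t) 𝒢.toTrivFst_cover).ob =
      (k ≫ 𝒢.pr₁ (𝒢.prodJ J)) ≫ 𝒢.pr₁ J :=
  (Category.assoc _ _ _).trans ((k ≫= fpOb_fst _ _ _).trans (Category.assoc _ _ _).symm)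

theorem assocF_ob_snd_fst (k : T ⟶ (𝒢.prod (𝒢.prodJ J)).ob) :
    ((k ≫ (assocF 𝒢 J).ob) ≫
      (fpSnd J (toTrivFst 𝒢.s 𝒢.t 𝒢.t_cover 𝒢.t) 𝒢.toTrivFst_cover).ob) ≫ 𝒢.pr₁ 𝒢.s =
      (k ≫ 𝒢.pr₁ (𝒢.prodJ J)) ≫ 𝒢.pr₂ J := by
  refine (((Category.assoc _ _ _).trans (k ≫= fpOb_snd _ _ _)) =≫ _).trans ?_
  exact (Category.assoc _ _ _).trans ((k ≫= fpOb_fst _ _ _).trans (Category.assoc _ _ _).symm)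

theorem assocF_ob_snd_snd (k : T ⟶ (𝒢.prod (𝒢.prodJ J)).ob) :
    ((k ≫ (assocF 𝒢 J).ob) ≫
      (fpSnd J (toTrivFst 𝒢.s 𝒢.t 𝒢.t_cover 𝒢.t) 𝒢.toTrivFst_cover).ob) ≫ 𝒢.pr₂ 𝒢.s =
      k ≫ 𝒢.pr₂ (𝒢.prodJ J) := by
  refine (((Category.assoc _ _ _).trans (k ≫= fpOb_snd _ _ _)) =≫ _).trans ?_
  exact (Category.assoc _ _ _).trans (k ≫= fpOb_snd _ _ _)

theorem assocF_mor_fst (k : T ⟶ (𝒢.prod (𝒢.prodJ J)).mor) :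
    (k ≫ (assocF 𝒢 J).mor) ≫
      (fpFst J (toTrivFst 𝒢.s 𝒢.t 𝒢.t_cover 𝒢.t) 𝒢.toTrivFst_cover).mor =
      (k ≫ (fpFst (𝒢.prodJ J) 𝒢.t 𝒢.t_cover).mor) ≫ (fpFst J 𝒢.t 𝒢.t_cover).mor :=
  (Category.assoc _ _ _).trans ((k ≫= fpMor_fst _ _ _).trans (Category.assoc _ _ _).symm)

theorem assocF_mor_snd_fst (k : T ⟶ (𝒢.prod (𝒢.prodJ J)).mor) :
    ((k ≫ (assocF 𝒢 J).mor) ≫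
      (fpSnd J (toTrivFst 𝒢.s 𝒢.t 𝒢.t_cover 𝒢.t) 𝒢.toTrivFst_cover).mor) ≫
        (fpFst 𝒢.s 𝒢.t 𝒢.t_cover).mor =
      (k ≫ (fpFst (𝒢.prodJ J) 𝒢.t 𝒢.t_cover).mor) ≫ (fpSnd J 𝒢.t 𝒢.t_cover).mor := by
  refine (((Category.assoc _ _ _).trans (k ≫= fpMor_snd _ _ _)) =≫ _).trans ?_
  exact (Category.assoc _ _ _).trans ((k ≫= fpMor_fst _ _ _).trans (Category.assoc _ _ _).symm)

theorem assocF_mor_snd_snd (k : T ⟶ (𝒢.prod (𝒢.prodJ J)).mor) :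
    ((k ≫ (assocF 𝒢 J).mor) ≫
      (fpSnd J (toTrivFst 𝒢.s 𝒢.t 𝒢.t_cover 𝒢.t) 𝒢.toTrivFst_cover).mor) ≫
        (fpSnd 𝒢.s 𝒢.t 𝒢.t_cover).mor =
      k ≫ (fpSnd (𝒢.prodJ J) 𝒢.t 𝒢.t_cover).mor := by
  refine (((Category.assoc _ _ _).trans (k ≫= fpMor_snd _ _ _)) =≫ _).trans ?_
  exact (Category.assoc _ _ _).trans (k ≫= fpMor_snd _ _ _)

end AssocFun

section Relation

variable {act : 𝒢.ActionMorphism J} {mul : 𝒢.MulMorphism} {α : Associator act mul}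
  {a a' b b' c c' : T ⟶ act.bun.X} {m m' : T ⟶ mul.bun.X}

theorem assocRel_iff : AssocRel α a b m c ↔
    ∃ n, TenL act a b n ∧ TenR act mul m c (n ≫ α.map ≫ restrictSnd) := by
  constructor
  · rintro ⟨x, y, hx, hy, h₁, h₂, h₃, h₄, h₅⟩
    exact ⟨_, ⟨x, h₁, h₂, hx, rfl⟩, y, h₃, h₄, hy, h₅.symm⟩
  · rintro ⟨n, ⟨x, h₁, h₂, hx, rfl⟩, y, h₃, h₄, hy, h₅⟩
    exact ⟨x, y, hx, hy, h₁, h₂, h₃, h₄, h₅.symm⟩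

theorem Associator.map_l_fst (α : Associator act mul)
    (n : T ⟶ (comp (actId act) act.bun).R.X) :
    ((n ≫ α.map ≫ restrictSnd) ≫ (comp (idMul (J := J) mul) act.bun).R.l) ≫
      (fpFst J (toTrivFst 𝒢.s 𝒢.t 𝒢.t_cover 𝒢.t) 𝒢.toTrivFst_cover).ob =
      ((n ≫ (comp (actId act) act.bun).R.l) ≫ 𝒢.pr₁ (𝒢.prodJ J)) ≫ 𝒢.pr₁ J := by
  rw [← assocF_ob_fst, ← α.map_l]
  simp only [Category.assoc]
  rw [reassoc_of% restrictSnd_l]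

theorem Associator.map_l_snd_fst (α : Associator act mul)
    (n : T ⟶ (comp (actId act) act.bun).R.X) :
    (((n ≫ α.map ≫ restrictSnd) ≫ (comp (idMul (J := J) mul) act.bun).R.l) ≫
      (fpSnd J (toTrivFst 𝒢.s 𝒢.t 𝒢.t_cover 𝒢.t) 𝒢.toTrivFst_cover).ob) ≫ 𝒢.pr₁ 𝒢.s =
      ((n ≫ (comp (actId act) act.bun).R.l) ≫ 𝒢.pr₁ (𝒢.prodJ J)) ≫ 𝒢.pr₂ J := by
  rw [← assocF_ob_snd_fst, ← α.map_l]
  simp only [Category.assoc]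
  rw [reassoc_of% restrictSnd_l]

theorem Associator.map_l_snd_snd (α : Associator act mul)
    (n : T ⟶ (comp (actId act) act.bun).R.X) :
    (((n ≫ α.map ≫ restrictSnd) ≫ (comp (idMul (J := J) mul) act.bun).R.l) ≫
      (fpSnd J (toTrivFst 𝒢.s 𝒢.t 𝒢.t_cover 𝒢.t) 𝒢.toTrivFst_cover).ob) ≫ 𝒢.pr₂ 𝒢.s =
      (n ≫ (comp (actId act) act.bun).R.l) ≫ 𝒢.pr₂ (𝒢.prodJ J) := by
  rw [← assocF_ob_snd_snd, ← α.map_l]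
  simp only [Category.assoc]
  rw [reassoc_of% restrictSnd_l]

theorem Associator.map_r' (α : Associator act mul) (n : T ⟶ (comp (actId act) act.bun).R.X) :
    (n ≫ α.map ≫ restrictSnd) ≫ (comp (idMul (J := J) mul) act.bun).R.r =
      n ≫ (comp (actId act) act.bun).R.r := by
  rw [← α.map_r]
  simp only [Category.assoc]
  rfl

namespace AssocRel

theorem nat (i : AssocRel α a b m c) (v : T' ⟶ T) :
    AssocRel α (v ≫ a) (v ≫ b) (v ≫ m) (v ≫ c) := by
  obtain ⟨n, h, h'⟩ := assocRel_iff.1 i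
  exact assocRel_iff.2 ⟨_, h.nat v, by simpa using h'.nat v⟩

theorem w (i : AssocRel α a b m c) : a ≫ act.bun.r = b ≫ act.l₁ := by
  obtain ⟨n, h, h'⟩ := assocRel_iff.1 i
  exact h.w

theorem wR (i : AssocRel α a b m c) : m ≫ mul.bun.r = c ≫ act.l₂ := by
  obtain ⟨n, h, h'⟩ := assocRel_iff.1 i
  exact h'.w

theorem l₁ (i : AssocRel α a b m c) : c ≫ act.l₁ = a ≫ act.l₁ := by
  obtain ⟨n, h, h'⟩ := assocRel_iff.1 i
  rw [← h'.l_fst, α.map_l_fst, h.l_fst, Category.assoc]; rfl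

theorem l₂ (i : AssocRel α a b m c) : m ≫ mul.l₁ = a ≫ act.l₂ := by
  obtain ⟨n, h, h'⟩ := assocRel_iff.1 i
  rw [ActionMorphism.l₁, ← Category.assoc, ← h'.l_snd, α.map_l_snd_fst, h.l_fst,
    Category.assoc]; rfl

theorem l₃ (i : AssocRel α a b m c) : m ≫ mul.l₂ = b ≫ act.l₂ := by
  obtain ⟨n, h, h'⟩ := assocRel_iff.1 i
  rw [ActionMorphism.l₂, ← Category.assoc, ← h'.l_snd, α.map_l_snd_snd, h.l_snd]

theorem r (i : AssocRel α a b m c) : c ≫ act.bun.r = b ≫ act.bun.r := by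
  obtain ⟨n, h, h'⟩ := assocRel_iff.1 i
  rw [← h'.r, α.map_r', h.r]

theorem ract {k : T ⟶ E.mor} (i : AssocRel α a b m c) (hb : act.bun.IsRact b k b')
    (hc : act.bun.IsRact c k c') : AssocRel α a b' m c' := by
  obtain ⟨n, h, h'⟩ := assocRel_iff.1 i
  obtain ⟨n', hn'⟩ := HSBibundle.exists_isRact (P := (comp (actId act) act.bun).R) (p := n)
    (h := k) (by rw [h.r, hb.w])
  refine assocRel_iff.2 ⟨n', h.ract hn' hb, h'.ract ?_ hc⟩
  simpa using restrict_isRact (α.isRact hn')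

theorem lact {k : T ⟶ (𝒢.prod J).mor} {k' : T ⟶ (𝒢.prod 𝒢.s).mor} (i : AssocRel α a b m c)
    (e : k' ≫ (fpFst 𝒢.s 𝒢.t 𝒢.t_cover).mor = k ≫ (fpSnd J 𝒢.t 𝒢.t_cover).mor)
    (ha : act.bun.IsLact k a a') (hb : act.IsLG (k' ≫ (fpSnd 𝒢.s 𝒢.t 𝒢.t_cover).mor) b b')
    (hm : mul.bun.IsLact k' m m') (hc : act.IsLE (k ≫ (fpFst J 𝒢.t 𝒢.t_cover).mor) c c') :
    AssocRel α a' b' m' c' := by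
  obtain ⟨n, h, h'⟩ := assocRel_iff.1 i
  obtain ⟨κ, h₁, h₂⟩ := exists_fpMor (a := 𝒢.prodJ J) (b := 𝒢.t) (hb := 𝒢.t_cover) k
    (k' ≫ (fpSnd 𝒢.s 𝒢.t 𝒢.t_cover).mor) (by
      rw [← Category.assoc k, ha.w, ← Category.assoc _ 𝒢.G.s, hb.w, Category.assoc, act.hJ,
        ← Category.assoc, i.w, Category.assoc, Category.assoc, ActionMorphism.l₁_J])
  obtain ⟨n', hn'⟩ := HSBibundle.exists_isLact (P := (comp (actId act) act.bun).R) (p := n)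
    (g := κ) (fp_ob_ext (by
      rw [h.l_fst, Category.assoc, Gpd.Fun.s_ob, ← Category.assoc, h₁, ha.w]) (by
      rw [h.l_snd, Category.assoc, Gpd.Fun.s_ob, ← Category.assoc, h₂, hb.w]))
  refine assocRel_iff.2 ⟨n', h.lact hn' (h₁.symm ▸ ha) (h₂.symm ▸ hb), ?_⟩
  have j := restrict_isLact (α.isLact hn')
  simp only [Category.assoc] at j
  refine h'.lact (k := κ ≫ (assocF 𝒢 J).mor) j ?_ ?_
  · rw [assocF_mor_fst, h₁]; exact hc
  · convert hm using 1
    exact fp_mor_ext ((assocF_mor_snd_fst _).trans (by rw [h₁, e]))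
      ((assocF_mor_snd_snd _).trans h₂)

theorem balanced {k : T ⟶ E.mor} (ha : act.bun.IsRact a k a') (hb : act.IsLE k b b')
    (i : AssocRel α a' b m c) : AssocRel α a b' m c := by
  obtain ⟨n, h, h'⟩ := assocRel_iff.1 i
  exact assocRel_iff.2 ⟨n, h.balanced ha hb, h'⟩

theorem balancedR {k : T ⟶ 𝒢.G.mor} (hm : mul.bun.IsRact m k m') (hc : act.IsLG k c c')
    (i : AssocRel α a b m' c) : AssocRel α a b m c' := by
  obtain ⟨n, h, h'⟩ := assocRel_iff.1 i
  exact assocRel_iff.2 ⟨n, h, h'.balanced hm hc⟩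

end AssocRel

end Relation

end CatGraph

end Actions

end HigherGpd

namespace HigherGpd

section Actions

variable {C : Type u} [Category.{v} C] {W : MorphismProperty C} [NicePretopology W]
  {𝒢 : CatGraph W} {E : Gpd W} {J : E.ToTriv 𝒢.M} {T T' : C}

namespace CatGraph

section Ones

variable {act : 𝒢.ActionMorphism J}

theorem fp_one_fst {M : C} {G H : Gpd W} {a : G.ToTriv M} {b : H.ToTriv M} {hb : W b.map}
    (x : T ⟶ (fiberProd a b hb).ob) :
    (x ≫ (fiberProd a b hb).one) ≫ (fpFst a b hb).mor = (x ≫ (fpFst a b hb).ob) ≫ G.one := by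
  rw [Category.assoc, Gpd.Fun.mor_one, Category.assoc]

theorem fp_one_snd {M : C} {G H : Gpd W} {a : G.ToTriv M} {b : H.ToTriv M} {hb : W b.map}
    (x : T ⟶ (fiberProd a b hb).ob) :
    (x ≫ (fiberProd a b hb).one) ≫ (fpSnd a b hb).mor = (x ≫ (fpSnd a b hb).ob) ≫ H.one := by
  rw [Category.assoc, Gpd.Fun.mor_one, Category.assoc]

theorem ActionMorphism.l_pr₁ (p : T ⟶ act.bun.X) : (p ≫ act.bun.l) ≫ 𝒢.pr₁ J = p ≫ act.l₁ :=
  Category.assoc _ _ _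

theorem ActionMorphism.l_pr₂ (p : T ⟶ act.bun.X) : (p ≫ act.bun.l) ≫ 𝒢.pr₂ J = p ≫ act.l₂ :=
  Category.assoc _ _ _

theorem ActionMorphism.one_isLE {p : T ⟶ act.bun.X} {x : T ⟶ E.ob} (e : p ≫ act.l₁ = x) :
    act.IsLE (x ≫ E.one) p p :=
  ⟨_, (fp_one_fst _).trans (by rw [l_pr₁, e]), (fp_one_snd _).trans (by rw [l_pr₂]),
    HSBibundle.one_isLact_of rfl⟩

theorem ActionMorphism.one_isLG {p : T ⟶ act.bun.X} {x : T ⟶ 𝒢.G.ob} (e : p ≫ act.l₂ = x) :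
    act.IsLG (x ≫ 𝒢.G.one) p p :=
  ⟨_, (fp_one_fst _).trans (by rw [l_pr₁]), (fp_one_snd _).trans (by rw [l_pr₂, e]),
    HSBibundle.one_isLact_of rfl⟩

end Ones

section Relation

variable {act : 𝒢.ActionMorphism J} {mul : 𝒢.MulMorphism} {α : Associator act mul}
  {a a' b b' c c' : T ⟶ act.bun.X} {m m' : T ⟶ mul.bun.X}

namespace AssocRel

theorem lactE {ε : T ⟶ E.mor} (i : AssocRel α a b m c) (ha : act.IsLE ε a a')
    (hc : act.IsLE ε c c') : AssocRel α a' b m c' := by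
  obtain ⟨k, rfl, h₂, ha⟩ := ha
  refine i.lact (k' := (m ≫ mul.bun.l) ≫ (𝒢.prod 𝒢.s).one) ?_ ha ?_
    (HSBibundle.one_isLact_of rfl) hc
  · rw [fp_one_fst, h₂, ← i.l₂, ← ActionMorphism.l_pr₁]
  · rw [fp_one_snd]
    exact ActionMorphism.one_isLG (i.l₃.symm.trans (ActionMorphism.l_pr₂ _).symm)

theorem lactG {g : T ⟶ 𝒢.G.mor} (i : AssocRel α a b m c) (ha : act.IsLG g a a')
    (hm : mul.IsLE g m m') : AssocRel α a' b m' c := by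
  obtain ⟨k, h₁, rfl, ha⟩ := ha
  obtain ⟨k', e, h₃, hm⟩ := hm
  refine i.lact e ha ?_ hm ?_
  · rw [h₃]
    exact ActionMorphism.one_isLG i.l₃.symm
  · rw [h₁]
    exact ActionMorphism.one_isLE i.l₁

theorem uniq_c (i : AssocRel α a b m c) (j : AssocRel α a b m c') : c = c' := by
  obtain ⟨n, h, h'⟩ := assocRel_iff.1 i
  obtain ⟨n₂, h₂, h₂'⟩ := assocRel_iff.1 j
  obtain rfl := h.unique h₂
  obtain ⟨k, hk, hk'⟩ := h'.exact h₂'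
  obtain rfl := hk.eq_one
  exact ((ActionMorphism.one_isLG i.wR.symm).unique (by simpa using hk'))

theorem exact_a (i : AssocRel α a b m c) (j : AssocRel α a' b' m c) :
    ∃ k, act.bun.IsRact a' k a ∧ act.IsLE k b b' := by
  have e₁ := i.l₁.symm.trans j.l₁
  have e₂ := i.l₂.symm.trans j.l₂
  have e₃ := i.l₃.symm.trans j.l₃
  obtain ⟨n, h, h'⟩ := assocRel_iff.1 i
  obtain ⟨n₂, h₂, h₂'⟩ := assocRel_iff.1 j
  obtain rfl : n = n₂ := α.map_inj (restrict_ext (by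
    rw [Category.assoc, α.map_l, Category.assoc, α.map_l]
    exact fp_ob_ext ((h.l_fst.trans (ActionMorphism.l_ext e₁ e₂)).trans h₂.l_fst.symm)
      ((h.l_snd.trans e₃).trans h₂.l_snd.symm))
    ((Category.assoc _ _ _).trans ((h'.unique h₂').trans (Category.assoc _ _ _).symm)))
  exact h.exact h₂

theorem uniq_b (i : AssocRel α a b m c) (j : AssocRel α a b' m c) : b = b' := by
  obtain ⟨k, hk, hk'⟩ := i.exact_a j
  obtain rfl := hk.eq_one
  exact ((ActionMorphism.one_isLE i.w.symm).unique (by simpa using hk'))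

end AssocRel

variable (α)

theorem Associator.exists_c (h : a ≫ act.bun.r = b ≫ act.l₁) (h₁ : m ≫ mul.l₁ = a ≫ act.l₂)
    (h₂ : m ≫ mul.l₂ = b ≫ act.l₂) : ∃ c, AssocRel α a b m c := by
  obtain ⟨n, hn⟩ := TenL.exists_of h
  obtain ⟨T', w, m', c', hw, hm'⟩ := TenR.surj (n ≫ α.map ≫ restrictSnd)
  have hn' := assocRel_iff.2 ⟨_, hn.nat w, by simpa using hm'⟩
  obtain ⟨k, hk⟩ := HSBibundle.exists_div (P := mul.bun) (p := w ≫ m) (p' := m')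
    (ActionMorphism.l_ext (by rw [hn'.l₂, Category.assoc, h₁, Category.assoc])
      (by rw [hn'.l₃, Category.assoc, h₂, Category.assoc]))
  obtain ⟨c, hc⟩ := ActionMorphism.exists_isLG (act := act) (g := k) (p := c')
    (by rw [← hn'.wR, hk.r])
  have := hn'.balancedR hk hc
  obtain ⟨F, rfl⟩ := exists_point_of_local (W := W) (T := T) (V := act.bun.X)
    (fun w c => AssocRel α (w ≫ a) (w ≫ b) (w ≫ m) c)
    (fun v y x e => by simpa using e.nat v) (fun e e' => e.uniq_c e') hw this
  refine ⟨F, assocRel_iff.2 ⟨n, hn, ?_⟩⟩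
  obtain ⟨n', hn'⟩ := TenR.exists_of (act := act) (mul := mul) (m := m) (c := F)
    (cover_cancel hw (by simpa using this.wR))
  convert hn'
  refine cover_cancel hw ?_
  obtain ⟨n₂, h₂, h₂'⟩ := assocRel_iff.1 this
  obtain rfl := h₂.unique (hn.nat w)
  rw [← Category.assoc]
  exact h₂'.unique (hn'.nat w)

theorem Associator.exists_b (h₁ : c ≫ act.l₁ = a ≫ act.l₁) (h₂ : m ≫ mul.l₁ = a ≫ act.l₂)
    (h : m ≫ mul.bun.r = c ≫ act.l₂) : ∃ b, AssocRel α a b m c := by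
  obtain ⟨n', hn'⟩ := TenR.exists_of h
  obtain ⟨κ, hκ₁, hκ₂⟩ := exists_fpOb (a := 𝒢.prodJ J) (b := 𝒢.t) (hb := 𝒢.t_cover)
    (a ≫ act.bun.l) (m ≫ mul.l₂) (by
      rw [Category.assoc m, ← ActionMorphism.l₁_J mul.toActionMorphism, ← Category.assoc m, h₂]
      simp only [ActionMorphism.l₂, Category.assoc]; rfl)
  obtain ⟨q, hq₁, hq₂⟩ := exists_restrict (F := assocF 𝒢 J)
    (P := (comp (idMul (J := J) mul) act.bun).R) κ n' (fp_ob_ext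
      ((assocF_ob_fst _).trans (by rw [hκ₁, hn'.l_fst, h₁, Category.assoc]; rfl))
      (fp_ob_ext ((assocF_ob_snd_fst _).trans (by
          rw [hκ₁, hn'.l_snd, ActionMorphism.l_pr₂, ← h₂, ← ActionMorphism.l_pr₁]))
        ((assocF_ob_snd_snd _).trans (by
          rw [hκ₂, hn'.l_snd, ← ActionMorphism.l_pr₂]))))
  obtain ⟨n, rfl⟩ := α.map_surj q
  obtain rfl : n ≫ α.map ≫ restrictSnd = n' := (Category.assoc _ _ _).symm.trans hq₂
  obtain ⟨T', w, a', b', hw, hab⟩ := TenL.surj n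
  have key := assocRel_iff.2 ⟨_, hab, by simpa using hn'.nat w⟩
  obtain ⟨k, hk⟩ := HSBibundle.exists_div (P := act.bun) (p := w ≫ a) (p' := a')
    (ActionMorphism.l_ext (by rw [← key.l₁, Category.assoc, ← h₁, Category.assoc])
      (by rw [← key.l₂, Category.assoc, ← h₂, Category.assoc]))
  obtain ⟨b, hb⟩ := ActionMorphism.exists_isLE (act := act) (ε := k) (p := b')
    (by rw [← key.w, hk.r])
  have := key.balanced hk hb
  obtain ⟨F, rfl⟩ := exists_point_of_local (W := W) (T := T) (V := act.bun.X)
    (fun w b => AssocRel α (w ≫ a) b (w ≫ m) (w ≫ c))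
    (fun v y x e => by simpa using e.nat v) (fun e e' => e.uniq_b e') hw this
  obtain ⟨n', h'⟩ := TenL.exists_of (act := act) (a := a) (b := F)
    (cover_cancel hw (by simpa using this.w))
  obtain rfl : n' = n := cover_cancel hw ((h'.nat w).unique (hab.balanced hk hb))
  exact ⟨F, assocRel_iff.2 ⟨_, h', hn'⟩⟩

end Relation

end CatGraph

end Actions

end HigherGpd

namespace HigherGpd

section Actions

variable {C : Type u} [Category.{v} C] {W : MorphismProperty C} [NicePretopology W]
  {𝒢 : CatGraph W} {E : Gpd W} {J : E.ToTriv 𝒢.M} {T T' : C}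

namespace CatGraph

/-- The properties of the relation defined by an associator. -/
structure IsAssocRel (act : 𝒢.ActionMorphism J) (mul : 𝒢.MulMorphism)
    (R : ∀ {T : C}, (T ⟶ act.bun.X) → (T ⟶ act.bun.X) → (T ⟶ mul.bun.X) → (T ⟶ act.bun.X) → Prop) :
    Prop where
  nat {T T' : C} {a b c : T ⟶ act.bun.X} {m : T ⟶ mul.bun.X} (v : T' ⟶ T) :
    R a b m c → R (v ≫ a) (v ≫ b) (v ≫ m) (v ≫ c)
  w {T : C} {a b c : T ⟶ act.bun.X} {m : T ⟶ mul.bun.X} :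
    R a b m c → a ≫ act.bun.r = b ≫ act.l₁
  wR {T : C} {a b c : T ⟶ act.bun.X} {m : T ⟶ mul.bun.X} :
    R a b m c → m ≫ mul.bun.r = c ≫ act.l₂
  l₁ {T : C} {a b c : T ⟶ act.bun.X} {m : T ⟶ mul.bun.X} :
    R a b m c → c ≫ act.l₁ = a ≫ act.l₁
  l₂ {T : C} {a b c : T ⟶ act.bun.X} {m : T ⟶ mul.bun.X} :
    R a b m c → m ≫ mul.l₁ = a ≫ act.l₂
  l₃ {T : C} {a b c : T ⟶ act.bun.X} {m : T ⟶ mul.bun.X} :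
    R a b m c → m ≫ mul.l₂ = b ≫ act.l₂
  r {T : C} {a b c : T ⟶ act.bun.X} {m : T ⟶ mul.bun.X} :
    R a b m c → c ≫ act.bun.r = b ≫ act.bun.r
  exists_c {T : C} {a b : T ⟶ act.bun.X} {m : T ⟶ mul.bun.X} : a ≫ act.bun.r = b ≫ act.l₁ →
    m ≫ mul.l₁ = a ≫ act.l₂ → m ≫ mul.l₂ = b ≫ act.l₂ → ∃ c, R a b m c
  uniq_c {T : C} {a b c c' : T ⟶ act.bun.X} {m : T ⟶ mul.bun.X} :
    R a b m c → R a b m c' → c = c'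
  balanced {T : C} {a a' b b' c : T ⟶ act.bun.X} {m : T ⟶ mul.bun.X} {k : T ⟶ E.mor} :
    act.bun.IsRact a k a' → act.IsLE k b b' → R a' b m c → R a b' m c
  balancedR {T : C} {a b c c' : T ⟶ act.bun.X} {m m' : T ⟶ mul.bun.X} {k : T ⟶ 𝒢.G.mor} :
    mul.bun.IsRact m k m' → act.IsLG k c c' → R a b m' c → R a b m c'
  ract {T : C} {a b b' c c' : T ⟶ act.bun.X} {m : T ⟶ mul.bun.X} {k : T ⟶ E.mor} :
    R a b m c → act.bun.IsRact b k b' → act.bun.IsRact c k c' → R a b' m c'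
  lactE {T : C} {a a' b c c' : T ⟶ act.bun.X} {m : T ⟶ mul.bun.X} {ε : T ⟶ E.mor} :
    R a b m c → act.IsLE ε a a' → act.IsLE ε c c' → R a' b m c'
  lactG {T : C} {a a' b c : T ⟶ act.bun.X} {m m' : T ⟶ mul.bun.X} {g : T ⟶ 𝒢.G.mor} :
    R a b m c → act.IsLG g a a' → mul.IsLE g m m' → R a' b m' c
  lactH {T : C} {a b b' c : T ⟶ act.bun.X} {m m' : T ⟶ mul.bun.X} {h : T ⟶ 𝒢.G.mor} :
    R a b m c → act.IsLG h b b' → mul.IsLG h m m' → R a b' m' c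

namespace IsAssocRel

variable {act : 𝒢.ActionMorphism J} {mul : 𝒢.MulMorphism}
  {R : ∀ {T : C}, (T ⟶ act.bun.X) → (T ⟶ act.bun.X) → (T ⟶ mul.bun.X) → (T ⟶ act.bun.X) → Prop}
  {a a' b b' c c' : T ⟶ act.bun.X} {m m' : T ⟶ mul.bun.X}

/-- The relation between `(a, 1) ⊗ b` and `(1, m) ⊗ c`. -/
def TenRel (_ : IsAssocRel act mul R) (n : T ⟶ (comp (actId act) act.bun).R.X)
    (n' : T ⟶ (comp (idMul (J := J) mul) act.bun).R.X) : Prop :=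
  ∃ a b m c, TenL act a b n ∧ R a b m c ∧ TenR act mul m c n'

theorem func (hR : IsAssocRel act mul R) (h : R a b m c) (h' : R a' b' m' c')
    {n : T ⟶ (comp (actId act) act.bun).R.X}
    {n₁ n₂ : T ⟶ (comp (idMul (J := J) mul) act.bun).R.X} (i : TenL act a b n)
    (i' : TenL act a' b' n) (j : TenR act mul m c n₁) (j' : TenR act mul m' c' n₂) : n₁ = n₂ := by
  obtain ⟨k, hk, hk'⟩ := i.exact i'
  obtain ⟨l, hl⟩ := HSBibundle.exists_div (P := mul.bun) (p := m') (p' := m) (ActionMorphism.l_ext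
    (by rw [hR.l₂ h', hR.l₂ h, ActionMorphism.l₂, ← Category.assoc, ← Category.assoc, hk.l])
    (by rw [hR.l₃ h', hR.l₃ h, hk'.l₂]))
  obtain ⟨c₁, hc₁⟩ := ActionMorphism.exists_isLG (act := act) (g := l) (p := c)
    (by rw [← hR.wR h, hl.r])
  obtain rfl := hR.uniq_c (hR.balancedR hl hc₁ (hR.balanced hk hk' h)) h'
  exact (j.balanced hl hc₁).unique j'

theorem tenRel_unique (hR : IsAssocRel act mul R) {n : T ⟶ (comp (actId act) act.bun).R.X}
    {n₁ n₂ : T ⟶ (comp (idMul (J := J) mul) act.bun).R.X} (h : hR.TenRel n n₁)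
    (h' : hR.TenRel n n₂) : n₁ = n₂ := by
  obtain ⟨a, b, m, c, i, h, j⟩ := h
  obtain ⟨a', b', m', c', i', h', j'⟩ := h'
  exact hR.func h h' i i' j j'

theorem tenRel_nat (hR : IsAssocRel act mul R) {n : T ⟶ (comp (actId act) act.bun).R.X}
    {n₁ : T ⟶ (comp (idMul (J := J) mul) act.bun).R.X} (v : T' ⟶ T) (h : hR.TenRel n n₁) :
    hR.TenRel (v ≫ n) (v ≫ n₁) := by
  obtain ⟨a, b, m, c, i, h, j⟩ := h
  exact ⟨_, _, _, _, i.nat v, hR.nat v h, j.nat v⟩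

theorem exists_tenRel (hR : IsAssocRel act mul R) (n : T ⟶ (comp (actId act) act.bun).R.X) :
    ∃ (T' : C) (w : T' ⟶ T) (n' : T' ⟶ (comp (idMul (J := J) mul) act.bun).R.X), W w ∧
      hR.TenRel (w ≫ n) n' := by
  obtain ⟨T₁, w, a, b, hw, h⟩ := TenL.surj n
  obtain ⟨T₂, w', m, hw', h₁, h₂⟩ := mul.exists_local (a ≫ act.l₂) (b ≫ act.l₂) (by
    rw [Category.assoc, ActionMorphism.l₂_s, ← Category.assoc, h.w, Category.assoc,
      ActionMorphism.l₁_J, Category.assoc])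
  have h' := h.nat w'
  obtain ⟨c, hc⟩ := hR.exists_c h'.w (h₁.trans (Category.assoc _ _ _).symm)
    (h₂.trans (Category.assoc _ _ _).symm)
  obtain ⟨n', hn'⟩ := TenR.exists_of (hR.wR hc)
  exact ⟨T₂, w' ≫ w, n', cover_comp hw' hw, _, _, m, c, by simpa using h', hc, hn'⟩

theorem exists_associator (hR : IsAssocRel act mul R) : ∃ α : Associator act mul,
    ∀ {T : C} {a b c : T ⟶ act.bun.X} {m : T ⟶ mul.bun.X}, AssocRel α a b m c ↔ R a b m c := by
  obtain ⟨T₀, w₀, n₀, hw₀, h₀⟩ := hR.exists_tenRel (𝟙 (comp (actId act) act.bun).R.X)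
  rw [Category.comp_id] at h₀
  obtain ⟨F, hF⟩ := exists_hom_of_local (W := W) (Y := (comp (actId act) act.bun).R.X)
    (V := (comp (idMul (J := J) mul) act.bun).R.X) (fun n n' => hR.TenRel n n')
    (fun v _ _ h => hR.tenRel_nat v h) ⟨T₀, w₀, n₀, hw₀, h₀⟩ (fun h h' => hR.tenRel_unique h h')
  have hl : ((comp (actId act) act.bun).R.l) ≫ (assocF 𝒢 J).ob =
      F ≫ (comp (idMul (J := J) mul) act.bun).R.l := by
    refine cover_cancel hw₀ ?_
    rw [← Category.assoc _ F, hF h₀]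
    obtain ⟨a, b, m, c, i, h, j⟩ := h₀
    rw [← Category.assoc]
    refine fp_ob_ext ?_ (fp_ob_ext ?_ ?_)
    · rw [assocF_ob_fst, i.l_fst, j.l_fst, hR.l₁ h, ActionMorphism.l_pr₁]
    · refine (assocF_ob_snd_fst _).trans ?_
      rw [i.l_fst, j.l_snd, ActionMorphism.l_pr₂, ActionMorphism.l_pr₁, hR.l₂ h]
    · refine (assocF_ob_snd_snd _).trans ?_
      rw [i.l_snd, j.l_snd, ActionMorphism.l_pr₂, hR.l₃ h]
  obtain ⟨f, hf₁, hf₂⟩ := exists_restrict (F := assocF 𝒢 J)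
    (P := (comp (idMul (J := J) mul) act.bun).R) _ _ hl
  have hr : F ≫ (comp (idMul (J := J) mul) act.bun).R.r = (comp (actId act) act.bun).R.r := by
    refine cover_cancel hw₀ ?_
    rw [← Category.assoc _ F, hF h₀]
    obtain ⟨a, b, m, c, i, h, j⟩ := h₀
    rw [i.r, j.r, hR.r h]
  have cov : ∀ {T : C} (n : T ⟶ (comp (actId act) act.bun).R.X), ∃ (T' : C) (w : T' ⟶ T),
      W w ∧ hR.TenRel (w ≫ n) (w ≫ n ≫ F) := by
    intro T n
    obtain ⟨T', w, n', hw, h⟩ := hR.exists_tenRel n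
    refine ⟨T', w, hw, ?_⟩
    rw [← Category.assoc, hF h]
    exact h
  have hlact : ∀ {T : C} (k : T ⟶ (𝒢.prod (𝒢.prodJ J)).mor)
      (n n' : T ⟶ (comp (actId act) act.bun).R.X),
      (comp (actId act) act.bun).R.IsLact k n n' →
      (comp (idMul (J := J) mul) act.bun).R.IsLact (k ≫ (assocF 𝒢 J).mor) (n ≫ F) (n' ≫ F) := by
    intro T k n n' hk
    obtain ⟨n₁, h₁⟩ := HSBibundle.exists_isLact (P := (comp (idMul (J := J) mul) act.bun).R)
      (g := k ≫ (assocF 𝒢 J).mor) (p := n ≫ F) (by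
        rw [Category.assoc, Gpd.Fun.mor_s, ← Category.assoc, hk.w, Category.assoc, hl,
          Category.assoc])
    convert h₁
    obtain ⟨T', w, hw, a, b, m, c, i, h, j⟩ := cov n
    refine cover_cancel hw ?_
    have hk' := hk.nat w
    have h₁' := h₁.nat w
    set κ := w ≫ k
    obtain ⟨a', ha'⟩ := HSBibundle.exists_isLact (P := act.bun)
      (g := κ ≫ (fpFst (𝒢.prodJ J) 𝒢.t 𝒢.t_cover).mor) (p := a)
      (by rw [← i.l_fst, ← hk'.w]; simp only [Category.assoc, Gpd.Fun.s_ob])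
    obtain ⟨b', hb'⟩ := ActionMorphism.exists_isLG (act := act)
      (g := κ ≫ (fpSnd (𝒢.prodJ J) 𝒢.t 𝒢.t_cover).mor) (p := b)
      (by rw [← i.l_snd, ← hk'.w]; simp only [Category.assoc, Gpd.Fun.s_ob])
    obtain ⟨a₁, ha₁, ha₁'⟩ := ActionMorphism.isLact_iff_LG_LE.1 ha'
    obtain ⟨m₁, hm₁⟩ := ActionMorphism.exists_isLE (act := mul.toActionMorphism) (p := m)
      (ε := (κ ≫ (fpFst (𝒢.prodJ J) 𝒢.t 𝒢.t_cover).mor) ≫ (fpSnd J 𝒢.t 𝒢.t_cover).mor)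
      (by rw [hR.l₂ h, ha₁.w])
    obtain ⟨m₂, hm₂⟩ := ActionMorphism.exists_isLG (act := mul.toActionMorphism) (p := m₁)
      (g := κ ≫ (fpSnd (𝒢.prodJ J) 𝒢.t 𝒢.t_cover).mor)
      (by rw [hm₁.l₂, hR.l₃ h, hb'.w])
    obtain ⟨c', hc'⟩ := ActionMorphism.exists_isLE (act := act) (p := c)
      (ε := (κ ≫ (fpFst (𝒢.prodJ J) 𝒢.t 𝒢.t_cover).mor) ≫ (fpFst J 𝒢.t 𝒢.t_cover).mor)
      (by rw [hR.l₁ h, ActionMorphism.isLact_w₁ ha'])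
    have key := hR.lactE (hR.lactH (hR.lactG h ha₁ hm₁) hb' hm₂) ha₁' hc'
    have t₁ := i.lact hk' ha' hb'
    obtain ⟨κ', e₁, e₂, hm'⟩ := ActionMorphism.exists_isLact (act := mul.toActionMorphism) (p := m)
      (ε := (κ ≫ (fpFst (𝒢.prodJ J) 𝒢.t 𝒢.t_cover).mor) ≫ (fpSnd J 𝒢.t 𝒢.t_cover).mor)
      (g := κ ≫ (fpSnd (𝒢.prodJ J) 𝒢.t 𝒢.t_cover).mor) (by rw [hR.l₂ h, ha₁.w])
      (by rw [hR.l₃ h, hb'.w])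
    have hm : mul.bun.IsLact ((κ ≫ (assocF 𝒢 J).mor) ≫
        (fpSnd J (toTrivFst 𝒢.s 𝒢.t 𝒢.t_cover 𝒢.t) 𝒢.toTrivFst_cover).mor) m m₂ :=
      ActionMorphism.isLact_iff_LE_LG.2 ⟨m₁, by rw [assocF_mor_snd_fst]; exact hm₁,
        by rw [assocF_mor_snd_snd]; exact hm₂⟩
    have t₂ := j.lact (k := κ ≫ (assocF 𝒢 J).mor) (by simpa [κ] using h₁')
      (by rw [assocF_mor_fst]; exact hc') hm
    rw [← Category.assoc]
    exact hF ⟨_, _, _, _, t₁, key, t₂⟩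
  have hract : ∀ {T : C} (k : T ⟶ E.mor) (n n' : T ⟶ (comp (actId act) act.bun).R.X),
      (comp (actId act) act.bun).R.IsRact n k n' →
      (comp (idMul (J := J) mul) act.bun).R.IsRact (n ≫ F) k (n' ≫ F) := by
    intro T k n n' hk
    obtain ⟨n₁, h₁⟩ := HSBibundle.exists_isRact (P := (comp (idMul (J := J) mul) act.bun).R)
      (h := k) (p := n ≫ F) (by rw [Category.assoc, hr, hk.w])
    convert h₁
    obtain ⟨T', w, hw, a, b, m, c, i, h, j⟩ := cov n
    refine cover_cancel hw ?_
    have hk' := hk.nat w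
    obtain ⟨b', hb'⟩ := HSBibundle.exists_isRact (P := act.bun) (p := b) (h := w ≫ k)
      (by rw [← i.r, hk'.w])
    obtain ⟨c', hc'⟩ := HSBibundle.exists_isRact (P := act.bun) (p := c) (h := w ≫ k)
      (by rw [hR.r h, hb'.w])
    rw [← Category.assoc]
    exact hF ⟨_, _, _, _, i.ract hk' hb', hR.ract h hb' hc', j.ract (h₁.nat w) hc'⟩
  let α : Associator act mul := {
    map := f
    map_l := hf₁
    map_r := by rw [← hr, ← hf₂, Category.assoc]; rfl
    map_lact := fun {T} k n e e' => by
      have i : (comp (actId act) act.bun).R.IsLact k n _ := ⟨e, rfl⟩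
      have : (restrict (assocF 𝒢 J) (comp (idMul (J := J) mul) act.bun).R).IsLact k (n ≫ f)
          ((comp (actId act) act.bun).R.lact k n e ≫ f) := by
        refine restrict_isLact_iff.2 ⟨e', by rw [Category.assoc, hf₁, i.l], ?_⟩
        rw [Category.assoc, hf₂, Category.assoc, hf₂]
        exact hlact _ _ _ i
      exact this.unique ⟨e', rfl⟩
    map_ract := fun {T} n k e e' => by
      have i : (comp (actId act) act.bun).R.IsRact n k _ := ⟨e, rfl⟩
      have : (restrict (assocF 𝒢 J) (comp (idMul (J := J) mul) act.bun).R).IsRact (n ≫ f) k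
          ((comp (actId act) act.bun).R.ract n k e ≫ f) := by
        refine restrict_isRact_iff.2 ⟨by rw [Category.assoc, hf₁, i.l, Category.assoc, hf₁], ?_⟩
        rw [Category.assoc, hf₂, Category.assoc, hf₂]
        exact hract _ _ _ i
      exact this.unique ⟨e', rfl⟩ }
  refine ⟨α, fun {T a b c m} => ⟨fun i => ?_, fun i => ?_⟩⟩
  · obtain ⟨c', hc'⟩ := hR.exists_c i.w i.l₂ i.l₃
    obtain ⟨n, h, h'⟩ := assocRel_iff.1 i
    obtain ⟨n', hn'⟩ := TenR.exists_of (hR.wR hc')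
    have e : n ≫ α.map ≫ restrictSnd = n' := by
      rw [← hF ⟨_, _, _, _, h, hc', hn'⟩]
      exact congrArg (n ≫ ·) hf₂
    rw [e] at h'
    obtain ⟨k, hk, hk'⟩ := h'.exact hn'
    obtain rfl := hk.eq_one
    obtain rfl := (ActionMorphism.one_isLG i.wR.symm).unique (by simpa using hk')
    exact hc'
  · obtain ⟨n, hn⟩ := TenL.exists_of (act := act) (a := a) (b := b) (hR.w i)
    obtain ⟨n', hn'⟩ := TenR.exists_of (hR.wR i)
    refine assocRel_iff.2 ⟨n, hn, ?_⟩
    have e : n ≫ α.map ≫ restrictSnd = n' := by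
      rw [← hF ⟨_, _, _, _, hn, i, hn'⟩]
      exact congrArg (n ≫ ·) hf₂
    rw [e]
    exact hn'

end IsAssocRel

end CatGraph

end Actions

end HigherGpd

namespace HigherGpd

section Actions

variable {C : Type u} [Category.{v} C] {W : MorphismProperty C} [NicePretopology W]
  {T T' : C}

namespace CatGraph

variable {𝒢 : CatGraph W} {E : Gpd W} {J : E.ToTriv 𝒢.M} {act : 𝒢.ActionMorphism J}
  {mul : 𝒢.MulMorphism} {one : 𝒢.UnitMorphism}

namespace Unitor

variable (ρ : Unitor act one)

/-- The inverse of a unitor, as a map to the bibundle of the action. -/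
noncomputable def κ : E.mor ⟶ act.bun.X := (ρ.map_surj (𝟙 E.mor)).choose ≫ restrictSnd

theorem exists_κ (ε : T ⟶ E.mor) : ∃ x : T ⟶ (restrict (idUnit J one) act.bun).X,
    x ≫ ρ.map = ε ∧ x ≫ restrictSnd = ε ≫ ρ.κ := by
  refine ⟨ε ≫ (ρ.map_surj (𝟙 E.mor)).choose, ?_, Category.assoc _ _ _⟩
  exact (Category.assoc _ _ _).trans
    ((ε ≫= (ρ.map_surj (𝟙 E.mor)).choose_spec).trans (Category.comp_id _))

variable {ρ}

theorem _root_.HigherGpd.CatGraph.unitorRel_iff {x : T ⟶ act.bun.X} {ε : T ⟶ E.mor} :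
    UnitorRel ρ x ε ↔ x = ε ≫ ρ.κ := by
  obtain ⟨y, h₁, h₂⟩ := ρ.exists_κ ε
  constructor
  · rintro ⟨y', rfl, h⟩
    obtain rfl := ρ.map_inj (h.trans h₁.symm)
    exact h₂
  · rintro rfl
    exact ⟨y, h₂, h₁⟩

theorem κ_l (ε : T ⟶ E.mor) : (ε ≫ ρ.κ) ≫ act.bun.l = (ε ≫ E.t) ≫ (idUnit J one).ob := by
  obtain ⟨y, h₁, h₂⟩ := ρ.exists_κ ε
  rw [← h₂, Category.assoc, restrictSnd_l, ← Category.assoc, ← ρ.map_l, ← Category.assoc, h₁]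
  rfl

theorem κ_l₁ (ε : T ⟶ E.mor) : (ε ≫ ρ.κ) ≫ act.l₁ = ε ≫ E.t := by
  rw [← ActionMorphism.l_pr₁, κ_l]
  refine (Category.assoc _ _ _).trans ((_ ≫= fpOb_fst _ _ _).trans ?_)
  exact Category.comp_id _

theorem κ_l₂ (ε : T ⟶ E.mor) : (ε ≫ ρ.κ) ≫ act.l₂ = (ε ≫ E.t) ≫ J.map ≫ one.u := by
  rw [← ActionMorphism.l_pr₂, κ_l]
  exact (Category.assoc _ _ _).trans (_ ≫= fpOb_snd _ _ _)

theorem κ_r (ε : T ⟶ E.mor) : (ε ≫ ρ.κ) ≫ act.bun.r = ε ≫ E.s := by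
  obtain ⟨y, h₁, h₂⟩ := ρ.exists_κ ε
  rw [← h₂, Category.assoc, restrictSnd_r, ← ρ.map_r, ← Category.assoc, h₁]
  rfl

theorem κ_inj {ε ε' : T ⟶ E.mor} (h : ε ≫ ρ.κ = ε' ≫ ρ.κ) : ε = ε' := by
  obtain ⟨y, h₁, h₂⟩ := ρ.exists_κ ε
  obtain ⟨y', h₁', h₂'⟩ := ρ.exists_κ ε'
  obtain rfl : y = y' := restrict_ext (by
    rw [← ρ.map_l, ← Category.assoc, h₁, ← Category.assoc, h₁']
    change ε ≫ E.t = ε' ≫ E.t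
    rw [← κ_l₁ (ρ := ρ), h, κ_l₁]) (by rw [h₂, h, h₂'])
  exact h₁.symm.trans h₁'

theorem κ_lift {x : T ⟶ act.bun.X} (h : x ≫ act.l₂ = (x ≫ act.l₁) ≫ J.map ≫ one.u) :
    ∃ ε, ε ≫ ρ.κ = x := by
  obtain ⟨y, h₁, rfl⟩ := exists_restrict (F := idUnit J one) (P := act.bun) (x ≫ act.l₁) x
    (fp_ob_ext ((Category.assoc _ _ _).trans ((_ ≫= fpOb_fst _ _ _).trans
      ((Category.comp_id _).trans (ActionMorphism.l_pr₁ _).symm)))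
      ((Category.assoc _ _ _).trans ((_ ≫= fpOb_snd _ _ _).trans
        (h.symm.trans (ActionMorphism.l_pr₂ _).symm))))
  obtain ⟨y', h, h'⟩ := ρ.exists_κ (y ≫ ρ.map)
  obtain rfl := ρ.map_inj h
  exact ⟨_, h'.symm⟩

theorem isRact {g h k : T ⟶ E.mor} (i : E.IsMul g h k) :
    act.bun.IsRact (g ≫ ρ.κ) h (k ≫ ρ.κ) := by
  obtain ⟨y, h₁, h₂⟩ := ρ.exists_κ g
  obtain ⟨y', h₁', h₂'⟩ := ρ.exists_κ k
  obtain ⟨z, hz⟩ := HSBibundle.exists_isRact (P := restrict (idUnit J one) act.bun) (p := y)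
    (h := h) (by rw [← ρ.map_r, ← Category.assoc, h₁]; exact i.w)
  have := HSHom.isRact ρ hz
  rw [h₁] at this
  obtain rfl := ρ.map_inj ((Gpd.IsMul.unique this i).trans h₁'.symm)
  rw [← h₂, ← h₂']
  exact restrict_isRact hz

theorem isLE {g h k : T ⟶ E.mor} (i : E.IsMul g h k) : act.IsLE g (h ≫ ρ.κ) (k ≫ ρ.κ) := by
  obtain ⟨y, h₁, h₂⟩ := ρ.exists_κ h
  obtain ⟨y', h₁', h₂'⟩ := ρ.exists_κ k
  obtain ⟨z, hz⟩ := HSBibundle.exists_isLact (P := restrict (idUnit J one) act.bun) (p := y)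
    (g := g) (by rw [← ρ.map_l, ← Category.assoc, h₁]; exact i.w)
  have := HSHom.isLact ρ hz
  rw [h₁] at this
  obtain rfl := ρ.map_inj ((Gpd.IsMul.unique this i).trans h₁'.symm)
  refine ⟨g ≫ (idUnit J one).mor, ?_, ?_, ?_⟩
  · exact (Category.assoc _ _ _).trans ((_ ≫= fpMor_fst _ _ _).trans (Category.comp_id _))
  · refine (Category.assoc _ _ _).trans ((_ ≫= fpMor_snd _ _ _).trans ?_)
    rw [κ_l₂, ← i.w]
    simp [constFun]
  · rw [← h₂, ← h₂']
    exact restrict_isLact hz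

theorem eq_one_of_isLE {k : T ⟶ E.mor} {e : T ⟶ E.ob}
    (i : act.IsLE k ((e ≫ E.one) ≫ ρ.κ) ((e ≫ E.one) ≫ ρ.κ)) : k = e ≫ E.one := by
  have := i.w
  rw [κ_l₁, Category.assoc, E.one_t, Category.comp_id] at this
  exact κ_inj ((isLE (ρ := ρ) (Gpd.isMul_one_of this)).unique i)

end Unitor

namespace LeftUnitor

variable (lam : LeftUnitor mul one)

/-- The inverse of a left unitor, as a map to the bibundle of the multiplication. -/
noncomputable def κ : 𝒢.G.mor ⟶ mul.bun.X := (lam.map_surj (𝟙 𝒢.G.mor)).choose ≫ restrictSnd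

theorem exists_κ (g : T ⟶ 𝒢.G.mor) : ∃ x : T ⟶ (restrict (unitId one) mul.bun).X,
    x ≫ lam.map = g ∧ x ≫ restrictSnd = g ≫ lam.κ := by
  refine ⟨g ≫ (lam.map_surj (𝟙 𝒢.G.mor)).choose, ?_, Category.assoc _ _ _⟩
  exact (Category.assoc _ _ _).trans
    ((g ≫= (lam.map_surj (𝟙 𝒢.G.mor)).choose_spec).trans (Category.comp_id _))

variable {lam}

theorem _root_.HigherGpd.CatGraph.leftUnitorRel_iff {x : T ⟶ mul.bun.X} {g : T ⟶ 𝒢.G.mor} :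
    LeftUnitorRel lam x g ↔ x = g ≫ lam.κ := by
  obtain ⟨y, h₁, h₂⟩ := lam.exists_κ g
  constructor
  · rintro ⟨y', rfl, h⟩
    obtain rfl := lam.map_inj (h.trans h₁.symm)
    exact h₂
  · rintro rfl
    exact ⟨y, h₂, h₁⟩

end LeftUnitor

end CatGraph

namespace CatAction

variable {𝒢 : CatGroupoid W}

/-- The action of a categorified groupoid on its arrows by multiplication. -/
def self (𝒢 : CatGroupoid W) : CatAction 𝒢 where
  E := 𝒢.G
  J := 𝒢.s
  act := 𝒢.mul.toActionMorphism
  α := 𝒢.α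
  ρ := 𝒢.ρ
  pentagon := 𝒢.pentagon
  triangle := 𝒢.triangle

variable (a : CatAction 𝒢) {p p' : T ⟶ a.act.bun.X} {ε h : T ⟶ a.E.mor} {g : T ⟶ 𝒢.G.mor}

theorem assocRel_unit_l (p : T ⟶ a.act.bun.X) :
    CatGraph.AssocRel a.α (((p ≫ a.act.l₁) ≫ a.E.one) ≫ a.ρ.κ) p
      (((p ≫ a.act.l₂) ≫ 𝒢.G.one) ≫ 𝒢.lam.κ) p :=
  a.triangle _ _ _ (CatGraph.unitorRel_iff.2 rfl) (CatGraph.leftUnitorRel_iff.2 rfl)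

theorem assocRel_unit_r (p : T ⟶ a.act.bun.X) :
    CatGraph.AssocRel a.α p (((p ≫ a.act.bun.r) ≫ a.E.one) ≫ a.ρ.κ)
      (((p ≫ a.act.l₂) ≫ 𝒢.G.one) ≫ 𝒢.ρ.κ) p := by
  set e := ((p ≫ a.act.bun.r) ≫ a.E.one) ≫ a.ρ.κ with he
  set μ := ((p ≫ a.act.l₂) ≫ 𝒢.G.one) ≫ 𝒢.ρ.κ with hμ
  have e₁ : e ≫ a.act.l₁ = p ≫ a.act.bun.r := by
    rw [he, CatGraph.Unitor.κ_l₁, Category.assoc, a.E.one_t, Category.comp_id]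
  have e₂ : e ≫ a.act.l₂ = p ≫ a.act.bun.r ≫ a.J.map ≫ 𝒢.one.u := by
    rw [he, CatGraph.Unitor.κ_l₂, Category.assoc _ a.E.one, a.E.one_t, Category.comp_id,
      Category.assoc]
  have e₃ : e ≫ a.act.bun.r = p ≫ a.act.bun.r := by
    rw [he, CatGraph.Unitor.κ_r, Category.assoc, a.E.one_s, Category.comp_id]
  have μ₁ : μ ≫ 𝒢.mul.l₁ = p ≫ a.act.l₂ := by
    rw [hμ, CatGraph.Unitor.κ_l₁, Category.assoc, 𝒢.G.one_t, Category.comp_id]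
  have μ₂ : μ ≫ 𝒢.mul.l₂ = p ≫ a.act.bun.r ≫ a.J.map ≫ 𝒢.one.u := by
    rw [hμ, CatGraph.Unitor.κ_l₂, Category.assoc _ 𝒢.G.one, 𝒢.G.one_t, Category.comp_id,
      Category.assoc, CatGraph.ActionMorphism.l₂_s_assoc]
  obtain ⟨d, hd⟩ := a.α.exists_c (a := p) (b := e) (m := μ) e₁.symm μ₁ (by rw [μ₂, e₂])
  obtain ⟨f, hf⟩ := a.α.exists_c (a := d) (b := e) (m := μ) (by rw [hd.r, e₁, e₃])
    (by rw [μ₁, ← hd.wR, hμ, CatGraph.Unitor.κ_r, Category.assoc, 𝒢.G.one_s, Category.comp_id])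
    (by rw [μ₂, e₂])
  have h₁ := a.assocRel_unit_l e
  rw [e₁] at h₁
  have h₂ := (self 𝒢).assocRel_unit_l μ
  replace h₂ : CatGraph.AssocRel 𝒢.α (((μ ≫ 𝒢.mul.l₁) ≫ 𝒢.G.one) ≫ 𝒢.ρ.κ) μ
      (((μ ≫ 𝒢.mul.l₂) ≫ 𝒢.G.one) ≫ 𝒢.lam.κ) μ := h₂
  rw [μ₁, μ₂, ← e₂] at h₂
  have h₃ := a.pentagon _ _ _ _ _ _ _ _ _ _ hd hf h₂ h₁
  obtain rfl := hd.uniq_c h₃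
  obtain ⟨k, hk, hk'⟩ := hf.exact_a hd
  obtain rfl := CatGraph.Unitor.eq_one_of_isLE hk'
  obtain rfl := (HSBibundle.isRact_one_of rfl).unique hk
  exact hd

theorem isRact_iff : a.act.bun.IsRact p h p' ↔
    CatGraph.AssocRel a.α p (h ≫ a.ρ.κ) (((p ≫ a.act.l₂) ≫ 𝒢.G.one) ≫ 𝒢.ρ.κ) p' := by
  have key : ∀ {p'}, a.act.bun.IsRact p h p' →
      CatGraph.AssocRel a.α p (h ≫ a.ρ.κ) (((p ≫ a.act.l₂) ≫ 𝒢.G.one) ≫ 𝒢.ρ.κ) p' :=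
    fun i => (a.assocRel_unit_r p).ract (CatGraph.Unitor.isRact (Gpd.one_isMul_of i.w.symm)) i
  refine ⟨key, fun i => ?_⟩
  obtain ⟨q, hq⟩ := HSBibundle.exists_isRact (P := a.act.bun) (p := p) (h := h)
    (by rw [i.w, CatGraph.Unitor.κ_l₁])
  obtain rfl := i.uniq_c (key hq)
  exact hq

theorem isLE_iff : a.act.IsLE ε p p' ↔
    CatGraph.AssocRel a.α (ε ≫ a.ρ.κ) p (((p ≫ a.act.l₂) ≫ 𝒢.G.one) ≫ 𝒢.lam.κ) p' := by
  have key : ∀ {p'}, a.act.IsLE ε p p' →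
      CatGraph.AssocRel a.α (ε ≫ a.ρ.κ) p (((p ≫ a.act.l₂) ≫ 𝒢.G.one) ≫ 𝒢.lam.κ) p' :=
    fun i => (a.assocRel_unit_l p).lactE (CatGraph.Unitor.isLE (Gpd.isMul_one_of i.w)) i
  refine ⟨key, fun i => ?_⟩
  obtain ⟨q, hq⟩ := CatGraph.ActionMorphism.exists_isLE (act := a.act) (p := p) (ε := ε)
    (by rw [← i.w, CatGraph.Unitor.κ_r])
  obtain rfl := i.uniq_c (key hq)
  exact hq

theorem isLG_iff : a.act.IsLG g p p' ↔ g ≫ 𝒢.G.s = p ≫ a.act.l₂ ∧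
    CatGraph.AssocRel a.α p' (((p ≫ a.act.bun.r) ≫ a.E.one) ≫ a.ρ.κ) (g ≫ 𝒢.ρ.κ) p := by
  have key : ∀ {p'}, a.act.IsLG g p p' →
      CatGraph.AssocRel a.α p' (((p ≫ a.act.bun.r) ≫ a.E.one) ≫ a.ρ.κ) (g ≫ 𝒢.ρ.κ) p :=
    fun i => (a.assocRel_unit_r p).lactG i (CatGraph.Unitor.isLE (Gpd.isMul_one_of i.w))
  refine ⟨fun i => ⟨i.w, key i⟩, fun ⟨w, i⟩ => ?_⟩
  obtain ⟨q, hq⟩ := CatGraph.ActionMorphism.exists_isLG (act := a.act) (p := p) (g := g) w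
  obtain ⟨k, hk, hk'⟩ := i.exact_a (key hq)
  obtain rfl := CatGraph.Unitor.eq_one_of_isLE hk'
  obtain rfl := (HSBibundle.isRact_one_of hq.r).unique hk
  exact hq

theorem isMul_iff {g h k : T ⟶ a.E.mor} : a.E.IsMul g h k ↔
    CatGraph.AssocRel a.α (g ≫ a.ρ.κ) (h ≫ a.ρ.κ)
      ((((g ≫ a.E.t) ≫ a.J.map ≫ 𝒢.one.u) ≫ 𝒢.G.one) ≫ 𝒢.ρ.κ) (k ≫ a.ρ.κ) := by
  rw [← CatGraph.Unitor.κ_l₂ (ρ := a.ρ), ← isRact_iff]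
  refine ⟨fun i => CatGraph.Unitor.isRact i, fun i => ?_⟩
  obtain ⟨l, hl⟩ := a.E.exists_isMul (g := g) (h := h) (by rw [← i.w, CatGraph.Unitor.κ_r])
  obtain rfl := CatGraph.Unitor.κ_inj (i.unique (CatGraph.Unitor.isRact hl))
  exact hl

end CatAction

end Actions

end HigherGpd

namespace HigherGpd

section Actions

variable {C : Type u} [Category.{v} C] {W : MorphismProperty C} [NicePretopology W]
  {T T' : C} {𝒢 : CatGroupoid W} {X : SimplicialObject C}

namespace CatAction

/-- An identification of the objects and of the action bibundles of two actions which preserves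
the moment maps, the unit arrows and the associators. -/
structure Match (a a' : CatAction 𝒢) where
  φ₀ : a.E.ob ≅ a'.E.ob
  φ₁ : a.act.bun.X ≅ a'.act.bun.X
  moment : φ₀.hom ≫ a'.J.map = a.J.map
  left₁ : φ₁.hom ≫ a'.act.l₁ = a.act.l₁ ≫ φ₀.hom
  left₂ : φ₁.hom ≫ a'.act.l₂ = a.act.l₂
  right : φ₁.hom ≫ a'.act.bun.r = a.act.bun.r ≫ φ₀.hom
  one : (a.E.one ≫ a.ρ.κ) ≫ φ₁.hom = φ₀.hom ≫ a'.E.one ≫ a'.ρ.κ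
  associator : ∀ {T : C} {p q : T ⟶ a.act.bun.X} {m : T ⟶ 𝒢.mul.bun.X} {s : T ⟶ a.act.bun.X},
    CatGraph.AssocRel a.α p q m s ↔
      CatGraph.AssocRel a'.α (p ≫ φ₁.hom) (q ≫ φ₁.hom) m (s ≫ φ₁.hom)

namespace Match

variable {a a' : CatAction 𝒢}

/-- The inverse identification. -/
def symm (f : Match a a') : Match a' a where
  φ₀ := f.φ₀.symm
  φ₁ := f.φ₁.symm
  moment := by rw [← f.moment]; simp
  left₁ := by simp [Iso.inv_comp_eq, reassoc_of% f.left₁]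
  left₂ := by simp [Iso.inv_comp_eq, f.left₂]
  right := by simp [Iso.inv_comp_eq, reassoc_of% f.right]
  one := by
    have := f.φ₀.inv ≫= f.one =≫ f.φ₁.inv
    simp only [Category.assoc, Iso.hom_inv_id, Iso.inv_hom_id_assoc, Category.comp_id] at this
    simpa using this.symm
  associator := by intros; rw [f.associator]; simp

theorem exists_mor (f : Match a a') (ε : T ⟶ a.E.mor) :
    ∃ ε' : T ⟶ a'.E.mor, ε' ≫ a'.ρ.κ = (ε ≫ a.ρ.κ) ≫ f.φ₁.hom := by
  refine CatGraph.Unitor.κ_lift ?_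
  have h₁ : ((ε ≫ a.ρ.κ) ≫ f.φ₁.hom) ≫ a'.act.l₂ = (ε ≫ a.ρ.κ) ≫ a.act.l₂ := by
    rw [Category.assoc, f.left₂]
  have h₂ : ((ε ≫ a.ρ.κ) ≫ f.φ₁.hom) ≫ a'.act.l₁ = ((ε ≫ a.ρ.κ) ≫ a.act.l₁) ≫ f.φ₀.hom := by
    rw [Category.assoc, f.left₁]; simp only [Category.assoc]
  rw [h₁, h₂, CatGraph.Unitor.κ_l₁, CatGraph.Unitor.κ_l₂]
  simp [← f.moment]

/-- The map on arrows. -/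
noncomputable def mor (f : Match a a') : a.E.mor ⟶ a'.E.mor := (f.exists_mor (𝟙 _)).choose

theorem mor_κ (f : Match a a') (ε : T ⟶ a.E.mor) :
    (ε ≫ f.mor) ≫ a'.ρ.κ = (ε ≫ a.ρ.κ) ≫ f.φ₁.hom := by
  have h : f.mor ≫ a'.ρ.κ = (𝟙 _ ≫ a.ρ.κ) ≫ f.φ₁.hom := (f.exists_mor (𝟙 _)).choose_spec
  rw [Category.assoc, h, Category.id_comp, Category.assoc]

theorem mor_s (f : Match a a') : f.mor ≫ a'.E.s = a.E.s ≫ f.φ₀.hom := by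
  have := f.mor_κ (𝟙 _)
  rw [Category.id_comp, Category.id_comp] at this
  rw [← CatGraph.Unitor.κ_r (ρ := a'.ρ), this, Category.assoc, f.right, ← Category.assoc]
  have := CatGraph.Unitor.κ_r (ρ := a.ρ) (𝟙 _)
  rw [Category.id_comp, Category.id_comp] at this
  rw [this]

theorem mor_t (f : Match a a') : f.mor ≫ a'.E.t = a.E.t ≫ f.φ₀.hom := by
  have := f.mor_κ (𝟙 _)
  rw [Category.id_comp, Category.id_comp] at this
  rw [← CatGraph.Unitor.κ_l₁ (ρ := a'.ρ), this, Category.assoc, f.left₁, ← Category.assoc]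
  have := CatGraph.Unitor.κ_l₁ (ρ := a.ρ) (𝟙 _)
  rw [Category.id_comp, Category.id_comp] at this
  rw [this]

theorem isMul (f : Match a a') {g h k : T ⟶ a.E.mor} (i : a.E.IsMul g h k) :
    a'.E.IsMul (g ≫ f.mor) (h ≫ f.mor) (k ≫ f.mor) := by
  rw [isMul_iff, f.associator] at i
  rw [isMul_iff, mor_κ, mor_κ, mor_κ, Category.assoc g f.mor, mor_t]
  simpa [← f.moment] using i

theorem mor_one (f : Match a a') : a.E.one ≫ f.mor = f.φ₀.hom ≫ a'.E.one :=
  CatGraph.Unitor.κ_inj (by rw [mor_κ, f.one, Category.assoc])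

theorem isRact (f : Match a a') {p p' : T ⟶ a.act.bun.X} {h : T ⟶ a.E.mor}
    (i : a.act.bun.IsRact p h p') :
    a'.act.bun.IsRact (p ≫ f.φ₁.hom) (h ≫ f.mor) (p' ≫ f.φ₁.hom) := by
  rw [isRact_iff, f.associator] at i
  rw [isRact_iff, mor_κ]
  simpa [f.left₂] using i

theorem isLE (f : Match a a') {p p' : T ⟶ a.act.bun.X} {ε : T ⟶ a.E.mor}
    (i : a.act.IsLE ε p p') : a'.act.IsLE (ε ≫ f.mor) (p ≫ f.φ₁.hom) (p' ≫ f.φ₁.hom) := by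
  rw [isLE_iff, f.associator] at i
  rw [isLE_iff, mor_κ]
  simpa [f.left₂] using i

theorem isLG (f : Match a a') {p p' : T ⟶ a.act.bun.X} {g : T ⟶ 𝒢.G.mor}
    (i : a.act.IsLG g p p') : a'.act.IsLG g (p ≫ f.φ₁.hom) (p' ≫ f.φ₁.hom) := by
  rw [isLG_iff, f.associator] at i
  rw [isLG_iff]
  refine ⟨by rw [i.1, Category.assoc, f.left₂], ?_⟩
  have h : (((p ≫ f.φ₁.hom) ≫ a'.act.bun.r) ≫ a'.E.one) ≫ a'.ρ.κ =
      (((p ≫ a.act.bun.r) ≫ a.E.one) ≫ a.ρ.κ) ≫ f.φ₁.hom := by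
    have := (p ≫ a.act.bun.r) ≫= f.one
    simp only [Category.assoc] at this ⊢
    rw [this, reassoc_of% f.right]
  rw [h]
  exact i.2

theorem isLact (f : Match a a') {p p' : T ⟶ a.act.bun.X} {k : T ⟶ (𝒢.prod a.J).mor}
    {k' : T ⟶ (𝒢.prod a'.J).mor} (i : a.act.bun.IsLact k p p')
    (h₁ : k' ≫ (fpFst a'.J 𝒢.t 𝒢.t_cover).mor = (k ≫ (fpFst a.J 𝒢.t 𝒢.t_cover).mor) ≫ f.mor)
    (h₂ : k' ≫ (fpSnd a'.J 𝒢.t 𝒢.t_cover).mor = k ≫ (fpSnd a.J 𝒢.t 𝒢.t_cover).mor) :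
    a'.act.bun.IsLact k' (p ≫ f.φ₁.hom) (p' ≫ f.φ₁.hom) := by
  obtain ⟨q, hq, hq'⟩ := CatGraph.ActionMorphism.isLact_iff_LG_LE.1 i
  exact CatGraph.ActionMorphism.isLact_iff_LG_LE.2
    ⟨_, by rw [h₂]; exact f.isLG hq, by rw [h₁]; exact f.isLE hq'⟩

theorem mor_symm (f : Match a a') : f.mor ≫ f.symm.mor = 𝟙 _ := by
  refine CatGraph.Unitor.κ_inj (ρ := a.ρ) ?_
  rw [mor_κ, ← Category.id_comp f.mor, mor_κ]
  simp [symm]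

theorem nonempty_iso (f : Match a a') : Nonempty (Iso a a') := ⟨{
  F := {
    ob := f.φ₀.hom
    mor := f.mor
    mor_s := f.mor_s
    mor_t := f.mor_t
    mor_one := f.mor_one
    mor_mul := fun g h e e' => by
      obtain ⟨e'', h⟩ := f.isMul ⟨e, rfl⟩
      exact h }
  isIso_ob := by dsimp; infer_instance
  isIso_mor := ⟨f.symm.mor, f.mor_symm, f.symm.mor_symm⟩
  F_J := f.moment
  φ := f.φ₁
  φ_fst := f.left₁.trans (Category.assoc _ _ _)
  φ_snd := f.left₂
  φ_r := f.right
  φ_lact := fun g g' p e e' h₁ h₂ => (f.isLact ⟨e, rfl⟩ (by rw [h₁, Category.assoc]) h₂).unique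
    ⟨e', rfl⟩
  φ_ract := fun p h e e' => (f.isRact ⟨e, rfl⟩).unique ⟨e', rfl⟩
  φ_α := fun _ _ _ _ => f.associator
  φ_ρ := fun p ε => by
    rw [CatGraph.unitorRel_iff, CatGraph.unitorRel_iff, mor_κ]
    exact (cancel_mono f.φ₁.hom).symm }⟩

end Match

end CatAction

namespace NerveData

variable (n : NerveData 𝒢 X)

theorem κ_one (g : T ⟶ 𝒢.G.ob) :
    (g ≫ 𝒢.G.one) ≫ 𝒢.ρ.κ = ((g ≫ n.e₁.hom) ≫ X.σ 1) ≫ n.e₂.inv := by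
  rw [← cancel_mono n.e₂.hom, (n.unitor g _).1 (CatGraph.unitorRel_iff.2 rfl)]
  simp

theorem lam_one (g : T ⟶ 𝒢.G.ob) :
    (g ≫ 𝒢.G.one) ≫ 𝒢.lam.κ = ((g ≫ n.e₁.hom) ≫ X.σ 0) ≫ n.e₂.inv := by
  rw [← cancel_mono n.e₂.hom, (n.leftUnitor g _).1 (CatGraph.leftUnitorRel_iff.2 rfl)]
  simp

theorem l₁ : n.e₂.hom ≫ X.δ 2 = 𝒢.mul.l₁ ≫ n.e₁.hom := n.left₁.trans (Category.assoc _ _ _).symm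

theorem l₂ : n.e₂.hom ≫ X.δ 0 = 𝒢.mul.l₂ ≫ n.e₁.hom := n.left₂.trans (Category.assoc _ _ _).symm

end NerveData

/-- An identification of `D` with the low-dimensional part of the action `2`-groupoid of the
categorified action `a`. -/
structure DataNerve (n : NerveData 𝒢 X) (a : CatAction 𝒢) (D : ActData W X) where
  φ₀ : a.E.ob ≅ D.A0
  φ₁ : a.act.bun.X ≅ D.A1
  moment : φ₀.hom ≫ D.p0 = a.J.map ≫ n.e₀.hom
  left₁ : φ₁.hom ≫ D.d1 = a.act.l₁ ≫ φ₀.hom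
  left₂ : φ₁.hom ≫ D.p1 = a.act.l₂ ≫ n.e₁.hom
  right : φ₁.hom ≫ D.d0 = a.act.bun.r ≫ φ₀.hom
  unitor : (a.E.one ≫ a.ρ.κ) ≫ φ₁.hom = φ₀.hom ≫ D.s0
  associator : ∀ {T : C} {p q : T ⟶ a.act.bun.X} {m : T ⟶ 𝒢.mul.bun.X} {s : T ⟶ a.act.bun.X},
    CatGraph.AssocRel a.α p q m s ↔
      D.R (p ≫ φ₁.hom) (q ≫ φ₁.hom) (s ≫ φ₁.hom) (m ≫ n.e₂.hom)

namespace DataNerve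

variable {n : NerveData 𝒢 X} {a a' : CatAction 𝒢} {D D' : ActData W X}

theorem nonempty_iso (N : DataNerve n a D) (N' : DataNerve n a' D) :
    Nonempty (CatAction.Iso a a') :=
  CatAction.Match.nonempty_iso {
    φ₀ := N.φ₀ ≪≫ N'.φ₀.symm
    φ₁ := N.φ₁ ≪≫ N'.φ₁.symm
    moment := by
      rw [← cancel_mono n.e₀.hom, Category.assoc, ← N'.moment]
      simp [N.moment]
    left₁ := by
      rw [← cancel_mono N'.φ₀.hom]
      simp [← N'.left₁, N.left₁]
    left₂ := by
      rw [← cancel_mono n.e₁.hom]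
      simp [← N'.left₂, N.left₂]
    right := by
      rw [← cancel_mono N'.φ₀.hom]
      simp [← N'.right, N.right]
    one := by
      have h₁ := N.unitor
      have h₂ := N'.unitor
      simp only [Category.assoc] at h₁ h₂
      rw [← cancel_mono N'.φ₁.hom]
      simp [h₁, h₂]
    associator := by
      intro T p q m s
      rw [N.associator, N'.associator]
      simp }

variable (n a)

/-- The low-dimensional part of the action `2`-groupoid. -/
noncomputable def dataOf (hX : IsNGroupoid W 2 X) : ActData W X where
  A0 := a.E.ob
  A1 := a.act.bun.X
  d0 := a.act.bun.r
  d1 := a.act.l₁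
  s0 := a.E.one ≫ a.ρ.κ
  p0 := a.J.map ≫ n.e₀.hom
  p1 := a.act.l₂ ≫ n.e₁.hom
  s0_d0 := by rw [CatGraph.Unitor.κ_r, a.E.one_s]
  s0_d1 := by rw [CatGraph.Unitor.κ_l₁, a.E.one_t]
  s0_p1 := by
    rw [← Category.assoc, CatGraph.Unitor.κ_l₂, a.E.one_t, Category.id_comp, Category.assoc,
      n.unit, Category.assoc]
  d0_p0 := by rw [← Category.assoc, ← CatGraph.ActionMorphism.l₂_s]; simp [n.source]
  d1_p0 := by rw [← Category.assoc, CatGraph.ActionMorphism.l₁_J]; simp [n.target]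
  R p q s x := CatGraph.AssocRel a.α p q (x ≫ n.e₂.inv) s
  R_nat w _ _ _ _ h := by simpa using h.nat w
  R_v1 h := h.w
  R_v0 h := h.l₁.symm
  R_v2 h := h.r.symm
  R_e01 {T p q s x} h := by
    rw [← Category.assoc, ← h.l₂]; simp [← n.l₁]
  R_e12 {T p q s x} h := by
    rw [← Category.assoc, ← h.l₃]; simp [← n.l₂]
  R_e02 {T p q s x} h := by
    rw [← Category.assoc, ← h.wR]; simp [← n.right]
  fill_c {T p q x} h₁ h₂ h₃ := by
    obtain ⟨c, hc⟩ := a.α.exists_c (m := x ≫ n.e₂.inv) h₁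
      (by rw [← cancel_mono n.e₁.hom, Category.assoc, Category.assoc, Category.assoc, h₂, ← n.l₁]; simp)
      (by rw [← cancel_mono n.e₁.hom, Category.assoc, Category.assoc, Category.assoc, h₃, ← n.l₂]; simp)
    exact ⟨c, hc, fun c' hc' => hc'.uniq_c hc⟩
  fill_b {T p s x} h₁ h₂ h₃ := by
    obtain ⟨c, hc⟩ := a.α.exists_b (m := x ≫ n.e₂.inv) h₁.symm
      (by rw [← cancel_mono n.e₁.hom, Category.assoc, Category.assoc, Category.assoc, h₂, ← n.l₁]; simp)
      (by rw [← cancel_mono n.e₁.hom, Category.assoc, Category.assoc, Category.assoc, h₃, ← n.right]; simp)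
    exact ⟨c, hc, fun c' hc' => hc'.uniq_b hc⟩
  unit_r {T} p := by
    have := a.assocRel_unit_r p
    rw [n.κ_one] at this
    simpa using this
  unit_l {T} p := by
    have := a.assocRel_unit_l p
    rw [n.lam_one] at this
    simpa using this
  pent {T} y {a₀₁ a₁₂ a₀₂ a₂₃ a₀₃ a₁₃} h₃ h₁ h₀ :=
    a.pentagon _ _ _ _ _ _ _ _ _ _ h₃ h₁ ((n.associator _ _ _ _).2
      ⟨y, by simp, by simp, by simp, by simp⟩) h₀
  l_cover := by
    refine ⟨(𝒢.prod a.J).ob, 𝒢.pr₁ a.J, 𝒢.pr₂ a.J ≫ n.e₁.hom, a.act.bun.l, ?_, rfl,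
      (Category.assoc _ _ _).symm, a.act.bun.l_cover⟩
    refine isPullback_of_points ?_ (fun p q e => ?_) (fun x y e e' => ?_)
    · rw [Category.assoc, n.target, reassoc_of% fp_cond (a := a.J) (b := 𝒢.t) (hb := 𝒢.t_cover)]
    · obtain ⟨k, h₁, h₂⟩ := exists_fpOb (a := a.J) (b := 𝒢.t) (hb := 𝒢.t_cover) p (q ≫ n.e₁.inv)
        (by rw [← cancel_mono n.e₀.hom, Category.assoc, e, Category.assoc _ 𝒢.t.map, ← n.target]
            simp)
      exact ⟨k, h₁, by rw [reassoc_of% h₂]; simp⟩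
    · exact fp_ob_ext e (by rw [← cancel_mono n.e₁.hom]; simpa using e')

/-- The action is identified with its data. -/
noncomputable def self (hX : IsNGroupoid W 2 X) : DataNerve n a (dataOf n a hX) where
  φ₀ := Iso.refl _
  φ₁ := Iso.refl _
  moment := Category.id_comp _
  left₁ := (Category.id_comp _).trans (Category.comp_id _).symm
  left₂ := Category.id_comp _
  right := (Category.id_comp _).trans (Category.comp_id _).symm
  unitor := (Category.comp_id _).trans (Category.id_comp _).symm
  associator {T p q m s} := by
    change _ ↔ CatGraph.AssocRel a.α (p ≫ 𝟙 _) (q ≫ 𝟙 _) ((m ≫ n.e₂.hom) ≫ n.e₂.inv) (s ≫ 𝟙 _)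
    rw [Category.comp_id, Category.comp_id, Category.comp_id, Category.assoc, n.e₂.hom_inv_id,
      Category.comp_id]

variable {n a}

/-- Transport along an isomorphism of data. -/
def trans (N : DataNerve n a D) (f : ActData.DataIso D D') : DataNerve n a D' where
  φ₀ := N.φ₀ ≪≫ f.φ₀
  φ₁ := N.φ₁ ≪≫ f.φ₁
  moment := by simp [f.p0, N.moment]
  left₁ := by simp [f.d1, reassoc_of% N.left₁]
  left₂ := by simp [f.p1, N.left₂]
  right := by simp [f.d0, reassoc_of% N.right]
  unitor := by
    have := N.unitor
    simp only [Category.assoc] at this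
    simp [f.s0, reassoc_of% this]
  associator := by
    intros
    rw [N.associator, f.R]
    simp

end DataNerve

end Actions

end HigherGpd

namespace HigherGpd

section Correspondence

variable {C : Type u} [Category.{v} C] {W : MorphismProperty C} [NicePretopology W]
  {T T' : C} {𝒢 : CatGroupoid W} {X A : SimplicialObject C} {n : NerveData 𝒢 X}
  {a a' : CatAction 𝒢} {π : A ⟶ X}

/-- A nerve of an action gives an identification of the low-dimensional data. -/
def ActionNerve.toDataNerve (N : ActionNerve n a π) (hπ : IsNGroupoidKanFibration W 2 π) :
    DataNerve n a hπ.toData where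
  φ₀ := N.φ₀
  φ₁ := N.φ₁
  moment := N.moment
  left₁ := N.left₁.trans (Category.assoc _ _ _).symm
  left₂ := N.left₂.trans (Category.assoc _ _ _).symm
  right := N.right
  unitor := by
    have := (N.unitor (𝟙 _) _).1 (CatGraph.unitorRel_iff.2 rfl)
    rwa [Category.id_comp, Category.id_comp] at this
  associator {T p q m s} := (N.associator p q m s).trans
    ⟨fun ⟨z, h₂, h₀, h, h₁⟩ => ⟨z, h₂, h₀, h₁, h⟩, fun ⟨z, h₂, h₀, h₁, h⟩ => ⟨z, h₂, h₀, h, h₁⟩⟩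

/-- An identification of the low-dimensional data gives a nerve. -/
def DataNerve.toActionNerve {hπ : IsNGroupoidKanFibration W 2 π}
    (N : DataNerve n a hπ.toData) : ActionNerve n a π where
  φ₀ := N.φ₀
  φ₁ := N.φ₁
  moment := N.moment
  left₁ := N.left₁.trans (Category.assoc _ _ _)
  left₂ := N.left₂.trans (Category.assoc _ _ _)
  right := N.right
  unitor {T} e x := by
    have h : ((e ≫ a.E.one) ≫ a.ρ.κ) ≫ N.φ₁.hom = (e ≫ N.φ₀.hom) ≫ A.σ 0 := by
      refine Eq.trans ?_ ((e ≫= N.unitor).trans (Category.assoc _ _ _).symm)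
      simp only [Category.assoc]
    rw [CatGraph.unitorRel_iff]
    exact (cancel_mono N.φ₁.hom).symm.trans (by rw [h]; exact Iff.rfl)
  associator p q m s := N.associator.trans
    ⟨fun ⟨z, h₂, h₀, h₁, h⟩ => ⟨z, h₂, h₀, h, h₁⟩, fun ⟨z, h₂, h₀, h, h₁⟩ => ⟨z, h₂, h₀, h₁, h⟩⟩

namespace DataNerve

variable {D D' : ActData W X}

/-- The data of an action are unique up to isomorphism. -/
def dataIso (N : DataNerve n a D) (N' : DataNerve n a D') : ActData.DataIso D D' where
  φ₀ := N.φ₀.symm ≪≫ N'.φ₀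
  φ₁ := N.φ₁.symm ≪≫ N'.φ₁
  d0 := by simp [Iso.inv_comp_eq, N'.right, reassoc_of% N.right]
  d1 := by simp [Iso.inv_comp_eq, N'.left₁, reassoc_of% N.left₁]
  s0 := by
    have h₁ := N.unitor
    have h₂ := N'.unitor
    simp only [Category.assoc] at h₁ h₂
    simp [Iso.inv_comp_eq, ← h₂, ← reassoc_of% h₁]
  p0 := by simp [Iso.inv_comp_eq, N'.moment, N.moment]
  p1 := by simp [Iso.inv_comp_eq, N'.left₂, N.left₂]
  R {T} p q s x := by
    have h := N.associator (p := p ≫ N.φ₁.inv) (q := q ≫ N.φ₁.inv) (s := s ≫ N.φ₁.inv)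
      (m := x ≫ n.e₂.inv)
    have h' := N'.associator (p := p ≫ N.φ₁.inv) (q := q ≫ N.φ₁.inv) (s := s ≫ N.φ₁.inv)
      (m := x ≫ n.e₂.inv)
    simp only [Category.assoc, Iso.inv_hom_id, Category.comp_id] at h h'
    exact h.symm.trans h'

/-- Transport along an isomorphism of actions. -/
noncomputable def ofIso (i : CatAction.Iso a a') (N : DataNerve n a' D) : DataNerve n a D :=
  have := i.isIso_ob
  { φ₀ := asIso i.F.ob ≪≫ N.φ₀
    φ₁ := i.φ ≪≫ N.φ₁
    moment := by simp [N.moment, reassoc_of% i.F_J]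
    left₁ := by
      have h : i.φ.hom ≫ a'.act.l₁ = a.act.l₁ ≫ i.F.ob :=
        i.φ_fst.trans (Category.assoc _ _ _).symm
      simp [N.left₁, reassoc_of% h]
    left₂ := by
      have h : i.φ.hom ≫ a'.act.l₂ = a.act.l₂ := i.φ_snd
      simp [N.left₂, reassoc_of% h]
    right := by simp [N.right, reassoc_of% i.φ_r]
    unitor := by
      have h := (i.φ_ρ (a.E.one ≫ a.ρ.κ) a.E.one).1 (CatGraph.unitorRel_iff.2 rfl)
      rw [CatGraph.unitorRel_iff, i.F.mor_one] at h
      have h' := N.unitor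
      simp only [Category.assoc] at h h'
      simp [reassoc_of% h, h']
    associator := by
      intros
      rw [i.φ_α, N.associator]
      simp }

end DataNerve

/-- Isomorphic fibrations have isomorphic data. -/
def ActData.dataIsoOfOverIso {A' : SimplicialObject C} {π' : A' ⟶ X}
    (hπ : IsNGroupoidKanFibration W 2 π) (hπ' : IsNGroupoidKanFibration W 2 π')
    (i : Over.mk π ≅ Over.mk π') : ActData.DataIso hπ.toData hπ'.toData :=
  have h : ∀ k, i.hom.left.app k ≫ π'.app k = π.app k := fun k =>
    congrArg (fun f : A ⟶ X => f.app k) (Over.w i.hom)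
  have h' : ∀ k, i.inv.left.app k ≫ π.app k = π'.app k := fun k =>
    congrArg (fun f : A' ⟶ X => f.app k) (Over.w i.inv)
  let e : ∀ k, A.obj k ≅ A'.obj k := fun k => ((Over.forget X).mapIso i).app k
  { φ₀ := e (op ⦋0⦌)
    φ₁ := e (op ⦋1⦌)
    d0 := (SimplicialObject.δ_naturality i.hom.left 0).symm
    d1 := (SimplicialObject.δ_naturality i.hom.left 1).symm
    s0 := (SimplicialObject.σ_naturality i.hom.left 0).symm
    p0 := h _
    p1 := h _
    R := fun {T} p q s x => by
      constructor
      · rintro ⟨z, rfl, rfl, rfl, rfl⟩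
        refine ⟨z ≫ i.hom.left.app (op ⦋2⦌), ?_, ?_, ?_, ?_⟩
        · exact (Category.assoc _ _ _).trans ((z ≫=
            (SimplicialObject.δ_naturality i.hom.left (2 : Fin 3)).symm).trans (Category.assoc _ _ _).symm)
        · exact (Category.assoc _ _ _).trans ((z ≫=
            (SimplicialObject.δ_naturality i.hom.left (0 : Fin 3)).symm).trans (Category.assoc _ _ _).symm)
        · exact (Category.assoc _ _ _).trans ((z ≫=
            (SimplicialObject.δ_naturality i.hom.left (1 : Fin 3)).symm).trans (Category.assoc _ _ _).symm)
        · exact (Category.assoc _ _ _).trans (z ≫= h _)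
      · rintro ⟨z, h₂, h₀, h₁, rfl⟩
        have key : ∀ {y : T ⟶ A _⦋1⦌} (j : Fin 3), z ≫ A'.δ j = y ≫ (e (op ⦋1⦌)).hom →
            (z ≫ i.inv.left.app (op ⦋2⦌)) ≫ A.δ j = y := by
          intro y j hj
          rw [← cancel_mono (e (op ⦋1⦌)).hom, ← hj, Category.assoc, Category.assoc]
          refine z ≫= ?_
          have h₁ : i.inv.left.app (op ⦋2⦌) ≫ A.δ j = A'.δ j ≫ i.inv.left.app (op ⦋1⦌) :=
            (SimplicialObject.δ_naturality i.inv.left j).symm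
          refine (Category.assoc _ _ _).symm.trans ((h₁ =≫ _).trans ((Category.assoc _ _ _).trans ?_))
          exact (_ ≫= (e (op ⦋1⦌)).inv_hom_id).trans (Category.comp_id _)
        exact ⟨z ≫ i.inv.left.app (op ⦋2⦌), key 2 h₂, key 0 h₀, key 1 h₁,
          (Category.assoc _ _ _).trans (z ≫= h' _)⟩ }

variable (n) in
/-- Isomorphism classes of categorified actions correspond to isomorphism classes of Kan
fibrations. -/
theorem exists_equiv_of_exists_action (hX : IsNGroupoid W 2 X)
    (H : ∀ D : ActData W X, ∃ a : CatAction 𝒢, Nonempty (DataNerve n a D)) :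
    ∃ Φ : Quotient (CatAction.isoSetoid 𝒢) ≃ Quotient (TwoGroupoidKanFibration.isoSetoid W X),
      ∀ (a : CatAction 𝒢) (π : TwoGroupoidKanFibration W X),
        Φ ⟦a⟧ = ⟦π⟧ ↔ Nonempty (ActionNerve n a π.1.hom) := by
  have ex : ∀ a : CatAction 𝒢, ∃ π : TwoGroupoidKanFibration W X,
      Nonempty (ActionNerve n a π.1.hom) := by
    intro a
    obtain ⟨A, π, hπ, ⟨f⟩⟩ := (DataNerve.dataOf n a hX).exists_dataIso hX
    exact ⟨⟨Over.mk π, hπ⟩, ⟨DataNerve.toActionNerve (hπ := hπ)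
      ((DataNerve.self n a hX).trans f.symm)⟩⟩
  have iso : ∀ (a : CatAction 𝒢) (π π' : TwoGroupoidKanFibration W X),
      Nonempty (ActionNerve n a π.1.hom) → Nonempty (ActionNerve n a π'.1.hom) →
      Nonempty (π.1 ≅ π'.1) := by
    rintro a ⟨π, hπ⟩ ⟨π', hπ'⟩ ⟨N⟩ ⟨N'⟩
    exact ActData.nonempty_iso_of_dataIso ((N.toDataNerve hπ).dataIso (N'.toDataNerve hπ'))
  have iso' : ∀ (a a' : CatAction 𝒢) (π : TwoGroupoidKanFibration W X),
      Nonempty (ActionNerve n a π.1.hom) → Nonempty (ActionNerve n a' π.1.hom) →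
      Nonempty (CatAction.Iso a a') := by
    rintro a a' ⟨π, hπ⟩ ⟨N⟩ ⟨N'⟩
    exact (N.toDataNerve hπ).nonempty_iso (N'.toDataNerve hπ)
  have tr : ∀ (a a' : CatAction 𝒢) (π π' : TwoGroupoidKanFibration W X),
      Nonempty (CatAction.Iso a a') → Nonempty (π.1 ≅ π'.1) →
      Nonempty (ActionNerve n a' π.1.hom) → Nonempty (ActionNerve n a π'.1.hom) := by
    rintro a a' ⟨π, hπ⟩ ⟨π', hπ'⟩ ⟨i⟩ ⟨j⟩ ⟨N⟩
    exact ⟨DataNerve.toActionNerve (hπ := hπ')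
      (((N.toDataNerve hπ).ofIso i).trans (ActData.dataIsoOfOverIso hπ hπ' j))⟩
  choose F hF using ex
  let Φ : Quotient (CatAction.isoSetoid 𝒢) → Quotient (TwoGroupoidKanFibration.isoSetoid W X) :=
    Quotient.map F fun a a' h => iso a _ _ (hF a)
      (tr a a' _ _ h ⟨Iso.refl _⟩ (hF a'))
  have hΦ : ∀ (a : CatAction 𝒢) (π : TwoGroupoidKanFibration W X),
      Φ ⟦a⟧ = ⟦π⟧ ↔ Nonempty (ActionNerve n a π.1.hom) := fun a π =>
    ⟨fun h => tr a a _ _ (CatAction.Iso.refl a) (Quotient.exact h) (hF a),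
      fun h => Quotient.sound (iso a _ _ (hF a) h)⟩
  have bij : Function.Bijective Φ := by
    constructor
    · rintro ⟨a⟩ ⟨a'⟩ h
      exact Quotient.sound (iso' a a' (F a) (hF a) ((hΦ a' (F a)).1 h.symm))
    · rintro ⟨π, hπ⟩
      obtain ⟨a, ⟨N⟩⟩ := H (IsNGroupoidKanFibration.toData hπ)
      exact ⟨⟦a⟧, (hΦ a ⟨π, hπ⟩).2 ⟨N.toActionNerve⟩⟩
  exact ⟨Equiv.ofBijective Φ bij, hΦ⟩

end Correspondence

end HigherGpd

namespace HigherGpd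

section Actions

variable {C : Type u} [Category.{v} C] {W : MorphismProperty C} [NicePretopology W]
  {T T' : C}

/-- The subobject on which the second component of a covering square is a section of the first. -/
theorem CoverSq.exists_fiber {Z A B S : C} {f : Z ⟶ A} {g : Z ⟶ B} {a : A ⟶ S} {b : B ⟶ S}
    (h : CoverSq W f g a b) (σ : A ⟶ B) (e : σ ≫ b = a) :
    ∃ (K : C) (κ : K ⟶ Z), W (κ ≫ f) ∧
      (∀ {T : C} (x : T ⟶ K), (x ≫ κ) ≫ g = ((x ≫ κ) ≫ f) ≫ σ) ∧
      (∀ {T : C} (z : T ⟶ Z), z ≫ g = (z ≫ f) ≫ σ → ∃ x, x ≫ κ = z) ∧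
      ∀ {T : C} (x y : T ⟶ K), x ≫ κ = y ≫ κ → x = y := by
  obtain ⟨P, p, q, l, hP, hl₁, hl₂, hl⟩ := h
  have h₁ : hP.lift (𝟙 A) σ (by rw [Category.id_comp, e]) ≫ p = 𝟙 A := hP.lift_fst _ _ _
  have h₂ : hP.lift (𝟙 A) σ (by rw [Category.id_comp, e]) ≫ q = σ := hP.lift_snd _ _ _
  set s := hP.lift (𝟙 A) σ (by rw [Category.id_comp, e])
  have hc := Fp.cond (f := s) hl
  have hf : Fp.snd (f := s) hl ≫ f = Fp.fst (f := s) hl := by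
    rw [← hl₁, ← Category.assoc, ← hc, Category.assoc, h₁, Category.comp_id]
  refine ⟨Fp s l hl, Fp.snd hl, by rw [hf]; exact Fp.fst_cover hl, fun x => ?_, fun z hz => ?_,
    fun x y h => Fp.ext hl ?_ h⟩
  · rw [Category.assoc x, Category.assoc x, hf, ← hl₂, reassoc_of% hc.symm, h₂, Category.assoc]
  · exact ⟨Fp.lift hl (z ≫ f) z (hP.hom_ext
      (by rw [Category.assoc, h₁, Category.comp_id, Category.assoc, hl₁])
      (by rw [Category.assoc, h₂, ← hz, Category.assoc, hl₂])), Fp.lift_snd _ _ _ _⟩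
  · rw [← hf, ← Category.assoc, h, Category.assoc]

variable (W) in
/-- A groupoid described by the relation `g * h = k`. -/
structure GpdRel where
  ob : C
  mor : C
  s : mor ⟶ ob
  t : mor ⟶ ob
  t_cover : W t
  one : ob ⟶ mor
  one_s : one ≫ s = 𝟙 ob
  one_t : one ≫ t = 𝟙 ob
  M : ∀ {T : C}, (T ⟶ mor) → (T ⟶ mor) → (T ⟶ mor) → Prop
  nat : ∀ {T T' : C} (v : T' ⟶ T) {g h k : T ⟶ mor}, M g h k → M (v ≫ g) (v ≫ h) (v ≫ k)
  w : ∀ {T : C} {g h k : T ⟶ mor}, M g h k → g ≫ s = h ≫ t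
  M_s : ∀ {T : C} {g h k : T ⟶ mor}, M g h k → k ≫ s = h ≫ s
  M_t : ∀ {T : C} {g h k : T ⟶ mor}, M g h k → k ≫ t = g ≫ t
  total : ∀ {T : C} {g h : T ⟶ mor}, g ≫ s = h ≫ t → ∃ k, M g h k
  uniq : ∀ {T : C} {g h k k' : T ⟶ mor}, M g h k → M g h k' → k = k'
  one_mul : ∀ {T : C} (g : T ⟶ mor), M (g ≫ t ≫ one) g g
  mul_one : ∀ {T : C} (g : T ⟶ mor), M g (g ≫ s ≫ one) g
  assoc : ∀ {T : C} {g h k gh hk l : T ⟶ mor}, M g h gh → M h k hk → M gh k l → M g hk l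
  div : ∀ {T : C} {g k : T ⟶ mor}, g ≫ t = k ≫ t → ∃ h, M g h k

namespace GpdRel

variable (A : GpdRel W)

theorem exists_inv : ∃ i : A.mor ⟶ A.mor, A.M (𝟙 _) i (A.t ≫ A.one) :=
  A.div (by rw [Category.assoc, A.one_t, Category.comp_id, Category.id_comp])

/-- The inversion. -/
noncomputable def inv : A.mor ⟶ A.mor := A.exists_inv.choose

theorem mul_inv (g : T ⟶ A.mor) : A.M g (g ≫ A.inv) (g ≫ A.t ≫ A.one) := by
  have h := A.nat g A.exists_inv.choose_spec
  rw [Category.comp_id] at h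
  exact h

theorem inv_t : A.inv ≫ A.t = A.s := by
  exact (A.w A.exists_inv.choose_spec).symm.trans (Category.id_comp _)

theorem inv_s : A.inv ≫ A.s = A.t := by
  refine (A.M_s A.exists_inv.choose_spec).symm.trans ?_
  rw [Category.assoc, A.one_s, Category.comp_id]

theorem inv_inv : A.inv ≫ A.inv = 𝟙 _ := by
  have h₁ := A.mul_inv (𝟙 A.mor)
  have h₂ := A.mul_inv A.inv
  rw [reassoc_of% A.inv_t] at h₂
  simp only [Category.id_comp] at h₁
  have h₃ := A.one_mul (A.inv ≫ A.inv)
  rw [Category.assoc, reassoc_of% A.inv_t, reassoc_of% A.inv_s] at h₃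
  have h₄ := A.mul_one (𝟙 A.mor)
  simp only [Category.id_comp] at h₄
  exact A.uniq (A.assoc h₁ h₂ h₃) h₄

/-- The groupoid. -/
noncomputable def toGpd : Gpd W where
  ob := A.ob
  mor := A.mor
  s := A.s
  t := A.t
  s_cover := by
    rw [← A.inv_t]
    exact cover_comp (SingletonPretopology.of_isIso _ ⟨A.inv, A.inv_inv, A.inv_inv⟩) A.t_cover
  t_cover := A.t_cover
  one := A.one
  inv := A.inv
  mul g h e := (A.total e).choose
  mul_nat v g h e e' := A.uniq (A.total e').choose_spec (A.nat v (A.total e).choose_spec)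
  one_s := A.one_s
  one_t := A.one_t
  inv_s := A.inv_s
  inv_t := A.inv_t
  mul_s g h e := A.M_s (A.total e).choose_spec
  mul_t g h e := A.M_t (A.total e).choose_spec
  one_mul g e := A.uniq (A.total e).choose_spec (A.one_mul g)
  mul_one g e := A.uniq (A.total e).choose_spec (A.mul_one g)
  mul_assoc g h k e₁ e₂ e₃ e₄ := (A.uniq (A.total e₄).choose_spec
    (A.assoc (A.total e₁).choose_spec (A.total e₂).choose_spec (A.total e₃).choose_spec)).symm
  mul_inv g e := A.uniq (A.total e).choose_spec (A.mul_inv g)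
  inv_mul g e := A.uniq (A.total e).choose_spec (by
    have := A.mul_inv (g ≫ A.inv)
    simpa [A.inv_inv, reassoc_of% A.inv_t] using this)

theorem isMul_iff {g h k : T ⟶ A.mor} : A.toGpd.IsMul g h k ↔ A.M g h k :=
  ⟨fun ⟨e, h⟩ => h ▸ (A.total e).choose_spec, fun h => ⟨A.w h, A.uniq (A.total (A.w h)).choose_spec h⟩⟩

end GpdRel

/-- A morphism of bibundles from its compatibility with the action relations. -/
def HSHom.of {G H : Gpd W} {P Q : HSBibundle G H} (f : P.X ⟶ Q.X) (hl : f ≫ Q.l = P.l)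
    (hr : f ≫ Q.r = P.r)
    (hL : ∀ {T : C} {g : T ⟶ G.mor} {p p' : T ⟶ P.X}, P.IsLact g p p' →
      Q.IsLact g (p ≫ f) (p' ≫ f))
    (hR : ∀ {T : C} {h : T ⟶ H.mor} {p p' : T ⟶ P.X}, P.IsRact p h p' →
      Q.IsRact (p ≫ f) h (p' ≫ f)) : HSHom P Q where
  map := f
  map_l := hl
  map_r := hr
  map_lact g p e e' := (hL ⟨e, rfl⟩).unique ⟨e', rfl⟩
  map_ract p h e e' := (hR ⟨e, rfl⟩).unique ⟨e', rfl⟩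

/-- Morphisms out of a composite of bibundles. -/
theorem Composite.nonempty_hom {G H K : Gpd W} {P : HSBibundle G H} {Q : HSBibundle H K}
    (A : Composite P Q) {Z : HSBibundle G K}
    (φ : ∀ {T : C}, (T ⟶ P.X) → (T ⟶ Q.X) → (T ⟶ Z.X) → Prop)
    (nat : ∀ {T T' : C} (v : T' ⟶ T) {p : T ⟶ P.X} {q : T ⟶ Q.X} {z : T ⟶ Z.X},
      φ p q z → φ (v ≫ p) (v ≫ q) (v ≫ z))
    (total : ∀ {T : C} {p : T ⟶ P.X} {q : T ⟶ Q.X}, p ≫ P.r = q ≫ Q.l → ∃ z, φ p q z)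
    (uniq : ∀ {T : C} {p : T ⟶ P.X} {q : T ⟶ Q.X} {z z' : T ⟶ Z.X}, φ p q z → φ p q z' → z = z')
    (l : ∀ {T : C} {p : T ⟶ P.X} {q : T ⟶ Q.X} {z : T ⟶ Z.X}, φ p q z → z ≫ Z.l = p ≫ P.l)
    (r : ∀ {T : C} {p : T ⟶ P.X} {q : T ⟶ Q.X} {z : T ⟶ Z.X}, φ p q z → z ≫ Z.r = q ≫ Q.r)
    (bal : ∀ {T : C} {p p' : T ⟶ P.X} {q q' : T ⟶ Q.X} {z : T ⟶ Z.X} {h : T ⟶ H.mor},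
      P.IsRact p h p' → Q.IsLact h q q' → φ p' q z → φ p q' z)
    (lact : ∀ {T : C} {p p' : T ⟶ P.X} {q : T ⟶ Q.X} {z z' : T ⟶ Z.X} {g : T ⟶ G.mor},
      φ p q z → P.IsLact g p p' → Z.IsLact g z z' → φ p' q z')
    (ract : ∀ {T : C} {p : T ⟶ P.X} {q q' : T ⟶ Q.X} {z z' : T ⟶ Z.X} {k : T ⟶ K.mor},
      φ p q z → Q.IsRact q k q' → Z.IsRact z k z' → φ p q' z') :
    Nonempty (HSHom A.R Z) := by
  obtain ⟨T₀, w₀, p₀, q₀, hw₀, i₀⟩ := A.surj (𝟙 _)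
  rw [Category.comp_id] at i₀
  obtain ⟨z₀, hz₀⟩ := total i₀.w
  obtain ⟨F, hF⟩ := exists_hom_of_local (W := W) (Y := A.R.X) (V := Z.X)
    (fun n z => ∃ p q, A.IsTen p q n ∧ φ p q z)
    (fun v _ _ ⟨p, q, i, h⟩ => ⟨_, _, i.nat v, nat v h⟩) ⟨T₀, w₀, z₀, hw₀, _, _, i₀, hz₀⟩
    (fun ⟨p, q, i, h⟩ ⟨p', q', i', h'⟩ => by
      obtain ⟨k, hk, hk'⟩ := i.exact i'
      exact uniq (bal hk hk' h) h')
  have hF' : ∀ {T : C} {p : T ⟶ P.X} {q : T ⟶ Q.X} {n : T ⟶ A.R.X} {z : T ⟶ Z.X},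
      A.IsTen p q n → φ p q z → n ≫ F = z := fun i h => hF ⟨_, _, i, h⟩
  have hl : F ≫ Z.l = A.R.l := cover_cancel hw₀ (by
    rw [← Category.assoc, hF' i₀ hz₀, l hz₀, i₀.l])
  have hr : F ≫ Z.r = A.R.r := cover_cancel hw₀ (by
    rw [← Category.assoc, hF' i₀ hz₀, r hz₀, i₀.r])
  refine ⟨HSHom.of F hl hr (fun {T g n n'} i => ?_) (fun {T g n n'} i => ?_)⟩
  · obtain ⟨z', hz'⟩ := HSBibundle.exists_isLact (P := Z) (g := g) (p := n ≫ F)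
      (by rw [Category.assoc, hl, i.w])
    convert hz'
    obtain ⟨T', w, p, q, hw, j⟩ := A.surj n
    obtain ⟨z, hz⟩ := total j.w
    have k := hz'.nat w
    have i' := i.nat w
    obtain ⟨p', hp'⟩ := HSBibundle.exists_isLact (P := P) (g := w ≫ g) (p := p)
      (by rw [i'.w, j.l])
    rw [← Category.assoc, hF' j hz] at k
    exact cover_cancel hw ((Category.assoc _ _ _).symm.trans (hF' (j.lact hp' i') (lact hz hp' k)))
  · obtain ⟨z', hz'⟩ := HSBibundle.exists_isRact (P := Z) (h := g) (p := n ≫ F)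
      (by rw [Category.assoc, hr, i.w])
    convert hz'
    obtain ⟨T', w, p, q, hw, j⟩ := A.surj n
    obtain ⟨z, hz⟩ := total j.w
    have k := hz'.nat w
    have i' := i.nat w
    obtain ⟨q', hq'⟩ := HSBibundle.exists_isRact (P := Q) (h := w ≫ g) (p := q)
      (by rw [← i'.w, j.r])
    rw [← Category.assoc, hF' j hz] at k
    exact cover_cancel hw ((Category.assoc _ _ _).symm.trans (hF' (j.ract hq' i') (ract hz hq' k)))

/-- An action morphism described by the relations `p * h = p'`, `(ε, 1) * p = p'` and
`(1, g) * p = p'`. -/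
structure ActRel (𝒢 : CatGraph W) {E : Gpd W} (J : E.ToTriv 𝒢.M) where
  X : C
  l₁ : X ⟶ E.ob
  l₂ : X ⟶ 𝒢.G.ob
  r : X ⟶ E.ob
  l₁_J : l₁ ≫ J.map = l₂ ≫ 𝒢.t.map
  l₂_s : l₂ ≫ 𝒢.s.map = r ≫ J.map
  cover : CoverSq W l₁ l₂ J.map 𝒢.t.map
  Ra : ∀ {T : C}, (T ⟶ X) → (T ⟶ E.mor) → (T ⟶ X) → Prop
  Le : ∀ {T : C}, (T ⟶ E.mor) → (T ⟶ X) → (T ⟶ X) → Prop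
  Lg : ∀ {T : C}, (T ⟶ 𝒢.G.mor) → (T ⟶ X) → (T ⟶ X) → Prop
  Ra_nat : ∀ {T T' : C} (v : T' ⟶ T) {p p' : T ⟶ X} {h : T ⟶ E.mor}, Ra p h p' →
    Ra (v ≫ p) (v ≫ h) (v ≫ p')
  Le_nat : ∀ {T T' : C} (v : T' ⟶ T) {p p' : T ⟶ X} {ε : T ⟶ E.mor}, Le ε p p' →
    Le (v ≫ ε) (v ≫ p) (v ≫ p')
  Lg_nat : ∀ {T T' : C} (v : T' ⟶ T) {p p' : T ⟶ X} {g : T ⟶ 𝒢.G.mor}, Lg g p p' →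
    Lg (v ≫ g) (v ≫ p) (v ≫ p')
  Ra_total : ∀ {T : C} {p : T ⟶ X} {h : T ⟶ E.mor}, p ≫ r = h ≫ E.t → ∃ p', Ra p h p'
  Le_total : ∀ {T : C} {p : T ⟶ X} {ε : T ⟶ E.mor}, ε ≫ E.s = p ≫ l₁ → ∃ p', Le ε p p'
  Lg_total : ∀ {T : C} {p : T ⟶ X} {g : T ⟶ 𝒢.G.mor}, g ≫ 𝒢.G.s = p ≫ l₂ → ∃ p', Lg g p p'
  Ra_uniq : ∀ {T : C} {p p' p'' : T ⟶ X} {h : T ⟶ E.mor}, Ra p h p' → Ra p h p'' → p' = p''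
  Le_uniq : ∀ {T : C} {p p' p'' : T ⟶ X} {ε : T ⟶ E.mor}, Le ε p p' → Le ε p p'' → p' = p''
  Lg_uniq : ∀ {T : C} {p p' p'' : T ⟶ X} {g : T ⟶ 𝒢.G.mor}, Lg g p p' → Lg g p p'' → p' = p''
  Ra_w : ∀ {T : C} {p p' : T ⟶ X} {h : T ⟶ E.mor}, Ra p h p' →
    p ≫ r = h ≫ E.t ∧ p' ≫ l₁ = p ≫ l₁ ∧ p' ≫ l₂ = p ≫ l₂ ∧ p' ≫ r = h ≫ E.s
  Le_w : ∀ {T : C} {p p' : T ⟶ X} {ε : T ⟶ E.mor}, Le ε p p' →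
    ε ≫ E.s = p ≫ l₁ ∧ p' ≫ l₁ = ε ≫ E.t ∧ p' ≫ l₂ = p ≫ l₂ ∧ p' ≫ r = p ≫ r
  Lg_w : ∀ {T : C} {p p' : T ⟶ X} {g : T ⟶ 𝒢.G.mor}, Lg g p p' →
    g ≫ 𝒢.G.s = p ≫ l₂ ∧ p' ≫ l₁ = p ≫ l₁ ∧ p' ≫ l₂ = g ≫ 𝒢.G.t ∧ p' ≫ r = p ≫ r
  Ra_one : ∀ {T : C} (p : T ⟶ X), Ra p (p ≫ r ≫ E.one) p
  Le_one : ∀ {T : C} (p : T ⟶ X), Le (p ≫ l₁ ≫ E.one) p p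
  Lg_one : ∀ {T : C} (p : T ⟶ X), Lg (p ≫ l₂ ≫ 𝒢.G.one) p p
  Ra_mul : ∀ {T : C} {p p' p'' : T ⟶ X} {h h' k : T ⟶ E.mor}, Ra p h p' → Ra p' h' p'' →
    E.IsMul h h' k → Ra p k p''
  Le_mul : ∀ {T : C} {p p' p'' : T ⟶ X} {ε ε' k : T ⟶ E.mor}, Le ε p p' → Le ε' p' p'' →
    E.IsMul ε' ε k → Le k p p''
  Lg_mul : ∀ {T : C} {p p' p'' : T ⟶ X} {g g' k : T ⟶ 𝒢.G.mor}, Lg g p p' → Lg g' p' p'' →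
    𝒢.G.IsMul g' g k → Lg k p p''
  Le_Ra : ∀ {T : C} {p p' q q' : T ⟶ X} {ε h : T ⟶ E.mor}, Le ε p p' → Ra p h q → Le ε q q' →
    Ra p' h q'
  Lg_Ra : ∀ {T : C} {p p' q q' : T ⟶ X} {g : T ⟶ 𝒢.G.mor} {h : T ⟶ E.mor}, Lg g p p' →
    Ra p h q → Ra p' h q' → Lg g q q'
  Le_Lg : ∀ {T : C} {p p' q q' : T ⟶ X} {g : T ⟶ 𝒢.G.mor} {ε : T ⟶ E.mor}, Le ε p q →
    Lg g p p' → Le ε p' q' → Lg g q q'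
  shear : ∀ {T : C} {p p' : T ⟶ X}, p ≫ l₁ = p' ≫ l₁ → p ≫ l₂ = p' ≫ l₂ → ∃! h, Ra p h p'

namespace ActRel

variable {𝒢 : CatGraph W} {E : Gpd W} {J : E.ToTriv 𝒢.M} (A : ActRel 𝒢 J)

/-- The combined left action. -/
def L (k : T ⟶ (𝒢.prod J).mor) (p p' : T ⟶ A.X) : Prop :=
  ∃ q, A.Lg (k ≫ (fpSnd J 𝒢.t 𝒢.t_cover).mor) p q ∧ A.Le (k ≫ (fpFst J 𝒢.t 𝒢.t_cover).mor) q p'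

/-- The left moment map. -/
noncomputable def l : A.X ⟶ (𝒢.prod J).ob := fpOb J 𝒢.t 𝒢.t_cover A.l₁ A.l₂ A.l₁_J

theorem l_fst : A.l ≫ (fpFst J 𝒢.t 𝒢.t_cover).ob = A.l₁ := fpOb_fst _ _ _

theorem l_snd : A.l ≫ (fpSnd J 𝒢.t 𝒢.t_cover).ob = A.l₂ := fpOb_snd _ _ _

variable {A}

theorem L_nat (v : T' ⟶ T) {k : T ⟶ (𝒢.prod J).mor} {p p' : T ⟶ A.X} (h : A.L k p p') :
    A.L (v ≫ k) (v ≫ p) (v ≫ p') := by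
  obtain ⟨q, h₁, h₂⟩ := h
  exact ⟨v ≫ q, by simpa using A.Lg_nat v h₁, by simpa using A.Le_nat v h₂⟩

theorem L_uniq {k : T ⟶ (𝒢.prod J).mor} {p p' p'' : T ⟶ A.X} (h : A.L k p p') (h' : A.L k p p'') :
    p' = p'' := by
  obtain ⟨q, h₁, h₂⟩ := h
  obtain ⟨q', h₁', h₂'⟩ := h'
  obtain rfl := A.Lg_uniq h₁ h₁'
  exact A.Le_uniq h₂ h₂'

theorem L_total {k : T ⟶ (𝒢.prod J).mor} {p : T ⟶ A.X} (e : k ≫ (𝒢.prod J).s = p ≫ A.l) :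
    ∃ p', A.L k p p' := by
  have e₁ : (k ≫ (fpFst J 𝒢.t 𝒢.t_cover).mor) ≫ E.s = p ≫ A.l₁ := by
    rw [Category.assoc, ← Gpd.Fun.s_ob, ← Category.assoc, e, Category.assoc, A.l_fst]
  have e₂ : (k ≫ (fpSnd J 𝒢.t 𝒢.t_cover).mor) ≫ 𝒢.G.s = p ≫ A.l₂ := by
    rw [Category.assoc, ← Gpd.Fun.s_ob, ← Category.assoc, e, Category.assoc, A.l_snd]
  obtain ⟨q, hq⟩ := A.Lg_total e₂
  obtain ⟨p', hp'⟩ := A.Le_total (e₁.trans (A.Lg_w hq).2.1.symm)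
  exact ⟨p', q, hq, hp'⟩

theorem L_l {k : T ⟶ (𝒢.prod J).mor} {p p' : T ⟶ A.X} (h : A.L k p p') :
    p' ≫ A.l = k ≫ (𝒢.prod J).t := by
  obtain ⟨q, h₁, h₂⟩ := h
  refine fp_ob_ext ?_ ?_
  · rw [Category.assoc, A.l_fst, (A.Le_w h₂).2.1, Category.assoc, Category.assoc, Gpd.Fun.t_ob]
  · rw [Category.assoc, A.l_snd, (A.Le_w h₂).2.2.1, (A.Lg_w h₁).2.2.1, Category.assoc,
      Category.assoc, Gpd.Fun.t_ob]

theorem L_r {k : T ⟶ (𝒢.prod J).mor} {p p' : T ⟶ A.X} (h : A.L k p p') : p' ≫ A.r = p ≫ A.r := by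
  obtain ⟨q, h₁, h₂⟩ := h
  rw [(A.Le_w h₂).2.2.2, (A.Lg_w h₁).2.2.2]

theorem L_one (p : T ⟶ A.X) : A.L (p ≫ A.l ≫ (𝒢.prod J).one) p p := by
  refine ⟨p, ?_, ?_⟩
  · convert A.Lg_one p using 1
    rw [Category.assoc, Category.assoc, Gpd.Fun.mor_one, reassoc_of% A.l_snd]
  · convert A.Le_one p using 1
    rw [Category.assoc, Category.assoc, Gpd.Fun.mor_one, reassoc_of% A.l_fst]

theorem L_mul {g g' k : T ⟶ (𝒢.prod J).mor} {p p' p'' : T ⟶ A.X} (h : A.L g p p')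
    (h' : A.L g' p' p'') (i : (𝒢.prod J).IsMul g' g k) : A.L k p p'' := by
  obtain ⟨i₁, i₂⟩ := fiberProd_isMul_iff.1 i
  obtain ⟨q, h₁, h₂⟩ := h
  obtain ⟨q', h₁', h₂'⟩ := h'
  obtain ⟨x, hx⟩ := A.Lg_total (p := q) ((A.Lg_w h₁').1.trans (A.Le_w h₂).2.2.1)
  obtain ⟨x', hx'⟩ := A.Le_total (p := x) ((A.Le_w h₂).1.trans (A.Lg_w hx).2.1.symm)
  obtain rfl := A.Lg_uniq (A.Le_Lg h₂ hx hx') h₁'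
  exact ⟨x, A.Lg_mul h₁ hx i₂, A.Le_mul hx' h₂' i₁⟩

theorem L_Ra {k : T ⟶ (𝒢.prod J).mor} {p p' q q' : T ⟶ A.X} {h : T ⟶ E.mor} (i : A.L k p p')
    (j : A.Ra p h q) (i' : A.L k q q') : A.Ra p' h q' := by
  obtain ⟨x, h₁, h₂⟩ := i
  obtain ⟨y, h₁', h₂'⟩ := i'
  obtain ⟨z, hz⟩ := A.Ra_total ((A.Lg_w h₁).2.2.2.trans (A.Ra_w j).1)
  obtain rfl := A.Lg_uniq h₁' (A.Lg_Ra h₁ j hz)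
  exact A.Le_Ra h₂ hz h₂'

variable (A)

theorem l_cover : W A.l := by
  obtain ⟨P, p, q, l, hP, h₁, h₂, hl⟩ := A.cover
  let i : P ⟶ (𝒢.prod J).ob := fpOb J 𝒢.t 𝒢.t_cover p q hP.w
  have hi : IsIso i := by
    refine ⟨hP.lift (𝒢.pr₁ J) (𝒢.pr₂ J) fp_cond, hP.hom_ext ?_ ?_, fp_ob_ext ?_ ?_⟩
    · rw [Category.assoc, hP.lift_fst, Category.id_comp]; exact fpOb_fst _ _ _
    · rw [Category.assoc, hP.lift_snd, Category.id_comp]; exact fpOb_snd _ _ _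
    · rw [Category.assoc, fpOb_fst, hP.lift_fst]; exact (Category.id_comp _).symm
    · rw [Category.assoc, fpOb_snd, hP.lift_snd]; exact (Category.id_comp _).symm
  have e : A.l = l ≫ i := fp_ob_ext (by rw [A.l_fst, Category.assoc, fpOb_fst, h₁])
    (by rw [A.l_snd, Category.assoc, fpOb_snd, h₂])
  rw [e]
  exact cover_comp hl (SingletonPretopology.of_isIso _ hi)

/-- The bibundle. -/
noncomputable def bun : HSBibundle (𝒢.prod J) E where
  X := A.X
  l := A.l
  r := A.r
  lact g p e := (L_total e).choose
  ract p h e := (A.Ra_total e).choose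
  lact_nat v g p e e' := L_uniq (L_total e').choose_spec (L_nat v (L_total e).choose_spec)
  ract_nat v p h e e' := A.Ra_uniq (A.Ra_total e').choose_spec (A.Ra_nat v (A.Ra_total e).choose_spec)
  lact_l g p e := L_l (L_total e).choose_spec
  lact_r g p e := L_r (L_total e).choose_spec
  one_lact p e := L_uniq (L_total e).choose_spec (L_one p)
  mul_lact g g' p e₁ e₂ e₃ e₄ := L_uniq (L_total e₃).choose_spec
    (L_mul (L_total e₂).choose_spec (L_total e₄).choose_spec ⟨e₁, rfl⟩)
  ract_r p h e := (A.Ra_w (A.Ra_total e).choose_spec).2.2.2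
  ract_l p h e := fp_ob_ext
    (by rw [Category.assoc, A.l_fst, (A.Ra_w (A.Ra_total e).choose_spec).2.1, Category.assoc, A.l_fst])
    (by rw [Category.assoc, A.l_snd, (A.Ra_w (A.Ra_total e).choose_spec).2.2.1, Category.assoc, A.l_snd])
  ract_one p e := A.Ra_uniq (A.Ra_total e).choose_spec (A.Ra_one p)
  ract_mul p h h' e₁ e₂ e₃ e₄ := A.Ra_uniq (A.Ra_mul (A.Ra_total e₁).choose_spec
    (A.Ra_total e₂).choose_spec ⟨e₃, rfl⟩) (A.Ra_total e₄).choose_spec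
  comm g p h e₁ e₂ e₃ e₄ := A.Ra_uniq (A.Ra_total e₂).choose_spec (L_Ra (L_total e₁).choose_spec
    (A.Ra_total e₃).choose_spec (L_total e₄).choose_spec)
  l_cover := A.l_cover
  shear p p' e := by
    have e₁ := e =≫ (fpFst J 𝒢.t 𝒢.t_cover).ob
    have e₂ := e =≫ (fpSnd J 𝒢.t 𝒢.t_cover).ob
    rw [Category.assoc, Category.assoc, A.l_fst] at e₁
    rw [Category.assoc, Category.assoc, A.l_snd] at e₂
    obtain ⟨h, hh, hu⟩ := A.shear e₁ e₂
    refine ⟨h, ⟨(A.Ra_w hh).1, A.Ra_uniq (A.Ra_total (A.Ra_w hh).1).choose_spec hh⟩, ?_⟩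
    rintro h' ⟨e', rfl⟩
    exact hu _ (A.Ra_total e').choose_spec

/-- The action morphism. -/
noncomputable def act : 𝒢.ActionMorphism J where
  bun := A.bun
  hJ := by
    refine (Category.assoc _ _ _).symm.trans ?_
    exact (A.l_snd =≫ _).trans A.l₂_s

theorem act_l₁ : A.act.l₁ = A.l₁ := A.l_fst

theorem act_l₂ : A.act.l₂ = A.l₂ := A.l_snd

variable {A}

theorem isRact_iff {p p' : T ⟶ A.X} {h : T ⟶ E.mor} : A.act.bun.IsRact p h p' ↔ A.Ra p h p' :=
  ⟨fun ⟨e, h⟩ => h ▸ (A.Ra_total e).choose_spec,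
    fun h => ⟨(A.Ra_w h).1, A.Ra_uniq (A.Ra_total (A.Ra_w h).1).choose_spec h⟩⟩

theorem isLact_L {p p' : T ⟶ A.X} {k : T ⟶ (𝒢.prod J).mor} (h : A.act.bun.IsLact k p p') :
    A.L k p p' := by
  obtain ⟨e, rfl⟩ := h
  exact (L_total e).choose_spec

theorem isLE_iff {p p' : T ⟶ A.X} {ε : T ⟶ E.mor} : A.act.IsLE ε p p' ↔ A.Le ε p p' := by
  have key : ∀ {p'}, A.act.IsLE ε p p' → A.Le ε p p' := by
    rintro p' ⟨k, rfl, h₂, h⟩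
    obtain ⟨q, h₃, h₄⟩ := isLact_L h
    rw [h₂.trans (((p ≫= A.act_l₂) =≫ _).trans (Category.assoc _ _ _))] at h₃
    obtain rfl := A.Lg_uniq h₃ (A.Lg_one p)
    exact h₄
  refine ⟨key, fun h => ?_⟩
  obtain ⟨q, hq⟩ := CatGraph.ActionMorphism.exists_isLE (act := A.act) (p := p) (ε := ε)
    (by rw [act_l₁]; exact (A.Le_w h).1)
  obtain rfl := A.Le_uniq h (key hq)
  exact hq

theorem isLG_iff {p p' : T ⟶ A.X} {g : T ⟶ 𝒢.G.mor} : A.act.IsLG g p p' ↔ A.Lg g p p' := by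
  have key : ∀ {p'}, A.act.IsLG g p p' → A.Lg g p p' := by
    rintro p' ⟨k, h₁, rfl, h⟩
    obtain ⟨q, h₃, h₄⟩ := isLact_L h
    rw [h₁.trans (((p ≫= A.act_l₁).trans (A.Lg_w h₃).2.1.symm =≫ _).trans (Category.assoc _ _ _))] at h₄
    obtain rfl := A.Le_uniq h₄ (A.Le_one q)
    exact h₃
  refine ⟨key, fun h => ?_⟩
  obtain ⟨q, hq⟩ := CatGraph.ActionMorphism.exists_isLG (act := A.act) (p := p) (g := g)
    (by rw [act_l₂]; exact (A.Lg_w h).1)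
  obtain rfl := A.Lg_uniq h (key hq)
  exact hq

end ActRel

end Actions

end HigherGpd

namespace HigherGpd

open SimplicialIdentities

section Actions

variable {C : Type u} [Category.{v} C] {W : MorphismProperty C} [NicePretopology W]
  {X : SimplicialObject C} {T T' : C}

namespace ActData

variable (D : ActData W X)

/-- The relation `p * z = p'` for an edge `z` over a degenerate edge. -/
def Ra (p z p' : T ⟶ D.A1) : Prop := D.R p z p' ((p ≫ D.p1) ≫ X.σ (1 : Fin 2))

/-- The relation `z * p = p'` for an edge `z` over a degenerate edge. -/
def Le (z p p' : T ⟶ D.A1) : Prop := D.R z p p' ((p ≫ D.p1) ≫ X.σ (0 : Fin 2))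

/-- The relation `x * p = p'` for a triangle `x` whose zeroth face is degenerate. -/
def Lg (x : T ⟶ X _⦋2⦌) (p p' : T ⟶ D.A1) : Prop := D.R p' ((p ≫ D.d0) ≫ D.s0) p x

variable {D} {p p' p'' q q' z z' k h a a' c : T ⟶ D.A1} {x x' : T ⟶ X _⦋2⦌}

theorem Ra.nat (i : D.Ra p z p') (v : T' ⟶ T) : D.Ra (v ≫ p) (v ≫ z) (v ≫ p') := by
  simpa [Ra] using D.R_nat v i

theorem Le.nat (i : D.Le z p p') (v : T' ⟶ T) : D.Le (v ≫ z) (v ≫ p) (v ≫ p') := by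
  simpa [Le] using D.R_nat v i

theorem Lg.nat (i : D.Lg x p p') (v : T' ⟶ T) : D.Lg (v ≫ x) (v ≫ p) (v ≫ p') := by
  simpa [Lg] using D.R_nat v i

theorem Ra.p1 (i : D.Ra p z p') : p' ≫ D.p1 = p ≫ D.p1 := by simpa using D.R_e02 i

theorem Ra.z_p1 (i : D.Ra p z p') : z ≫ D.p1 = p ≫ D.p1 ≫ X.δ 0 ≫ X.σ 0 := by
  simpa using D.R_e12 i

theorem Le.p1 (i : D.Le z p p') : p' ≫ D.p1 = p ≫ D.p1 := by simpa using D.R_e02 i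

theorem Le.z_p1 (i : D.Le z p p') : z ≫ D.p1 = p ≫ D.p1 ≫ X.δ 1 ≫ X.σ 0 := by
  simpa using D.R_e01 i

theorem Lg.δ0 (i : D.Lg x p p') : x ≫ X.δ 0 = p ≫ D.p1 ≫ X.δ 0 ≫ X.σ 0 := by
  simpa using (D.R_e12 i).symm

theorem Lg.δ1 (i : D.Lg x p p') : x ≫ X.δ 1 = p ≫ D.p1 := (D.R_e02 i).symm

theorem Lg.δ2 (i : D.Lg x p p') : x ≫ X.δ 2 = p' ≫ D.p1 := (D.R_e01 i).symm

theorem Lg.d0 (i : D.Lg x p p') : p' ≫ D.d0 = p ≫ D.d0 := by simpa using D.R_v1 i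

theorem Ra.mul (i : D.Ra p z p') (j : D.Ra p' z' p'') (l : D.Ra z z' k) : D.Ra p k p'' :=
  pent' (p ≫ D.p1 ≫ X.σ (1 : Fin 2) ≫ X.σ (2 : Fin 3)) i j l (by simp)
    (by simp [reassoc_of% i.p1]) (by simp [reassoc_of% i.z_p1]) (by simp)

theorem Le.mul (i : D.Le z p p') (j : D.Le z' p' p'') (l : D.Ra z' z k) : D.Le k p p'' :=
  pent₁ (p ≫ D.p1 ≫ X.σ (0 : Fin 2) ≫ X.σ (0 : Fin 3)) l j i
    (by simp [reassoc_of% j.z_p1, reassoc_of% i.p1]) (by simp) (by simp)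
    (by simp [reassoc_of% i.p1])

theorem Le.ra (i : D.Le z p p') (j : D.Ra p h q) (l : D.Le z q q') : D.Ra p' h q' :=
  pent₁ (p ≫ D.p1 ≫ X.σ (0 : Fin 2) ≫ X.σ (2 : Fin 3)) i l j (by simp)
    (by simp [reassoc_of% i.p1]) (by simp) (by simp [reassoc_of% j.p1])

theorem Le.lg (i : D.Le z p q) (j : D.Lg x p p') (l : D.Le z p' q') : D.Lg x q q' := by
  refine R_congr (pent₁ (x ≫ X.σ (0 : Fin 3)) l i j (by simp [← reassoc_of% j.δ2]) (by simp)
    (by simp) (by simp [reassoc_of% j.δ1])) rfl ?_ rfl rfl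
  rw [D.R_v2 i]

theorem Lg.rel (i : D.Lg x p p') (j : D.Ra p h q) : D.R p' h q x := by
  refine pent' (x ≫ X.σ (2 : Fin 3)) i j (unit_l' ?_ rfl) (by simp) (by simp [reassoc_of% i.δ1])
    ?_ (by simp)
  · rw [D.R_v1 j, Category.assoc]
  · simp [reassoc_of% i.δ0, reassoc_of% j.z_p1]

theorem lg_of_rel (i : D.R a h c x) (j : D.Ra a h a') : D.Lg x c a' := by
  refine R_congr (pent₁ (x ≫ X.σ (1 : Fin 3)) j i (unit_r' rfl rfl) ?_ (by simp) ?_ (by simp)) rfl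
    (by rw [← D.R_v2 i, Category.assoc]) rfl rfl
  · simp [reassoc_of% D.R_e01 i]
  · have e := (D.R_e12 i).symm.trans j.z_p1
    rw [reassoc_of% D.R_e12 i, reassoc_of% e, Category.assoc, σ1_δ0_2, reassoc_of% e]
    simp

theorem Lg.ra (i : D.Lg x p p') (j : D.Ra p h q) (l : D.Ra p' h q') : D.Lg x q q' :=
  lg_of_rel (i.rel j) l

theorem ra_one (p : T ⟶ D.A1) : D.Ra p ((p ≫ D.d0) ≫ D.s0) p := unit_r' (by simp) (by simp)

theorem one_le (p : T ⟶ D.A1) : D.Le ((p ≫ D.d1) ≫ D.s0) p p := unit_l' (by simp) (by simp)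

theorem one_lg (p : T ⟶ D.A1) : D.Lg ((p ≫ D.p1) ≫ X.σ 1) p p := ra_one p

theorem Lg.mul {hX : IsNGroupoid W 2 X} {y : T ⟶ X _⦋2⦌} (i : D.Lg x p p') (j : D.Lg x' p' p'')
    (l : (decData hX).Ra x' x y) : D.Lg y p p'' := by
  obtain ⟨t, h₃, h₁, h₂, h₀⟩ := l
  refine pent' t (R_congr j rfl ?_ rfl rfl) i (unit_r' (a := (p ≫ D.d0) ≫ D.s0) ?_ ?_) h₃ h₁ rfl h₂
  · rw [i.d0]
  · simp
  · refine h₀.trans ?_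
    have e : p' ≫ D.p1 ≫ X.δ 0 = p ≫ D.p1 ≫ X.δ 0 := by simpa using i.d0 =≫ D.p0
    change (x' ≫ X.δ 0) ≫ X.σ 1 = _
    rw [j.δ0]
    simp [reassoc_of% e]

theorem Ra.uniq (i : D.Ra p z p') (j : D.Ra p z p'') : p' = p'' := uniq_c i j

theorem Le.uniq (i : D.Le z p p') (j : D.Le z p p'') : p' = p'' := uniq_c i j

theorem exists_ra {w : T ⟶ X _⦋0⦌} (e : p ≫ D.d0 = z ≫ D.d1) (hz : z ≫ D.p1 = w ≫ X.σ 0) :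
    ∃ p', D.Ra p z p' := by
  refine (D.fill_c e (by simp) ?_).exists
  have := e =≫ D.p0
  simp only [Category.assoc, d0_p0, d1_p0, reassoc_of% hz, σ0_δ1_0, Category.comp_id] at this
  simp [hz, reassoc_of% this]

theorem exists_le {w : T ⟶ X _⦋0⦌} (e : z ≫ D.d0 = p ≫ D.d1) (hz : z ≫ D.p1 = w ≫ X.σ 0) :
    ∃ p', D.Le z p p' := by
  refine (D.fill_c e ?_ (by simp)).exists
  have := e =≫ D.p0
  simp only [Category.assoc, d0_p0, d1_p0, reassoc_of% hz, σ0_δ0_0, Category.comp_id] at this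
  simp [hz, ← reassoc_of% this]

theorem exists_lg (hX : IsNGroupoid W 2 X) {w : T ⟶ X _⦋0⦌} (h₁ : x ≫ X.δ 1 = p ≫ D.p1)
    (h₀ : x ≫ X.δ 0 = w ≫ X.σ 0) : ∃ p', D.Lg x p p' := by
  refine (fill_a hX (by simp) ?_ h₁.symm).exists
  have := h₁ =≫ X.δ (0 : Fin 2)
  rw [Category.assoc, δ1_δ0_2, reassoc_of% h₀, σ0_δ0_0, Category.comp_id, Category.assoc] at this
  simp [h₀, reassoc_of% this]

theorem exists_div (h₁ : p ≫ D.d1 = p' ≫ D.d1) (h₂ : p ≫ D.p1 = p' ≫ D.p1) : ∃! z, D.Ra p z p' :=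
  D.fill_b h₁ (by simp) (by simp [h₂])

variable (D)

theorem exists_mor : ∃ (K : C) (κ : K ⟶ D.A1), W (κ ≫ D.d1) ∧
    (∀ {T : C} (x : T ⟶ K), (x ≫ κ) ≫ D.p1 = ((x ≫ κ) ≫ D.d1) ≫ D.p0 ≫ X.σ 0) ∧
    (∀ {T : C} (z : T ⟶ D.A1), z ≫ D.p1 = (z ≫ D.d1) ≫ D.p0 ≫ X.σ 0 → ∃ x, x ≫ κ = z) ∧
    ∀ {T : C} (x y : T ⟶ K), x ≫ κ = y ≫ κ → x = y :=
  D.l_cover.exists_fiber (D.p0 ≫ X.σ 0) (by simp)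

/-- The object of edges over degenerate edges. -/
noncomputable def mor : C := D.exists_mor.choose

/-- The inclusion of the edges over degenerate edges. -/
noncomputable def κ : D.mor ⟶ D.A1 := D.exists_mor.choose_spec.choose

theorem κ_cover : W (D.κ ≫ D.d1) := D.exists_mor.choose_spec.choose_spec.1

variable {D}

theorem κ_p1 (g : T ⟶ D.mor) : (g ≫ D.κ) ≫ D.p1 = ((g ≫ D.κ) ≫ D.d1 ≫ D.p0) ≫ X.σ 0 := by
  have e : ((g ≫ D.κ) ≫ D.d1) ≫ D.p0 ≫ X.σ 0 = ((g ≫ D.κ) ≫ D.d1 ≫ D.p0) ≫ X.σ 0 := by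
    simp only [Category.assoc]
  exact (D.exists_mor.choose_spec.choose_spec.2.1 g).trans e

theorem κ_inj {g g' : T ⟶ D.mor} (h : g ≫ D.κ = g' ≫ D.κ) : g = g' :=
  D.exists_mor.choose_spec.choose_spec.2.2.2 g g' h

theorem κ_lift {w : T ⟶ X _⦋0⦌} (h : z ≫ D.p1 = w ≫ X.σ 0) : ∃ g, g ≫ D.κ = z :=
  D.exists_mor.choose_spec.choose_spec.2.2.1 z (by
    have := h =≫ X.δ (1 : Fin 2)
    rw [Category.assoc, Category.assoc, σ0_δ1_0, Category.comp_id] at this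
    rw [h, ← this]; simp)

variable (D)

theorem exists_one : ∃ o : D.A0 ⟶ D.mor, o ≫ D.κ = D.s0 := κ_lift D.s0_p1

/-- The relational description of the groupoid of edges over degenerate edges. -/
noncomputable def gpdRel : GpdRel W where
  ob := D.A0
  mor := D.mor
  s := D.κ ≫ D.d0
  t := D.κ ≫ D.d1
  t_cover := D.κ_cover
  one := D.exists_one.choose
  one_s := by rw [reassoc_of% D.exists_one.choose_spec, D.s0_d0]
  one_t := by rw [reassoc_of% D.exists_one.choose_spec, D.s0_d1]
  M g h k := D.Ra (g ≫ D.κ) (h ≫ D.κ) (k ≫ D.κ)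
  nat v _ _ _ h := by simpa using h.nat v
  w h := by simpa using D.R_v1 h
  M_s h := by simpa using (D.R_v2 h).symm
  M_t h := by simpa using (D.R_v0 h).symm
  total {T g h} e := by
    obtain ⟨c, hc⟩ := exists_ra (D := D) (p := g ≫ D.κ) (z := h ≫ D.κ) (by simpa using e) (κ_p1 h)
    obtain ⟨k, rfl⟩ := κ_lift (hc.p1.trans (κ_p1 g))
    exact ⟨k, hc⟩
  uniq h h' := κ_inj (h.uniq h')
  one_mul g := by
    simp only [Category.assoc, D.exists_one.choose_spec]
    refine unit_l' (by simp) ?_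
    simp only [Category.assoc, s0_p1_assoc, σ0_σ1]
    simpa using (κ_p1 g =≫ X.σ (0 : Fin 2)).symm
  mul_one g := by
    simp only [Category.assoc, D.exists_one.choose_spec]
    simpa using ra_one (g ≫ D.κ)
  assoc i j l := i.mul l j
  div {T g k} e := by
    have e' : (g ≫ D.κ) ≫ D.d1 = (k ≫ D.κ) ≫ D.d1 := by simpa using e
    obtain ⟨b, hb, -⟩ := exists_div (D := D) (p := g ≫ D.κ) (p' := k ≫ D.κ) e'
      (by rw [κ_p1, κ_p1, ← Category.assoc _ D.d1, e', Category.assoc, Category.assoc]; simp)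
    obtain ⟨h, rfl⟩ := κ_lift (hb.z_p1.trans (by simp : _ = ((g ≫ D.κ) ≫ D.p1 ≫ X.δ 0) ≫ X.σ 0))
    exact ⟨h, hb⟩

/-- The groupoid of edges over degenerate edges. -/
noncomputable def gpd : Gpd W := D.gpdRel.toGpd

variable {D}

theorem gpd_isMul_iff {g h k : T ⟶ D.mor} :
    D.gpd.IsMul g h k ↔ D.Ra (g ≫ D.κ) (h ≫ D.κ) (k ≫ D.κ) := D.gpdRel.isMul_iff

theorem κ_d0 (g : T ⟶ D.mor) : (g ≫ D.κ) ≫ D.d0 = g ≫ D.gpd.s := Category.assoc _ _ _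

theorem κ_d1 (g : T ⟶ D.mor) : (g ≫ D.κ) ≫ D.d1 = g ≫ D.gpd.t := Category.assoc _ _ _

theorem one_κ (e : T ⟶ D.A0) : (e ≫ D.gpd.one) ≫ D.κ = e ≫ D.s0 :=
  (Category.assoc _ _ _).trans (e ≫= D.exists_one.choose_spec)

variable (D) in
/-- The moment map of the action. -/
noncomputable def moment {M : C} (e₀ : M ≅ X _⦋0⦌) : D.gpd.ToTriv M where
  map := D.p0 ≫ e₀.inv
  inv := by
    have h := D.κ_p1 (𝟙 _) =≫ (X.δ (0 : Fin 2) ≫ e₀.inv)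
    simp only [Category.id_comp, Category.assoc, σ0_δ0_0_assoc] at h
    change (D.κ ≫ D.d0) ≫ D.p0 ≫ e₀.inv = (D.κ ≫ D.d1) ≫ D.p0 ≫ e₀.inv
    rw [Category.assoc, Category.assoc, ← h]
    simp

end ActData

/-- An identification of the objects and arrows of a categorified graph with those given by `X`. -/
structure Base (hX : IsNGroupoid W 2 X) (𝒢 : CatGraph W) where
  e₀ : 𝒢.M ≅ X _⦋0⦌
  e₁ : 𝒢.G.ob ≅ X _⦋1⦌
  κ : 𝒢.G.mor ⟶ X _⦋2⦌
  target : e₁.hom ≫ X.δ 1 = 𝒢.t.map ≫ e₀.hom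
  source : e₁.hom ≫ X.δ 0 = 𝒢.s.map ≫ e₀.hom
  κ_δ2 : κ ≫ X.δ 2 = 𝒢.G.t ≫ e₁.hom
  κ_δ1 : κ ≫ X.δ 1 = 𝒢.G.s ≫ e₁.hom
  κ_δ0 : κ ≫ X.δ 0 = 𝒢.G.t ≫ 𝒢.s.map ≫ e₀.hom ≫ X.σ 0
  one_κ : 𝒢.G.one ≫ κ = e₁.hom ≫ X.σ 1
  κ_mul : ∀ {T : C} {g h k : T ⟶ 𝒢.G.mor}, 𝒢.G.IsMul g h k →
    (decData hX).Ra (g ≫ κ) (h ≫ κ) (k ≫ κ)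

namespace ActData

variable (D : ActData W X) {hX : IsNGroupoid W 2 X} {𝒢 : CatGraph W} (B : Base hX 𝒢)

/-- The relational description of the action. -/
noncomputable def actRel : ActRel 𝒢 (D.moment B.e₀) where
  X := D.A1
  l₁ := D.d1
  l₂ := D.p1 ≫ B.e₁.inv
  r := D.d0
  l₁_J := by
    change D.d1 ≫ D.p0 ≫ B.e₀.inv = _
    rw [← cancel_mono B.e₀.hom]
    simp [← B.target]
  l₂_s := by
    change _ = D.d0 ≫ D.p0 ≫ B.e₀.inv
    rw [← cancel_mono B.e₀.hom]
    simp [← B.source]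
  cover := by
    obtain ⟨P, p, q, l, hP, h₁, h₂, hl⟩ := D.l_cover
    refine ⟨P, p, q ≫ B.e₁.inv, l, isPullback_of_points ?_ (fun a b e => ?_) (fun c c' e e' => ?_),
      h₁, by rw [reassoc_of% h₂], hl⟩
    · change p ≫ D.p0 ≫ B.e₀.inv = _
      rw [← cancel_mono B.e₀.hom]
      simp [← B.target, hP.w]
    · replace e : (show _ ⟶ D.A0 from a) ≫ D.p0 ≫ B.e₀.inv = b ≫ 𝒢.t.map := e
      obtain ⟨c, hc₁, hc₂⟩ : ∃ c, c ≫ p = a ∧ c ≫ q = b ≫ B.e₁.hom :=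
        ⟨hP.lift a (b ≫ B.e₁.hom) (by
          have h := e =≫ B.e₀.hom
          rw [Category.assoc, Category.assoc, Category.assoc, B.e₀.inv_hom_id, Category.comp_id,
            ← B.target, ← Category.assoc] at h
          exact h), hP.lift_fst _ _ _, hP.lift_snd _ _ _⟩
      exact ⟨c, hc₁, by rw [reassoc_of% hc₂]; simp⟩
    · exact hP.hom_ext e (by rw [← cancel_mono B.e₁.inv]; simpa using e')
  Ra p h p' := D.Ra p (h ≫ D.κ) p'
  Le ε p p' := D.Le (ε ≫ D.κ) p p'
  Lg g p p' := D.Lg (g ≫ B.κ) p p'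
  Ra_nat {T T'} v _ _ h i := by
    have e : (v ≫ h) ≫ D.κ = v ≫ h ≫ D.κ := Category.assoc _ _ _
    exact e ▸ i.nat v
  Le_nat {T T'} v _ _ h i := by
    have e : (v ≫ h) ≫ D.κ = v ≫ h ≫ D.κ := Category.assoc _ _ _
    exact e ▸ i.nat v
  Lg_nat v _ _ _ h := by simpa using h.nat v
  Ra_total {T p h} e := exists_ra (e.trans (κ_d1 h).symm) (κ_p1 h)
  Le_total {T p h} e := exists_le ((κ_d0 h).trans e) (κ_p1 h)
  Lg_total {T p g} e := exists_lg hX (w := g ≫ 𝒢.G.t ≫ 𝒢.s.map ≫ B.e₀.hom)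
    (by rw [Category.assoc, B.κ_δ1, reassoc_of% e]; simp) (by simp [B.κ_δ0])
  Ra_uniq h h' := h.uniq h'
  Le_uniq h h' := h.uniq h'
  Lg_uniq {T p p' p'' g} h h' := uniq_a hX h h'
  Ra_w {T p p' h} i := ⟨(D.R_v1 i).trans (κ_d1 h), (D.R_v0 i).symm, by rw [reassoc_of% i.p1],
    (D.R_v2 i).symm.trans (κ_d0 h)⟩
  Le_w {T p p' h} i := ⟨(κ_d0 h).symm.trans (D.R_v1 i), (D.R_v0 i).symm.trans (κ_d1 h),
    by rw [reassoc_of% i.p1], (D.R_v2 i).symm⟩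
  Lg_w {T p p' g} i := ⟨by
      have := i.δ1
      rw [Category.assoc, B.κ_δ1] at this
      rw [← cancel_mono B.e₁.hom]; simpa using this, D.R_v0 i, by
      have := i.δ2
      rw [Category.assoc, B.κ_δ2] at this
      rw [← cancel_mono B.e₁.hom]; simpa using this.symm, i.d0⟩
  Ra_one p := by
    have e : (p ≫ D.d0 ≫ D.gpd.one) ≫ D.κ = (p ≫ D.d0) ≫ D.s0 :=
      ((Category.assoc _ _ _).symm =≫ _).trans (one_κ _)
    exact e ▸ ra_one p
  Le_one p := by
    have e : (p ≫ D.d1 ≫ D.gpd.one) ≫ D.κ = (p ≫ D.d1) ≫ D.s0 :=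
      ((Category.assoc _ _ _).symm =≫ _).trans (one_κ _)
    exact e ▸ one_le p
  Lg_one p := by
    rw [Category.assoc, Category.assoc, Category.assoc, B.one_κ]
    simpa using one_lg p
  Ra_mul i j l := i.mul j (gpd_isMul_iff.1 l)
  Le_mul i j l := i.mul j (gpd_isMul_iff.1 l)
  Lg_mul i j l := i.mul j (B.κ_mul l)
  Le_Ra i j l := i.ra j l
  Lg_Ra i j l := i.ra j l
  Le_Lg i j l := i.lg j l
  shear {T p p'} h₁ h₂ := by
    have h₂' : p ≫ D.p1 = p' ≫ D.p1 := by rw [← cancel_mono B.e₁.inv]; simpa using h₂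
    obtain ⟨z, hz, hu⟩ := exists_div h₁ h₂'
    obtain ⟨h, rfl⟩ := κ_lift (hz.z_p1.trans (by simp : _ = (p ≫ D.p1 ≫ X.δ 0) ≫ X.σ 0))
    exact ⟨h, hz, fun h' i => κ_inj (hu _ i)⟩

/-- The action morphism defined by `D`. -/
noncomputable def act : 𝒢.ActionMorphism (D.moment B.e₀) := (D.actRel B).act

variable {D B}

theorem act_l₁ : (D.act B).l₁ = D.d1 := (D.actRel B).act_l₁

theorem act_l₂ : (D.act B).l₂ = D.p1 ≫ B.e₁.inv := (D.actRel B).act_l₂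

theorem act_isRact_iff {p p' : T ⟶ D.A1} {h : T ⟶ D.mor} :
    (D.act B).bun.IsRact p h p' ↔ D.Ra p (h ≫ D.κ) p' := ActRel.isRact_iff

theorem act_isLE_iff {p p' : T ⟶ D.A1} {ε : T ⟶ D.mor} :
    (D.act B).IsLE ε p p' ↔ D.Le (ε ≫ D.κ) p p' := ActRel.isLE_iff

theorem act_isLG_iff {p p' : T ⟶ D.A1} {g : T ⟶ 𝒢.G.mor} :
    (D.act B).IsLG g p p' ↔ D.Lg (g ≫ B.κ) p p' := ActRel.isLG_iff

end ActData

end Actions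

end HigherGpd

namespace HigherGpd

open SimplicialIdentities

section Actions

variable {C : Type u} [Category.{v} C] {W : MorphismProperty C} [NicePretopology W]
  {X : SimplicialObject C} {T T' : C}

/-- An identification of the bibundle of a multiplication with the triangles of `X`. -/
structure MulBase {hX : IsNGroupoid W 2 X} {𝒢 : CatGraph W} (B : Base hX 𝒢)
    (mul : 𝒢.MulMorphism) where
  e₂ : mul.bun.X ≅ X _⦋2⦌
  left₁ : e₂.hom ≫ X.δ 2 = mul.l₁ ≫ B.e₁.hom
  left₂ : e₂.hom ≫ X.δ 0 = mul.l₂ ≫ B.e₁.hom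
  right : e₂.hom ≫ X.δ 1 = mul.bun.r ≫ B.e₁.hom
  ract : ∀ {T : C} {m m' : T ⟶ mul.bun.X} {h : T ⟶ 𝒢.G.mor}, mul.bun.IsRact m h m' →
    (decData hX).Ra (m ≫ e₂.hom) (h ≫ B.κ) (m' ≫ e₂.hom)
  le : ∀ {T : C} {m m' : T ⟶ mul.bun.X} {g : T ⟶ 𝒢.G.mor}, mul.IsLE g m m' →
    (decData hX).Le (g ≫ B.κ) (m ≫ e₂.hom) (m' ≫ e₂.hom)
  lg : ∀ {T : C} {m m' : T ⟶ mul.bun.X} {g : T ⟶ 𝒢.G.mor}, mul.IsLG g m m' →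
    (decData hX).Lg (g ≫ B.κ) (m ≫ e₂.hom) (m' ≫ e₂.hom)

namespace ActData

variable {D : ActData W X} {hX : IsNGroupoid W 2 X} {𝒢 : CatGraph W} {B : Base hX 𝒢}

theorem R_balanced {a a' b b' c k : T ⟶ D.A1} {x : T ⟶ X _⦋2⦌} (h : D.Ra a k a')
    (h' : D.Le k b b') (i : D.R a' b c x) : D.R a b' c x :=
  pent' (x ≫ X.σ (1 : Fin 3)) h i h' (by rw [← h.p1, D.R_e01 i]; simp) (by simp)
    (by rw [D.R_e12 i]; simp) (by simp)

theorem R_balancedR {a b c c' : T ⟶ D.A1} {m m' k : T ⟶ X _⦋2⦌} (h : (decData hX).Ra m k m')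
    (j : D.Lg k c c') (i : D.R a b c m') : D.R a b c' m := by
  have e : m ≫ X.δ 0 = b ≫ D.p1 := h.p1.symm.trans (D.R_e12 i).symm
  obtain ⟨y, h₃, h₁, h₂, h₀⟩ := h
  refine pent₃ hX y i j (unit_r' ?_ ?_) h₃ h₁ h₀ h₂
  · rw [← D.R_v2 i, Category.assoc]
  · exact (e =≫ X.σ 1).trans (Category.assoc _ _ _)

theorem R_ra {a b b' c c' k : T ⟶ D.A1} {x : T ⟶ X _⦋2⦌} (i : D.R a b c x) (h : D.Ra b k b')
    (h' : D.Ra c k c') : D.R a b' c' x :=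
  pent' (x ≫ X.σ (2 : Fin 3)) i h' h (by simp) (by rw [D.R_e02 i]; simp)
    (by rw [D.R_e12 i]; simp) (by simp)

theorem R_le {a a' b c c' k : T ⟶ D.A1} {x : T ⟶ X _⦋2⦌} (i : D.R a b c x) (h : D.Le k a a')
    (h' : D.Le k c c') : D.R a' b c' x :=
  pent₁ (x ≫ X.σ (0 : Fin 3)) h h' i (by rw [D.R_e01 i]; simp) (by simp) (by simp)
    (by rw [D.R_e02 i]; simp)

theorem R_lg {a a' b c : T ⟶ D.A1} {m m' k : T ⟶ X _⦋2⦌} (i : D.R a b c m) (h : D.Lg k a a')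
    (h' : (decData hX).Le k m m') : D.R a' b c m' := by
  obtain ⟨y, h₃, h₁, h₂, h₀⟩ := h'
  refine pent' y h i (unit_l' ?_ ?_) h₃ h₁ h₀ h₂
  · rw [D.R_v1 i, Category.assoc]
  · exact ((D.R_e12 i).symm =≫ X.σ 0).trans (Category.assoc _ _ _)

theorem R_lg_mid {a b b' c : T ⟶ D.A1} {m m' k : T ⟶ X _⦋2⦌} (i : D.R a b c m) (h : D.Lg k b b')
    (h' : (decData hX).Lg k m m') : D.R a b' c m' := by
  obtain ⟨y, h₃, h₁, h₂, h₀⟩ := h'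
  refine pent₃ hX y i (unit_r' ?_ ?_) h h₃ h₁ h₀ h₂
  · rw [D.R_v2 i, Category.assoc]
  · exact ((D.R_e02 i).symm =≫ X.σ 1).trans (Category.assoc _ _ _)

theorem comp_act_l₁ (p : T ⟶ D.A1) :
    (show T ⟶ (D.act B).bun.X from p) ≫ (D.act B).l₁ = p ≫ D.d1 :=
  p ≫= (act_l₁ (D := D) (B := B))

theorem comp_act_l₂ (p : T ⟶ D.A1) :
    ((show T ⟶ (D.act B).bun.X from p) ≫ (D.act B).l₂) ≫ B.e₁.hom = p ≫ D.p1 := by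
  have h : (show T ⟶ (D.act B).bun.X from p) ≫ (D.act B).l₂ = p ≫ D.p1 ≫ B.e₁.inv :=
    p ≫= act_l₂
  have h' : (p ≫ D.p1 ≫ B.e₁.inv) ≫ B.e₁.hom = p ≫ D.p1 := by simp
  exact (h =≫ _).trans h'

theorem eq_act_l₂ {p : T ⟶ D.A1} {g : T ⟶ 𝒢.G.ob} (e : p ≫ D.p1 = g ≫ B.e₁.hom) :
    g = (show T ⟶ (D.act B).bun.X from p) ≫ (D.act B).l₂ :=
  (cancel_mono B.e₁.hom).1 (e.symm.trans (comp_act_l₂ p).symm)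

theorem eq_of_act_l₂ {p : T ⟶ D.A1} {g : T ⟶ 𝒢.G.ob}
    (e : g = (show T ⟶ (D.act B).bun.X from p) ≫ (D.act B).l₂) : p ≫ D.p1 = g ≫ B.e₁.hom :=
  (comp_act_l₂ p).symm.trans (e.symm =≫ _)

theorem isAssocRel {mul : 𝒢.MulMorphism} (M : MulBase B mul) :
    CatGraph.IsAssocRel (D.act B) mul (fun a b m c => D.R a b c (m ≫ M.e₂.hom)) where
  nat v h := (Category.assoc v _ M.e₂.hom).symm ▸ D.R_nat v h
  w h := (D.R_v1 h).trans (comp_act_l₁ _).symm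
  wR {T a b c m} h := eq_act_l₂ ((D.R_e02 h).trans (by simp [M.right]))
  l₁ h := (comp_act_l₁ _).trans ((D.R_v0 h).symm.trans (comp_act_l₁ _).symm)
  l₂ {T a b c m} h := eq_act_l₂ ((D.R_e01 h).trans (by simp [M.left₁]))
  l₃ {T a b c m} h := eq_act_l₂ ((D.R_e12 h).trans (by simp [M.left₂]))
  r h := (D.R_v2 h).symm
  exists_c {T a b m} h h' h'' := (D.fill_c (h.trans (comp_act_l₁ _))
    ((eq_of_act_l₂ h').trans (by simp [M.left₁]))
    ((eq_of_act_l₂ h'').trans (by simp [M.left₂]))).exists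
  uniq_c h h' := uniq_c h h'
  balanced h h' i := R_balanced (act_isRact_iff.1 h) (act_isLE_iff.1 h') i
  balancedR h h' i := R_balancedR (M.ract h) (act_isLG_iff.1 h') i
  ract i h h' := R_ra i (act_isRact_iff.1 h) (act_isRact_iff.1 h')
  lactE i h h' := R_le i (act_isLE_iff.1 h) (act_isLE_iff.1 h')
  lactG i h h' := R_lg i (act_isLG_iff.1 h) (M.le h')
  lactH i h h' := R_lg_mid i (act_isLG_iff.1 h) (M.lg h')

theorem Ra.congr {p p' z q q' h : T ⟶ D.A1} (i : D.Ra p z p') (e : p = q) (e' : z = h)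
    (e'' : p' = q') : D.Ra q h q' := by
  subst e e' e''; exact i

theorem Le.isRa {z p p' : T ⟶ D.A1} {w : T ⟶ X _⦋0⦌} (i : D.Le z p p')
    (h : p ≫ D.p1 = w ≫ X.σ 0) : D.Ra z p p' := by
  refine R_congr i rfl rfl rfl ?_
  rw [i.z_p1, reassoc_of% h, h]
  simp

theorem exists_unitor {one : 𝒢.UnitMorphism} (h₁ : one.u ≫ B.e₁.hom = B.e₀.hom ≫ X.σ 0) :
    ∃ ρ : CatGraph.Unitor (D.act B) one, ρ.κ = D.κ := by
  have hs₁ : ∀ {T : C} (y : T ⟶ (restrict (CatGraph.idUnit (D.moment B.e₀) one) (D.act B).bun).X),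
      (y ≫ restrictSnd) ≫ (D.act B).l₁ =
        y ≫ (restrict (CatGraph.idUnit (D.moment B.e₀) one) (D.act B).bun).l := by
    intro T y
    rw [← CatGraph.ActionMorphism.l_pr₁, Category.assoc y, restrictSnd_l, Category.assoc,
      Category.assoc]
    exact y ≫= ((_ ≫= fpOb_fst _ _ _).trans (Category.comp_id _))
  have hs₂ : ∀ {T : C} (y : T ⟶ (restrict (CatGraph.idUnit (D.moment B.e₀) one) (D.act B).bun).X),
      (y ≫ restrictSnd) ≫ (D.act B).l₂ =
        (y ≫ (restrict (CatGraph.idUnit (D.moment B.e₀) one) (D.act B).bun).l) ≫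
          (D.moment B.e₀).map ≫ one.u := by
    intro T y
    rw [← CatGraph.ActionMorphism.l_pr₂, Category.assoc y, restrictSnd_l, Category.assoc,
      Category.assoc, Category.assoc]
    exact y ≫= (_ ≫= fpOb_snd _ _ _)
  have hs₃ : ∀ {T : C} (y : T ⟶ (restrict (CatGraph.idUnit (D.moment B.e₀) one) (D.act B).bun).X),
      (show T ⟶ D.A1 from y ≫ restrictSnd) ≫ D.p1 =
        ((y ≫ (restrict (CatGraph.idUnit (D.moment B.e₀) one) (D.act B).bun).l) ≫
          (D.moment B.e₀).map ≫ B.e₀.hom) ≫ X.σ 0 := by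
    intro T y
    refine (comp_act_l₂ (B := B) _).symm.trans ((hs₂ y =≫ _).trans ?_)
    simp [h₁]
  obtain ⟨f, hf⟩ := κ_lift (hs₃ (𝟙 _))
  have hf' : ∀ {T : C} (y : T ⟶ (restrict (CatGraph.idUnit (D.moment B.e₀) one) (D.act B).bun).X),
      (y ≫ f) ≫ D.κ = y ≫ restrictSnd := fun y =>
    (Category.assoc _ _ _).trans (y ≫= (hf.trans (Category.id_comp _)))
  have hfκ : f ≫ D.κ = restrictSnd := hf.trans (Category.id_comp _)
  obtain ⟨ρ, hρ⟩ : ∃ ρ : CatGraph.Unitor (D.act B) one, ρ.map = f := by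
    refine ⟨HSHom.of (Q := unitBibundle D.gpd) f ?_ ?_ (fun {T g y y'} i => ?_)
      (fun {T h y y'} i => ?_), rfl⟩
    · refine (κ_d1 f).symm.trans ((hfκ =≫ D.d1).trans ((comp_act_l₁ (B := B) _).symm.trans ?_))
      have := hs₁ (𝟙 _)
      rw [Category.id_comp, Category.id_comp] at this
      exact this
    · exact (κ_d0 f).symm.trans (hfκ =≫ D.d0)
    · obtain ⟨q, hq, hq'⟩ := CatGraph.ActionMorphism.isLact_iff_LG_LE.1 (restrict_isLact i)
      have e₁ : (g ≫ (CatGraph.idUnit (D.moment B.e₀) one).mor) ≫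
          (fpFst (D.moment B.e₀) 𝒢.t 𝒢.t_cover).mor = g :=
        (Category.assoc _ _ _).trans ((_ ≫= fpMor_fst _ _ _).trans (Category.comp_id _))
      have e₂ : (g ≫ (CatGraph.idUnit (D.moment B.e₀) one).mor) ≫
          (fpSnd (D.moment B.e₀) 𝒢.t 𝒢.t_cover).mor =
            ((y ≫ restrictSnd) ≫ (D.act B).l₂) ≫ 𝒢.G.one := by
        refine (Category.assoc _ _ _).trans ((_ ≫= fpMor_snd _ _ _).trans ?_)
        rw [hs₂, ← i.w]
        simp [constFun]
      rw [e₂] at hq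
      rw [e₁] at hq'
      obtain rfl := (CatGraph.ActionMorphism.one_isLG rfl).unique hq
      refine gpd_isMul_iff.2 ?_
      exact (Le.isRa (act_isLE_iff.1 hq') (hs₃ y)).congr rfl (hf' y).symm (hf' y').symm
    · refine gpd_isMul_iff.2 ?_
      exact (act_isRact_iff.1 (restrict_isRact i)).congr (hf' y).symm rfl (hf' y').symm
  refine ⟨ρ, ?_⟩
  obtain ⟨y, h₂, h₃⟩ := ρ.exists_κ (𝟙 _)
  refine (Category.id_comp _).symm.trans (h₃.symm.trans ((hf' y).symm.trans ?_))
  rw [← hρ]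
  exact (h₂ =≫ D.κ).trans (Category.id_comp _)

end ActData

namespace NerveData

variable {𝒢 : CatGroupoid W} (n : NerveData 𝒢 X) (hX : IsNGroupoid W 2 X)

theorem dec_ra {m m' : T ⟶ 𝒢.mul.bun.X} {h : T ⟶ 𝒢.G.mor} (i : 𝒢.mul.bun.IsRact m h m') :
    (decData hX).Ra (m ≫ n.e₂.hom) ((h ≫ 𝒢.ρ.κ) ≫ n.e₂.hom) (m' ≫ n.e₂.hom) := by
  obtain ⟨x, h₃, h₁, h₀, h₂⟩ :=
    (n.associator _ _ _ _).1 ((CatAction.self 𝒢).isRact_iff.1 i)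
  refine ⟨x, h₃, h₁, h₂, h₀.trans ?_⟩
  have e := n.κ_one (m ≫ 𝒢.mul.l₂)
  have e' : (m ≫ 𝒢.mul.l₂) ≫ n.e₁.hom = (m ≫ n.e₂.hom) ≫ X.δ 0 := by simp [n.l₂]
  rw [e'] at e
  exact (e =≫ _).trans (by rw [Category.assoc, n.e₂.inv_hom_id, Category.comp_id]; rfl)

theorem dec_le {m m' : T ⟶ 𝒢.mul.bun.X} {g : T ⟶ 𝒢.G.mor} (i : 𝒢.mul.IsLE g m m') :
    (decData hX).Le ((g ≫ 𝒢.ρ.κ) ≫ n.e₂.hom) (m ≫ n.e₂.hom) (m' ≫ n.e₂.hom) := by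
  obtain ⟨x, h₃, h₁, h₀, h₂⟩ :=
    (n.associator _ _ _ _).1 ((CatAction.self 𝒢).isLE_iff.1 i)
  refine ⟨x, h₃, h₁, h₂, h₀.trans ?_⟩
  have e := n.lam_one (m ≫ 𝒢.mul.l₂)
  have e' : (m ≫ 𝒢.mul.l₂) ≫ n.e₁.hom = (m ≫ n.e₂.hom) ≫ X.δ 0 := by simp [n.l₂]
  rw [e'] at e
  exact (e =≫ _).trans (by rw [Category.assoc, n.e₂.inv_hom_id, Category.comp_id]; rfl)

theorem dec_lg {m m' : T ⟶ 𝒢.mul.bun.X} {g : T ⟶ 𝒢.G.mor} (i : 𝒢.mul.IsLG g m m') :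
    (decData hX).Lg ((g ≫ 𝒢.ρ.κ) ≫ n.e₂.hom) (m ≫ n.e₂.hom) (m' ≫ n.e₂.hom) := by
  obtain ⟨x, h₃, h₁, h₀, h₂⟩ :=
    (n.associator _ _ _ _).1 ((CatAction.self 𝒢).isLG_iff.1 i).2
  refine ⟨x, h₃, h₁.trans ?_, h₂, h₀⟩
  have e := n.κ_one (m ≫ 𝒢.mul.bun.r)
  have e' : (m ≫ 𝒢.mul.bun.r) ≫ n.e₁.hom = (m ≫ n.e₂.hom) ≫ X.δ 1 := by simp [n.right]
  rw [e'] at e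
  exact (e =≫ _).trans (by rw [Category.assoc, n.e₂.inv_hom_id, Category.comp_id]; rfl)

/-- The categorified graph underlying `𝒢` as given by `X`. -/
noncomputable def base : Base hX 𝒢.toCatGraph where
  e₀ := n.e₀
  e₁ := n.e₁
  κ := 𝒢.ρ.κ ≫ n.e₂.hom
  target := n.target
  source := n.source
  κ_δ2 := by
    have h := CatGraph.Unitor.κ_l₁ (ρ := 𝒢.ρ) (𝟙 _)
    rw [Category.id_comp, Category.id_comp] at h
    rw [Category.assoc, n.l₁, ← Category.assoc, h]
  κ_δ1 := by
    have h := CatGraph.Unitor.κ_r (ρ := 𝒢.ρ) (𝟙 _)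
    rw [Category.id_comp, Category.id_comp] at h
    rw [Category.assoc, n.right, ← Category.assoc, h]
  κ_δ0 := by
    have h := CatGraph.Unitor.κ_l₂ (ρ := 𝒢.ρ) (𝟙 _)
    rw [Category.id_comp, Category.id_comp] at h
    rw [Category.assoc, n.l₂, ← Category.assoc, h, Category.assoc, Category.assoc, n.unit]
  one_κ := by
    have h := n.κ_one (𝟙 _)
    rw [Category.id_comp, Category.id_comp] at h
    rw [← Category.assoc, h]
    simp
  κ_mul {T g h k} i := by
    exact (n.dec_ra hX (CatGraph.Unitor.isRact (ρ := 𝒢.ρ) i)).congr (Category.assoc _ _ _)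
      (Category.assoc _ _ _) (Category.assoc _ _ _)

/-- The multiplication of `𝒢` as given by `X`. -/
noncomputable def mulBase : MulBase (n.base hX) 𝒢.mul where
  e₂ := n.e₂
  left₁ := n.l₁
  left₂ := n.l₂
  right := n.right
  ract {T m m' h} i := (Category.assoc h 𝒢.ρ.κ n.e₂.hom) ▸ n.dec_ra hX i
  le {T m m' g} i := (Category.assoc g 𝒢.ρ.κ n.e₂.hom) ▸ n.dec_le hX i
  lg {T m m' g} i := (Category.assoc g 𝒢.ρ.κ n.e₂.hom) ▸ n.dec_lg hX i

include hX in
/-- Data of an action `2`-groupoid are the data of a categorified action. -/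
theorem exists_dataNerve (D : ActData W X) : ∃ a : CatAction 𝒢, Nonempty (DataNerve n a D) := by
  obtain ⟨α, hα⟩ := (ActData.isAssocRel (D := D) (n.mulBase hX)).exists_associator
  obtain ⟨ρ, hρ⟩ := ActData.exists_unitor (D := D) (B := n.base hX) n.unit
  refine ⟨{
    E := D.gpd
    J := D.moment (n.base hX).e₀
    act := D.act (n.base hX)
    α := α
    ρ := ρ
    pentagon := ?_
    triangle := ?_ }, ⟨{
      φ₀ := Iso.refl D.A0
      φ₁ := Iso.refl D.A1
      moment := ?_
      left₁ := ?_
      left₂ := ?_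
      right := ?_
      unitor := ?_
      associator := ?_ }⟩⟩
  · intro T a b c d f b' m k p o h₁ h₂ h₃ h₄
    obtain ⟨y, k₃, k₁, k₀, k₂⟩ := (n.associator _ _ _ _).1 h₃
    exact (hα).2 (ActData.pent' y (hα.1 h₁) (hα.1 h₂) (hα.1 h₄) k₃ k₁ k₀ k₂)
  · intro T a x l hx hl
    refine hα.2 ?_
    have h₁ := CatGraph.unitorRel_iff.1 hx
    have h₂ := (n.leftUnitor _ _).1 hl
    rw [hρ] at h₁
    refine ActData.unit_l' (h₁.trans ?_) (h₂.trans ?_)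
    · exact (ActData.one_κ (D := D) _).trans
        ((ActData.comp_act_l₁ (B := n.base hX) a =≫ D.s0).trans (Category.assoc _ _ _))
    · exact (ActData.comp_act_l₂ (B := n.base hX) a =≫ X.σ 0).trans (Category.assoc _ _ _)
  · change 𝟙 _ ≫ D.p0 = (D.p0 ≫ n.e₀.inv) ≫ n.e₀.hom
    simp
  · exact (Category.id_comp _).trans (ActData.act_l₁.symm.trans (Category.comp_id _).symm)
  · exact (ActData.comp_act_l₂ (B := n.base hX) (𝟙 D.A1)).symm.trans
      (Category.id_comp (D.act (n.base hX)).l₂ =≫ n.e₁.hom)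
  · exact (Category.id_comp _).trans (Category.comp_id _).symm
  · exact (Category.comp_id _).trans ((D.gpd.one ≫= hρ).trans
      (((Category.id_comp D.gpd.one).symm =≫ D.κ).trans (ActData.one_κ (D := D) (𝟙 _))))
  · intro T p q m s
    refine hα.trans (iff_of_eq ?_)
    congr 1 <;> exact (Category.comp_id _).symm

end NerveData

end Actions

end HigherGpd

namespace HigherGpd

open SimplicialIdentities

section Actions

variable {C : Type u} [Category.{v} C] {W : MorphismProperty C} [NicePretopology W]
  {X : SimplicialObject C} {T T' : C}

namespace IsNGroupoid

variable (hX : IsNGroupoid W 2 X)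

/-- The groupoid with objects the edges of `X`, and its maps to the vertices. -/
noncomputable def catGraph : CatGraph W where
  M := X _⦋0⦌
  G := (decData hX).gpd
  s := (decData hX).moment (Iso.refl _)
  t := {
    map := X.δ (1 : Fin 2)
    inv := (Category.assoc _ _ _).trans (((decData hX).κ ≫= (δ2_δ1_2 X).symm).trans
      (Category.assoc _ _ _).symm) }
  s_cover := by
    change W (X.δ (0 : Fin 2) ≫ 𝟙 _)
    rw [Category.comp_id]
    exact hX.δ0_cover
  t_cover := hX.δ1_cover

theorem catGraph_s : hX.catGraph.s.map = X.δ (0 : Fin 2) := Category.comp_id _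

/-- The identification of `catGraph` with the vertices and edges of `X`. -/
noncomputable def base : Base hX hX.catGraph where
  e₀ := Iso.refl _
  e₁ := Iso.refl (X _⦋1⦌)
  κ := (decData hX).κ
  target := (Category.id_comp _).trans (Category.comp_id _).symm
  source := (Category.id_comp _).trans (hX.catGraph_s.symm.trans (Category.comp_id _).symm)
  κ_δ2 := (Category.comp_id _).symm
  κ_δ1 := (Category.comp_id _).symm
  κ_δ0 := by
    have h := (decData hX).κ_p1 (𝟙 _)
    rw [Category.id_comp] at h
    change (decData hX).κ ≫ (decData hX).p1 = ((decData hX).κ ≫ (decData hX).d1) ≫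
      ((decData hX).p0 ≫ 𝟙 _) ≫ 𝟙 _ ≫ X.σ 0
    rw [Category.id_comp, Category.comp_id]
    exact h.trans (by simp only [Category.assoc])
  one_κ := ((Category.id_comp (decData hX).gpd.one).symm =≫ (decData hX).κ).trans
    ((decData hX).one_κ (𝟙 _))
  κ_mul := (decData hX).gpd_isMul_iff.1

/-- The multiplication on the edges of `X`. -/
noncomputable def mul : hX.catGraph.MulMorphism where
  toActionMorphism := (decData hX).act hX.base
  ht := by
    have h := (ActData.act_l₁ (D := decData hX) (B := hX.base)) =≫ X.δ (1 : Fin 2)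
    exact (Category.assoc _ _ _).symm.trans (h.trans (δ2_δ1_2 X))

/-- The identification of the multiplication with the triangles of `X`. -/
noncomputable def mulBase : MulBase hX.base hX.mul where
  e₂ := Iso.refl (X _⦋2⦌)
  left₁ := (Category.id_comp _).trans ((ActData.act_l₁ (D := decData hX) (B := hX.base)).symm.trans
    (Category.comp_id _).symm)
  left₂ := (Category.id_comp _).trans ((Category.comp_id _).symm.trans
    ((ActData.act_l₂ (D := decData hX) (B := hX.base)).symm.trans (Category.comp_id _).symm))
  right := (Category.id_comp _).trans (Category.comp_id _).symm
  ract {T m m' h} i := (ActData.act_isRact_iff.1 i).congr (Category.comp_id _).symm rfl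
    (Category.comp_id _).symm
  le {T m m' h} i := ActData.R_congr (ActData.act_isLE_iff.1 i) rfl (Category.comp_id _).symm
    (Category.comp_id _).symm
    (congrArg (fun m => (m ≫ X.δ (0 : Fin 3)) ≫ X.σ (0 : Fin 2)) (Category.comp_id m).symm)
  lg {T m m' h} i := ActData.R_congr (ActData.act_isLG_iff.1 i) (Category.comp_id _).symm
    (congrArg (fun m => (m ≫ X.δ (1 : Fin 3)) ≫ X.σ (1 : Fin 2)) (Category.comp_id m).symm)
    (Category.comp_id _).symm rfl

/-- The unit given by the degenerate edges of `X`. -/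
noncomputable def unit : hX.catGraph.UnitMorphism where
  u := X.σ (0 : Fin 1)
  us := by rw [catGraph_s]; exact σ0_δ0_0 X
  ut := σ0_δ1_0 X

theorem exists_associator : ∃ α : CatGraph.Associator hX.mul.toActionMorphism hX.mul,
    ∀ {T : C} {a b c m : T ⟶ X _⦋2⦌}, CatGraph.AssocRel α (show T ⟶ hX.mul.bun.X from a) b m c ↔
      (decData hX).R a b c m := by
  obtain ⟨α, hα⟩ := (ActData.isAssocRel (D := decData hX) hX.mulBase).exists_associator
  refine ⟨α, fun {T a b c m} => hα.trans ?_⟩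
  have e : m ≫ hX.mulBase.e₂.hom = m := Category.comp_id (Y := hX.mul.bun.X) m
  exact ⟨fun i => ActData.R_congr i rfl rfl rfl e, fun i => ActData.R_congr i rfl rfl rfl e.symm⟩

theorem exists_unitor : ∃ ρ : CatGraph.Unitor hX.mul.toActionMorphism hX.unit,
    ρ.κ = (decData hX).κ :=
  ActData.exists_unitor ((Category.comp_id _).trans (Category.id_comp _).symm)

/-- The relation `1 * k = m` for an arrow `k` of the groupoid of edges and a triangle `m`. -/
def LRel (k : T ⟶ (decData hX).gpd.mor) (m : T ⟶ X _⦋2⦌) : Prop :=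
  (decData hX).Ra ((m ≫ X.δ 0) ≫ X.σ (0 : Fin 2)) (k ≫ (decData hX).κ) m

variable {hX} {k k' g : T ⟶ (decData hX).gpd.mor} {m m' : T ⟶ X _⦋2⦌}

theorem LRel.isMul_right {h : T ⟶ (decData hX).gpd.mor} (i : hX.LRel k m)
    (j : (decData hX).Ra m (h ≫ (decData hX).κ) m') (i' : hX.LRel k' m') :
    (decData hX).gpd.IsMul k h k' := by
  obtain ⟨l, hl⟩ := (decData hX).gpd.exists_isMul (g := k) (h := h)
    ((ActData.κ_d0 k).symm.trans (((decData hX).R_v2 i).trans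
      (((decData hX).R_v1 j).trans (ActData.κ_d1 h))))
  have e : m' ≫ X.δ 0 = m ≫ X.δ 0 := j.p1
  rw [LRel, e] at i'
  have := (ActData.Ra.mul i j (ActData.gpd_isMul_iff.1 hl))
  obtain rfl := ActData.κ_inj ((decData hX).uniq_b this i')
  exact hl

theorem rel_deg (x : T ⟶ X _⦋2⦌) : (decData hX).R ((x ≫ X.δ 2) ≫ X.σ (0 : Fin 2)) x
    ((x ≫ X.δ 1) ≫ X.σ (0 : Fin 2)) x :=
  show ∃ y : T ⟶ X _⦋3⦌, y ≫ X.δ 3 = (x ≫ X.δ 2) ≫ X.σ 0 ∧ y ≫ X.δ 1 = x ∧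
    y ≫ X.δ 2 = (x ≫ X.δ 1) ≫ X.σ 0 ∧ y ≫ X.δ 0 = x from
  ⟨x ≫ X.σ (0 : Fin 3), by simp, by simp, by simp, by simp⟩

theorem exists_ra_ra {x z : T ⟶ X _⦋2⦌} {w w' : T ⟶ X _⦋0⦌} (h : x ≫ X.δ 0 = w ≫ X.σ 0)
    (h' : z ≫ X.δ 0 = w' ≫ X.σ 0) (i : (decData hX).Ra ((m ≫ X.δ 0) ≫ X.σ (0 : Fin 2)) z m)
    (j : (decData hX).Lg x m m') : ∃ q, (decData hX).Ra ((m' ≫ X.δ 0) ≫ X.σ (0 : Fin 2)) x q ∧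
      (decData hX).Ra q z m' := by
  have e₁ : x ≫ X.δ 1 = m ≫ X.δ 0 := j.δ1
  have e₂ : x ≫ X.δ 2 = m' ≫ X.δ 0 := j.δ2
  have e₃ : m ≫ X.δ 0 = ((m ≫ X.δ 0) ≫ X.σ 0) ≫ X.δ 1 := by simp
  have k := rel_deg (hX := hX) x
  rw [e₁, e₂] at k
  obtain ⟨q, hq⟩ := ActData.exists_ra ((decData hX).R_v1 k) h
  obtain ⟨z', hz⟩ := ActData.exists_ra (((decData hX).R_v2 hq).symm.trans (e₁.trans (e₃.trans
    ((decData hX).R_v1 i)))) h'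
  obtain rfl := ActData.uniq_a hX ((ActData.lg_of_rel k hq).ra i hz) j
  exact ⟨q, hq, hz⟩

theorem LRel.isMul_left (i : hX.LRel k m)
    (j : (decData hX).Lg (g ≫ (decData hX).κ) m m') (i' : hX.LRel k' m') :
    (decData hX).gpd.IsMul g k k' := by
  obtain ⟨q, hq, hq'⟩ := exists_ra_ra (ActData.κ_p1 g) (ActData.κ_p1 k) i j
  obtain ⟨l, hl⟩ := (decData hX).gpd.exists_isMul (g := g) (h := k) ((ActData.κ_d0 g).symm.trans
    (((decData hX).R_v2 hq).trans (((decData hX).R_v1 hq').trans (ActData.κ_d1 k))))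
  obtain rfl := ActData.κ_inj ((decData hX).uniq_b (hq.mul hq' (ActData.gpd_isMul_iff.1 hl)) i')
  exact hl

theorem exists_lRel (e : m ≫ X.δ 2 = (m ≫ X.δ 0) ≫ X.δ 1 ≫ X.σ 0) : ∃ k, hX.LRel k m := by
  have e₁ : ((m ≫ X.δ 0) ≫ X.σ 0) ≫ X.δ 2 = m ≫ X.δ 2 := by rw [e]; simp
  have e₂ : ((m ≫ X.δ 0) ≫ X.σ 0) ≫ X.δ 0 = m ≫ X.δ 0 := by simp
  obtain ⟨z, hz, -⟩ := ActData.exists_div (D := decData hX) e₁ e₂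
  obtain ⟨k, rfl⟩ := ActData.κ_lift (hz.z_p1.trans ((Category.assoc _ _ _).symm.trans
    (Category.assoc _ _ _).symm))
  exact ⟨k, hz⟩

theorem LRel.unique (i : hX.LRel k m) (i' : hX.LRel k' m) : k = k' :=
  ActData.κ_inj ((decData hX).uniq_b i i')

theorem LRel.congr (i : hX.LRel k m) (e : k = k') (e' : m = m') : hX.LRel k' m' :=
  e ▸ e' ▸ i

theorem LRel.nat (i : hX.LRel k m) (v : T' ⟶ T) : hX.LRel (v ≫ k) (v ≫ m) :=
  (ActData.Ra.nat i v).congr ((Category.assoc _ _ _).symm.trans ((Category.assoc _ _ _).symm =≫ _))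
    (Category.assoc _ _ _).symm rfl

theorem LRel.t (i : hX.LRel k m) : k ≫ (decData hX).gpd.t = m ≫ X.δ 0 :=
  (ActData.κ_d1 k).symm.trans (((decData hX).R_v1 i).symm.trans
    (by simp : ((m ≫ X.δ 0) ≫ X.σ 0) ≫ X.δ 1 = m ≫ X.δ 0))

theorem LRel.s (i : hX.LRel k m) : k ≫ (decData hX).gpd.s = m ≫ X.δ 1 :=
  (ActData.κ_d0 k).symm.trans ((decData hX).R_v2 i)

theorem lRel_one_iff {g : T ⟶ X _⦋1⦌} :
    hX.LRel (g ≫ (decData hX).gpd.one) m ↔ m = g ≫ X.σ (0 : Fin 2) := by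
  have e : ((g ≫ X.σ 0) ≫ X.δ 0) ≫ X.σ 0 = g ≫ X.σ 0 := by simp
  have e' : ((g ≫ X.σ 0) ≫ X.δ 1) ≫ X.σ 1 = g ≫ X.σ 1 := by simp
  have h : (decData hX).Ra (g ≫ X.σ 0) ((g ≫ (decData hX).gpd.one) ≫ (decData hX).κ) (g ≫ X.σ 0) :=
    (ActData.ra_one (D := decData hX) (g ≫ X.σ (0 : Fin 2))).congr rfl
      (e'.trans (ActData.one_κ (D := decData hX) g).symm) rfl
  constructor
  · intro i
    have e : m ≫ X.δ 0 = g := i.t.symm.trans ((Category.assoc _ _ _).trans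
      ((g ≫= (decData hX).gpd.one_t).trans (Category.comp_id _)))
    exact (decData hX).uniq_c (ActData.Ra.congr i (e =≫ _) rfl rfl) h
  · rintro rfl
    exact h.congr e.symm rfl rfl

theorem exists_leftUnitor : ∃ lam : CatGraph.LeftUnitor hX.mul hX.unit,
    ∀ {T : C} (g : T ⟶ X _⦋1⦌) (m : T ⟶ X _⦋2⦌),
      CatGraph.LeftUnitorRel lam m (g ≫ (decData hX).gpd.one) ↔ m = g ≫ X.σ (0 : Fin 2) := by
  have hl₁ : ∀ {T : C} (y : T ⟶ (restrict (CatGraph.unitId hX.unit) hX.mul.bun).X),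
      (y ≫ restrictSnd) ≫ hX.mul.l₁ =
        (y ≫ (restrict (CatGraph.unitId hX.unit) hX.mul.bun).l) ≫
          hX.catGraph.t.map ≫ hX.unit.u := by
    intro T y
    rw [← CatGraph.ActionMorphism.l_pr₁, Category.assoc y, restrictSnd_l, Category.assoc,
      Category.assoc, Category.assoc]
    exact y ≫= (_ ≫= fpOb_fst _ _ _)
  have hl₂ : ∀ {T : C} (y : T ⟶ (restrict (CatGraph.unitId hX.unit) hX.mul.bun).X),
      (y ≫ restrictSnd) ≫ hX.mul.l₂ =
        y ≫ (restrict (CatGraph.unitId hX.unit) hX.mul.bun).l := by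
    intro T y
    rw [← CatGraph.ActionMorphism.l_pr₂, Category.assoc y, restrictSnd_l, Category.assoc,
      Category.assoc]
    exact y ≫= ((_ ≫= fpOb_snd _ _ _).trans (Category.comp_id _))
  have hs₂ : ∀ {T : C} (y : T ⟶ (restrict (CatGraph.unitId hX.unit) hX.mul.bun).X),
      (show T ⟶ X _⦋2⦌ from (y ≫ restrictSnd : T ⟶ hX.mul.bun.X)) ≫ X.δ 0 =
        y ≫ (restrict (CatGraph.unitId hX.unit) hX.mul.bun).l := fun y =>
    (ActData.comp_act_l₂ (D := decData hX) (B := hX.base) _).symm.trans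
      ((Category.comp_id _).trans (hl₂ y))
  have hs₁ : ∀ {T : C} (y : T ⟶ (restrict (CatGraph.unitId hX.unit) hX.mul.bun).X),
      (show T ⟶ X _⦋2⦌ from (y ≫ restrictSnd : T ⟶ hX.mul.bun.X)) ≫ X.δ 2 =
        ((show T ⟶ X _⦋2⦌ from (y ≫ restrictSnd : T ⟶ hX.mul.bun.X)) ≫ X.δ 0) ≫ X.δ 1 ≫ X.σ 0 := fun y =>
    (ActData.comp_act_l₁ (D := decData hX) (B := hX.base) _).symm.trans
      ((hl₁ y).trans ((hs₂ y).symm =≫ _))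
  obtain ⟨f, hf⟩ := exists_lRel (hX := hX) (hs₁ (𝟙 _))
  have hf' : ∀ {T : C} (y : T ⟶ (restrict (CatGraph.unitId hX.unit) hX.mul.bun).X),
      hX.LRel (y ≫ f) (y ≫ restrictSnd : T ⟶ hX.mul.bun.X) := fun y =>
    (hf.nat y).congr rfl (y ≫= Category.id_comp (restrictSnd (F := CatGraph.unitId hX.unit)))
  obtain ⟨lam, hlam⟩ : ∃ lam : CatGraph.LeftUnitor hX.mul hX.unit, lam.map = f := by
    refine ⟨HSHom.of (Q := unitBibundle hX.catGraph.G) f ?_ ?_ (fun {T g y y'} i => ?_)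
      (fun {T h y y'} i => ?_), rfl⟩
    · have := hf.t.trans (hs₂ (𝟙 _))
      rw [Category.id_comp] at this
      exact this
    · exact hf.s.trans ((Category.id_comp _) =≫ _)
    · obtain ⟨q, hq, hq'⟩ := CatGraph.ActionMorphism.isLact_iff_LE_LG.1 (restrict_isLact i)
      have e₁ : (g ≫ (CatGraph.unitId hX.unit).mor) ≫
          (fpFst hX.catGraph.s hX.catGraph.t hX.catGraph.t_cover).mor =
            ((y ≫ restrictSnd) ≫ hX.mul.l₁) ≫ hX.catGraph.G.one := by
        refine (Category.assoc _ _ _).trans ((_ ≫= fpMor_fst _ _ _).trans ?_)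
        rw [hl₁, ← i.w]
        simp [constFun]
      have e₂ : (g ≫ (CatGraph.unitId hX.unit).mor) ≫
          (fpSnd hX.catGraph.s hX.catGraph.t hX.catGraph.t_cover).mor = g :=
        (Category.assoc _ _ _).trans ((_ ≫= fpMor_snd _ _ _).trans (Category.comp_id _))
      rw [e₁] at hq
      rw [e₂] at hq'
      obtain rfl := (CatGraph.ActionMorphism.one_isLE rfl).unique hq
      have j := (ActData.act_isLG_iff (D := decData hX) (B := hX.base)).1 hq'
      exact LRel.isMul_left (hf' y) j (hf' y')
    · have j := (ActData.act_isRact_iff (D := decData hX) (B := hX.base)).1 (restrict_isRact i)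
      exact LRel.isMul_right (hf' y) j (hf' y')
  refine ⟨lam, fun {T} g m => ⟨?_, fun h => ?_⟩⟩
  · rintro ⟨x, hm, hx⟩
    exact lRel_one_iff.1 ((hf' x).congr ((x ≫= hlam.symm).trans hx) hm)
  · have h₁ : m ≫ hX.mul.l₁ = g ≫ X.δ (1 : Fin 2) ≫ X.σ (0 : Fin 1) :=
      (ActData.comp_act_l₁ (D := decData hX) (B := hX.base) m).trans
        ((h =≫ X.δ (2 : Fin 3)).trans (by simp))
    have h₂ : m ≫ hX.mul.l₂ = g := (Category.comp_id _).symm.trans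
      ((ActData.comp_act_l₂ (D := decData hX) (B := hX.base) m).trans
        ((h =≫ X.δ (0 : Fin 3)).trans (by simp)))
    obtain ⟨x, hx, hx'⟩ := exists_restrict (F := CatGraph.unitId hX.unit) (P := hX.mul.bun) g m
      (fp_ob_ext
        ((Category.assoc _ _ _).trans ((_ ≫= fpOb_fst _ _ _).trans
          (h₁.symm.trans (Category.assoc _ _ _).symm)))
        ((Category.assoc _ _ _).trans ((_ ≫= fpOb_snd _ _ _).trans
          ((Category.comp_id _).trans (h₂.symm.trans (Category.assoc _ _ _).symm)))))
    refine ⟨x, hx', ?_⟩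
    exact (x ≫= hlam).trans (((hf' x).congr rfl hx').unique (lRel_one_iff.2 h))

end IsNGroupoid

end Actions

end HigherGpd

namespace HigherGpd

open SimplicialIdentities

section Actions

variable {C : Type u} [Category.{v} C] {W : MorphismProperty C} [NicePretopology W]
  {X : SimplicialObject C} {T T' : C}

/-- A morphism out of a composite of `P` and `Q` to a constant functor, given by an equivariant map
from `P` to `Q`. -/
theorem Composite.nonempty_hom_const {G H K : Gpd W} {P : HSBibundle G H} {Q : HSBibundle H K}
    (A : Composite P Q) {M : C} {J : G.ToTriv M} {o : M ⟶ K.ob} (c : P.X ⟶ Q.X) (hl : c ≫ Q.l = P.r)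
    (hr : c ≫ Q.r = P.l ≫ J.map ≫ o)
    (hL : ∀ {T : C} {g : T ⟶ G.mor} {p p' : T ⟶ P.X}, P.IsLact g p p' → p ≫ c = p' ≫ c)
    (hR : ∀ {T : C} {h : T ⟶ H.mor} {p p' : T ⟶ P.X}, P.IsRact p h p' →
      Q.IsLact h (p' ≫ c) (p ≫ c)) :
    Nonempty (HSHom A.R (restrict (constFun J o) (unitBibundle K))) := by
  refine A.nonempty_hom (fun p q z => z ≫ (restrict (constFun J o) (unitBibundle K)).l = p ≫ P.l ∧
    Q.IsRact (p ≫ c) (z ≫ restrictSnd) q) (fun v p q z h => ⟨by simp [h.1], by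
      have := h.2.nat v
      rw [← Category.assoc] at this
      exact (Category.assoc v z (restrictSnd (F := constFun J o))).symm ▸ this⟩)
    (fun {T p q} e => ?_) (fun h h' => restrict_ext (h.1.trans h'.1.symm) (h.2.unique_right h'.2))
    And.left (fun h => (Category.assoc _ _ _).symm.trans h.2.r.symm)
    (fun i j h => ⟨h.1.trans i.l, (hR i).isRact h.2 j⟩)
    (fun {T p p' q z z' g} h i j => ⟨j.l.trans i.l.symm, ?_⟩)
    (fun h i j => ⟨j.l.trans h.1, h.2.mul i (restrict_isRact j)⟩)
  · obtain ⟨h, hh⟩ := HSBibundle.exists_div (P := Q) (p := p ≫ c) (p' := q)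
      (by rw [Category.assoc, hl, e])
    obtain ⟨z, hz, rfl⟩ := exists_restrict (F := constFun J o) (P := unitBibundle K) (p ≫ P.l) h
      ((Category.assoc _ _ _).trans ((p ≫= hr.symm).trans ((Category.assoc _ _ _).symm.trans hh.w)))
    exact ⟨z, hz, hh⟩
  · have k := restrict_isLact j
    have e : g ≫ (constFun J o).mor = (g ≫ G.s ≫ J.map ≫ o) ≫ K.one := by simp [constFun]
    rw [e] at k
    have l : z ≫ restrictSnd = z' ≫ restrictSnd :=
      (Gpd.one_isMul_of (k.w.symm.trans (by simp [K.one_s]))).unique k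
    exact hL i ▸ l ▸ h.2

namespace ActData

variable {D : ActData W X} {p p' p₁ p₁' z z₁ : T ⟶ D.A1} {x x₁ : T ⟶ X _⦋2⦌}

theorem Le.congr (i : D.Le z p p') (e : z = z₁) (e' : p = p₁) (e'' : p' = p₁') :
    D.Le z₁ p₁ p₁' := e ▸ e' ▸ e'' ▸ i

theorem Lg.congr (i : D.Lg x p p') (e : x = x₁) (e' : p = p₁) (e'' : p' = p₁') :
    D.Lg x₁ p₁ p₁' := e ▸ e' ▸ e'' ▸ i

theorem Lg.uniq_left (i : D.Lg x p p') (j : D.Lg x p₁ p') : p = p₁ :=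
  uniq_c (R_congr i rfl (i.d0.symm =≫ D.s0) rfl rfl) (R_congr j rfl (j.d0.symm =≫ D.s0) rfl rfl)

theorem exists_lg_left (e₁ : p ≫ D.d0 = ((p ≫ D.d0) ≫ D.s0) ≫ D.d1) (e₂ : x ≫ X.δ 2 = p ≫ D.p1)
    (e₀ : ((p ≫ D.d0) ≫ D.s0) ≫ D.p1 = x ≫ X.δ 0) : ∃ p', D.Lg x p' p := by
  obtain ⟨q, hq, -⟩ := D.fill_c e₁ e₂.symm e₀
  exact ⟨q, R_congr hq rfl (by rw [← D.R_v2 hq]; simp) rfl rfl⟩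

end ActData

namespace IsNGroupoid

variable {hX : IsNGroupoid W 2 X} {x x' j j' g : T ⟶ X _⦋2⦌}

/-- The relation between the two triangles exhibiting an edge as a right and as a left inverse. -/
def InvRel (x j : T ⟶ X _⦋2⦌) : Prop :=
  ∃ y : T ⟶ X _⦋3⦌, y ≫ X.δ 3 = x ∧ y ≫ X.δ 1 = (x ≫ X.δ 2) ≫ X.σ 0 ∧
    y ≫ X.δ 2 = (x ≫ X.δ 2) ≫ X.σ 1 ∧ y ≫ X.δ 0 = j

variable (hX) in
theorem InvRel.rel (h : InvRel x j) :
    (decData hX).R x ((x ≫ X.δ 2) ≫ X.σ (0 : Fin 2)) ((x ≫ X.δ 2) ≫ X.σ (1 : Fin 2)) j := h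

theorem exists_invRel (hX : IsNGroupoid W 2 X) (e : x ≫ X.δ 1 = (x ≫ X.δ 2) ≫ X.δ 1 ≫ X.σ 0) : ∃ j, InvRel x j := by
  obtain ⟨y, h₁, h₂, h₃⟩ := hX.exists_fill3_0 ((x ≫ X.δ 2) ≫ X.σ (0 : Fin 2))
    ((x ≫ X.δ 2) ≫ X.σ (1 : Fin 2)) x (by simp) (by simp [e]) (by simp)
  exact ⟨_, y, h₃, h₁, h₂, rfl⟩

theorem rel_unique {a b c : T ⟶ X _⦋2⦌} (h : (decData hX).R a b c x) (h' : (decData hX).R a b c x') :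
    x = x' := by
  obtain ⟨y, h₃, h₁, h₂, rfl⟩ := h
  obtain ⟨y', h₃', h₁', h₂', rfl⟩ := h'
  rw [hX.ext3 0 (y := y) (y' := y') fun i hi => ?_]
  fin_cases i
  · exact absurd rfl hi
  · exact h₁.trans h₁'.symm
  · exact h₂.trans h₂'.symm
  · exact h₃.trans h₃'.symm

theorem InvRel.nat (h : InvRel x j) (v : T' ⟶ T) : InvRel (v ≫ x) (v ≫ j) := by
  obtain ⟨y, h₃, h₁, h₂, rfl⟩ := h
  exact ⟨v ≫ y, by simp [h₃], by simp [h₁], by simp [h₂], by simp⟩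

theorem InvRel.δ0 (h : InvRel x j) : j ≫ X.δ 0 = x ≫ X.δ 2 := by
  obtain ⟨y, h₃, h₁, h₂, rfl⟩ := h
  simpa using h₁ =≫ X.δ 0

theorem InvRel.δ1 (h : InvRel x j) : j ≫ X.δ 1 = (x ≫ X.δ 2) ≫ X.δ 0 ≫ X.σ 0 := by
  obtain ⟨y, h₃, h₁, h₂, rfl⟩ := h
  simpa using h₂ =≫ X.δ 0

theorem InvRel.δ2 (h : InvRel x j) : j ≫ X.δ 2 = x ≫ X.δ 0 := by
  obtain ⟨y, rfl, h₁, h₂, rfl⟩ := h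
  simp

theorem InvRel.lg (h : InvRel x j) (i : (decData hX).Le g x x') (h' : InvRel x' j') :
    (decData hX).Lg g j j' := by
  have e₂ : x' ≫ X.δ 2 = g ≫ X.δ 2 := ((decData hX).R_v0 i).symm
  have e₁ : x ≫ X.δ 2 = g ≫ X.δ 1 := ((decData hX).R_v1 i).symm
  have e₀ : g ≫ X.δ 0 = (g ≫ X.δ 1) ≫ X.δ 0 ≫ X.σ 0 := by
    rw [← e₁]
    exact i.z_p1.trans (by simp [decData])
  have e : (g ≫ X.δ 2) ≫ X.δ 0 = (g ≫ X.δ 1) ≫ X.δ 0 := by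
    simpa using e₀ =≫ X.δ 1
  have d₁ := h.δ1
  have d₁' := h'.δ1
  have d₀' := h'.δ0
  rw [e₁] at d₁
  rw [e₂, ← Category.assoc, e, Category.assoc] at d₁'
  rw [e₂] at d₀'
  have r := h.rel hX
  have r' := h'.rel hX
  rw [e₁] at r
  rw [e₂] at r'
  have k : (decData hX).R x' ((g ≫ X.δ 1) ≫ X.σ 0) g j :=
    ActData.pent₁ (j ≫ X.σ 0) i (ActData.ra_one (D := decData hX) g) r
      (by simp [decData, reassoc_of% h.δ2]) (by simp) (by simp)
      (by simp [decData, reassoc_of% d₁, reassoc_of% e₀])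
  obtain ⟨q, hq, -⟩ := (decData hX).fill_c (a := j') (b := (j ≫ X.δ 1) ≫ X.σ 1) (x := g)
    (by simp [decData, d₁, d₁']) (by simp [decData, d₀']) (by simp [decData, d₁, e₀])
  obtain ⟨y, h₃, h₁, rfl, h₀⟩ := id hq
  have l := ActData.pent' y r' (ActData.one_le (D := decData hX) g) (rel_deg g) h₃
    (h₁.trans (by simp [decData, d₁, e₀])) h₀ rfl
  obtain rfl := rel_unique k l
  exact hq

theorem InvRel.le (h : InvRel x j) (i : (decData hX).Lg g x x') (h' : InvRel x' j') :
    (decData hX).Le g j j' := by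
  have e₂ : x' ≫ X.δ 2 = x ≫ X.δ 2 := (decData hX).R_v0 i
  have d₁ : x ≫ X.δ 1 = (x ≫ X.δ 2) ≫ X.δ 1 ≫ X.σ 0 :=
    ((decData hX).R_v1 (h.rel hX)).trans (by simp [decData])
  obtain ⟨q, hq⟩ := ActData.exists_le (D := decData hX) (z := g) (p := j)
    (w := (x ≫ X.δ 0) ≫ X.δ 0) (i.δ1.trans h.δ2.symm) (i.δ0.trans (by simp [decData]))
  obtain ⟨y, h₃, h₁, rfl, h₀⟩ := id hq
  have l := ActData.pent' y i (h.rel hX)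
    (ActData.unit_l' (D := decData hX) (a := (x ≫ X.δ 2) ≫ X.σ 0) (by simp [decData, d₁]) rfl) h₃ h₁
    (h₀.trans (by simp [decData, h.δ0])) rfl
  rw [← e₂] at l
  obtain rfl := rel_unique l (h'.rel hX)
  exact hq

theorem κ_δ0 (g : T ⟶ (decData hX).gpd.mor) : (show T ⟶ X _⦋2⦌ from g ≫ (decData hX).κ) ≫ X.δ 0 =
    ((show T ⟶ X _⦋2⦌ from g ≫ (decData hX).κ) ≫ X.δ 2) ≫ X.δ 0 ≫ X.σ 0 :=
  (ActData.κ_p1 g).trans (((Category.assoc _ _ _).symm =≫ _).trans (Category.assoc _ _ _))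

variable (hX) in
/-- The inversion: its elements are the triangles with degenerate first face. -/
theorem exists_inv : ∃ (i : hX.catGraph.InvMorphism) (ι : i.bun.X ⟶ X _⦋2⦌),
    ι ≫ X.δ 2 = i.bun.l ∧ ι ≫ X.δ 0 = i.bun.r ∧ ι ≫ X.δ 1 = (ι ≫ X.δ 2) ≫ X.δ 1 ≫ X.σ 0 ∧
    (∀ {T : C} {g : T ⟶ (decData hX).gpd.mor} {p p' : T ⟶ i.bun.X}, i.bun.IsLact g p p' →
      (decData hX).Le (g ≫ (decData hX).κ) (p ≫ ι) (p' ≫ ι)) ∧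
    ∀ {T : C} {h : T ⟶ (decData hX).gpd.mor} {p p' : T ⟶ i.bun.X}, i.bun.IsRact p h p' →
      (decData hX).Lg (h ≫ (decData hX).κ) (p' ≫ ι) (p ≫ ι) := by
  obtain ⟨I, ι, hι, hw, hs, inj⟩ := hX.sq0.symm.exists_fiber (X.δ 1 ≫ X.σ 0) (by simp)
  have lift : ∀ {T : C} {z : T ⟶ X _⦋2⦌} {w : T ⟶ X _⦋0⦌}, z ≫ X.δ 1 = w ≫ X.σ 0 →
      ∃ x, x ≫ ι = z := fun {T z w} e => hs z (by
    have := e =≫ X.δ (1 : Fin 2)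
    simp only [Category.assoc, σ0_δ1_0, Category.comp_id] at this
    rw [e]
    simp [reassoc_of% this])
  have L_total : ∀ {T : C} {g : T ⟶ (decData hX).gpd.mor} {p : T ⟶ I},
      g ≫ (decData hX).gpd.s = p ≫ ι ≫ X.δ 2 →
        ∃ p' : T ⟶ I, (decData hX).Le (g ≫ (decData hX).κ) (p ≫ ι) (p' ≫ ι) := by
    intro T g p e
    obtain ⟨q, hq⟩ := ActData.exists_le (D := decData hX) (p := p ≫ ι)
      ((ActData.κ_d0 g).trans (e.trans (Category.assoc _ _ _).symm)) (ActData.κ_p1 g)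
    obtain ⟨p', rfl⟩ := lift (((decData hX).R_v2 hq).symm.trans
      ((hw p).trans (Category.assoc _ _ _).symm))
    exact ⟨p', hq⟩
  have R_total : ∀ {T : C} {h : T ⟶ (decData hX).gpd.mor} {p : T ⟶ I},
      p ≫ ι ≫ X.δ 0 = h ≫ (decData hX).gpd.t →
        ∃ p' : T ⟶ I, (decData hX).Lg (h ≫ (decData hX).κ) (p' ≫ ι) (p ≫ ι) := by
    intro T h p e
    have k : (show T ⟶ X _⦋2⦌ from h ≫ (decData hX).κ) ≫ X.δ 2 = (p ≫ ι) ≫ X.δ 0 :=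
      (ActData.κ_d1 h).trans (e.symm.trans (Category.assoc _ _ _).symm)
    obtain ⟨q, hq⟩ := ActData.exists_lg_left (D := decData hX) (p := p ≫ ι)
      (by change (p ≫ ι) ≫ X.δ 1 = (((p ≫ ι) ≫ X.δ 1) ≫ X.σ 1) ≫ X.δ 2
          rw [hw]; simp) k
      (by refine Eq.trans ?_ (κ_δ0 h).symm
          rw [k]
          change (((p ≫ ι) ≫ X.δ 1) ≫ X.σ 1) ≫ X.δ 0 = _
          simp)
    obtain ⟨p', rfl⟩ := lift (hq.d0.symm.trans ((hw p).trans (Category.assoc _ _ _).symm))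
    exact ⟨p', hq⟩
  let B : HSBibundle (decData hX).gpd (decData hX).gpd := {
    X := I
    l := ι ≫ X.δ (2 : Fin 3)
    r := ι ≫ X.δ (0 : Fin 3)
    lact g p e := (L_total e).choose
    ract p h e := (R_total e).choose
    lact_nat v g p e e' := inj _ _ ((L_total e').choose_spec.uniq
      (((L_total e).choose_spec.nat v).congr (Category.assoc _ _ _).symm (Category.assoc _ _ _).symm
        (Category.assoc _ _ _).symm))
    ract_nat v p h e e' := inj _ _ ((R_total e').choose_spec.uniq_left
      (((R_total e).choose_spec.nat v).congr (Category.assoc _ _ _).symm (Category.assoc _ _ _).symm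
        (Category.assoc _ _ _).symm))
    lact_l g p e := (Category.assoc _ _ _).symm.trans
      (((decData hX).R_v0 (L_total e).choose_spec).symm.trans (ActData.κ_d1 g))
    lact_r g p e := (Category.assoc _ _ _).symm.trans
      ((L_total e).choose_spec.p1.trans (Category.assoc _ _ _))
    one_lact p e := inj _ _ ((L_total e).choose_spec.uniq
      ((ActData.one_le (D := decData hX) (p ≫ ι)).congr ((ActData.one_κ (D := decData hX) _).symm.trans
        (((Category.assoc _ _ _ =≫ _).trans (Category.assoc _ _ _)) =≫ _)) rfl rfl))
    mul_lact g g' p e₁ e₂ e₃ e₄ := inj _ _ ((L_total e₃).choose_spec.uniq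
      ((L_total e₂).choose_spec.mul (L_total e₄).choose_spec (ActData.gpd_isMul_iff.1 ⟨e₁, rfl⟩)))
    ract_r p h e := (Category.assoc _ _ _).symm.trans
      ((R_total e).choose_spec.δ1.symm.trans (ActData.κ_d0 h))
    ract_l p h e := (Category.assoc _ _ _).symm.trans
      (((decData hX).R_v0 (R_total e).choose_spec).symm.trans (Category.assoc _ _ _))
    ract_one p e := inj _ _ ((R_total e).choose_spec.uniq_left
      ((ActData.one_lg (D := decData hX) (p ≫ ι)).congr ((ActData.one_κ (D := decData hX) _).symm.trans
        (((Category.assoc _ _ _ =≫ _).trans (Category.assoc _ _ _)) =≫ _)) rfl rfl))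
    ract_mul p h h' e₁ e₂ e₃ e₄ := inj _ _ (((R_total e₂).choose_spec.mul (R_total e₁).choose_spec
      (ActData.gpd_isMul_iff.1 ⟨e₃, rfl⟩)).uniq_left (R_total e₄).choose_spec)
    comm g p h e₁ e₂ e₃ e₄ := inj _ _ ((R_total e₂).choose_spec.uniq_left
      ((L_total e₄).choose_spec.lg (R_total e₃).choose_spec (L_total e₁).choose_spec))
    l_cover := hι
    shear p p' e := by
      replace e : (p ≫ ι) ≫ X.δ 2 = (p' ≫ ι) ≫ X.δ 2 :=
        (Category.assoc _ _ _).trans (e.trans (Category.assoc _ _ _).symm)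
      obtain ⟨y, h₁, h₂, h₃⟩ := hX.exists_fill3_0 (((p' ≫ ι) ≫ X.δ 1) ≫ X.σ 1) (p' ≫ ι) (p ≫ ι)
        (by simp) (by rw [hw p, e, hw p']; simp) e.symm
      obtain ⟨h, hh⟩ := ActData.κ_lift (D := decData hX) (z := y ≫ X.δ 0)
        (w := ((p' ≫ ι) ≫ X.δ 1) ≫ X.δ 0) (by
          change (y ≫ X.δ 0) ≫ X.δ 0 = _
          simpa using h₁ =≫ X.δ 0)
      have k : (decData hX).Lg (h ≫ (decData hX).κ) (p' ≫ ι) (p ≫ ι) := ⟨y, h₃, h₁, h₂, hh.symm⟩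
      have e' : p ≫ ι ≫ X.δ 0 = h ≫ (decData hX).gpd.t :=
        (Category.assoc _ _ _).symm.trans (k.δ2.symm.trans (ActData.κ_d1 h))
      refine ⟨h, ⟨e', inj _ _ ((R_total e').choose_spec.uniq_left k)⟩, ?_⟩
      rintro h' ⟨e', rfl⟩
      exact ActData.κ_inj (rel_unique (R_total e').choose_spec k) }
  have hw' := hw (𝟙 _)
  rw [Category.id_comp] at hw'
  have ht : ι ≫ X.δ 2 ≫ X.δ 1 = ι ≫ X.δ 0 ≫ X.δ 0 := by simpa using (hw' =≫ X.δ 0).symm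
  refine ⟨⟨B, ?_, ?_⟩, ι, rfl, rfl, hw', ?_, ?_⟩
  · rw [catGraph_s]
    exact (Category.assoc _ _ _).trans ((ι ≫= δ2_δ0_2 X).trans (Category.assoc _ _ _).symm)
  · rw [catGraph_s]
    exact (Category.assoc _ _ _).trans (ht.trans (Category.assoc _ _ _).symm)
  · rintro T g p _ ⟨e, rfl⟩
    exact (L_total e).choose_spec
  · rintro T g p _ ⟨e, rfl⟩
    exact (R_total e).choose_spec

end IsNGroupoid

end Actions

end HigherGpd

namespace HigherGpd

open SimplicialIdentities

section Actions

variable {C : Type u} [Category.{v} C] {W : MorphismProperty C} [NicePretopology W]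
  {X : SimplicialObject C} {T T' : C}

theorem HSBibundle.IsLact.congr {G H : Gpd W} {P : HSBibundle G H} {g g' : T ⟶ G.mor}
    {p p' q q' : T ⟶ P.X} (i : P.IsLact g p p') (e₁ : g = g') (e₂ : p = q) (e₃ : p' = q') :
    P.IsLact g' q q' := e₁ ▸ e₂ ▸ e₃ ▸ i

theorem HSBibundle.IsRact.congr {G H : Gpd W} {P : HSBibundle G H} {h h' : T ⟶ H.mor}
    {p p' q q' : T ⟶ P.X} (i : P.IsRact p h p') (e₁ : p = q) (e₂ : h = h') (e₃ : p' = q') :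
    P.IsRact q h' q' := e₁ ▸ e₂ ▸ e₃ ▸ i

section Diagonal

variable {G G' H' : Gpd W} {M : C} {a : G.ToTriv M} {a' : G'.ToTriv M} {b' : H'.ToTriv M}
  {ha : W a.map} {hb' : W b'.map} {P : HSBibundle G G'} {Q : HSBibundle G H'}
  {hP : P.l ≫ a.map = P.r ≫ a'.map} {hQ : Q.l ≫ a.map = Q.r ≫ b'.map}

local notation "PQ" => restrict (pairFun a a ha (Gpd.Fun.id G) (Gpd.Fun.id G) rfl)
  (prodBibundle a a' a b' ha hb' P Q hP hQ)

/-- The first projection of the bibundle of pairs. -/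
noncomputable def diagFst : (PQ).X ⟶ P.X := restrictSnd ≫ prodFst

/-- The second projection of the bibundle of pairs. -/
noncomputable def diagSnd : (PQ).X ⟶ Q.X := restrictSnd ≫ prodSnd

theorem diagFst_l : (diagFst : (PQ).X ⟶ _) ≫ P.l = (PQ).l := by
  rw [diagFst, Category.assoc, ← prod_l_fst, ← Category.assoc, restrictSnd_l, Category.assoc]
  exact (_ ≫= fpOb_fst _ _ _).trans (Category.comp_id _)

theorem diagSnd_l : (diagSnd : (PQ).X ⟶ _) ≫ Q.l = (PQ).l := by
  rw [diagSnd, Category.assoc, ← prod_l_snd, ← Category.assoc, restrictSnd_l, Category.assoc]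
  exact (_ ≫= fpOb_snd _ _ _).trans (Category.comp_id _)

theorem diag_r_fst : (PQ).r ≫ (fpFst a' b' hb').ob = diagFst ≫ P.r := by
  rw [← restrictSnd_r, Category.assoc, prod_r_fst, diagFst, Category.assoc]

theorem diag_r_snd : (PQ).r ≫ (fpSnd a' b' hb').ob = diagSnd ≫ Q.r := by
  rw [← restrictSnd_r, Category.assoc, prod_r_snd, diagSnd, Category.assoc]

theorem diag_isLact {g : T ⟶ G.mor} {y y' : T ⟶ (PQ).X} (h : (PQ).IsLact g y y') :
    P.IsLact g (y ≫ diagFst) (y' ≫ diagFst) ∧ Q.IsLact g (y ≫ diagSnd) (y' ≫ diagSnd) := by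
  obtain ⟨h₁, h₂⟩ := prod_isLact_iff.1 (restrict_isLact h)
  exact ⟨h₁.congr ((Category.assoc _ _ _).trans ((_ ≫= fpMor_fst _ _ _).trans (Category.comp_id _)))
      (Category.assoc _ _ _) (Category.assoc _ _ _),
    h₂.congr ((Category.assoc _ _ _).trans ((_ ≫= fpMor_snd _ _ _).trans (Category.comp_id _)))
      (Category.assoc _ _ _) (Category.assoc _ _ _)⟩

theorem diag_isRact {k : T ⟶ (fiberProd a' b' hb').mor} {y y' : T ⟶ (PQ).X}
    (h : (PQ).IsRact y k y') :
    P.IsRact (y ≫ diagFst) (k ≫ (fpFst a' b' hb').mor) (y' ≫ diagFst) ∧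
      Q.IsRact (y ≫ diagSnd) (k ≫ (fpSnd a' b' hb').mor) (y' ≫ diagSnd) := by
  obtain ⟨h₁, h₂⟩ := prod_isRact_iff.1 (restrict_isRact h)
  exact ⟨h₁.congr (Category.assoc _ _ _) rfl (Category.assoc _ _ _),
    h₂.congr (Category.assoc _ _ _) rfl (Category.assoc _ _ _)⟩

end Diagonal

namespace ActData

variable {D : ActData W X} {p p' m m' a a' z z' h : T ⟶ D.A1} {x x' y y' : T ⟶ X _⦋2⦌}

theorem Le.uniq_right (i : D.Le z p a) (j : D.Le z p' a) : p = p' :=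
  uniq_b (R_congr i rfl rfl rfl (i.p1.symm =≫ X.σ 0)) (R_congr j rfl rfl rfl (j.p1.symm =≫ X.σ 0))

theorem exists_le_left (h₁ : z ≫ D.d1 = p ≫ D.d1) (h₂ : z ≫ D.p1 = ((p ≫ D.p1) ≫ X.σ 0) ≫ X.δ 2) :
    ∃ p', D.Le z p' p := by
  obtain ⟨q, hq, -⟩ := D.fill_b h₁ h₂ (by simp)
  exact ⟨q, R_congr hq rfl rfl rfl ((by simpa using (D.R_e12 hq).symm : p ≫ D.p1 = q ≫ D.p1) =≫ _)⟩

theorem Le.exists_le_lg (hX : IsNGroupoid W 2 X) (j : D.Le z m a) (j' : D.Le z' m' a')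
    (k : D.Ra z h z') (i : D.Lg x a' a) : ∃ q, D.Le h m' q ∧ D.Lg x q m := by
  have hz : ∀ {v w : T ⟶ D.A1}, v ≫ D.p1 = w ≫ D.p1 ≫ X.δ 1 ≫ X.σ 0 →
      v ≫ D.p1 = (w ≫ D.p1 ≫ X.δ 1) ≫ X.σ 0 := fun e => by simpa using e
  obtain ⟨q, hq⟩ := exists_le ((D.R_v2 k).trans (D.R_v1 j'))
    (k.z_p1.trans (by simp : _ = (z ≫ D.p1 ≫ X.δ 0) ≫ X.σ 0))
  obtain ⟨b, hb⟩ := exists_le (z := z) (p := q) ((D.R_v1 k).trans (D.R_v0 hq)) (hz j.z_p1)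
  obtain rfl := (hq.mul hb k).uniq j'
  obtain ⟨q', hq'⟩ := exists_lg hX (p := q) (i.δ1.trans hb.p1)
    (i.δ0.trans (by simp : _ = (b ≫ D.p1 ≫ X.δ 0) ≫ X.σ 0))
  obtain ⟨b', hb'⟩ := exists_le (z := z) (p := q') ((D.R_v1 hb).trans (D.R_v0 hq').symm)
    (hz j.z_p1)
  obtain rfl := uniq_a hX (hb.lg hq' hb') i
  obtain rfl := hb'.uniq_right j
  exact ⟨q, hq, hq'⟩

theorem Lg.exists_le_lg (hX : IsNGroupoid W 2 X) (j : D.Lg y m a) (j' : D.Lg y' m' a')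
    (k : (decData hX).Ra y x y') (i : D.Le h a' a) : ∃ q, D.Le h m' q ∧ D.Lg x q m := by
  have hx : x ≫ X.δ 0 = (y ≫ X.δ 0 ≫ X.δ 0) ≫ X.σ 0 := k.z_p1.trans (by simp [decData])
  have hy : x ≫ X.δ 1 = y' ≫ X.δ 1 := (decData hX).R_v2 k
  have hy' : y ≫ X.δ 1 = x ≫ X.δ 2 := (decData hX).R_v1 k
  obtain ⟨q, hq⟩ := exists_le ((D.R_v1 i).trans (D.R_v0 j'))
    (i.z_p1.trans (by simp : _ = (a' ≫ D.p1 ≫ X.δ 1) ≫ X.σ 0))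
  obtain ⟨q', hq'⟩ := exists_lg hX (p := q) (hy.trans (j'.δ1.trans hq.p1.symm)) hx
  obtain ⟨b, hb⟩ := exists_lg hX (p := q') (hy'.trans hq'.δ2)
    (j.δ0.trans (by simp : _ = (m ≫ D.p1 ≫ X.δ 0) ≫ X.σ 0))
  obtain rfl := uniq_a hX (hq'.mul hb k) (hq.lg j' i)
  obtain rfl := hb.uniq_left j
  exact ⟨q, hq, hq'⟩

end ActData

namespace IsNGroupoid

variable {hX : IsNGroupoid W 2 X}

theorem nonempty_hom_mul {G : Gpd W} {M : C} {J : G.ToTriv M} {o : M ⟶ X _⦋1⦌}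
    {P : HSBibundle G (hX.catGraph.prod hX.catGraph.s)} {c : P.X ⟶ X _⦋2⦌}
    (h₂ : c ≫ X.δ 2 = P.r ≫ (fpFst hX.catGraph.s hX.catGraph.t hX.catGraph.t_cover).ob)
    (h₀ : c ≫ X.δ 0 = P.r ≫ (fpSnd hX.catGraph.s hX.catGraph.t hX.catGraph.t_cover).ob)
    (h₁ : c ≫ X.δ 1 = P.l ≫ J.map ≫ o)
    (hL : ∀ {T : C} {g : T ⟶ G.mor} {p p' : T ⟶ P.X}, P.IsLact g p p' → p ≫ c = p' ≫ c)
    (hR : ∀ {T : C} {k : T ⟶ (hX.catGraph.prod hX.catGraph.s).mor} {p p' : T ⟶ P.X},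
      P.IsRact p k p' → ∃ q,
        (decData hX).Le ((k ≫ (fpFst hX.catGraph.s hX.catGraph.t hX.catGraph.t_cover).mor) ≫
          (decData hX).κ) (p' ≫ c) q ∧
        (decData hX).Lg ((k ≫ (fpSnd hX.catGraph.s hX.catGraph.t hX.catGraph.t_cover).mor) ≫
          (decData hX).κ) q (p ≫ c)) :
    Nonempty (HSHom (comp P hX.mul.bun).R
      (restrict (constFun (G := (decData hX).gpd) J o) (unitBibundle (decData hX).gpd))) := by
  refine Composite.nonempty_hom_const _ (Q := hX.mul.bun) c (fp_ob_ext ?_ ?_) h₁ hL fun k => ?_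
  · exact (Category.assoc _ _ _).trans
      ((ActData.comp_act_l₁ (D := decData hX) (B := hX.base) c).trans h₂)
  · exact (Category.assoc _ _ _).trans ((Category.comp_id _).symm.trans
      ((ActData.comp_act_l₂ (D := decData hX) (B := hX.base) c).trans h₀))
  · obtain ⟨q, i, j⟩ := hR k
    exact CatGraph.ActionMorphism.isLact_iff_LE_LG.2 ⟨q,
      (ActData.act_isLE_iff (D := decData hX) (B := hX.base)).2 i,
      (ActData.act_isLG_iff (D := decData hX) (B := hX.base)).2 j⟩

variable {i : hX.catGraph.InvMorphism} {ι : i.bun.X ⟶ X _⦋2⦌}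

theorem nonempty_η (h₂ : ι ≫ X.δ 2 = i.bun.l) (h₀ : ι ≫ X.δ 0 = i.bun.r)
    (h₁ : ι ≫ X.δ 1 = (ι ≫ X.δ 2) ≫ X.δ 1 ≫ X.σ 0)
    (hl : ∀ {T : C} {g : T ⟶ (decData hX).gpd.mor} {p p' : T ⟶ i.bun.X}, i.bun.IsLact g p p' →
      (decData hX).Le (g ≫ (decData hX).κ) (p ≫ ι) (p' ≫ ι))
    (hr : ∀ {T : C} {h : T ⟶ (decData hX).gpd.mor} {p p' : T ⟶ i.bun.X}, i.bun.IsRact p h p' →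
      (decData hX).Lg (h ≫ (decData hX).κ) (p' ≫ ι) (p ≫ ι)) :
    Nonempty (HSHom (comp (CatGraph.idInv i) hX.mul.bun).R
      (restrict (constFun hX.catGraph.t hX.unit.u) (unitBibundle hX.catGraph.G))) := by
  let f : (CatGraph.idInv i).X ⟶ (decData hX).gpd.mor := diagFst
  let s : (CatGraph.idInv i).X ⟶ i.bun.X := diagSnd
  have e₂ : (s ≫ ι) ≫ X.δ 2 = (CatGraph.idInv i).l :=
    (Category.assoc _ _ _).trans ((s ≫= h₂).trans diagSnd_l)
  have e₀ : (s ≫ ι) ≫ X.δ 0 = s ≫ i.bun.r := (Category.assoc _ _ _).trans (s ≫= h₀)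
  have e₁ : (s ≫ ι) ≫ X.δ 1 = ((s ≫ ι) ≫ X.δ 2) ≫ X.δ 1 ≫ X.σ 0 := by
    rw [Category.assoc, h₁]; simp
  have ef : (f ≫ (decData hX).κ) ≫ X.δ 2 = (s ≫ ι) ≫ X.δ 2 :=
    (ActData.κ_d1 f).trans (diagFst_l.trans e₂.symm)
  obtain ⟨c, hc⟩ : ∃ c : (CatGraph.idInv i).X ⟶ X _⦋2⦌,
      (decData hX).Le (f ≫ (decData hX).κ) c (s ≫ ι) :=
    ActData.exists_le_left (D := decData hX) ef ((κ_δ0 f).trans (by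
      refine (ef =≫ _).trans ?_
      change _ = (((s ≫ ι) ≫ X.δ 0) ≫ X.σ 0) ≫ X.δ 2
      simp))
  have hc' : ∀ {T : C} (y : T ⟶ (CatGraph.idInv i).X),
      (decData hX).Le ((y ≫ f) ≫ (decData hX).κ) (y ≫ c) ((y ≫ s) ≫ ι) := fun y =>
    (hc.nat y).congr (Category.assoc _ _ _).symm rfl (Category.assoc _ _ _).symm
  refine nonempty_hom_mul (c := c) ?_ ?_ ?_ (fun {T g y y'} k => ?_) (fun {T h y y'} k => ?_)
  · exact ((decData hX).R_v1 hc).symm.trans ((ActData.κ_d0 f).trans diag_r_fst.symm)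
  · exact hc.p1.symm.trans (e₀.trans diag_r_snd.symm)
  · exact ((decData hX).R_v2 hc).trans (e₁.trans (e₂ =≫ _))
  · obtain ⟨j, j'⟩ := diag_isLact k
    exact ((hc' y).mul (hl j') (ActData.gpd_isMul_iff.1 j)).uniq_right (hc' y')
  · obtain ⟨j, j'⟩ := diag_isRact k
    exact (hc' y).exists_le_lg hX (hc' y') (ActData.gpd_isMul_iff.1 j) (hr j')

theorem nonempty_ε (h₂ : ι ≫ X.δ 2 = i.bun.l) (h₀ : ι ≫ X.δ 0 = i.bun.r)
    (h₁ : ι ≫ X.δ 1 = (ι ≫ X.δ 2) ≫ X.δ 1 ≫ X.σ 0)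
    (hl : ∀ {T : C} {g : T ⟶ (decData hX).gpd.mor} {p p' : T ⟶ i.bun.X}, i.bun.IsLact g p p' →
      (decData hX).Le (g ≫ (decData hX).κ) (p ≫ ι) (p' ≫ ι))
    (hr : ∀ {T : C} {h : T ⟶ (decData hX).gpd.mor} {p p' : T ⟶ i.bun.X}, i.bun.IsRact p h p' →
      (decData hX).Lg (h ≫ (decData hX).κ) (p' ≫ ι) (p ≫ ι)) :
    Nonempty (HSHom (comp (CatGraph.invId i) hX.mul.bun).R
      (restrict (constFun hX.catGraph.s hX.unit.u) (unitBibundle hX.catGraph.G))) := by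
  let s : (CatGraph.invId i).X ⟶ i.bun.X := diagFst
  let f : (CatGraph.invId i).X ⟶ (decData hX).gpd.mor := diagSnd
  obtain ⟨J, hJ⟩ := exists_invRel hX h₁
  have e₂ : (s ≫ ι) ≫ X.δ 2 = (CatGraph.invId i).l :=
    (Category.assoc _ _ _).trans ((s ≫= h₂).trans diagFst_l)
  have e₀ : (s ≫ ι) ≫ X.δ 0 = s ≫ i.bun.r := (Category.assoc _ _ _).trans (s ≫= h₀)
  have hs := hJ.nat s
  have ef : (f ≫ (decData hX).κ) ≫ X.δ 2 = (s ≫ ι) ≫ X.δ 2 :=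
    (ActData.κ_d1 f).trans (diagSnd_l.trans e₂.symm)
  obtain ⟨c, hc⟩ : ∃ c : (CatGraph.invId i).X ⟶ X _⦋2⦌,
      (decData hX).Lg (f ≫ (decData hX).κ) c (s ≫ J) := by
    refine ActData.exists_lg_left (D := decData hX) ?_ (ef.trans hs.δ0.symm) ?_
    · change (s ≫ J) ≫ X.δ 1 = (((s ≫ J) ≫ X.δ 1) ≫ X.σ 1) ≫ X.δ 2
      rw [hs.δ1]
      simp
    · refine Eq.trans ?_ ((κ_δ0 f).trans (ef =≫ _)).symm
      change (((s ≫ J) ≫ X.δ 1) ≫ X.σ 1) ≫ X.δ 0 = _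
      rw [hs.δ1]
      simp
  have hc' : ∀ {T : C} (y : T ⟶ (CatGraph.invId i).X),
      (decData hX).Lg ((y ≫ f) ≫ (decData hX).κ) (y ≫ c) ((y ≫ s) ≫ J) := fun y =>
    (hc.nat y).congr (Category.assoc _ _ _).symm rfl (Category.assoc _ _ _).symm
  refine nonempty_hom_mul (c := c) ?_ ?_ ?_ (fun {T g y y'} k => ?_) (fun {T h y y'} k => ?_)
  · exact ((decData hX).R_v0 hc).symm.trans (hs.δ2.trans (e₀.trans diag_r_fst.symm))
  · exact hc.δ1.symm.trans ((ActData.κ_d0 f).trans diag_r_snd.symm)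
  · refine hc.d0.symm.trans (hs.δ1.trans ((e₂ =≫ _).trans (_ ≫= ?_)))
    exact hX.catGraph_s.symm =≫ _
  · obtain ⟨j, j'⟩ := diag_isLact k
    exact ((hc' y).mul ((hJ.nat (y ≫ s)).lg (hl j) (hJ.nat (y' ≫ s)))
      (ActData.gpd_isMul_iff.1 j')).uniq_left (hc' y')
  · obtain ⟨j, j'⟩ := diag_isRact k
    exact (hc' y).exists_le_lg hX (hc' y') (ActData.gpd_isMul_iff.1 j')
      ((hJ.nat (y' ≫ s)).le (hr j) (hJ.nat (y ≫ s)))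

end IsNGroupoid

end Actions

end HigherGpd

namespace HigherGpd

section Actions

variable {C : Type u} [Category.{v} C] {W : MorphismProperty C} [NicePretopology W]
  {X : SimplicialObject C}

theorem IsNGroupoid.exists_nerveData (hX : IsNGroupoid W 2 X) :
    ∃ 𝒢 : CatGroupoid W, Nonempty (NerveData 𝒢 X) := by
  obtain ⟨α, hα⟩ := hX.exists_associator
  obtain ⟨ρ, hρ⟩ := hX.exists_unitor
  obtain ⟨lam, hlam⟩ := hX.exists_leftUnitor
  obtain ⟨i, ι, h₂, h₀, h₁, hl, hr⟩ := hX.exists_inv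
  obtain ⟨η⟩ := nonempty_η h₂ h₀ h₁ hl hr
  obtain ⟨ε⟩ := nonempty_ε h₂ h₀ h₁ hl hr
  refine ⟨{
    toCatGraph := hX.catGraph
    mul := hX.mul
    one := hX.unit
    inv := i
    α := α
    ρ := ρ
    lam := lam
    η := η
    ε := ε
    pentagon := ?_
    triangle := ?_ }, ⟨{
      e₀ := Iso.refl _
      e₁ := Iso.refl (X _⦋1⦌)
      e₂ := Iso.refl (X _⦋2⦌)
      target := hX.base.target
      source := hX.base.source
      left₁ := hX.mulBase.left₁.trans (Category.assoc _ _ _)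
      left₂ := hX.mulBase.left₂.trans (Category.assoc _ _ _)
      right := hX.mulBase.right
      unit := (Category.comp_id _).trans (Category.id_comp _).symm
      unitor := ?_
      leftUnitor := ?_
      associator := ?_ }⟩⟩
  · intro T a b c d f b' m k p o j₁ j₂ j₃ j₄
    obtain ⟨y, k₃, k₁, k₂, k₀⟩ := hα.1 j₃
    exact hα.2 (ActData.pent' y (hα.1 j₁) (hα.1 j₂) (hα.1 j₄) k₃ k₁ k₀ k₂)
  · intro T a x l hx hl
    refine hα.2 ?_
    have j₁ := CatGraph.unitorRel_iff.1 hx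
    have j₂ := (hlam _ _).1 hl
    rw [hρ] at j₁
    refine ActData.unit_l' (j₁.trans ?_) (j₂.trans ?_)
    · exact (ActData.one_κ (D := decData hX) _).trans
        ((ActData.comp_act_l₁ (D := decData hX) (B := hX.base) a =≫ _).trans (Category.assoc _ _ _))
    · exact ((Category.comp_id _).symm.trans
        (ActData.comp_act_l₂ (D := decData hX) (B := hX.base) a) =≫ X.σ 0).trans
          (Category.assoc _ _ _)
  · intro T g m
    have h : (g ≫ (decData hX).gpd.one) ≫ ρ.κ = (g ≫ 𝟙 _) ≫ X.σ (1 : Fin 2) :=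
      (_ ≫= hρ).trans ((ActData.one_κ (D := decData hX) g).trans ((Category.comp_id g).symm =≫ _))
    have e : m ≫ 𝟙 _ = m := Category.comp_id m
    exact CatGraph.unitorRel_iff.trans ⟨fun k => e.trans (k.trans h),
      fun k => e.symm.trans (k.trans h.symm)⟩
  · intro T g m
    have h : g ≫ 𝟙 _ = g := Category.comp_id g
    have e : m ≫ 𝟙 _ = m := Category.comp_id m
    exact (hlam g m).trans ⟨fun k => e.trans (k.trans (h.symm =≫ X.σ 0)),
      fun k => e.symm.trans (k.trans (h =≫ X.σ 0))⟩
  · intro T a b m c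
    have e : ∀ m : T ⟶ hX.mul.bun.X, m ≫ 𝟙 _ = m := Category.comp_id
    refine hα.trans ⟨fun ⟨y, h₃, h₁, h₂, h₀⟩ => ⟨y, h₃.trans (e a).symm, h₁.trans (e b).symm,
      h₀.trans (e m).symm, h₂.trans (e c).symm⟩, fun ⟨y, h₃, h₁, h₀, h₂⟩ => ⟨y, h₃.trans (e a),
      h₁.trans (e b), h₂.trans (e c), h₀.trans (e m)⟩⟩

end Actions

end HigherGpd

theorem mainTheorem2 {C : Type u} [Category.{v} C] (W : MorphismProperty C)
    [HigherGpd.NicePretopology W] (X : SimplicialObject C) (hX : HigherGpd.IsNGroupoid W 2 X) :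
    (∃ 𝒢 : HigherGpd.CatGroupoid W, Nonempty (HigherGpd.NerveData 𝒢 X)) ∧
    ∀ (𝒢 : HigherGpd.CatGroupoid W) (n : HigherGpd.NerveData 𝒢 X),
      ∃ Φ : Quotient (HigherGpd.CatAction.isoSetoid 𝒢) ≃
          Quotient (HigherGpd.TwoGroupoidKanFibration.isoSetoid W X),
        ∀ (a : HigherGpd.CatAction 𝒢) (π : HigherGpd.TwoGroupoidKanFibration W X),
          Φ ⟦a⟧ = ⟦π⟧ ↔ Nonempty (HigherGpd.ActionNerve n a π.1.hom) :=
  ⟨hX.exists_nerveData, fun 𝒢 n => HigherGpd.exists_equiv_of_exists_action n hX (n.exists_dataNerve hX)⟩
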